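/- Let $(X,\omega)$ be a compact symplectic manifold and let $G$ be a compact connected Lie group, with an $\mathrm{Ad}$-invariant inner product $\langle\cdot,\cdot\rangle$ on its Lie algebra $\mathfrak g$, which acts smoothly on $X$ with a $G$-equivariant moment map $\mu:X\to\mathfrak g$, i.e. $\iota_{X_\xi}\omega=\langle d\mu,\xi\rangle$ and $\mu(gx)=\mathrm{Ad}_g\mu(x)$. Here $L_x\xi=X_\xi(x)$ denotes the infinitesimal action. Assume that $0$ is a regular value of $\mu$, and let $J$ be a $G$-invariant $\omega$-compatible almost complex structure, with metric $\omega(\cdot,J\cdot)$. Let $N=\mathrm{Img}(JL)\to\mu^{-1}(0)$ be the vector bundle with fibre $\{JL_z\xi:\xi\in\mathfrak g\}\subset T_zX$ at $z$, let $\pi:N\to\mu^{-1}(0)$ be its projection, and let $N^\epsilon=\{n\in N:|n|<\epsilon\}$. On $N$ consider the one-form $\Theta$ given at $n=JL_z\xi$ by $\Theta_n(w)=\omega_z(JL_z\xi,\mathrm{pr}_G\,d\pi(w))$, where $\mathrm{pr}_G$ is the orthogonal projection of $T_z\mu^{-1}(0)$ onto $\mathrm{Img}\,L_z$; this is the pullback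 of the canonical one-form of the dual of the bundle of tangent spaces to the $G$-orbits in $\mu^{-1}(0)$. Put $$\omega_0=\pi^*(\omega|_{\mu^{-1}(0)})+d\Theta,\qquad \mu_0(z,JL_z\xi)=d_z\mu(JL_z\xi).$$ For every $\delta>0$ the following holds for all sufficiently small $\epsilon>0$. The exponential map $\exp$ of the metric is a $G$-equivariant diffeomorphism from $N^\epsilon$ onto an open subset of $X$; by means of it $\omega$ and $\mu$ are regarded as living on $N^\epsilon$. On $N^\epsilon$ the form $\omega_0$ is symplectic and the $G$-action is Hamiltonian with moment map $\mu_0$. There is a $G$-equivariant diffeomorphism $\phi$ from the tubular neighbourhood $N^\epsilon$ of $\mu^{-1}(0)$ onto an open neighbourhood of $\mu^{-1}(0)$ contained in (the image under $\exp$ of) $N^\delta$ such that $$\phi^*\omega=\omega_0,\qquad \phi^*\mu=\mu_0,\qquad \phi|_{\mu^{-1}(0)}=\mathrm{id}_{\mu^{-1}(0)},\qquad d\phi|_{TN^\epsilon|_{\mu^{-1}(0)}}=\mathrm{id}|_{TN^\epsilon|_{\mu^{-1}(0)}}.$$ -/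

import Mathlib

open scoped Manifold ContDiff Topology
open Set

noncomputable section

namespace NormalForm

/-! ### Differential forms on a manifold without boundary modelled on `E` -/

section Forms

variable {E : Type*} [NormedAddCommGroup E] [NormedSpace ℝ E]
  {X : Type*} [TopologicalSpace X] [ChartedSpace E X]

variable (E X) in
/-- A (not necessarily smooth) differential `n`-form on the manifold `X`. -/
abbrev Form (n : ℕ) : Type _ := Π x : X, TangentSpace 𝓘(ℝ, E) x [⋀^Fin n]→L[ℝ] ℝ

/-- The expression of the form `α` in the preferred chart around `x₀`, i.e. the pullback of `α` by
the inverse of this chart. It is meaningful on the target of the chart. -/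
def Form.inChart {n : ℕ} (α : Form E X n) (x₀ : X) (e : E) : E [⋀^Fin n]→L[ℝ] ℝ :=
  (α ((extChartAt 𝓘(ℝ, E) x₀).symm e)).compContinuousLinearMap
    (mfderiv 𝓘(ℝ, E) 𝓘(ℝ, E) (extChartAt 𝓘(ℝ, E) x₀).symm e)

/-- A form is smooth at `x` if its coefficients in the chart around `x` are. -/
def Form.SmoothAt {n : ℕ} (α : Form E X n) (x : X) : Prop :=
  ContDiffAt ℝ ∞ (α.inChart x) (extChartAt 𝓘(ℝ, E) x x)

/-- The exterior derivative of a form, computed at `x` in the chart around `x`. -/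
def Form.d {n : ℕ} (α : Form E X n) : Form E X (n + 1) := fun x ↦
  (extDeriv (α.inChart x) (extChartAt 𝓘(ℝ, E) x x)).compContinuousLinearMap
    (mfderiv 𝓘(ℝ, E) 𝓘(ℝ, E) (extChartAt 𝓘(ℝ, E) x) x)

/-- The pullback `f^*α` of a form. -/
def Form.pullback {n : ℕ} (f : X → X) (α : Form E X n) : Form E X n := fun x ↦
  (α (f x)).compContinuousLinearMap (mfderiv 𝓘(ℝ, E) 𝓘(ℝ, E) f x)

/-- The contraction `a(v, ·)` of an alternating two-form `a` with a vector `v`. -/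
def contract {V : Type*} [AddCommGroup V] [Module ℝ V] [TopologicalSpace V]
    (v : V) (a : V [⋀^Fin 2]→L[ℝ] ℝ) : V [⋀^Fin 1]→L[ℝ] ℝ :=
  ContinuousAlternatingMap.ofSubsingleton ℝ V ℝ (0 : Fin 1)
    (a.toContinuousMultilinearMap.toContinuousLinearMap ![v, 0] 1)

theorem contract_apply {V : Type*} [AddCommGroup V] [Module ℝ V] [TopologicalSpace V]
    (v : V) (a : V [⋀^Fin 2]→L[ℝ] ℝ) (w : Fin 1 → V) : contract v a w = a ![v, w 0] := by
  have h : Function.update ![v, 0] 1 (w 0) = ![v, w 0] := by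
    ext i; fin_cases i <;> simp
  simp [contract, ContinuousMultilinearMap.toContinuousLinearMap, h]

end Forms

/-! ### Lie group actions

The Lie algebra of `G` is `TangentSpace 𝓘(ℝ, E_G) (1 : G)`, which is by definition the vector space
`E_G` on which `G` is modelled; we denote it by `E_G`. -/

section Action

variable {E : Type*} [NormedAddCommGroup E] [NormedSpace ℝ E]
  {X : Type*} [TopologicalSpace X] [ChartedSpace E X]
  {E_G : Type*} [NormedAddCommGroup E_G] [NormedSpace ℝ E_G]
  {G : Type*} [TopologicalSpace G] [ChartedSpace E_G G] [Group G]

/-- The adjoint action of `g` on the Lie algebra: the derivative at `1` of `h ↦ g h g⁻¹`. -/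
def Ad (g : G) : E_G →L[ℝ] E_G :=
  (mfderiv 𝓘(ℝ, E_G) 𝓘(ℝ, E_G) (fun h : G ↦ g * h * g⁻¹) 1 :)

/-- An inner product on the Lie algebra of `G` that is invariant under the adjoint action. -/
structure IsInvariantInner (G : Type*) [TopologicalSpace G] [ChartedSpace E_G G] [Group G]
    (B : E_G →L[ℝ] E_G →L[ℝ] ℝ) : Prop where
  symm : ∀ ξ η, B ξ η = B η ξ
  pos : ∀ ξ, ξ ≠ 0 → 0 < B ξ ξ
  invariant : ∀ (g : G) (ξ η), B (Ad g ξ) (Ad g η) = B ξ η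

variable [MulAction G X]

variable (E E_G G) in
/-- The infinitesimal action `L_x : 𝔤 → T_x X`, i.e. `L_x ξ = X_ξ (x)`: the derivative at `1` of the
orbit map `g ↦ g x`. -/
def L (x : X) : E_G →L[ℝ] TangentSpace 𝓘(ℝ, E) x :=
  (mfderiv 𝓘(ℝ, E_G) 𝓘(ℝ, E) (fun g : G ↦ g • x) 1 :)

/-- On the `G`-invariant open set `U`, `ω_X` is a symplectic form, and the action of `G` is Hamiltonian
with moment map `μ`, the Lie algebra being identified with its dual by `B`. -/
structure IsHamiltonianOn (G : Type*) [TopologicalSpace G] [ChartedSpace E_G G] [Group G]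
    [MulAction G X] (B : E_G →L[ℝ] E_G →L[ℝ] ℝ) (ω_X : Form E X 2) (μ : X → E_G) (U : Set X) :
    Prop where
  isOpen : IsOpen U
  smul_mem : ∀ (g : G), ∀ x ∈ U, g • x ∈ U
  smooth : ∀ x ∈ U, ω_X.SmoothAt x
  closed : ∀ x ∈ U, ω_X.d x = 0
  nondegenerate : ∀ x ∈ U, ∀ v, (∀ w, ω_X x ![v, w] = 0) → v = 0
  smooth_moment : ContMDiffOn 𝓘(ℝ, E) 𝓘(ℝ, E_G) ∞ μ U
  equivariant : ∀ (g : G), ∀ x ∈ U, μ (g • x) = Ad g (μ x)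
  moment : ∀ x ∈ U, ∀ (ξ : E_G) (v : TangentSpace 𝓘(ℝ, E) x),
    ω_X x ![L E E_G G x ξ, v] = B (mvfderiv 𝓘(ℝ, E) μ x v) ξ

/-- `J` is a smooth `G`-invariant almost complex structure on `X` which is compatible with `ω_X`:
`g(v, w) = ω_X(v, J w)` is a Riemannian metric for which `J` is an isometry. -/
structure IsCompatible (G : Type*) [Group G] [MulAction G X] [IsManifold 𝓘(ℝ, E) ∞ X]
    (ω_X : Form E X 2) (J : Π x : X, TangentSpace 𝓘(ℝ, E) x →L[ℝ] TangentSpace 𝓘(ℝ, E) x) :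
    Prop where
  smooth : ContMDiff 𝓘(ℝ, E) (𝓘(ℝ, E).prod 𝓘(ℝ, E →L[ℝ] E)) ∞
    (fun x ↦ Bundle.TotalSpace.mk' (E →L[ℝ] E)
      (E := fun x : X ↦ TangentSpace 𝓘(ℝ, E) x →L[ℝ] TangentSpace 𝓘(ℝ, E) x) x (J x))
  sq : ∀ x v, J x (J x v) = -v
  isometry : ∀ x v w, ω_X x ![J x v, J x w] = ω_X x ![v, w]
  pos : ∀ x v, v ≠ 0 → 0 < ω_X x ![v, J x v]
  invariant : ∀ (g : G) x v, J (g • x) (mfderiv 𝓘(ℝ, E) 𝓘(ℝ, E) (fun y : X ↦ g • y) x v) =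
    mfderiv 𝓘(ℝ, E) 𝓘(ℝ, E) (fun y : X ↦ g • y) x (J x v)

end Action

/-! ### The exponential map of the metric `ω_X(·, J ·)` -/

section Exp

variable {E : Type*} [NormedAddCommGroup E] [NormedSpace ℝ E]
  {X : Type*} [TopologicalSpace X] [ChartedSpace E X]
  (ω_X : Form E X 2) (J : Π x : X, TangentSpace 𝓘(ℝ, E) x →L[ℝ] TangentSpace 𝓘(ℝ, E) x)

/-- The metric `g(v, w) = ω_X(v, J w)`. -/
def metric (x : X) (v w : TangentSpace 𝓘(ℝ, E) x) : ℝ := ω_X x ![v, J x w]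

/-- The coefficients of the metric at the point `e` of the chart around `x₀`. -/
def metricInChart (x₀ : X) (e v w : E) : ℝ :=
  metric ω_X J ((extChartAt 𝓘(ℝ, E) x₀).symm e)
    (mfderiv 𝓘(ℝ, E) 𝓘(ℝ, E) (extChartAt 𝓘(ℝ, E) x₀).symm e v)
    (mfderiv 𝓘(ℝ, E) 𝓘(ℝ, E) (extChartAt 𝓘(ℝ, E) x₀).symm e w)

/-- `γ` satisfies the geodesic equation `∇_{γ'} γ' = 0` of the Levi-Civita connection at time `t`.
In the coordinates around `γ t`, writing `c` for the curve, the equation paired with a vector `w` is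
`g(c'', w) + (∂_{c'} g)(c', w) - (1 / 2) (∂_w g)(c', c') = 0`, by the formula for the
Christoffel symbols of the first kind. -/
def IsGeodesicAt (γ : ℝ → X) (t : ℝ) : Prop :=
  ContMDiffAt 𝓘(ℝ, ℝ) 𝓘(ℝ, E) 2 γ t ∧
    let c : ℝ → E := fun s ↦ extChartAt 𝓘(ℝ, E) (γ t) (γ s)
    ∀ w : E, metricInChart ω_X J (γ t) (c t) (deriv (deriv c) t) w
      + fderiv ℝ (fun e ↦ metricInChart ω_X J (γ t) e (deriv c t) w) (c t) (deriv c t)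
      - (1 / 2) *
        fderiv ℝ (fun e ↦ metricInChart ω_X J (γ t) e (deriv c t) (deriv c t)) (c t) w = 0

/-- `γ` is a geodesic on `[0, 1]` with initial velocity `p`. -/
def IsGeodesicFrom (γ : ℝ → X) (p : TangentBundle 𝓘(ℝ, E) X) : Prop :=
  (∀ t ∈ Icc (0 : ℝ) 1, IsGeodesicAt ω_X J γ t) ∧
    tangentMap 𝓘(ℝ, ℝ) 𝓘(ℝ, E) γ ⟨0, (1 : ℝ)⟩ = p

open Classical in
/-- The Riemannian exponential map: the value at time `1` of the geodesic with initial velocity `p`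
(and the base point of `p` if there is no such geodesic, which does not happen on a compact
manifold). -/
def expMap (p : TangentBundle 𝓘(ℝ, E) X) : X :=
  if h : ∃ γ : ℝ → X, IsGeodesicFrom ω_X J γ p then h.choose 1 else p.1

end Exp

/-! ### The tubular neighbourhood and the normal form -/

section Tube

variable {E : Type*} [NormedAddCommGroup E] [NormedSpace ℝ E]
  {X : Type*} [TopologicalSpace X] [ChartedSpace E X]
  {E_G : Type*} [NormedAddCommGroup E_G] [NormedSpace ℝ E_G]
  (G : Type*) [TopologicalSpace G] [ChartedSpace E_G G] [Group G] [MulAction G X]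
  (ω_X : Form E X 2) (J : Π x : X, TangentSpace 𝓘(ℝ, E) x →L[ℝ] TangentSpace 𝓘(ℝ, E) x)
  (μ : X → E_G)

/-- The disc bundle `N^ε` of radius `ε` in the vector bundle `N = Img (J L)` over `μ⁻¹(0)`. -/
def tube (ε : ℝ) : Set (TangentBundle 𝓘(ℝ, E) X) :=
  {p | μ p.1 = 0 ∧ (∃ ξ : E_G, p.2 = J p.1 (L E E_G G p.1 ξ)) ∧
    metric ω_X J p.1 p.2 p.2 < ε ^ 2}

/-- The image `U^ε = exp (N^ε)`. -/
def tubeImage (ε : ℝ) : Set X := expMap ω_X J '' tube G ω_X J μ ε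

open Classical in
/-- The inverse `U^ε → N^ε` of the exponential map (extended by the zero section outside `U^ε`). -/
def tubeInv (ε : ℝ) (y : X) : TangentBundle 𝓘(ℝ, E) X :=
  if h : ∃ p ∈ tube G ω_X J μ ε, expMap ω_X J p = y then h.choose else ⟨y, 0⟩

/-- The exponential map is a `G`-equivariant diffeomorphism from `N^ε` onto the open subset `U^ε`
of `X`. -/
structure IsTube [IsManifold 𝓘(ℝ, E) ∞ X] (ε : ℝ) : Prop where
  injOn : InjOn (expMap ω_X J) (tube G ω_X J μ ε)
  isOpen : IsOpen (tubeImage G ω_X J μ ε)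
  smooth : ContMDiffOn 𝓘(ℝ, E).tangent 𝓘(ℝ, E) ∞ (expMap ω_X J) (tube G ω_X J μ ε)
  smooth_inv : ContMDiffOn 𝓘(ℝ, E) 𝓘(ℝ, E).tangent ∞ (tubeInv G ω_X J μ ε) (tubeImage G ω_X J μ ε)
  equivariant : ∀ g : G, ∀ p ∈ tube G ω_X J μ ε,
    tangentMap 𝓘(ℝ, E) 𝓘(ℝ, E) (fun x : X ↦ g • x) p ∈ tube G ω_X J μ ε ∧
    expMap ω_X J (tangentMap 𝓘(ℝ, E) 𝓘(ℝ, E) (fun x : X ↦ g • x) p) = g • expMap ω_X J p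

/-- The bundle projection `π : N^ε → μ⁻¹(0)`, seen on `U^ε`. -/
def proj (ε : ℝ) (y : X) : X := (tubeInv G ω_X J μ ε y).1

/-- The pullback by `ι_G` of the canonical one-form of `T^*F_G`, seen on `U^ε`: at
`y = exp_z (J L_z ξ)` it is the form `w ↦ ω_X_z (J L_z ξ, pr_G (dπ_y w))`, where `pr_G` is the
orthogonal projection of `T_z μ⁻¹(0)` onto `Img L_z`. The projection may be left out, since
`ω_X_z (J L_z ξ, ·)` vanishes on the orthogonal complement of `Img L_z`, see
`omega_J_L_eq_omega_J_L_pr` below. -/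
def oneForm (ε : ℝ) : Form E X 1 := fun y ↦
  (contract (tubeInv G ω_X J μ ε y).2 (ω_X (proj G ω_X J μ ε y))).compContinuousLinearMap
    (mfderiv 𝓘(ℝ, E) 𝓘(ℝ, E) (proj G ω_X J μ ε) y)

/-- If `u = L_z η + h` with `h` orthogonal to `Img L_z`, so that `pr_G u = L_z η` when `u` is tangent
to `μ⁻¹(0)`, then `ω_X_z (J L_z ξ, u) = ω_X_z (J L_z ξ, pr_G u)`. -/
theorem omega_J_L_eq_omega_J_L_pr [IsManifold 𝓘(ℝ, E) ∞ X] (hJ : IsCompatible G ω_X J) (z : X)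
    (ξ η : E_G) (u h : TangentSpace 𝓘(ℝ, E) z) (hu : u = L E E_G G z η + h)
    (hh : ∀ ζ : E_G, metric ω_X J z (L E E_G G z ζ) h = 0) :
    ω_X z ![J z (L E E_G G z ξ), u] = ω_X z ![J z (L E E_G G z ξ), L E E_G G z η] := by
  have k0 (a b c : TangentSpace 𝓘(ℝ, E) z) : Function.update ![a, b] 0 c = ![c, b] := by
    ext i; fin_cases i <;> simp
  have k1 (a b c : TangentSpace 𝓘(ℝ, E) z) : Function.update ![a, b] 1 c = ![a, c] := by
    ext i; fin_cases i <;> simp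
  have h1 : ω_X z ![J z (L E E_G G z ξ), h] = 0 := by
    have h2 := hJ.isometry z (J z (L E E_G G z ξ)) h
    have h3 := (ω_X z).map_update_smul ![L E E_G G z ξ, J z h] 0 (-1 : ℝ) (L E E_G G z ξ)
    have h4 : ω_X z ![L E E_G G z ξ, J z h] = 0 := hh ξ
    rw [k0, k0, h4, smul_zero, neg_one_smul] at h3
    rw [← h2, hJ.sq, h3]
  have h5 := (ω_X z).map_update_add ![J z (L E E_G G z ξ), u] 1 (L E E_G G z η) h
  rw [k1, k1, k1, ← hu, h1, add_zero] at h5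
  exact h5

/-- The two-form `ω₀ = π^*(ω_X|_{μ⁻¹(0)}) + ι_G^* dΘ_G` of the normal form, seen on `U^ε`. -/
def omega₀ (ε : ℝ) : Form E X 2 := fun y ↦
  ω_X.pullback (proj G ω_X J μ ε) y + (oneForm G ω_X J μ ε).d y

/-- The moment map of the normal form that vanishes on `μ⁻¹(0)`, seen on `U^ε`: it is linear on the
fibres of `N`, with `μ₀ (z, J L_z ξ) = d_z μ (J L_z ξ)`. -/
def mu₀ (ε : ℝ) (y : X) : E_G :=
  mvfderiv 𝓘(ℝ, E) μ (proj G ω_X J μ ε y) (tubeInv G ω_X J μ ε y).2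

end Tube

end NormalForm

end

set_option linter.unusedSectionVars false

noncomputable section

namespace NormalForm

open Filter

/-! ### Germs of smooth maps -/

section SmoothNear

variable {E F F' : Type*} [NormedAddCommGroup E] [NormedSpace ℝ E] [NormedAddCommGroup F]
  [NormedSpace ℝ F] [NormedAddCommGroup F'] [NormedSpace ℝ F']

/-! The proof is an equivariant relative Moser argument along `μ⁻¹(0)`, in which the moment maps are
matched together with the forms.

The tube. At `z ∈ μ⁻¹(0)` regularity makes `L_z` injective (`IsHamiltonianOn.tensorL_injective`).
Since `ω(L_z η, J L_z η) = |L_z η|²`, the moment equation shows that `J L_z 𝔤` meets `ker d_z μ`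
only in `0`. Hence `(z, ξ) ↦ (exp_z (J L_z ξ), μ z)`, defined on an open set of `X × 𝔤` and not only
over the level set, is invertible to first order at `(z, 0)`. The slice `μ = 0` of its local inverse
gives smooth sections of the normal exponential map (`IsRegular.exists_normal_chart`), and
compactness of `μ⁻¹(0)` turns local injectivity into a radius (`IsRegular.exists_isTubeRadius`). The
exponential map is equivariant because `G` acts by isometries: closedness of `ω` and the moment
equation give `L_{X_ξ} ω = 0`, so the connected group `G` preserves `ω`, while `J` is invariant by
hypothesis.

The normal form. At points of `μ⁻¹(0)` the forms `ω₀` and `ω` coincide because `Img (J L_z)` is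
isotropic (`IsTubeChart.omega₀_self`), so `ω₀` is nondegenerate nearby. It is closed as a sum of a
pulled back closed form and an exact one. Its moment map is `μ₀` by Cartan's formula for the
invariant form `Θ` (`IsTubeChart.moment`).

Moser's argument. Multiplication by `s` in the fibres retracts the tube to `μ⁻¹(0)`. The homotopy
operator yields `β` with `dβ = ω - ω₀`, and `β` vanishes together with its first derivative along
the zero level (`homotopyPrimitive_spec`). The field `V_t` with `ι_{V_t} (ω₀ + t (ω - ω₀)) = -β`
therefore has a flow that fixes the zero level to first order, and its time one map `φ` satisfies
`φ^*ω = ω₀` (`exists_moser_flow`). Moreover `β(X_η) = -⟨μ - μ₀, η⟩`, because the two moment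
equations turn the defining integral into a total derivative along radial curves. It follows that
`⟨μ₀ + t (μ - μ₀), η⟩` is constant along the flow, which gives `φ^*μ = μ₀`.

The analysis. Flows are needed only near stationary points with vanishing linearization. There the
integral equation is solved for the whole time interval at once by the inverse function theorem in a
Banach space of paths, which also gives smooth dependence on the initial value
(`exists_flow_of_contDiff`). Moser's field is of this kind, and the geodesic flow becomes so after
the substitution `c = a + t w`. The time interval `[-1, 2]` contains `[0, 1]` in its interior, so
all derivatives on `[0, 1]` are two-sided.

From local to global. Moser's equation is formulated without charts (`IsMoserVector`), and its
solutions starting near the zero level are unique. This makes the local flows agree on overlaps, and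
since the equation is `G`-invariant it also makes the time one map equivariant. -/

/-- `f` is smooth on a neighbourhood of `x`. -/
def SmoothNear (f : E → F) (x : E) : Prop := ∀ᶠ y in 𝓝 x, ContDiffAt ℝ ∞ f y

theorem SmoothNear.contDiffAt {f : E → F} {x : E} (h : SmoothNear f x) : ContDiffAt ℝ ∞ f x :=
  h.self_of_nhds

theorem SmoothNear.differentiableAt {f : E → F} {x : E} (h : SmoothNear f x) :
    DifferentiableAt ℝ f x :=
  h.contDiffAt.differentiableAt (by simp)

theorem SmoothNear.continuousAt {f : E → F} {x : E} (h : SmoothNear f x) : ContinuousAt f x :=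
  h.contDiffAt.continuousAt

theorem SmoothNear.eventually {f : E → F} {x : E} (h : SmoothNear f x) :
    ∀ᶠ y in 𝓝 x, SmoothNear f y :=
  eventually_eventually_nhds.2 h

theorem SmoothNear.of_contDiff {f : E → F} (h : ContDiff ℝ ∞ f) (x : E) : SmoothNear f x :=
  Eventually.of_forall fun _ ↦ h.contDiffAt

theorem smoothNear_const (c : F) (x : E) : SmoothNear (fun _ : E ↦ c) x :=
  .of_contDiff contDiff_const x

theorem smoothNear_id (x : E) : SmoothNear (fun y : E ↦ y) x := .of_contDiff contDiff_id x

theorem SmoothNear.comp {g : F → F'} {f : E → F} {x : E} (hg : SmoothNear g (f x))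
    (hf : SmoothNear f x) : SmoothNear (fun y ↦ g (f y)) x := by
  filter_upwards [hf, hf.continuousAt.eventually hg] with y hy hy'
  exact hy'.comp y hy

theorem SmoothNear.prodMk {g : E → F'} {f : E → F} {x : E} (hf : SmoothNear f x)
    (hg : SmoothNear g x) : SmoothNear (fun y ↦ (f y, g y)) x := by
  filter_upwards [hf, hg] with y hy hy' using hy.prodMk hy'

protected theorem SmoothNear.fst {f : E → F × F'} {x : E} (hf : SmoothNear f x) :
    SmoothNear (fun y ↦ (f y).1) x := by
  filter_upwards [hf] with y hy using hy.fst

protected theorem SmoothNear.snd {f : E → F × F'} {x : E} (hf : SmoothNear f x) :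
    SmoothNear (fun y ↦ (f y).2) x := by
  filter_upwards [hf] with y hy using hy.snd

protected theorem SmoothNear.fderiv {f : E → F} {x : E} (hf : SmoothNear f x) :
    SmoothNear (fderiv ℝ f) x := by
  filter_upwards [hf] with y hy using hy.fderiv_right (by simp)

theorem SmoothNear.clm_const (A : F →L[ℝ] F') {f : E → F} {x : E} (hf : SmoothNear f x) :
    SmoothNear (fun y ↦ A (f y)) x := by
  filter_upwards [hf] with y hy using ContDiffAt.continuousLinearMap_comp A hy

theorem SmoothNear.clm_apply {f : E → F →L[ℝ] F'} {g : E → F} {x : E} (hf : SmoothNear f x)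
    (hg : SmoothNear g x) : SmoothNear (fun y ↦ f y (g y)) x := by
  filter_upwards [hf, hg] with y hy hy' using hy.clm_apply hy'

theorem SmoothNear.clm_comp {G : Type*} [NormedAddCommGroup G] [NormedSpace ℝ G]
    {f : E → F →L[ℝ] F'} {g : E → G →L[ℝ] F} {x : E} (hf : SmoothNear f x)
    (hg : SmoothNear g x) : SmoothNear (fun y ↦ (f y).comp (g y)) x := by
  filter_upwards [hf, hg] with y hy hy' using hy.clm_comp hy'

theorem SmoothNear.add {f g : E → F} {x : E} (hf : SmoothNear f x)
    (hg : SmoothNear g x) : SmoothNear (fun y ↦ f y + g y) x := by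
  filter_upwards [hf, hg] with y hy hy' using hy.add hy'

theorem SmoothNear.sub {f g : E → F} {x : E} (hf : SmoothNear f x)
    (hg : SmoothNear g x) : SmoothNear (fun y ↦ f y - g y) x := by
  filter_upwards [hf, hg] with y hy hy' using hy.sub hy'

theorem SmoothNear.neg {f : E → F} {x : E} (hf : SmoothNear f x) :
    SmoothNear (fun y ↦ - f y) x := by
  filter_upwards [hf] with y hy using hy.neg

theorem SmoothNear.smul {f : E → ℝ} {g : E → F} {x : E} (hf : SmoothNear f x)
    (hg : SmoothNear g x) : SmoothNear (fun y ↦ f y • g y) x := by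
  filter_upwards [hf, hg] with y hy hy' using hy.smul hy'

/-- On a finite-dimensional space a linear map is a fixed linear expression in its values on a
basis, so smoothness may be tested vector by vector. -/
theorem SmoothNear.clm_of_apply [FiniteDimensional ℝ F] {f : E → F →L[ℝ] F'} {x : E}
    (hf : ∀ v, SmoothNear (fun y ↦ f y v) x) : SmoothNear f x := by
  let b := Module.finBasis ℝ F
  have h : ∀ᶠ y in 𝓝 x, ∀ i, ContDiffAt ℝ ∞ (fun y ↦ f y (b i)) y :=
    eventually_all.2 fun i ↦ hf (b i)
  filter_upwards [h] with y hy
  have h2 : f = fun y ↦ ∑ i, (ContinuousLinearMap.smulRightL ℝ F F'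
      (LinearMap.toContinuousLinearMap (b.coord i))) (f y (b i)) := by
    ext y v
    conv_lhs => rw [← b.sum_repr v, map_sum]
    simp
  rw [h2]
  exact ContDiffAt.sum fun i _ ↦ ContDiffAt.continuousLinearMap_comp _ (hy i)

theorem SmoothNear.congr {f g : E → F} {x : E} (hf : SmoothNear f x) (h : g =ᶠ[𝓝 x] f) :
    SmoothNear g x := by
  filter_upwards [hf, eventually_eventually_nhds.2 h] with y hy hy'
  exact hy.congr_of_eventuallyEq hy'

theorem SmoothNear.inverse [CompleteSpace E] [CompleteSpace F'] {f : F → E →L[ℝ] F'} {x : F}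
    (hf : SmoothNear f x) (h : (f x).IsInvertible) :
    SmoothNear (fun y ↦ (f y).inverse) x ∧ ∀ᶠ y in 𝓝 x, (f y).IsInvertible := by
  have h1 : ∀ᶠ y in 𝓝 x, (f y).IsInvertible := by
    obtain ⟨e, he⟩ := h
    exact hf.continuousAt.eventually (he ▸ ContinuousLinearEquiv.nhds e)
  refine ⟨?_, h1⟩
  filter_upwards [hf, h1] with y hy hy'
  obtain ⟨e, he⟩ := hy'
  exact ContDiffAt.comp y (he ▸ contDiffAt_map_inverse e) hy

/-- The inverse function theorem, with smoothness on the whole domain. -/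
theorem SmoothNear.exists_openPartialHomeomorph [CompleteSpace E] {f : E → F} {x : E}
    (hf : SmoothNear f x) (h : (fderiv ℝ f x).IsInvertible) :
    ∃ P : OpenPartialHomeomorph E F, x ∈ P.source ∧ (∀ y, P y = f y) ∧
      ∀ y ∈ P.target, SmoothNear P.symm y := by
  obtain ⟨e, he⟩ := h
  have h1 : HasFDerivAt f (e : E →L[ℝ] F) x := he ▸ hf.differentiableAt.hasFDerivAt
  let P := hf.contDiffAt.toOpenPartialHomeomorph f h1 (by simp)
  have hP : ∀ y, P y = f y := fun _ ↦ rfl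
  -- The local inverse is a priori smooth only at the image of `x`. Restricting to an open set on
  -- which `f` is smooth with invertible derivative makes it smooth on the whole target.
  have h2 : ∀ᶠ y in 𝓝 x, ContDiffAt ℝ ∞ f y ∧ (fderiv ℝ f y).IsInvertible :=
    hf.and (hf.fderiv.continuousAt.eventually (he ▸ ContinuousLinearEquiv.nhds e))
  obtain ⟨U, hU, hUo, hxU⟩ := eventually_nhds_iff.1 h2
  refine ⟨P.restrOpen U hUo, ?_, hP, ?_⟩
  · exact ⟨ContDiffAt.mem_toOpenPartialHomeomorph_source hf.contDiffAt h1 (by simp), hxU⟩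
  intro y hy
  filter_upwards [(P.restrOpen U hUo).open_target.mem_nhds hy] with y hy
  have h3 := (P.restrOpen U hUo).map_target hy
  obtain ⟨e', he'⟩ := (hU _ h3.2).2
  refine (P.restrOpen U hUo).contDiffAt_symm (f₀' := e') hy ?_ (hU _ h3.2).1
  rw [he']
  exact ((hU _ h3.2).1.differentiableAt (by simp)).hasFDerivAt

/-- A map which is smooth near a compact set agrees near this set with a globally smooth map. -/
theorem exists_contDiff_eq_nhdsSet [FiniteDimensional ℝ E] {f : E → F} {s : Set E}
    (hs : IsCompact s) (hf : ∀ x ∈ s, SmoothNear f x) :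
    ∃ g : E → F, ContDiff ℝ ∞ g ∧ ∀ᶠ x in 𝓝ˢ s, g =ᶠ[𝓝 x] f := by
  let O := interior {x | ContDiffAt ℝ ∞ f x}
  have hO : s ⊆ O := fun x hx ↦ mem_interior_iff_mem_nhds.2 (hf x hx)
  obtain ⟨χ, h0, h1, -⟩ := exists_contMDiffMap_zero_one_nhds_of_isClosed (n := ⊤) 𝓘(ℝ, E)
    (isOpen_interior (s := {x | ContDiffAt ℝ ∞ f x})).isClosed_compl hs.isClosed
    (disjoint_compl_left_iff_subset.2 hO)
  have hχ : ContDiff ℝ ∞ χ := χ.contMDiff.contDiff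
  refine ⟨fun x ↦ χ x • f x, ?_, ?_⟩
  · rw [contDiff_iff_contDiffAt]
    intro x
    by_cases hx : x ∈ O
    · have hx' : ContDiffAt ℝ ∞ f x := interior_subset hx
      exact hχ.contDiffAt.smul hx'
    -- Outside `O` nothing is known about `f`, but the cutoff vanishes on a full neighbourhood of
    -- each such point.
    · have : (fun x ↦ χ x • f x) =ᶠ[𝓝 x] fun _ ↦ 0 := by
        filter_upwards [eventually_nhdsSet_iff_forall.1 h0 x hx] with y hy
        simp [hy]
      exact contDiffAt_const.congr_of_eventuallyEq this
  · filter_upwards [h1.eventually_nhdsSet] with x hx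
    filter_upwards [hx] with y hy
    simp [hy]

end SmoothNear

/-! ### Superposition operators and integration on spaces of continuous paths -/

/-- The time interval on which flows are constructed. -/
abbrev Time : Set ℝ := Icc (-1 : ℝ) 2

theorem zero_mem_time : (0 : ℝ) ∈ Time := by constructor <;> norm_num

theorem time_le : (-1 : ℝ) ≤ 2 := by norm_num

section Paths

set_option linter.unusedSectionVars false

universe u

variable {E F : Type u} [NormedAddCommGroup E] [NormedSpace ℝ E] [NormedAddCommGroup F]
  [NormedSpace ℝ F]

/-- The superposition operator `u ↦ (t ↦ f (t, u t))`. -/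
def superpos (f : ℝ × E → F) (hf : Continuous f) (u : C(Time, E)) : C(Time, F) :=
  ⟨fun t ↦ f (t, u t), by fun_prop⟩

theorem continuous_superpos (f : ℝ × E → F) (hf : Continuous f) : Continuous (superpos f hf) := by
  apply ContinuousMap.continuous_of_continuous_uncurry
  change Continuous fun p : C(Time, E) × Time ↦ f (p.2, p.1 p.2)
  fun_prop

/-- Pointwise application of a path of linear maps to a path. -/
def pathApply : C(Time, E →L[ℝ] F) →L[ℝ] C(Time, E) →L[ℝ] C(Time, F) :=
  LinearMap.mkContinuous₂
    (LinearMap.mk₂ ℝ (fun (A : C(Time, E →L[ℝ] F)) (h : C(Time, E)) ↦ (⟨fun t ↦ A t (h t), by fun_prop⟩ : C(Time, F)))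
      (fun _ _ _ ↦ by ext; simp) (fun _ _ _ ↦ by ext; simp) (fun _ _ _ ↦ by ext; simp)
      (fun _ _ _ ↦ by ext; simp)) 1 (by
    intro A h
    rw [ContinuousMap.norm_le _ (by positivity)]
    intro t
    calc ‖A t (h t)‖ ≤ ‖A t‖ * ‖h t‖ := (A t).le_opNorm _
      _ ≤ 1 * ‖A‖ * ‖h‖ := by
        rw [one_mul]
        gcongr
        · exact A.norm_coe_le_norm t
        · exact h.norm_coe_le_norm t)

theorem pathApply_apply (A : C(Time, E →L[ℝ] F)) (h : C(Time, E)) (t : Time) :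
    pathApply A h t = A t (h t) := rfl

/-- The derivative in the second variable. -/
def dsnd (f : ℝ × E → F) (p : ℝ × E) : E →L[ℝ] F :=
  (fderiv ℝ f p).comp (ContinuousLinearMap.inr ℝ ℝ E)

theorem dsnd_apply (f : ℝ × E → F) (p : ℝ × E) (v : E) : dsnd f p v = fderiv ℝ f p (0, v) := by
  simp [dsnd]

theorem contDiff_dsnd {f : ℝ × E → F} (hf : ContDiff ℝ ∞ f) : ContDiff ℝ ∞ (dsnd f) :=
  (hf.fderiv_right (by simp)).clm_comp contDiff_const

theorem hasFDerivAt_dsnd {f : ℝ × E → F} {t : ℝ} {x : E} (hf : DifferentiableAt ℝ f (t, x)) :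
    HasFDerivAt (fun y ↦ f (t, y)) (dsnd f (t, x)) x :=
  hf.hasFDerivAt.comp x (hasFDerivAt_prodMk_right t x)

/-- The mean value inequality is applied at each time separately. The constant is uniform in time
because the superposition operator of `dsnd f` is continuous for the sup norm. -/
theorem hasFDerivAt_superpos {f : ℝ × E → F} (hf : ContDiff ℝ ∞ f) (u : C(Time, E)) :
    HasFDerivAt (superpos f hf.continuous)
      (pathApply (superpos (dsnd f) (contDiff_dsnd hf).continuous u)) u := by
  have hc := (continuous_superpos (dsnd f) (contDiff_dsnd hf).continuous).continuousAt (x := u)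
  rw [hasFDerivAt_iff_isLittleO, Asymptotics.isLittleO_iff]
  intro c hc0
  obtain ⟨δ, hδ, h⟩ := Metric.continuousAt_iff.1 hc c hc0
  filter_upwards [Metric.ball_mem_nhds u hδ] with v hv
  rw [ContinuousMap.norm_le _ (by positivity)]
  intro t
  have h1 : ∀ y ∈ Metric.ball (u t) δ, ‖dsnd f (t, y) - dsnd f (t, u t)‖ ≤ c := by
    intro y hy
    -- Translating the whole path by a constant realizes the arbitrary point `y` as a value at time
    -- `t` of a path that is uniformly close to `u`.
    have h2 : dist (u + ContinuousMap.const _ (y - u t)) u < δ := by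
      rw [ContinuousMap.dist_lt_iff hδ]
      intro s
      simpa [dist_eq_norm] using hy
    have h3 := (ContinuousMap.dist_apply_le_dist t).trans (h h2).le
    simpa [dist_eq_norm, superpos] using h3
  have hv' : v t ∈ Metric.ball (u t) δ := (ContinuousMap.dist_apply_le_dist t).trans_lt hv
  have h4 := (convex_ball (u t) δ).norm_image_sub_le_of_norm_hasFDerivWithin_le'
    (f := fun y ↦ f (t, y)) (f' := fun y ↦ dsnd f (t, y)) (φ := dsnd f (t, u t)) (C := c)
    (fun y _ ↦ (hasFDerivAt_dsnd (hf.differentiable (by simp) _)).hasFDerivWithinAt) h1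
    (Metric.mem_ball_self hδ) hv'
  refine h4.trans (mul_le_mul_of_nonneg_left ((v - u).norm_coe_le_norm t) hc0.le)

/-- The derivative is again a superposition operator, that of `dsnd f`, followed by the bounded
bilinear map `pathApply`. The induction therefore runs over all target spaces at once: `F` is
replaced by `E →L[ℝ] F`, which has to live in the same universe. -/
theorem contDiff_superpos {f : ℝ × E → F} (hf : ContDiff ℝ ∞ f) :
    ContDiff ℝ ∞ (superpos f hf.continuous) := by
  rw [contDiff_infty]
  intro n
  induction n generalizing F with
  | zero => exact contDiff_zero.2 (continuous_superpos f _)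
  | succ n ih =>
    have := contDiff_succ_iff_hasFDerivAt (𝕜 := ℝ) (f := superpos f hf.continuous) (n := n)
    push_cast
    rw [this]
    exact ⟨_, ContDiff.continuousLinearMap_comp pathApply (ih (contDiff_dsnd hf)),
      hasFDerivAt_superpos hf⟩

/-- A path, extended to all times. -/
def extendPath (u : C(Time, E)) (t : ℝ) : E := u (projIcc (-1) 2 time_le t)

theorem continuous_extendPath (u : C(Time, E)) : Continuous (extendPath u) :=
  u.continuous.comp continuous_projIcc

theorem extendPath_of_mem (u : C(Time, E)) {t : ℝ} (ht : t ∈ Time) : extendPath u t = u ⟨t, ht⟩ := by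
  rw [extendPath, projIcc_of_mem _ ht]

variable [CompleteSpace F] [CompleteSpace E]

/-- The primitive of a path. -/
def primitive : C(Time, E) →L[ℝ] C(Time, E) :=
  LinearMap.mkContinuous
    { toFun := fun u ↦ ⟨fun t ↦ ∫ s in (0 : ℝ)..t, extendPath u s,
        (intervalIntegral.continuous_primitive
          (fun a b ↦ (continuous_extendPath u).intervalIntegrable a b) 0).comp
          continuous_subtype_val⟩
      map_add' := fun u v ↦ by
        ext t
        exact intervalIntegral.integral_add ((continuous_extendPath u).intervalIntegrable _ _)
          ((continuous_extendPath v).intervalIntegrable _ _)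
      map_smul' := fun c u ↦ by
        ext t
        exact intervalIntegral.integral_smul c _ } 2 (by
    intro u
    -- The bound `2` is the maximum of `|t|` on `[-1, 2]`.
    rw [ContinuousMap.norm_le _ (by positivity)]
    intro t
    have h := intervalIntegral.norm_integral_le_of_norm_le_const (a := 0) (b := t)
      (f := extendPath u) (C := ‖u‖) (fun s _ ↦ u.norm_coe_le_norm _)
    refine h.trans ?_
    rw [mul_comm]
    gcongr
    rw [abs_le]
    constructor <;> linarith [t.2.1, t.2.2])

theorem primitive_apply (u : C(Time, E)) (t : Time) :
    primitive u t = ∫ s in (0 : ℝ)..t, extendPath u s := rfl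

theorem hasDerivAt_extendPath_primitive (u : C(Time, E)) {t : ℝ} (ht : t ∈ Ioo (-1 : ℝ) 2) :
    HasDerivAt (extendPath (primitive u)) (extendPath u t) t := by
  have h1 : HasDerivAt (fun t ↦ ∫ s in (0 : ℝ)..t, extendPath u s) (extendPath u t) t :=
    ((continuous_extendPath u).integral_hasStrictDerivAt 0 t).hasDerivAt
  refine h1.congr_of_eventuallyEq ?_
  filter_upwards [Ioo_mem_nhds ht.1 ht.2] with s hs
  rw [extendPath_of_mem _ (Ioo_subset_Icc_self hs), primitive_apply]

/-- Local existence of the flow of a time-dependent vector field near a stationary point at which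
the linearization vanishes, for a globally smooth vector field. -/
theorem exists_flow_of_contDiff {f : ℝ × E → E} {e : E} (hf : ContDiff ℝ ∞ f)
    (h0 : ∀ t ∈ Time, f (t, e) = 0) (h1 : ∀ t ∈ Time, dsnd f (t, e) = 0) :
    ∃ Φ : ℝ → E → E,
      (∀ V ∈ 𝓝 e, ∀ᶠ x in 𝓝 e, ∀ t, Φ t x ∈ V) ∧
      (∀ᶠ x in 𝓝 e, ∀ t, SmoothNear (Φ t) x) ∧
      (∀ᶠ x in 𝓝 e, Φ 0 x = x ∧
        (∀ t ∈ Ioo (-1 : ℝ) 2, HasDerivAt (fun s ↦ Φ s x) (f (t, Φ t x)) t) ∧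
        ∀ v, fderiv ℝ (Φ 0) x v = v ∧ ∀ t ∈ Ioo (-1 : ℝ) 2,
          HasDerivAt (fun s ↦ fderiv ℝ (Φ s) x v)
            (dsnd f (t, Φ t x) (fderiv ℝ (Φ t) x v)) t) ∧
      ∀ᶠ x in 𝓝 e, (∀ t ∈ Time, f (t, x) = 0) → (∀ t, Φ t x = x) ∧
        ((∀ t ∈ Time, dsnd f (t, x) = 0) → ∀ t, fderiv ℝ (Φ t) x = .id ℝ E) := by
  let cst : E →L[ℝ] C(Time, E) := ContinuousLinearMap.const ℝ Time
  have hcst (x : E) (t : Time) : cst x t = x := rfl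
  -- The zeros of `R (x, ·)` are the solutions of the integral equation with initial value `x`.
  -- Keeping `x` as the first component of `H` turns the implicit function problem into an inversion
  -- of `H`.
  let R : E × C(Time, E) → C(Time, E) := fun p ↦
    p.2 - cst p.1 - primitive (superpos f hf.continuous p.2)
  let H : E × C(Time, E) → E × C(Time, E) := fun p ↦ (p.1, R p)
  have hR : ContDiff ℝ ∞ R := (contDiff_snd.sub (cst.contDiff.comp contDiff_fst)).sub
    (primitive.contDiff.comp ((contDiff_superpos hf).comp contDiff_snd))
  have hH : ContDiff ℝ ∞ H := contDiff_fst.prodMk hR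
  have hs0 (x : E) (hx : ∀ t ∈ Time, f (t, x) = 0) : superpos f hf.continuous (cst x) = 0 := by
    ext t
    exact hx t t.2
  have hd0 (x : E) (hx : ∀ t ∈ Time, dsnd f (t, x) = 0) :
      superpos (dsnd f) (contDiff_dsnd hf).continuous (cst x) = 0 := by
    ext1 t
    exact hx t t.2
  -- Since the linearization of `f` vanishes along the constant path `e`, the integral term has
  -- derivative zero. What remains is a shear, which is invertible whatever the length of the time
  -- interval.
  have hH' : HasFDerivAt H ((ContinuousLinearMap.fst ℝ E C(Time, E)).prod
      (ContinuousLinearMap.snd ℝ E C(Time, E) - cst.comp (ContinuousLinearMap.fst ℝ E C(Time, E))))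
      (e, cst e) := by
    refine hasFDerivAt_fst.prodMk ?_
    have h2 : HasFDerivAt (fun p : E × C(Time, E) ↦ superpos f hf.continuous p.2)
        (0 : E × C(Time, E) →L[ℝ] C(Time, E)) (e, cst e) := by
      have h3 := hasFDerivAt_superpos hf (cst e)
      rw [hd0 e h1, map_zero] at h3
      have := HasFDerivAt.comp (e, cst e) h3
        (hasFDerivAt_snd (𝕜 := ℝ) (E := E) (F := C(Time, E)) (p := (e, cst e)))
      simpa using! this
    have h4 := (hasFDerivAt_snd.sub (cst.hasFDerivAt.comp (e, cst e) hasFDerivAt_fst)).sub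
      (primitive.hasFDerivAt.comp (e, cst e) h2)
    simpa using! h4
  have hinv : (fderiv ℝ H (e, cst e)).IsInvertible := by
    rw [hH'.fderiv]
    refine ⟨ContinuousLinearEquiv.equivOfInverse ((ContinuousLinearMap.fst ℝ E C(Time, E)).prod
      (ContinuousLinearMap.snd ℝ E C(Time, E) -
        cst.comp (ContinuousLinearMap.fst ℝ E C(Time, E)))) ((ContinuousLinearMap.fst ℝ E C(Time, E)).prod
      (ContinuousLinearMap.snd ℝ E C(Time, E) +
        cst.comp (ContinuousLinearMap.fst ℝ E C(Time, E)))) ?_ ?_, rfl⟩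
    · intro p; ext1 <;> simp
    · intro p; ext1 <;> simp
  obtain ⟨P, hPs, hP, hPsm⟩ :=
    (SmoothNear.of_contDiff hH (e, cst e)).exists_openPartialHomeomorph hinv
  have hHc (x : E) (hx : ∀ t ∈ Time, f (t, x) = 0) : P (x, cst x) = (x, 0) := by
    rw [hP]
    simp [H, R, hs0 x hx]
  let sol : E → C(Time, E) := fun x ↦ (P.symm (x, 0)).2
  have htgt : (e, (0 : C(Time, E))) ∈ P.target := by
    rw [← hHc e h0]; exact P.map_source hPs
  have hcx : ContinuousAt (fun x : E ↦ (x, (0 : C(Time, E)))) e := by fun_prop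
  have htgt' : ∀ᶠ x in 𝓝 e, (x, (0 : C(Time, E))) ∈ P.target :=
    hcx.eventually (P.open_target.mem_nhds htgt)
  have hsol : ∀ᶠ x in 𝓝 e, SmoothNear sol x := by
    filter_upwards [htgt'] with x hx
    exact ((hPsm _ hx).comp (f := fun x : E ↦ (x, (0 : C(Time, E))))
      (.of_contDiff (contDiff_id.prodMk contDiff_const) x)).snd
  have heq : ∀ᶠ x in 𝓝 e, sol x = cst x + primitive (superpos f hf.continuous (sol x)) := by
    filter_upwards [htgt'] with x hx
    have h2 := P.right_inv hx
    rw [hP] at h2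
    have h3 : (P.symm (x, 0)).1 = x := congrArg Prod.fst h2
    have h4 : R (P.symm (x, 0)) = 0 := congrArg Prod.snd h2
    have h5 : sol x - cst (P.symm (x, 0)).1 - primitive (superpos f hf.continuous (sol x)) = 0 := h4
    rw [h3, sub_sub, sub_eq_zero] at h5
    exact h5
  -- At a stationary point the constant path solves the equation, so by injectivity of `H` near `(e,
  -- cst e)` it is the solution found by inversion.
  have hsolc (x : E) (hx : ∀ t ∈ Time, f (t, x) = 0) (hx' : (x, cst x) ∈ P.source) :
      sol x = cst x := by
    have h2 := P.left_inv hx'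
    rw [hHc x hx] at h2
    exact congrArg Prod.snd h2
  have hsrc' : ∀ᶠ x in 𝓝 e, (x, cst x) ∈ P.source :=
    (by fun_prop : ContinuousAt (fun x : E ↦ (x, cst x)) e).eventually
      (P.open_source.mem_nhds hPs)
  -- Differentiating the integral equation in `x` gives the integral form of the variational
  -- equation.
  have hdsol : ∀ᶠ x in 𝓝 e, ∀ v, fderiv ℝ sol x v = cst v + primitive (pathApply
      (superpos (dsnd f) (contDiff_dsnd hf).continuous (sol x)) (fderiv ℝ sol x v)) := by
    filter_upwards [eventually_eventually_nhds.2 heq, hsol] with x hx hx' v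
    have h2 : HasFDerivAt sol (cst + primitive.comp ((pathApply
        (superpos (dsnd f) (contDiff_dsnd hf).continuous (sol x))).comp (fderiv ℝ sol x))) x := by
      refine HasFDerivAt.congr_of_eventuallyEq ?_ hx
      exact cst.hasFDerivAt.add ((primitive (E := E)).hasFDerivAt.comp x
        ((hasFDerivAt_superpos hf (sol x)).comp x hx'.differentiableAt.hasFDerivAt))
    have h3 := congrArg (fun A ↦ A v) h2.fderiv
    exact h3
  let ev (t : ℝ) : C(Time, E) →L[ℝ] E :=
    ContinuousMap.evalCLM ℝ (projIcc (-1) 2 time_le t)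
  have hev (t : ℝ) (u : C(Time, E)) : ev t u = extendPath u t := rfl
  have hfd (t : ℝ) (x : E) (hx : SmoothNear sol x) (v : E) :
      fderiv ℝ (fun x ↦ extendPath (sol x) t) x v = extendPath (fderiv ℝ sol x v) t := by
    have h2 : HasFDerivAt (fun x ↦ ev t (sol x)) ((ev t).comp (fderiv ℝ sol x)) x :=
      (ev t).hasFDerivAt.comp x hx.differentiableAt.hasFDerivAt
    exact congrArg (fun A ↦ A v) h2.fderiv
  have hder (x v : E) (u : C(Time, E)) (w : C(Time, E)) (hw : w = cst v + primitive u) :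
      extendPath w 0 = v ∧ ∀ t ∈ Ioo (-1 : ℝ) 2, HasDerivAt (extendPath w) (extendPath u t) t := by
    constructor
    · rw [extendPath_of_mem _ zero_mem_time, hw]
      simp [primitive_apply, hcst]
    · intro t ht
      have h2 : extendPath w = fun t ↦ v + extendPath (primitive u) t := by
        rw [hw]; rfl
      rw [h2]
      exact (hasDerivAt_extendPath_primitive u ht).const_add v
  refine ⟨fun t x ↦ extendPath (sol x) t, ?_, ?_, ?_, ?_⟩
  · intro V hV
    obtain ⟨r, hr, hrV⟩ := Metric.mem_nhds_iff.1 hV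
    have h2 : sol e = cst e := hsolc e h0 hPs
    have h3 := hsol.self_of_nhds.continuousAt
    filter_upwards [h3.eventually (Metric.ball_mem_nhds _ hr)] with x hx t
    apply hrV
    have h4 := (ContinuousMap.dist_apply_le_dist (f := sol x) (g := sol e)
      (projIcc (-1) 2 time_le t)).trans_lt hx
    rw [h2] at h4
    exact h4
  · filter_upwards [hsol] with x hx t
    exact (SmoothNear.of_contDiff (ev t).contDiff _).comp hx
  · filter_upwards [heq, hdsol, hsol] with x hx hdx hsx
    obtain ⟨h2, h3⟩ := hder x x _ _ hx
    refine ⟨h2, ?_, ?_⟩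
    · intro t ht
      have h4 := h3 t ht
      convert! h4 using 1
      simp only [extendPath, superpos, ContinuousMap.coe_mk]
      rw [projIcc_of_mem _ (Ioo_subset_Icc_self ht)]
    · intro v
      simp only [hfd _ x hsx v]
      obtain ⟨h5, h6⟩ := hder x v _ _ (hdx v)
      refine ⟨h5, fun t ht ↦ ?_⟩
      have h4 := h6 t ht
      convert! h4 using 1
      simp only [extendPath, superpos, ContinuousMap.coe_mk, pathApply_apply]
      rw [projIcc_of_mem _ (Ioo_subset_Icc_self ht)]
  · filter_upwards [hsrc', hdsol, hsol] with x hx hdx hsx hx0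
    have h2 := hsolc x hx0 hx
    refine ⟨fun t ↦ by rw [h2]; rfl, fun hx1 t ↦ ?_⟩
    ext v
    rw [hfd t x hsx v, hdx v, h2, hd0 x hx1]
    simp [extendPath, hcst]

/-- Local existence of the flow of a time-dependent vector field near a stationary point at which
the linearization vanishes. -/
theorem exists_flow [FiniteDimensional ℝ E] {f : ℝ × E → E} {e : E}
    (hf : ∀ t ∈ Time, SmoothNear f (t, e))
    (h0 : ∀ t ∈ Time, f (t, e) = 0) (h1 : ∀ t ∈ Time, dsnd f (t, e) = 0) :
    ∃ Φ : ℝ → E → E,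
      (∀ V ∈ 𝓝 e, ∀ᶠ x in 𝓝 e, ∀ t, Φ t x ∈ V) ∧
      (∀ᶠ x in 𝓝 e, ∀ t, SmoothNear (Φ t) x) ∧
      (∀ᶠ x in 𝓝 e, Φ 0 x = x ∧
        (∀ t ∈ Ioo (-1 : ℝ) 2, HasDerivAt (fun s ↦ Φ s x) (f (t, Φ t x)) t) ∧
        ∀ v, fderiv ℝ (Φ 0) x v = v ∧ ∀ t ∈ Ioo (-1 : ℝ) 2,
          HasDerivAt (fun s ↦ fderiv ℝ (Φ s) x v)
            (dsnd f (t, Φ t x) (fderiv ℝ (Φ t) x v)) t) ∧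
      ∀ᶠ x in 𝓝 e, (∀ t ∈ Time, f (t, x) = 0) → (∀ t, Φ t x = x) ∧
        ((∀ t ∈ Time, dsnd f (t, x) = 0) → ∀ t, fderiv ℝ (Φ t) x = .id ℝ E) := by
  -- Superposition operators require a globally smooth field, so `f` is first cut off near the
  -- compact set `Time × {e}`.
  obtain ⟨g, hg, hgf⟩ := exists_contDiff_eq_nhdsSet (f := f) (s := Time ×ˢ {e})
    (isCompact_Icc.prod isCompact_singleton) (by
      rintro ⟨t, x⟩ ⟨ht, hx⟩
      rw [mem_singleton_iff] at hx
      subst hx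
      exact hf t ht)
  have hloc : ∀ᶠ x in 𝓝 e, ∀ t ∈ Time, g =ᶠ[𝓝 (t, x)] f := by
    refine isCompact_Icc.eventually_forall_of_forall_eventually (x₀ := e)
      (P := fun x t ↦ g =ᶠ[𝓝 (t, x)] f) fun t ht ↦ ?_
    have h2 := eventually_nhdsSet_iff_forall.1 hgf (t, e) ⟨ht, rfl⟩
    exact (continuous_swap.tendsto (e, t)).eventually h2
  have hloc' : ∀ᶠ x in 𝓝 e, ∀ t ∈ Time, g (t, x) = f (t, x) ∧ dsnd g (t, x) = dsnd f (t, x) := by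
    filter_upwards [hloc] with x hx t ht
    exact ⟨(hx t ht).eq_of_nhds, by rw [dsnd, dsnd, (hx t ht).fderiv_eq]⟩
  have he := hloc'.self_of_nhds
  obtain ⟨Φ, hΦ1, hΦ2, hΦ3, hΦ4⟩ := exists_flow_of_contDiff hg
    (fun t ht ↦ by rw [(he t ht).1, h0 t ht]) (fun t ht ↦ by rw [(he t ht).2, h1 t ht])
  refine ⟨Φ, hΦ1, hΦ2, ?_, ?_⟩
  -- Trajectories starting near `e` never leave the region where `g` and `f` agree to first order,
  -- so the flow of `g` is a flow of `f`.
  · filter_upwards [hΦ3, hΦ1 _ hloc'] with x ⟨hx, hx1, hx2⟩ hx3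
    refine ⟨hx, fun t ht ↦ ?_, fun v ↦ ⟨(hx2 v).1, fun t ht ↦ ?_⟩⟩
    · rw [← (hx3 t t (Ioo_subset_Icc_self ht)).1]
      exact hx1 t ht
    · rw [← (hx3 t t (Ioo_subset_Icc_self ht)).2]
      exact (hx2 v).2 t ht
  · filter_upwards [hΦ4, hloc'] with x hx hx' hx0
    obtain ⟨h2, h3⟩ := hx fun t ht ↦ by rw [(hx' t ht).1, hx0 t ht]
    exact ⟨h2, fun hx1 ↦ h3 fun t ht ↦ by rw [(hx' t ht).2, hx1 t ht]⟩

end Paths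

/-! ### Differential forms on vector spaces -/

section AltForms

set_option linter.unusedSectionVars false

variable {E F : Type*} [NormedAddCommGroup E] [NormedSpace ℝ E] [NormedAddCommGroup F]
  [NormedSpace ℝ F]

theorem extDeriv_oneForm_apply (θ : E → E [⋀^Fin 1]→L[ℝ] ℝ) (x a b : E) :
    extDeriv θ x ![a, b] = fderiv ℝ θ x a ![b] - fderiv ℝ θ x b ![a] := by
  have h0 : (0 : Fin 2).removeNth ![a, b] = ![b] := by ext i; fin_cases i; rfl
  have h1 : (1 : Fin 2).removeNth ![a, b] = ![a] := by ext i; fin_cases i; rfl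
  rw [extDeriv, ContinuousAlternatingMap.alternatizeUncurryFin_apply, Fin.sum_univ_two, h0, h1]
  simp [sub_eq_add_neg]

theorem extDeriv_twoForm_apply (τ : E → E [⋀^Fin 2]→L[ℝ] ℝ) (x a b c : E) :
    extDeriv τ x ![a, b, c] =
      fderiv ℝ τ x a ![b, c] - fderiv ℝ τ x b ![a, c] + fderiv ℝ τ x c ![a, b] := by
  have h0 : (0 : Fin 3).removeNth ![a, b, c] = ![b, c] := by ext i; fin_cases i <;> rfl
  have h1 : (1 : Fin 3).removeNth ![a, b, c] = ![a, c] := by ext i; fin_cases i <;> rfl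
  have h2 : (2 : Fin 3).removeNth ![a, b, c] = ![a, b] := by ext i; fin_cases i <;> rfl
  rw [extDeriv, ContinuousAlternatingMap.alternatizeUncurryFin_apply, Fin.sum_univ_three, h0, h1,
    h2]
  simp [sub_eq_add_neg]

theorem eq_vec_one {α : Type*} (v : Fin 1 → α) : v = ![v 0] := by ext i; fin_cases i; rfl

theorem eq_vec_two {α : Type*} (v : Fin 2 → α) : v = ![v 0, v 1] := by
  ext i; fin_cases i <;> rfl

theorem comp_vec_one {α β : Type*} (f : α → β) (a : α) : f ∘ ![a] = ![f a] := by
  ext i; fin_cases i; rfl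

theorem comp_vec_two {α β : Type*} (f : α → β) (a b : α) : f ∘ ![a, b] = ![f a, f b] := by
  ext i; fin_cases i <;> rfl

/-- An alternating two-form as a bilinear map. -/
def bilin : (E [⋀^Fin 2]→L[ℝ] ℝ) →L[ℝ] E →L[ℝ] E →L[ℝ] ℝ :=
  (ContinuousLinearMap.compL ℝ E (E [⋀^Fin 1]→L[ℝ] ℝ) (E →L[ℝ] ℝ)
    ((ContinuousAlternatingMap.ofSubsingletonLIE (𝕜 := ℝ) (E := E) (F := ℝ)
      (0 : Fin 1)).symm.toContinuousLinearEquiv : (E [⋀^Fin 1]→L[ℝ] ℝ) →L[ℝ] E →L[ℝ] ℝ)).comp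
    (ContinuousAlternatingMap.curryLeftLI (𝕜 := ℝ) (E := E) (F := ℝ)
      (n := 1)).toContinuousLinearMap

theorem bilin_apply (a : E [⋀^Fin 2]→L[ℝ] ℝ) (v w : E) : bilin a v w = a ![v, w] := by
  have : (Matrix.vecCons v fun _ : Fin 1 ↦ w) = ![v, w] := by ext i; fin_cases i <;> rfl
  rw [← this]
  rfl

theorem isBoundedLinearMap_bilin :
    IsBoundedLinearMap ℝ (fun a : E [⋀^Fin 2]→L[ℝ] ℝ ↦ bilin a) where
  map_add := map_add _
  map_smul := map_smul _
  bound := by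
    refine ⟨1, one_pos, fun a ↦ ?_⟩
    rw [one_mul]
    refine ContinuousLinearMap.opNorm_le_bound _ (norm_nonneg _) fun v ↦ ?_
    refine ContinuousLinearMap.opNorm_le_bound _ (by positivity) fun w ↦ ?_
    have := a.le_opNorm ![v, w]
    rw [Fin.prod_univ_two] at this
    rw [bilin_apply]
    simpa [mul_assoc] using this

theorem bilin_swap (a : E [⋀^Fin 2]→L[ℝ] ℝ) (v w : E) : bilin a v w = - bilin a w v := by
  rw [bilin_apply, bilin_apply]
  have := a.toAlternatingMap.map_swap ![w, v] (i := 0) (j := 1) (by decide)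
  change a _ = - a _ at this
  rw [← this]
  congr 1
  ext i; fin_cases i <;> rfl

theorem bilin_ext {a b : E [⋀^Fin 2]→L[ℝ] ℝ} (h : ∀ v w, a ![v, w] = b ![v, w]) : a = b := by
  ext v
  rw [eq_vec_two v]
  exact h _ _

theorem isInvertible_bilin [FiniteDimensional ℝ E] {a : E [⋀^Fin 2]→L[ℝ] ℝ}
    (h : ∀ v, (∀ w, a ![v, w] = 0) → v = 0) : (bilin a).IsInvertible := by
  have hinj : Function.Injective (bilin a) := by
    rw [injective_iff_map_eq_zero]
    intro v hv
    apply h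
    intro w
    rw [← bilin_apply, hv]
    rfl
  have hdim : Module.finrank ℝ E = Module.finrank ℝ (E →L[ℝ] ℝ) := by
    rw [← LinearEquiv.finrank_eq (LinearMap.toContinuousLinearMap (𝕜 := ℝ) (E := E) (F' := ℝ))]
    exact (Subspace.dual_finrank_eq (K := ℝ) (V := E)).symm
  let e := LinearEquiv.ofInjectiveOfFinrankEq (bilin a : E →ₗ[ℝ] E →L[ℝ] ℝ) hinj hdim
  exact ⟨e.toContinuousLinearEquiv, by ext v w; rfl⟩

variable [FiniteDimensional ℝ F] {n : ℕ}

/-- Evaluation on tuples of basis vectors is an injective linear map into a finite product, hence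
has a left inverse `r`. It reduces smoothness of a form to smoothness of finitely many coefficients.
-/
theorem exists_linearMap_of_alternating (F : Type*) [NormedAddCommGroup F]
    [NormedSpace ℝ F] [FiniteDimensional ℝ F] (n : ℕ) :
    ∃ (d : ℕ) (b : Fin d → F) (r : ((Fin n → Fin d) → ℝ) →L[ℝ] F [⋀^Fin n]→L[ℝ] ℝ),
      ∀ a : F [⋀^Fin n]→L[ℝ] ℝ, r (fun i ↦ a (b ∘ i)) = a := by
  let b := Module.finBasis ℝ F
  let ev : (F [⋀^Fin n]→L[ℝ] ℝ) →ₗ[ℝ] ((Fin n → Fin (Module.finrank ℝ F)) → ℝ) :=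
    { toFun := fun a i ↦ a (b ∘ i)
      map_add' := fun _ _ ↦ rfl
      map_smul' := fun _ _ ↦ rfl }
  have hinj : LinearMap.ker ev = ⊥ := by
    rw [LinearMap.ker_eq_bot]
    intro a a' h
    have h2 : a.toAlternatingMap.toMultilinearMap = a'.toAlternatingMap.toMultilinearMap :=
      Module.Basis.ext_multilinear (fun _ ↦ b) fun i ↦ congrFun h i
    ext v
    exact congrArg (fun m ↦ m v) h2
  obtain ⟨r, hr⟩ := LinearMap.exists_leftInverse_of_injective ev hinj
  exact ⟨_, b, LinearMap.toContinuousLinearMap r, fun a ↦ LinearMap.congr_fun hr a⟩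

theorem SmoothNear.alternating_of_apply {f : E → F [⋀^Fin n]→L[ℝ] ℝ} {x : E}
    (hf : ∀ v, SmoothNear (fun y ↦ f y v) x) : SmoothNear f x := by
  obtain ⟨d, b, r, hr⟩ := exists_linearMap_of_alternating F n
  have h : ∀ᶠ y in 𝓝 x, ∀ i : Fin n → Fin d, ContDiffAt ℝ ∞ (fun y ↦ f y (b ∘ i)) y :=
    eventually_all.2 fun i ↦ hf (b ∘ i)
  filter_upwards [h] with y hy
  have h2 : f = fun y ↦ r (fun i ↦ f y (b ∘ i)) := by
    ext1 y
    exact (hr _).symm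
  rw [h2]
  exact r.contDiff.contDiffAt.comp y (contDiffAt_pi.2 hy)

protected theorem SmoothNear.bilin {f : E → F [⋀^Fin 2]→L[ℝ] ℝ} {x : E} (hf : SmoothNear f x) :
    SmoothNear (fun y ↦ NormalForm.bilin (f y)) x := by
  exact (SmoothNear.of_contDiff isBoundedLinearMap_bilin.contDiff _).comp hf

theorem fderiv_alternating_apply {f : E → F [⋀^Fin n]→L[ℝ] ℝ} {x : E}
    (hf : DifferentiableAt ℝ f x) (u : E) (v : Fin n → F) :
    fderiv ℝ (fun y ↦ f y v) x u = fderiv ℝ f x u v := by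
  have h := ((ContinuousAlternatingMap.apply ℝ F ℝ v).hasFDerivAt (x := f x)).comp x hf.hasFDerivAt
  exact congrArg (fun A ↦ A u) h.fderiv

theorem SmoothNear.alternating_apply {f : E → F [⋀^Fin 2]→L[ℝ] ℝ} {x : E} (hf : SmoothNear f x)
    {v w : E → F} (hv : SmoothNear v x) (hw : SmoothNear w x) :
    SmoothNear (fun y ↦ f y ![v y, w y]) x := by
  have h := (hf.bilin.clm_apply hv).clm_apply hw
  simpa only [bilin_apply] using h

end AltForms

/-! ### Integrals depending on a parameter -/

section Integral

universe u

variable {E F : Type u} [NormedAddCommGroup E] [NormedSpace ℝ E] [NormedAddCommGroup F]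
  [NormedSpace ℝ F] [FiniteDimensional ℝ E] [CompleteSpace F]

/-- Smoothness of a parametric integral, and differentiation under the integral sign. -/
theorem smoothNear_integral {k : ℝ × E → F} {e : E} (hk : ∀ t ∈ Time, SmoothNear k (t, e)) :
    SmoothNear (fun x ↦ ∫ s in (0 : ℝ)..1, k (s, x)) e ∧
      ∀ᶠ x in 𝓝 e, ∀ v, fderiv ℝ (fun x ↦ ∫ s in (0 : ℝ)..1, k (s, x)) x v =
        ∫ s in (0 : ℝ)..1, dsnd k (s, x) v := by
  obtain ⟨g, hg, hgf⟩ := exists_contDiff_eq_nhdsSet (f := k) (s := Time ×ˢ {e})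
    (isCompact_Icc.prod isCompact_singleton) (by
      rintro ⟨t, x⟩ ⟨ht, hx⟩
      rw [mem_singleton_iff] at hx
      subst hx
      exact hk t ht)
  have hloc : ∀ᶠ x in 𝓝 e, ∀ t ∈ Time, g =ᶠ[𝓝 (t, x)] k := by
    refine isCompact_Icc.eventually_forall_of_forall_eventually (x₀ := e)
      (P := fun x t ↦ g =ᶠ[𝓝 (t, x)] k) fun t ht ↦ ?_
    have h2 := eventually_nhdsSet_iff_forall.1 hgf (t, e) ⟨ht, rfl⟩
    exact (continuous_swap.tendsto (e, t)).eventually h2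
  let cst : E →L[ℝ] C(Time, E) := ContinuousLinearMap.const ℝ Time
  have h1 : (1 : ℝ) ∈ Time := by constructor <;> norm_num
  let ev : C(Time, F) →L[ℝ] F := ContinuousMap.evalCLM ℝ ⟨1, h1⟩
  have hsub {s : ℝ} (hs : s ∈ uIcc (0 : ℝ) 1) : s ∈ Time := by
    rw [uIcc_of_le zero_le_one] at hs
    constructor <;> linarith [hs.1, hs.2]
  -- The integral is written as evaluation and primitive, both continuous linear, applied to the
  -- superposition operator at constant paths. Smoothness and differentiation under the integral
  -- sign are then the chain rule.
  let B : E → F := fun x ↦ ev (primitive (superpos g hg.continuous (cst x)))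
  have hev (u : C(Time, F)) : ev (primitive u) = ∫ s in (0 : ℝ)..1, extendPath u s := rfl
  have hB : (fun x ↦ ∫ s in (0 : ℝ)..1, k (s, x)) =ᶠ[𝓝 e] B := by
    filter_upwards [hloc] with x hx
    simp only [B, hev]
    refine intervalIntegral.integral_congr fun s hs ↦ ?_
    simp only [extendPath_of_mem _ (hsub hs), superpos]
    exact ((hx s (hsub hs)).eq_of_nhds).symm
  have hBs : ContDiff ℝ ∞ B :=
    ev.contDiff.comp ((primitive (E := F)).contDiff.comp ((contDiff_superpos hg).comp cst.contDiff))
  refine ⟨(SmoothNear.of_contDiff hBs e).congr hB, ?_⟩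
  filter_upwards [eventually_eventually_nhds.2 hB, hloc] with x hx hx' v
  have h2 : HasFDerivAt B (ev.comp (primitive.comp ((pathApply
      (superpos (dsnd g) (contDiff_dsnd hg).continuous (cst x))).comp cst))) x :=
    ev.hasFDerivAt.comp x ((primitive (E := F)).hasFDerivAt.comp x
      ((hasFDerivAt_superpos hg (cst x)).comp x cst.hasFDerivAt))
  rw [EventuallyEq.fderiv_eq hx, h2.fderiv]
  simp only [ContinuousLinearMap.comp_apply, hev]
  refine intervalIntegral.integral_congr fun s hs ↦ ?_
  simp only [extendPath_of_mem _ (hsub hs), pathApply_apply, superpos]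
  change dsnd g (s, x) v = dsnd k (s, x) v
  rw [dsnd, dsnd, (hx' s (hsub hs)).fderiv_eq]

end Integral

/-! ### The relative Poincaré lemma and the local Moser theorem -/

section Moser

set_option linter.unusedSectionVars false

universe u

variable {E : Type u} [NormedAddCommGroup E] [NormedSpace ℝ E]

/-- This is the tube lemma for the compact interval `Time`. -/
theorem eventually_forall_time {E : Type*} [TopologicalSpace E] {P : ℝ × E → Prop} {e : E}
    (h : ∀ t ∈ Time, ∀ᶠ p in 𝓝 (t, e), P p) : ∀ᶠ x in 𝓝 e, ∀ t ∈ Time, P (t, x) := by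
  refine isCompact_Icc.eventually_forall_of_forall_eventually (x₀ := e)
    (P := fun x t ↦ P (t, x)) fun t ht ↦ ?_
  exact (continuous_swap.tendsto (e, t)).eventually (h t ht)

theorem mem_time_of_mem_uIcc {s : ℝ} (hs : s ∈ uIcc (0 : ℝ) 1) : s ∈ Time := by
  rw [uIcc_of_le zero_le_one] at hs
  constructor <;> linarith [hs.1, hs.2]

theorem mem_Ioo_of_mem_uIcc {s : ℝ} (hs : s ∈ uIcc (0 : ℝ) 1) : s ∈ Ioo (-1 : ℝ) 2 := by
  rw [uIcc_of_le zero_le_one] at hs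
  constructor <;> linarith [hs.1, hs.2]

/-- The contraction of the pullback of `τ` under the homotopy `H` with the time direction. -/
def homotopyIntegrand (τ : E → E [⋀^Fin 2]→L[ℝ] ℝ) (H : ℝ × E → E) (p : ℝ × E) : E →L[ℝ] ℝ :=
  (bilin (τ (H p)) (fderiv ℝ H p (1, 0))).comp (dsnd H p)

/-- The primitive of `τ` given by the homotopy operator. -/
def homotopyPrimitive (τ : E → E [⋀^Fin 2]→L[ℝ] ℝ) (H : ℝ × E → E) (e : E) : E →L[ℝ] ℝ :=
  ∫ s in (0 : ℝ)..1, homotopyIntegrand τ H (s, e)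

theorem minSmoothness_two_le : minSmoothness ℝ 2 ≤ (∞ : WithTop ℕ∞) := by
  rw [minSmoothness_of_isRCLikeNormedField]
  exact WithTop.coe_le_coe.2 le_top

theorem smoothNear_dsnd {F : Type u} [NormedAddCommGroup F] [NormedSpace ℝ F] {f : ℝ × E → F} {p : ℝ × E}
    (hf : SmoothNear f p) : SmoothNear (dsnd f) p :=
  SmoothNear.clm_comp hf.fderiv (smoothNear_const _ p)

theorem smoothNear_homotopyIntegrand [FiniteDimensional ℝ E] {τ : E → E [⋀^Fin 2]→L[ℝ] ℝ}
    {H : ℝ × E → E} {p : ℝ × E} (hτ : SmoothNear τ (H p)) (hH : SmoothNear H p) :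
    SmoothNear (homotopyIntegrand τ H) p :=
  SmoothNear.clm_comp (SmoothNear.clm_apply (hτ.bilin.comp hH)
    (SmoothNear.clm_apply hH.fderiv (smoothNear_const _ p))) (smoothNear_dsnd hH)

variable [FiniteDimensional ℝ E]

/-- This is the relative Poincaré lemma. For the closed form `σ = H^*τ` on `ℝ × E`, the identity
`dσ(∂_t, v, w) = 0` expresses `∂_t σ(v, w)` as the differential of `ι_{∂_t} σ`, and integrating from
`0` to `1` gives `dβ = H_1^*τ - H_0^*τ = τ`. Where `H` is stationary and `τ` vanishes, the integrand
is a product of two vanishing factors, so `β` vanishes there together with its first derivative. -/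
theorem homotopyPrimitive_spec {τ : E → E [⋀^Fin 2]→L[ℝ] ℝ} {H : ℝ × E → E} {e : E}
    (hτ : SmoothNear τ e) (hd : ∀ᶠ x in 𝓝 e, extDeriv τ x = 0)
    (hH : ∀ t ∈ Time, SmoothNear H (t, e)) (hHe : ∀ t ∈ Time, H (t, e) = e)
    (hH1 : ∀ᶠ x in 𝓝 e, H (1, x) = x) (hH0 : ∀ᶠ x in 𝓝 e, τ (H (0, x)) = 0) :
    SmoothNear (homotopyPrimitive τ H) e ∧
    (∀ᶠ x in 𝓝 e, ∀ v w, fderiv ℝ (homotopyPrimitive τ H) x v w -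
      fderiv ℝ (homotopyPrimitive τ H) x w v = τ x ![v, w]) ∧
    (∀ᶠ x in 𝓝 e, (∀ t ∈ Time, H (t, x) = x) → τ x = 0 → homotopyPrimitive τ H x = 0 ∧
      fderiv ℝ (homotopyPrimitive τ H) x = 0) ∧
    ∀ᶠ x in 𝓝 e, ∀ w, homotopyPrimitive τ H x w =
      ∫ s in (0 : ℝ)..1, τ (H (s, x)) ![fderiv ℝ H (s, x) (1, 0), fderiv ℝ H (s, x) (0, w)] := by
  have hk (t : ℝ) (ht : t ∈ Time) : SmoothNear (homotopyIntegrand τ H) (t, e) :=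
    smoothNear_homotopyIntegrand (by rw [hHe t ht]; exact hτ) (hH t ht)
  obtain ⟨hs, hfd⟩ := smoothNear_integral hk
  have hk' : ∀ᶠ x in 𝓝 e, ∀ t ∈ Time, SmoothNear (homotopyIntegrand τ H) (t, x) :=
    eventually_forall_time fun t ht ↦ (hk t ht).eventually
  have hH' : ∀ᶠ x in 𝓝 e, ∀ t ∈ Time, SmoothNear H (t, x) :=
    eventually_forall_time fun t ht ↦ (hH t ht).eventually
  have hτ' : ∀ᶠ x in 𝓝 e, ∀ t ∈ Time, SmoothNear τ (H (t, x)) ∧ extDeriv τ (H (t, x)) = 0 :=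
    eventually_forall_time (P := fun p ↦ SmoothNear τ (H p) ∧ extDeriv τ (H p) = 0) fun t ht ↦
      (hH t ht).continuousAt.eventually (by rw [hHe t ht]; exact hτ.eventually.and hd)
  have happ (p : ℝ × E) (w : E) : homotopyIntegrand τ H p w =
      τ (H p) ![fderiv ℝ H p (1, 0), fderiv ℝ H p (0, w)] := by
    rw [← bilin_apply, ← dsnd_apply]; rfl
  have hint {x : E} (hx : ∀ t ∈ Time, SmoothNear (homotopyIntegrand τ H) (t, x)) :
      ContinuousOn (fun s ↦ homotopyIntegrand τ H (s, x)) (uIcc 0 1) := fun s hs ↦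
    ((hx s (mem_time_of_mem_uIcc hs)).continuousAt.comp
      (f := fun s : ℝ ↦ (s, x)) (by fun_prop)).continuousWithinAt
  have hint' {x : E} (hx : ∀ t ∈ Time, SmoothNear (homotopyIntegrand τ H) (t, x)) (v : E) :
      ContinuousOn (fun s ↦ dsnd (homotopyIntegrand τ H) (s, x) v) (uIcc 0 1) := fun s hs ↦
    ((((smoothNear_dsnd (hx s (mem_time_of_mem_uIcc hs))).clm_apply
      (smoothNear_const v _)).continuousAt).comp
        (f := fun s : ℝ ↦ (s, x)) (by fun_prop)).continuousWithinAt
  refine ⟨hs, ?_, ?_, ?_⟩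
  · filter_upwards [hfd, hk', hH', hτ', eventually_eventually_nhds.2 hH1, hH0] with
      x hfd hk hH hτ hH1 hH0 v w
    -- The pullback of `τ` under the homotopy is taken on the product with time, where it is still
    -- closed.
    let σ : ℝ × E → (ℝ × E) [⋀^Fin 2]→L[ℝ] ℝ := fun p ↦
      (τ (H p)).compContinuousLinearMap (fderiv ℝ H p)
    have hσa (p a b) : σ p ![a, b] = τ (H p) ![fderiv ℝ H p a, fderiv ℝ H p b] := by
      simp only [σ, ContinuousAlternatingMap.compContinuousLinearMap_apply, comp_vec_two]
    have hσ (s : ℝ) (hs : s ∈ Time) : SmoothNear σ (s, x) := by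
      refine SmoothNear.alternating_of_apply fun v ↦ ?_
      have h2 := SmoothNear.alternating_apply ((hτ s hs).1.comp (hH s hs))
        ((hH s hs).fderiv.clm_apply (smoothNear_const (v 0) _))
        ((hH s hs).fderiv.clm_apply (smoothNear_const (v 1) _))
      refine h2.congr (Eventually.of_forall fun p ↦ ?_)
      conv_lhs => rw [eq_vec_two v]
      exact hσa _ _ _
    have hσc (s : ℝ) (hs : s ∈ Time) : extDeriv σ (s, x) = 0 := by
      have h2 := extDeriv_pullback (𝕜 := ℝ) (r := ∞) (hτ s hs).1.differentiableAt
        (hH s hs).contDiffAt minSmoothness_two_le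
      change extDeriv σ (s, x) = _ at h2
      rw [h2, (hτ s hs).2]
      rfl
    have hkσ (p) (w : E) : homotopyIntegrand τ H p w = σ p ![(1, 0), (0, w)] := by
      rw [happ, hσa]
    have hdk (s : ℝ) (hs : s ∈ Time) (v w : E) : dsnd (homotopyIntegrand τ H) (s, x) v w =
        fderiv ℝ σ (s, x) (0, v) ![(1, 0), (0, w)] := by
      rw [dsnd_apply, ← fderiv_alternating_apply (hσ s hs).differentiableAt]
      simp only [← hkσ]
      rw [fderiv_clm_apply (hk s hs).differentiableAt (differentiableAt_const _)]
      simp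
    -- This is `dσ((1, 0), (0, v), (0, w)) = 0`, solved for the time derivative.
    have key (s : ℝ) (hs : s ∈ uIcc (0 : ℝ) 1) :
        HasDerivAt (fun s ↦ σ (s, x) ![(0, v), (0, w)])
          (dsnd (homotopyIntegrand τ H) (s, x) v w - dsnd (homotopyIntegrand τ H) (s, x) w v)
          s := by
      have hs' := mem_time_of_mem_uIcc hs
      have h2 := extDeriv_twoForm_apply σ (s, x) (1, 0) (0, v) (0, w)
      rw [hσc s hs'] at h2
      have h3 : HasDerivAt (fun s : ℝ ↦ (s, x)) ((1 : ℝ), (0 : E)) s :=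
        (hasDerivAt_id s).prodMk (hasDerivAt_const s x)
      have h4 := ((ContinuousAlternatingMap.apply ℝ (ℝ × E) ℝ
        ![(0, v), (0, w)]).hasFDerivAt (x := σ (s, x))).comp_hasDerivAt s
          ((hσ s hs').differentiableAt.hasFDerivAt.comp_hasDerivAt s h3)
      refine h4.congr_deriv ?_
      rw [hdk s hs', hdk s hs']
      change fderiv ℝ σ (s, x) (1, 0) ![(0, v), (0, w)] = _
      change 0 = _ at h2
      linarith
    have h5 := intervalIntegral.integral_eq_sub_of_hasDerivAt key
      (((hint' hk v).clm_apply continuousOn_const).sub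
        ((hint' hk w).clm_apply continuousOn_const)).intervalIntegrable
    have h6 (a b : E) : fderiv ℝ (homotopyPrimitive τ H) x a b =
        ∫ s in (0 : ℝ)..1, dsnd (homotopyIntegrand τ H) (s, x) a b := by
      have h7 := hfd a
      change fderiv ℝ (homotopyPrimitive τ H) x a = _ at h7
      rw [h7]
      exact (ContinuousLinearMap.intervalIntegral_apply (hint' hk a).intervalIntegrable b)
    rw [h6, h6, ← intervalIntegral.integral_sub
      ((hint' hk v).clm_apply continuousOn_const).intervalIntegrable
      ((hint' hk w).clm_apply continuousOn_const).intervalIntegrable, h5]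
    have h1 : (1 : ℝ) ∈ Time := by constructor <;> norm_num
    -- The end `s = 1` contributes `τ` itself because `H (1, ·)` is the identity near `x`; the end
    -- `s = 0` contributes nothing because `τ` vanishes at `H (0, x)`.
    have h8 : dsnd H (1, x) = .id ℝ E := by
      have h9 := (hasFDerivAt_dsnd (hH 1 h1).differentiableAt).congr_of_eventuallyEq
        (hH1.mono fun y hy ↦ hy.symm)
      exact h9.unique (hasFDerivAt_id x)
    rw [hσa, hσa, hH0, ← dsnd_apply, ← dsnd_apply, h8, hH1.self_of_nhds]
    simp
  · filter_upwards [hfd, hk', hH', hτ'] with x hfd hk hH hτ hHx hτx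
    have hC0 (s : ℝ) (hs : s ∈ uIcc (0 : ℝ) 1) : fderiv ℝ H (s, x) (1, 0) = 0 := by
      have h3 : HasDerivAt (fun s : ℝ ↦ (s, x)) ((1 : ℝ), (0 : E)) s :=
        (hasDerivAt_id s).prodMk (hasDerivAt_const s x)
      have h4 := (hH s (mem_time_of_mem_uIcc hs)).differentiableAt.hasFDerivAt.comp_hasDerivAt s h3
      refine h4.unique ((hasDerivAt_const s x).congr_of_eventuallyEq ?_)
      filter_upwards [Ioo_mem_nhds (mem_Ioo_of_mem_uIcc hs).1 (mem_Ioo_of_mem_uIcc hs).2] with r hr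
      exact hHx r (Ioo_subset_Icc_self hr)
    have hk0 (s : ℝ) (hs : s ∈ uIcc (0 : ℝ) 1) : homotopyIntegrand τ H (s, x) = 0 := by
      rw [homotopyIntegrand, hC0 s hs]
      simp
    -- Both the form and the velocity of the homotopy vanish at `(s, x)`, so every term of the
    -- product rule contains a zero factor.
    have hdk0 (s : ℝ) (hs : s ∈ uIcc (0 : ℝ) 1) : dsnd (homotopyIntegrand τ H) (s, x) = 0 := by
      have hs' := mem_time_of_mem_uIcc hs
      let b : ℝ × E → E →L[ℝ] E →L[ℝ] ℝ := fun p ↦ bilin (τ (H p))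
      let X : ℝ × E → E := fun p ↦ fderiv ℝ H p (1, 0)
      have hb : SmoothNear b (s, x) := (hτ s hs').1.bilin.comp (hH s hs')
      have hX : SmoothNear X (s, x) := (hH s hs').fderiv.clm_apply (smoothNear_const _ _)
      have hb0 : b (s, x) = 0 := by simp only [b]; rw [hHx s hs', hτx, map_zero]
      have hX0 : X (s, x) = 0 := hC0 s hs
      have h2 := hb.differentiableAt.hasFDerivAt.clm_apply hX.differentiableAt.hasFDerivAt
      rw [hb0, hX0] at h2
      have h3 := h2.clm_comp (smoothNear_dsnd (hH s hs')).differentiableAt.hasFDerivAt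
      have h4 : HasFDerivAt (homotopyIntegrand τ H) _ (s, x) := h3
      ext v w
      rw [dsnd_apply, h4.fderiv]
      simp [hb0, hX0]
    constructor
    · rw [homotopyPrimitive, intervalIntegral.integral_congr hk0]
      simp
    · ext1 v
      have h7 := hfd v
      change fderiv ℝ (homotopyPrimitive τ H) x v = _ at h7
      rw [h7, intervalIntegral.integral_congr (g := fun _ ↦ 0)]
      · simp
      · intro s hs
        simp [hdk0 s hs]
  · filter_upwards [hk'] with x hk w
    rw [homotopyPrimitive, ContinuousLinearMap.intervalIntegral_apply (hint hk).intervalIntegrable]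
    exact intervalIntegral.integral_congr fun s _ ↦ happ _ _

theorem extDeriv_fun_sub {n : ℕ} {F : Type*} [NormedAddCommGroup F] [NormedSpace ℝ F]
    {f g : F → F [⋀^Fin n]→L[ℝ] ℝ} {x : F} (hf : DifferentiableAt ℝ f x)
    (hg : DifferentiableAt ℝ g x) :
    extDeriv (fun y ↦ f y - g y) x = extDeriv f x - extDeriv g x := by
  have h2 := extDeriv_fun_add (𝕜 := ℝ) hf (hg.const_smul (-1 : ℝ))
  have h3 := extDeriv_smul (𝕜 := ℝ) (-1 : ℝ) g (x := x)
  simp only [Pi.smul_def, neg_smul, one_smul, ← sub_eq_add_neg] at h2 h3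
  rw [h2, show extDeriv (fun y ↦ - g y) x = _ from h3, sub_eq_add_neg]

/-- The path `τ₀ + t (τ₁ - τ₀)` of two-forms. -/
def formPath (τ₁ τ₀ : E → E [⋀^Fin 2]→L[ℝ] ℝ) (p : ℝ × E) : E [⋀^Fin 2]→L[ℝ] ℝ :=
  τ₀ p.2 + p.1 • (τ₁ p.2 - τ₀ p.2)

/-- The time-dependent vector field of Moser's argument. -/
def moserField (τ₁ τ₀ : E → E [⋀^Fin 2]→L[ℝ] ℝ) (H : ℝ × E → E) (p : ℝ × E) : E :=
  -(bilin (formPath τ₁ τ₀ p)).inverse (homotopyPrimitive (fun x ↦ τ₁ x - τ₀ x) H p.2)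

theorem smoothNear_formPath {τ₁ τ₀ : E → E [⋀^Fin 2]→L[ℝ] ℝ} {t : ℝ} {x : E}
    (h1 : SmoothNear τ₁ x) (h0 : SmoothNear τ₀ x) : SmoothNear (formPath τ₁ τ₀) (t, x) := by
  have h1' : SmoothNear (fun p : ℝ × E ↦ τ₁ p.2) (t, x) :=
    SmoothNear.comp (f := Prod.snd) h1 (.of_contDiff contDiff_snd _)
  have h0' : SmoothNear (fun p : ℝ × E ↦ τ₀ p.2) (t, x) :=
    SmoothNear.comp (f := Prod.snd) h0 (.of_contDiff contDiff_snd _)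
  exact h0'.add ((SmoothNear.of_contDiff contDiff_fst _).smul (h1'.sub h0'))

theorem fderiv_bilin_formPath_fst {τ₁ τ₀ : E → E [⋀^Fin 2]→L[ℝ] ℝ} {t : ℝ} {x : E}
    (h1 : SmoothNear τ₁ x) (h0 : SmoothNear τ₀ x) (y z : E) :
    fderiv ℝ (fun p ↦ bilin (formPath τ₁ τ₀ p)) (t, x) (1, 0) y z = (τ₁ x - τ₀ x) ![y, z] := by
  have hP := (smoothNear_formPath (t := t) h1 h0).bilin.differentiableAt
  have h2 : HasDerivAt (fun s : ℝ ↦ (s, x)) ((1 : ℝ), (0 : E)) t :=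
    (hasDerivAt_id t).prodMk (hasDerivAt_const t x)
  have h3 := hP.hasFDerivAt.comp_hasDerivAt t h2
  have h3' := (h3.clm_apply (hasDerivAt_const t y)).clm_apply (hasDerivAt_const t z)
  have h4 : HasDerivAt (fun s : ℝ ↦ τ₀ x ![y, z] + s * (τ₁ x - τ₀ x) ![y, z])
      ((τ₁ x - τ₀ x) ![y, z]) t := by
    have := ((hasDerivAt_id t).mul_const ((τ₁ x - τ₀ x) ![y, z])).const_add (τ₀ x ![y, z])
    rwa [one_mul] at this
  have h5 := h3'.unique (h4.congr_of_eventuallyEq (Eventually.of_forall fun s ↦ by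
    simp only [Function.comp_apply, bilin_apply]; rfl))
  rw [← h5]
  simp

theorem fderiv_bilin_formPath_snd {τ₁ τ₀ : E → E [⋀^Fin 2]→L[ℝ] ℝ} {t : ℝ} {x : E}
    (h1 : SmoothNear τ₁ x) (h0 : SmoothNear τ₀ x) (u y z : E) :
    fderiv ℝ (fun p ↦ bilin (formPath τ₁ τ₀ p)) (t, x) (0, u) y z =
      fderiv ℝ (fun y ↦ formPath τ₁ τ₀ (t, y)) x u ![y, z] := by
  have hP := (smoothNear_formPath (t := t) h1 h0).bilin.differentiableAt
  have hT : SmoothNear (fun y ↦ formPath τ₁ τ₀ (t, y)) x :=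
    SmoothNear.comp (f := fun y ↦ (t, y)) (smoothNear_formPath h1 h0)
      (.of_contDiff (by fun_prop) x)
  have h2 := hasFDerivAt_dsnd hP
  have h3 := (h2.clm_apply (hasFDerivAt_const y x)).clm_apply (hasFDerivAt_const z x)
  rw [← fderiv_alternating_apply hT.differentiableAt]
  simp only [bilin_apply] at h3
  rw [h3.fderiv]
  simp [dsnd_apply]

theorem extDeriv_formPath {τ₁ τ₀ : E → E [⋀^Fin 2]→L[ℝ] ℝ} {t : ℝ} {x : E}
    (h1 : SmoothNear τ₁ x) (h0 : SmoothNear τ₀ x) (hd1 : extDeriv τ₁ x = 0)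
    (hd0 : extDeriv τ₀ x = 0) : extDeriv (fun y ↦ formPath τ₁ τ₀ (t, y)) x = 0 := by
  have h2 := extDeriv_fun_add (𝕜 := ℝ) h0.differentiableAt
    ((h1.differentiableAt.sub h0.differentiableAt).const_smul t)
  have h3 := extDeriv_smul (𝕜 := ℝ) t (fun y ↦ τ₁ y - τ₀ y) (x := x)
  change extDeriv (fun y ↦ τ₀ y + t • (τ₁ y - τ₀ y)) x = 0
  refine h2.trans ?_
  rw [show extDeriv (t • (τ₁ - τ₀)) x = _ from h3,
    extDeriv_fun_sub h1.differentiableAt h0.differentiableAt, hd0, hd1]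
  simp

/-- The pullback of the path of forms `formPath τ₁ τ₀` under the flow of a vector field `f` with
`ι_f (formPath τ₁ τ₀) = -β`, `dβ = τ₁ - τ₀`, is constant. -/
theorem hasDerivAt_bilin_formPath {τ₁ τ₀ : E → E [⋀^Fin 2]→L[ℝ] ℝ} {t : ℝ} {c a b : ℝ → E}
    (h1 : SmoothNear τ₁ (c t)) (h0 : SmoothNear τ₀ (c t)) (hd1 : extDeriv τ₁ (c t) = 0)
    (hd0 : extDeriv τ₀ (c t) = 0) {f : ℝ × E → E} (hf : SmoothNear f (t, c t))
    {β : E → E →L[ℝ] ℝ} (hβ : SmoothNear β (c t))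
    (hdβ : ∀ v w, fderiv ℝ β (c t) v w - fderiv ℝ β (c t) w v = (τ₁ (c t) - τ₀ (c t)) ![v, w])
    (hfβ : ∀ᶠ y in 𝓝 (c t), bilin (formPath τ₁ τ₀ (t, y)) (f (t, y)) = -β y)
    (hc : HasDerivAt c (f (t, c t)) t) (ha : HasDerivAt a (dsnd f (t, c t) (a t)) t)
    (hb : HasDerivAt b (dsnd f (t, c t) (b t)) t) :
    HasDerivAt (fun s ↦ bilin (formPath τ₁ τ₀ (s, c s)) (a s) (b s)) 0 t := by
  have hP := (smoothNear_formPath (t := t) h1 h0).bilin.differentiableAt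
  have hcurve : HasDerivAt (fun s ↦ (s, c s)) ((1 : ℝ), f (t, c t)) t :=
    (hasDerivAt_id t).prodMk hc
  have hPd := hP.hasFDerivAt.comp_hasDerivAt t hcurve
  refine HasDerivAt.congr_deriv ((hPd.clm_apply ha).clm_apply hb) ?_
  -- The spatial derivative in direction `u` of `ι_f (formPath) = -β`, paired with `u'`.
  have hdeq (u u' : E) :
      fderiv ℝ (fun p ↦ bilin (formPath τ₁ τ₀ p)) (t, c t) (0, u) (f (t, c t)) u'
        + bilin (formPath τ₁ τ₀ (t, c t)) (dsnd f (t, c t) u) u' = - fderiv ℝ β (c t) u u' := by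
    have h2 := (hasFDerivAt_dsnd hP).clm_apply (hasFDerivAt_dsnd hf.differentiableAt)
    have h3 := hβ.differentiableAt.hasFDerivAt.neg.congr_of_eventuallyEq hfβ
    have h4 := congrArg (fun A : E →L[ℝ] E →L[ℝ] ℝ ↦ A u u') (h2.unique h3)
    simp only [add_apply, ContinuousLinearMap.comp_apply,
      ContinuousLinearMap.flip_apply, neg_apply, dsnd_apply] at h4
    rw [dsnd_apply, ← h4]
    ring
  -- Closedness trades the derivative of the form along `f` for its derivatives along `a` and `b`,
  -- to which `hdeq` applies.
  have h6 := extDeriv_twoForm_apply (fun y ↦ formPath τ₁ τ₀ (t, y)) (c t) (f (t, c t)) (a t) (b t)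
  rw [extDeriv_formPath h1 h0 hd1 hd0] at h6
  change 0 = _ at h6
  simp only [← fderiv_bilin_formPath_snd h1 h0] at h6
  have h7 := hdeq (a t) (b t)
  have h8 := hdeq (b t) (a t)
  have h9 := hdβ (a t) (b t)
  have hsplit : ((1 : ℝ), f (t, c t)) = (1, 0) + (0, f (t, c t)) := by simp
  have h10 := bilin_swap (formPath τ₁ τ₀ (t, c t)) (a t) (dsnd f (t, c t) (b t))
  have h11 := fderiv_bilin_formPath_fst (t := t) h1 h0 (a t) (b t)
  -- The explicit time derivative contributes `τ₁ - τ₀ = dβ`. The remaining terms form the Lie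
  -- derivative along `f`, which is `d ι_f (formPath) = -dβ`.
  rw [hsplit, map_add]
  change fderiv ℝ (fun p ↦ bilin (formPath τ₁ τ₀ p)) (t, c t) (1, 0) (a t) (b t) +
    fderiv ℝ (fun p ↦ bilin (formPath τ₁ τ₀ p)) (t, c t) (0, f (t, c t)) (a t) (b t) +
    bilin (formPath τ₁ τ₀ (t, c t)) (dsnd f (t, c t) (a t)) (b t) +
    bilin (formPath τ₁ τ₀ (t, c t)) (a t) (dsnd f (t, c t) (b t)) = 0
  linarith

/-- Two closed two-forms which agree along the fixed points of a deformation retraction are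
related by a local diffeomorphism, the time one map of the flow of Moser's vector field. -/
theorem exists_moser_flow {τ₁ τ₀ : E → E [⋀^Fin 2]→L[ℝ] ℝ} {H : ℝ × E → E} {e : E}
    (hτ₁ : SmoothNear τ₁ e) (hτ₀ : SmoothNear τ₀ e) (hd₁ : ∀ᶠ x in 𝓝 e, extDeriv τ₁ x = 0)
    (hd₀ : ∀ᶠ x in 𝓝 e, extDeriv τ₀ x = 0)
    (hH : ∀ t ∈ Time, SmoothNear H (t, e)) (hHe : ∀ t ∈ Time, H (t, e) = e)
    (hH1 : ∀ᶠ x in 𝓝 e, H (1, x) = x) (hH0 : ∀ᶠ x in 𝓝 e, τ₁ (H (0, x)) = τ₀ (H (0, x)))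
    (hnd : ∀ v, (∀ w, τ₁ e ![v, w] = 0) → v = 0) :
    (∀ t ∈ Time, SmoothNear (moserField τ₁ τ₀ H) (t, e)) ∧
    (∀ᶠ x in 𝓝 e, ∀ t ∈ Time, ∀ v, (∀ w, formPath τ₁ τ₀ (t, x) ![v, w] =
        -∫ s in (0 : ℝ)..1, (τ₁ (H (s, x)) - τ₀ (H (s, x)))
          ![fderiv ℝ H (s, x) (1, 0), fderiv ℝ H (s, x) (0, w)]) ↔
      v = moserField τ₁ τ₀ H (t, x)) ∧
    ∃ Φ : ℝ → E → E,
      (∀ V ∈ 𝓝 e, ∀ᶠ x in 𝓝 e, ∀ t, Φ t x ∈ V) ∧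
      (∀ᶠ x in 𝓝 e, ∀ t, SmoothNear (Φ t) x) ∧
      (∀ᶠ x in 𝓝 e, Φ 0 x = x ∧ ∀ t ∈ Ioo (-1 : ℝ) 2,
        HasDerivAt (fun s ↦ Φ s x) (moserField τ₁ τ₀ H (t, Φ t x)) t) ∧
      (∀ᶠ x in 𝓝 e, (τ₁ (Φ 1 x)).compContinuousLinearMap (fderiv ℝ (Φ 1) x) = τ₀ x) ∧
      ∀ᶠ x in 𝓝 e, (∀ t ∈ Time, H (t, x) = x) → τ₁ x = τ₀ x →
        (∀ t, Φ t x = x) ∧ ∀ t, fderiv ℝ (Φ t) x = .id ℝ E := by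
  have hsub : ∀ᶠ x in 𝓝 e, extDeriv (fun x ↦ τ₁ x - τ₀ x) x = 0 := by
    filter_upwards [hd₁, hd₀, hτ₁.eventually, hτ₀.eventually] with x h1 h0 h1' h0'
    rw [extDeriv_fun_sub h1'.differentiableAt h0'.differentiableAt, h1, h0, sub_zero]
  obtain ⟨hβ, hdβ, hβ0, hβi⟩ := homotopyPrimitive_spec (hτ₁.sub hτ₀) hsub hH hHe hH1
    (hH0.mono fun x hx ↦ sub_eq_zero.2 hx)
  have h0T : (0 : ℝ) ∈ Time := zero_mem_time
  have he : τ₁ e = τ₀ e := by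
    have := hH0.self_of_nhds
    rwa [hHe 0 h0T] at this
  -- At `e` the two forms coincide, so the path of forms is constant there and nondegenerate for
  -- every `t`.
  have hinv (t : ℝ) : (bilin (formPath τ₁ τ₀ (t, e))).IsInvertible := by
    apply isInvertible_bilin
    simpa [formPath, he] using he ▸ hnd
  have hf0 (t : ℝ) {x : E} (h1 : SmoothNear τ₁ x) (h0 : SmoothNear τ₀ x)
      (hi : (bilin (formPath τ₁ τ₀ (t, x))).IsInvertible)
      (hb : SmoothNear (homotopyPrimitive (fun x ↦ τ₁ x - τ₀ x) H) x) :
      SmoothNear (moserField τ₁ τ₀ H) (t, x) :=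
    (SmoothNear.clm_apply ((smoothNear_formPath h1 h0).bilin.inverse hi).1
      (SmoothNear.comp (f := Prod.snd) hb (.of_contDiff contDiff_snd _))).neg
  have hinv' : ∀ᶠ x in 𝓝 e, ∀ t ∈ Time, (bilin (formPath τ₁ τ₀ (t, x))).IsInvertible :=
    eventually_forall_time fun t _ ↦ ((smoothNear_formPath hτ₁ hτ₀).bilin.inverse (hinv t)).2
  have hf : ∀ t ∈ Time, SmoothNear (moserField τ₁ τ₀ H) (t, e) := fun t _ ↦
    hf0 t hτ₁ hτ₀ (hinv t) hβ
  have hspec : ∀ᶠ x in 𝓝 e, ∀ t ∈ Time, ∀ v, (bilin (formPath τ₁ τ₀ (t, x)) v =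
      -homotopyPrimitive (fun x ↦ τ₁ x - τ₀ x) H x) ↔ v = moserField τ₁ τ₀ H (t, x) := by
    filter_upwards [hinv'] with x hx t ht v
    obtain ⟨A, hA⟩ := hx t ht
    rw [moserField, ← hA, ContinuousLinearMap.inverse_equiv, ← map_neg]
    exact (ContinuousLinearEquiv.eq_symm_apply A).symm
  -- Where the primitive and its derivative vanish, so do Moser's field and its linearization; this
  -- is what `exists_flow` requires at `e`.
  have hzero : ∀ᶠ x in 𝓝 e, (∀ t ∈ Time, H (t, x) = x) → τ₁ x = τ₀ x →
      ∀ t ∈ Time, moserField τ₁ τ₀ H (t, x) = 0 ∧ dsnd (moserField τ₁ τ₀ H) (t, x) = 0 := by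
    filter_upwards [hβ0, hinv', hτ₁.eventually, hτ₀.eventually, hβ.eventually] with
      x hx hi h1 h0 hb hHx hτx t ht
    obtain ⟨hb0, hdb0⟩ := hx hHx (by simp [hτx])
    refine ⟨by simp [moserField, hb0], ?_⟩
    have h2 := ((smoothNear_formPath (t := t) h1 h0).bilin.inverse (hi t ht)).1
    have h3 : SmoothNear (fun p : ℝ × E ↦
        homotopyPrimitive (fun x ↦ τ₁ x - τ₀ x) H p.2) (t, x) :=
      SmoothNear.comp (f := Prod.snd) hb (.of_contDiff contDiff_snd _)
    have h3' : HasFDerivAt (fun p : ℝ × E ↦ homotopyPrimitive (fun x ↦ τ₁ x - τ₀ x) H p.2)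
        (0 : ℝ × E →L[ℝ] E →L[ℝ] ℝ) (t, x) := by
      have := HasFDerivAt.comp (t, x) hb.differentiableAt.hasFDerivAt
        (hasFDerivAt_snd (𝕜 := ℝ) (E := ℝ) (F := E) (p := (t, x)))
      rw [hdb0] at this
      simpa using! this
    have h4 := (h2.differentiableAt.hasFDerivAt.clm_apply h3').neg
    have h5 : HasFDerivAt (moserField τ₁ τ₀ H) _ (t, x) := h4
    ext v
    rw [dsnd_apply, h5.fderiv]
    simp [hb0]
  obtain ⟨Φ, hΦ1, hΦ2, hΦ3, hΦ4⟩ := exists_flow hf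
    (fun t ht ↦ (hzero.self_of_nhds hHe he t ht).1) (fun t ht ↦ (hzero.self_of_nhds hHe he t ht).2)
  refine ⟨hf, ?_, Φ, hΦ1, hΦ2, hΦ3.mono fun x hx ↦ ⟨hx.1, hx.2.1⟩, ?_, ?_⟩
  · filter_upwards [hspec, hβi] with x hx hi t ht v
    rw [← hx t ht v, ContinuousLinearMap.ext_iff]
    refine forall_congr' fun w ↦ ?_
    rw [bilin_apply, neg_apply, hi]
  · have hgood : ∀ᶠ x in 𝓝 e, SmoothNear τ₁ x ∧ SmoothNear τ₀ x ∧ extDeriv τ₁ x = 0 ∧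
        extDeriv τ₀ x = 0 ∧
        SmoothNear (homotopyPrimitive (fun x ↦ τ₁ x - τ₀ x) H) x ∧
        (∀ v w, fderiv ℝ (homotopyPrimitive (fun x ↦ τ₁ x - τ₀ x) H) x v w -
          fderiv ℝ (homotopyPrimitive (fun x ↦ τ₁ x - τ₀ x) H) x w v = (τ₁ x - τ₀ x) ![v, w]) ∧
        (∀ t ∈ Time, (bilin (formPath τ₁ τ₀ (t, x))).IsInvertible) ∧
        ∀ᶠ y in 𝓝 x, ∀ t ∈ Time, bilin (formPath τ₁ τ₀ (t, y)) (moserField τ₁ τ₀ H (t, y)) =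
          -homotopyPrimitive (fun x ↦ τ₁ x - τ₀ x) H y := by
      filter_upwards [hτ₁.eventually, hτ₀.eventually, hd₁, hd₀, hβ.eventually, hdβ, hinv',
        eventually_eventually_nhds.2 hspec] with x a1 a2 a3 a4 a5 a6 a7 a8
      exact ⟨a1, a2, a3, a4, a5, a6, a7, a8.mono fun y hy t ht ↦ (hy t ht _).2 rfl⟩
    filter_upwards [hΦ3, hΦ1 _ hgood] with x ⟨hx0, hx1, hx2⟩ hx
    apply bilin_ext
    intro v w
    rw [ContinuousAlternatingMap.compContinuousLinearMap_apply, comp_vec_two, ← bilin_apply]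
    -- The pullback of the path of forms under the flow is constant in time. It equals `τ₀` at time
    -- `0` and the pullback of `τ₁` at time `1`.
    have hq : ∀ t ∈ Icc (0 : ℝ) 1, HasDerivAt (fun t ↦ bilin (formPath τ₁ τ₀ (t, Φ t x))
        (fderiv ℝ (Φ t) x v) (fderiv ℝ (Φ t) x w)) 0 t := by
      intro t ht
      have htT : t ∈ Time := by constructor <;> linarith [ht.1, ht.2]
      have htI : t ∈ Ioo (-1 : ℝ) 2 := by constructor <;> linarith [ht.1, ht.2]
      obtain ⟨g1, g0, c1, c0, hb, hdb, hi, hsp⟩ := hx t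
      exact hasDerivAt_bilin_formPath (c := fun t ↦ Φ t x) g1 g0 c1 c0
        (hf0 t g1 g0 (hi t htT) hb) hb hdb (hsp.mono fun y hy ↦ hy t htT)
        (hx1 t htI) ((hx2 v).2 t htI) ((hx2 w).2 t htI)
    have hconst := constant_of_has_deriv_right_zero
      (fun t ht ↦ (hq t ht).continuousAt.continuousWithinAt)
      (fun t ht ↦ (hq t (Ico_subset_Icc_self ht)).hasDerivWithinAt) 1 ⟨zero_le_one, le_rfl⟩
    simp only [hx0, (hx2 v).1, (hx2 w).1] at hconst
    simpa [formPath, bilin_apply] using hconst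
  · filter_upwards [hΦ4, hzero] with x h4 hz hHx hτx
    obtain ⟨b1, b2⟩ := h4 fun t ht ↦ (hz hHx hτx t ht).1
    exact ⟨b1, b2 fun t ht ↦ (hz hHx hτx t ht).2⟩

end Moser

/-! ### Charts of manifolds without boundary -/

section Charts

variable {A : Type*} [NormedAddCommGroup A] [NormedSpace ℝ A]
  {M : Type*} [TopologicalSpace M] [ChartedSpace A M]
  {B : Type*} [NormedAddCommGroup B] [NormedSpace ℝ B]
  {N : Type*} [TopologicalSpace N] [ChartedSpace B N]

/-- The derivative of the chart around `x₀` at `x`. -/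
def chartT (x₀ x : M) : A →L[ℝ] A := (mfderiv 𝓘(ℝ, A) 𝓘(ℝ, A) (extChartAt 𝓘(ℝ, A) x₀) x :)

/-- The derivative of the inverse of the chart around `x₀` at `e`. -/
def chartS (x₀ : M) (e : A) : A →L[ℝ] A :=
  (mfderiv 𝓘(ℝ, A) 𝓘(ℝ, A) (extChartAt 𝓘(ℝ, A) x₀).symm e :)

theorem chart_target_mem_nhds {x₀ : M} {e : A} (he : e ∈ (extChartAt 𝓘(ℝ, A) x₀).target) :
    (extChartAt 𝓘(ℝ, A) x₀).target ∈ 𝓝 e :=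
  (isOpen_extChartAt_target x₀).mem_nhds he

theorem chart_source_mem_nhds {x₀ x : M} (hx : x ∈ (extChartAt 𝓘(ℝ, A) x₀).source) :
    (extChartAt 𝓘(ℝ, A) x₀).source ∈ 𝓝 x :=
  (isOpen_extChartAt_source x₀).mem_nhds hx

theorem chart_continuousAt_symm {x₀ : M} {e : A} (he : e ∈ (extChartAt 𝓘(ℝ, A) x₀).target) :
    ContinuousAt (extChartAt 𝓘(ℝ, A) x₀).symm e :=
  continuousAt_extChartAt_symm'' he

theorem chart_continuousAt {x₀ x : M} (hx : x ∈ (extChartAt 𝓘(ℝ, A) x₀).source) :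
    ContinuousAt (extChartAt 𝓘(ℝ, A) x₀) x :=
  continuousAt_extChartAt' hx

/-- A property holds near `x` if it holds near `x` in a chart. -/
theorem eventually_of_chart {x₀ x : M} (hx : x ∈ (extChartAt 𝓘(ℝ, A) x₀).source) {P : M → Prop}
    (h : ∀ᶠ e in 𝓝 (extChartAt 𝓘(ℝ, A) x₀ x), P ((extChartAt 𝓘(ℝ, A) x₀).symm e)) :
    ∀ᶠ y in 𝓝 x, P y := by
  filter_upwards [(chart_continuousAt hx).eventually h, chart_source_mem_nhds hx] with y hy hy'
  rwa [(extChartAt 𝓘(ℝ, A) x₀).left_inv hy'] at hy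

/-- A property holds near `x` in a chart if it holds near `x`. -/
theorem eventually_chart {x₀ : M} {e : A} (he : e ∈ (extChartAt 𝓘(ℝ, A) x₀).target) {P : M → Prop}
    (h : ∀ᶠ y in 𝓝 ((extChartAt 𝓘(ℝ, A) x₀).symm e), P y) :
    ∀ᶠ e' in 𝓝 e, P ((extChartAt 𝓘(ℝ, A) x₀).symm e') :=
  (chart_continuousAt_symm he).eventually h

variable [IsManifold 𝓘(ℝ, A) ∞ M] [IsManifold 𝓘(ℝ, B) ∞ N]

theorem contMDiffAt_chart {x₀ x : M} (hx : x ∈ (extChartAt 𝓘(ℝ, A) x₀).source) :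
    ContMDiffAt 𝓘(ℝ, A) 𝓘(ℝ, A) ∞ (extChartAt 𝓘(ℝ, A) x₀) x :=
  contMDiffAt_extChartAt' (by simpa using hx)

theorem contMDiffAt_chart_symm {x₀ : M} {e : A} (he : e ∈ (extChartAt 𝓘(ℝ, A) x₀).target) :
    ContMDiffAt 𝓘(ℝ, A) 𝓘(ℝ, A) ∞ (extChartAt 𝓘(ℝ, A) x₀).symm e :=
  (contMDiffOn_extChartAt_symm x₀).contMDiffAt (chart_target_mem_nhds he)

theorem hasMFDerivAt_chart {x₀ x : M} (hx : x ∈ (extChartAt 𝓘(ℝ, A) x₀).source) :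
    HasMFDerivAt 𝓘(ℝ, A) 𝓘(ℝ, A) (extChartAt 𝓘(ℝ, A) x₀) x (chartT (A := A) x₀ x) :=
  ((contMDiffAt_chart hx).mdifferentiableAt (by simp)).hasMFDerivAt

theorem hasMFDerivAt_chart_symm {x₀ : M} {e : A} (he : e ∈ (extChartAt 𝓘(ℝ, A) x₀).target) :
    HasMFDerivAt 𝓘(ℝ, A) 𝓘(ℝ, A) (extChartAt 𝓘(ℝ, A) x₀).symm e (chartS (A := A) x₀ e) :=
  ((contMDiffAt_chart_symm he).mdifferentiableAt (by simp)).hasMFDerivAt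

theorem chartT_chartS {x₀ : M} {e : A} (he : e ∈ (extChartAt 𝓘(ℝ, A) x₀).target) (v : A) :
    chartT x₀ ((extChartAt 𝓘(ℝ, A) x₀).symm e) (chartS x₀ e v) = v := by
  have h1 := (hasMFDerivAt_chart ((extChartAt 𝓘(ℝ, A) x₀).map_target he)).comp e
    (hasMFDerivAt_chart_symm he)
  have h3 : HasFDerivAt (fun y ↦ extChartAt 𝓘(ℝ, A) x₀ ((extChartAt 𝓘(ℝ, A) x₀).symm y))
    ((chartT (A := A) x₀ ((extChartAt 𝓘(ℝ, A) x₀).symm e)).comp (chartS x₀ e) : A →L[ℝ] A) e :=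
    h1.hasFDerivAt
  have h2 := h3.congr_of_eventuallyEq (f₁ := id) (by
    filter_upwards [chart_target_mem_nhds he] with y hy
    exact ((extChartAt 𝓘(ℝ, A) x₀).right_inv hy).symm)
  exact congrArg (fun L : A →L[ℝ] A ↦ L v) (h2.unique (hasFDerivAt_id e))

theorem chartS_chartT {x₀ x : M} (hx : x ∈ (extChartAt 𝓘(ℝ, A) x₀).source) (v : A) :
    chartS x₀ (extChartAt 𝓘(ℝ, A) x₀ x) (chartT x₀ x v) = v := by
  have h1 := HasMFDerivAt.comp x (hasMFDerivAt_chart_symm ((extChartAt 𝓘(ℝ, A) x₀).map_source hx))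
    (hasMFDerivAt_chart hx)
  have h2 := h1.congr_of_eventuallyEq (f₁ := id) (by
    filter_upwards [chart_source_mem_nhds hx] with y hy
    exact ((extChartAt 𝓘(ℝ, A) x₀).left_inv hy).symm)
  exact congrArg (fun L : A →L[ℝ] A ↦ L v) (hasMFDerivAt_unique h2 (hasMFDerivAt_id x))

theorem chartS_chartT' {x₀ : M} {e : A} (he : e ∈ (extChartAt 𝓘(ℝ, A) x₀).target) (v : A) :
    chartS x₀ e (chartT x₀ ((extChartAt 𝓘(ℝ, A) x₀).symm e) v) = v := by
  have := chartS_chartT ((extChartAt 𝓘(ℝ, A) x₀).map_target he) v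
  rwa [(extChartAt 𝓘(ℝ, A) x₀).right_inv he] at this

theorem chartT_self (x : M) : chartT (A := A) x x = .id ℝ A := mfderiv_extChartAt_self

theorem chartS_self (x : M) : chartS (A := A) x (extChartAt 𝓘(ℝ, A) x x) = .id ℝ A := by
  ext v
  have := chartS_chartT (mem_extChartAt_source (I := 𝓘(ℝ, A)) x) v
  rwa [chartT_self] at this

/-- The expression of `f` in charts. -/
def reading (x₀ : M) (y₀ : N) (f : M → N) (e : A) : B :=
  extChartAt 𝓘(ℝ, B) y₀ (f ((extChartAt 𝓘(ℝ, A) x₀).symm e))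

theorem contDiffAt_reading {x₀ : M} {y₀ : N} {f : M → N} {e : A} {n : WithTop ℕ∞} (hn : n ≤ ∞)
    (he : e ∈ (extChartAt 𝓘(ℝ, A) x₀).target)
    (hf : ContMDiffAt 𝓘(ℝ, A) 𝓘(ℝ, B) n f ((extChartAt 𝓘(ℝ, A) x₀).symm e))
    (hy : f ((extChartAt 𝓘(ℝ, A) x₀).symm e) ∈ (extChartAt 𝓘(ℝ, B) y₀).source) :
    ContDiffAt ℝ n (reading (A := A) (B := B) x₀ y₀ f) e := by
  rw [← contMDiffAt_iff_contDiffAt]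
  exact ((contMDiffAt_chart hy).of_le hn).comp e (hf.comp e ((contMDiffAt_chart_symm he).of_le hn))

theorem hasFDerivAt_reading {x₀ : M} {y₀ : N} {f : M → N} {e : A} {f' : A →L[ℝ] B}
    (he : e ∈ (extChartAt 𝓘(ℝ, A) x₀).target)
    (hf : HasMFDerivAt 𝓘(ℝ, A) 𝓘(ℝ, B) f ((extChartAt 𝓘(ℝ, A) x₀).symm e) f')
    (hy : f ((extChartAt 𝓘(ℝ, A) x₀).symm e) ∈ (extChartAt 𝓘(ℝ, B) y₀).source) :
    HasFDerivAt (reading (A := A) (B := B) x₀ y₀ f)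
      ((chartT (A := B) y₀ (f ((extChartAt 𝓘(ℝ, A) x₀).symm e))).comp (f'.comp (chartS x₀ e)) : A →L[ℝ] B) e :=
  (HasMFDerivAt.comp e (hasMFDerivAt_chart hy)
    (HasMFDerivAt.comp e hf (hasMFDerivAt_chart_symm he))).hasFDerivAt

/-- A map is smooth if it is smooth in charts. -/
theorem contMDiffAt_of_reading {x₀ : M} {y₀ : N} {f : M → N} {F : A → B} {e : A}
    {n : WithTop ℕ∞} (hn : n ≤ ∞)
    (he : e ∈ (extChartAt 𝓘(ℝ, A) x₀).target) (hFe : F e ∈ (extChartAt 𝓘(ℝ, B) y₀).target)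
    (hf : ∀ᶠ e' in 𝓝 e, f ((extChartAt 𝓘(ℝ, A) x₀).symm e') = (extChartAt 𝓘(ℝ, B) y₀).symm (F e'))
    (hF : ContDiffAt ℝ n F e) :
    ContMDiffAt 𝓘(ℝ, A) 𝓘(ℝ, B) n f ((extChartAt 𝓘(ℝ, A) x₀).symm e) := by
  have hx := (extChartAt 𝓘(ℝ, A) x₀).map_target he
  have hxe := (extChartAt 𝓘(ℝ, A) x₀).right_inv he
  have h1 : ContMDiffAt 𝓘(ℝ, A) 𝓘(ℝ, B) n
      (fun x ↦ (extChartAt 𝓘(ℝ, B) y₀).symm (F (extChartAt 𝓘(ℝ, A) x₀ x)))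
      ((extChartAt 𝓘(ℝ, A) x₀).symm e) := by
    refine ContMDiffAt.comp _ (I' := 𝓘(ℝ, B)) (((contMDiffAt_chart_symm ?_)).of_le hn)
      (ContMDiffAt.comp _ (I' := 𝓘(ℝ, A)) ?_ ((contMDiffAt_chart hx).of_le hn))
    · rwa [hxe]
    · rw [hxe, contMDiffAt_iff_contDiffAt]; exact hF
  refine h1.congr_of_eventuallyEq ?_
  refine eventually_of_chart hx (P := fun x ↦ f x = (extChartAt 𝓘(ℝ, B) y₀).symm
    (F (extChartAt 𝓘(ℝ, A) x₀ x))) ?_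
  rw [hxe]
  filter_upwards [hf, chart_target_mem_nhds he] with e' h h'
  rw [h, (extChartAt 𝓘(ℝ, A) x₀).right_inv h']

theorem hasMFDerivAt_of_reading {x₀ : M} {y₀ : N} {f : M → N} {F : A → B} {e : A} {F' : A →L[ℝ] B}
    (he : e ∈ (extChartAt 𝓘(ℝ, A) x₀).target) (hFe : F e ∈ (extChartAt 𝓘(ℝ, B) y₀).target)
    (hf : ∀ᶠ e' in 𝓝 e, f ((extChartAt 𝓘(ℝ, A) x₀).symm e') = (extChartAt 𝓘(ℝ, B) y₀).symm (F e'))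
    (hF : HasFDerivAt F F' e) :
    HasMFDerivAt 𝓘(ℝ, A) 𝓘(ℝ, B) f ((extChartAt 𝓘(ℝ, A) x₀).symm e)
      ((chartS y₀ (F e)).comp (F'.comp (chartT x₀ ((extChartAt 𝓘(ℝ, A) x₀).symm e))) : A →L[ℝ] B) := by
  have hx := (extChartAt 𝓘(ℝ, A) x₀).map_target he
  have hxe := (extChartAt 𝓘(ℝ, A) x₀).right_inv he
  have h1 : HasMFDerivAt 𝓘(ℝ, A) 𝓘(ℝ, B)
      (fun x ↦ (extChartAt 𝓘(ℝ, B) y₀).symm (F (extChartAt 𝓘(ℝ, A) x₀ x)))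
      ((extChartAt 𝓘(ℝ, A) x₀).symm e)
      ((chartS y₀ (F e)).comp (F'.comp (chartT x₀ ((extChartAt 𝓘(ℝ, A) x₀).symm e))) : A →L[ℝ] B) := by
    refine HasMFDerivAt.comp _ (I' := 𝓘(ℝ, B)) (g := (extChartAt 𝓘(ℝ, B) y₀).symm)
      (f := fun x ↦ F (extChartAt 𝓘(ℝ, A) x₀ x)) ?_ ?_
    · rw [hxe]
      exact hasMFDerivAt_chart_symm hFe
    · refine HasMFDerivAt.comp _ (I' := 𝓘(ℝ, A)) (g := F) ?_ (hasMFDerivAt_chart hx)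
      rw [hxe]
      exact hF.hasMFDerivAt
  refine h1.congr_of_eventuallyEq ?_
  refine eventually_of_chart hx (P := fun x ↦ f x = (extChartAt 𝓘(ℝ, B) y₀).symm
    (F (extChartAt 𝓘(ℝ, A) x₀ x))) ?_
  rw [hxe]
  filter_upwards [hf, chart_target_mem_nhds he] with e' h h'
  rw [h, (extChartAt 𝓘(ℝ, A) x₀).right_inv h']

theorem chartT_mfderiv_of_reading {x₀ : M} {y₀ : N} {f : M → N} {F : A → B} {e : A}
    (he : e ∈ (extChartAt 𝓘(ℝ, A) x₀).target) (hFe : F e ∈ (extChartAt 𝓘(ℝ, B) y₀).target)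
    (hf : ∀ᶠ e' in 𝓝 e, f ((extChartAt 𝓘(ℝ, A) x₀).symm e') = (extChartAt 𝓘(ℝ, B) y₀).symm (F e'))
    (hF : DifferentiableAt ℝ F e) (v : A) :
    (mfderiv 𝓘(ℝ, A) 𝓘(ℝ, B) f ((extChartAt 𝓘(ℝ, A) x₀).symm e) (chartS x₀ e v) : B) =
      chartS y₀ (F e) (fderiv ℝ F e v) := by
  rw [(hasMFDerivAt_of_reading he hFe hf hF.hasFDerivAt).mfderiv]
  change chartS y₀ (F e) (fderiv ℝ F e
    (chartT x₀ ((extChartAt 𝓘(ℝ, A) x₀).symm e) (chartS x₀ e v))) = _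
  rw [chartT_chartS he]

theorem fderiv_reading {x₀ : M} {y₀ : N} {f : M → N} {e : A}
    (he : e ∈ (extChartAt 𝓘(ℝ, A) x₀).target)
    (hf : MDifferentiableAt 𝓘(ℝ, A) 𝓘(ℝ, B) f ((extChartAt 𝓘(ℝ, A) x₀).symm e))
    (hy : f ((extChartAt 𝓘(ℝ, A) x₀).symm e) ∈ (extChartAt 𝓘(ℝ, B) y₀).source) (v : A) :
    fderiv ℝ (reading (A := A) (B := B) x₀ y₀ f) e v = chartT (A := B) y₀ (f ((extChartAt 𝓘(ℝ, A) x₀).symm e))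
      (mfderiv 𝓘(ℝ, A) 𝓘(ℝ, B) f ((extChartAt 𝓘(ℝ, A) x₀).symm e) (chartS x₀ e v)) :=
  congrArg (fun L : A →L[ℝ] B ↦ L v) (hasFDerivAt_reading he hf.hasMFDerivAt hy).fderiv

end Charts

/-! ### Differential forms in charts -/

section FormCharts

variable {E : Type*} [NormedAddCommGroup E] [NormedSpace ℝ E]
  {X : Type*} [TopologicalSpace X] [ChartedSpace E X]

theorem Form.congr_point {n : ℕ} (α : Form E X n) {x y : X} (h : x = y) (v : Fin n → E) :
    (α x v : ℝ) = α y v := by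
  subst h; rfl

theorem Form.inChart_apply {n : ℕ} (α : Form E X n) (x₀ : X) (e : E) (v : Fin n → E) :
    α.inChart x₀ e v = α ((extChartAt 𝓘(ℝ, E) x₀).symm e) (fun i ↦ chartS x₀ e (v i)) := rfl

variable [IsManifold 𝓘(ℝ, E) ∞ X]

theorem Form.apply_eq_inChart {n : ℕ} (α : Form E X n) {x₀ x : X}
    (hx : x ∈ (extChartAt 𝓘(ℝ, E) x₀).source) (v : Fin n → E) :
    (α x v : ℝ) = α.inChart x₀ (extChartAt 𝓘(ℝ, E) x₀ x) (fun i ↦ chartT x₀ x (v i)) := by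
  rw [Form.inChart_apply]
  simp only [chartS_chartT hx]
  exact α.congr_point ((extChartAt 𝓘(ℝ, E) x₀).left_inv hx).symm v

/-- The expression in charts of the pullback of a form. -/
theorem Form.inChart_pullback {n : ℕ} (α : Form E X n) {x₀ y₀ : X} {f : X → X} {F : E → E} {e : E}
    (he : e ∈ (extChartAt 𝓘(ℝ, E) x₀).target) (hFe : F e ∈ (extChartAt 𝓘(ℝ, E) y₀).target)
    (hf : ∀ᶠ e' in 𝓝 e, f ((extChartAt 𝓘(ℝ, E) x₀).symm e') = (extChartAt 𝓘(ℝ, E) y₀).symm (F e'))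
    (hF : DifferentiableAt ℝ F e) :
    (α.pullback f).inChart x₀ e =
      (α.inChart y₀ (F e)).compContinuousLinearMap (fderiv ℝ F e) := by
  ext v
  rw [Form.inChart_apply, ContinuousAlternatingMap.compContinuousLinearMap_apply,
    Form.inChart_apply]
  have h1 : ((α.pullback f) ((extChartAt 𝓘(ℝ, E) x₀).symm e) (fun i ↦ chartS x₀ e (v i)) : ℝ) =
    α (f ((extChartAt 𝓘(ℝ, E) x₀).symm e)) (fun i ↦ (mfderiv 𝓘(ℝ, E) 𝓘(ℝ, E) f
      ((extChartAt 𝓘(ℝ, E) x₀).symm e) (chartS x₀ e (v i)) : E)) := rfl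
  rw [h1]
  simp only [chartT_mfderiv_of_reading he hFe hf hF]
  exact α.congr_point hf.self_of_nhds _

/-- Change of charts is then the chart formula for pullbacks applied to the identity map. -/
theorem Form.pullback_id {n : ℕ} (α : Form E X n) : α.pullback (fun x ↦ x) = α := by
  funext x
  ext v
  have h1 : ((α.pullback (fun x ↦ x)) x v : ℝ) =
    α x (fun i ↦ mfderiv 𝓘(ℝ, E) 𝓘(ℝ, E) (fun x : X ↦ x) x (v i)) := rfl
  rw [h1]
  have : mfderiv 𝓘(ℝ, E) 𝓘(ℝ, E) (fun x : X ↦ x) x = .id ℝ _ := mfderiv_id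
  rw [this]
  rfl

theorem contDiffAt_transition {x₀ y₀ : X} {e : E} (he : e ∈ (extChartAt 𝓘(ℝ, E) x₀).target)
    (hy : (extChartAt 𝓘(ℝ, E) x₀).symm e ∈ (extChartAt 𝓘(ℝ, E) y₀).source) :
    ContDiffAt ℝ ∞ (reading (A := E) (B := E) x₀ y₀ (fun x : X ↦ x)) e :=
  contDiffAt_reading le_rfl he contMDiffAt_id hy

theorem eventually_transition {x₀ y₀ : X} {e : E} (he : e ∈ (extChartAt 𝓘(ℝ, E) x₀).target)
    (hy : (extChartAt 𝓘(ℝ, E) x₀).symm e ∈ (extChartAt 𝓘(ℝ, E) y₀).source) :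
    ∀ᶠ e' in 𝓝 e, (extChartAt 𝓘(ℝ, E) x₀).symm e' =
      (extChartAt 𝓘(ℝ, E) y₀).symm (reading (A := E) (B := E) x₀ y₀ (fun x : X ↦ x) e') := by
  filter_upwards [(chart_continuousAt_symm he).eventually (chart_source_mem_nhds hy)] with e' h
  exact ((extChartAt 𝓘(ℝ, E) y₀).left_inv h).symm

/-- Change of charts. -/
theorem Form.inChart_eventuallyEq {n : ℕ} (α : Form E X n) {x₀ y₀ : X} {e : E}
    (he : e ∈ (extChartAt 𝓘(ℝ, E) x₀).target)
    (hy : (extChartAt 𝓘(ℝ, E) x₀).symm e ∈ (extChartAt 𝓘(ℝ, E) y₀).source) :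
    α.inChart x₀ =ᶠ[𝓝 e] fun e' ↦ (α.inChart y₀ (reading (A := E) (B := E) x₀ y₀ (fun x : X ↦ x) e')
      ).compContinuousLinearMap (fderiv ℝ (reading (A := E) (B := E) x₀ y₀ (fun x : X ↦ x)) e') := by
  filter_upwards [(chart_continuousAt_symm he).eventually (chart_source_mem_nhds hy),
    chart_target_mem_nhds he] with e' h h'
  have := α.inChart_pullback (f := fun x ↦ x) h' ((extChartAt 𝓘(ℝ, E) y₀).map_source h)
    (eventually_transition h' h) ((contDiffAt_transition h' h).differentiableAt (by simp))
  rwa [α.pullback_id] at this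

/-- The expression in charts of the exterior derivative. -/
theorem Form.inChart_d {n : ℕ} (α : Form E X n) {x₀ : X} {e : E}
    (he : e ∈ (extChartAt 𝓘(ℝ, E) x₀).target) (hα : DifferentiableAt ℝ (α.inChart x₀) e) :
    α.d.inChart x₀ e = extDeriv (α.inChart x₀) e := by
  set x := (extChartAt 𝓘(ℝ, E) x₀).symm e with hx
  have hxs : x ∈ (extChartAt 𝓘(ℝ, E) x₀).source := (extChartAt 𝓘(ℝ, E) x₀).map_target he
  have hxx : (extChartAt 𝓘(ℝ, E) x).symm (extChartAt 𝓘(ℝ, E) x x) = x :=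
    extChartAt_to_inv x
  have hxs' : (extChartAt 𝓘(ℝ, E) x).symm (extChartAt 𝓘(ℝ, E) x x) ∈
      (extChartAt 𝓘(ℝ, E) x₀).source := by rwa [hxx]
  have ht := mem_extChartAt_target (I := 𝓘(ℝ, E)) x
  have hr : reading (A := E) (B := E) x x₀ (fun x : X ↦ x) (extChartAt 𝓘(ℝ, E) x x) = e := by
    rw [reading, hxx, hx, (extChartAt 𝓘(ℝ, E) x₀).right_inv he]
  -- `Form.d` at `x` is computed in the preferred chart of `x`. The transition map to the chart
  -- around `x₀` is absorbed by naturality of `extDeriv`.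
  have h1 := (α.inChart_eventuallyEq ht hxs').extDeriv_eq
  have h2 := extDeriv_pullback (𝕜 := ℝ) (r := ∞) (f := reading (A := E) (B := E) x x₀ (fun x : X ↦ x))
    (x := extChartAt 𝓘(ℝ, E) x x) (show DifferentiableAt ℝ (α.inChart x₀) _ by rwa [hr])
    (contDiffAt_transition ht hxs') minSmoothness_two_le
  have h3 (v : E) : fderiv ℝ (reading (A := E) (B := E) x x₀ (fun x : X ↦ x)) (extChartAt 𝓘(ℝ, E) x x)
      (chartT x x (chartS x₀ e v)) = v := by
    rw [fderiv_reading (f := fun x : X ↦ x) ht mdifferentiableAt_id hxs', chartS_self, chartT_self]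
    have : mfderiv 𝓘(ℝ, E) 𝓘(ℝ, E) (fun x : X ↦ x)
      ((extChartAt 𝓘(ℝ, E) x).symm (extChartAt 𝓘(ℝ, E) x x)) = .id ℝ _ := mfderiv_id
    rw [this, hxx]
    exact chartT_chartS he v
  ext v
  rw [Form.inChart_apply]
  change extDeriv (α.inChart x) (extChartAt 𝓘(ℝ, E) x x)
    (fun i ↦ chartT x x (chartS x₀ e (v i))) = _
  rw [h1, h2, hr, ContinuousAlternatingMap.compContinuousLinearMap_apply]
  congr 1
  ext i
  exact h3 (v i)

theorem Form.d_apply_chart {n : ℕ} (α : Form E X n) {x₀ : X} {e : E}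
    (he : e ∈ (extChartAt 𝓘(ℝ, E) x₀).target) (hα : DifferentiableAt ℝ (α.inChart x₀) e)
    (v : Fin (n + 1) → E) :
    (α.d ((extChartAt 𝓘(ℝ, E) x₀).symm e) v : ℝ) = extDeriv (α.inChart x₀) e
      (fun i ↦ chartT x₀ ((extChartAt 𝓘(ℝ, E) x₀).symm e) (v i)) := by
  rw [← α.inChart_d he hα, Form.inChart_apply]
  simp only [chartS_chartT' he]

theorem Form.d_eq_zero_iff {n : ℕ} (α : Form E X n) {x₀ : X} {e : E}
    (he : e ∈ (extChartAt 𝓘(ℝ, E) x₀).target) (hα : DifferentiableAt ℝ (α.inChart x₀) e) :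
    α.d ((extChartAt 𝓘(ℝ, E) x₀).symm e) = 0 ↔ extDeriv (α.inChart x₀) e = 0 := by
  constructor
  · intro h
    rw [← α.inChart_d he hα]
    ext v
    rw [Form.inChart_apply, h]
    rfl
  · intro h
    ext v
    exact (α.d_apply_chart he hα v).trans (by rw [h]; rfl)

/-- The exterior derivative commutes with pullbacks. -/
theorem Form.d_pullback {n : ℕ} (α : Form E X n) {f : X → X} {x : X}
    (hf : ∀ᶠ y in 𝓝 x, ContMDiffAt 𝓘(ℝ, E) 𝓘(ℝ, E) ∞ f y)
    (hα : DifferentiableAt ℝ (α.inChart (f x)) (extChartAt 𝓘(ℝ, E) (f x) (f x))) :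
    (α.pullback f).d x = α.d.pullback f x := by
  have ht := mem_extChartAt_target (I := 𝓘(ℝ, E)) x
  have hxx : (extChartAt 𝓘(ℝ, E) x).symm (extChartAt 𝓘(ℝ, E) x x) = x := extChartAt_to_inv x
  have hs : f ((extChartAt 𝓘(ℝ, E) x).symm (extChartAt 𝓘(ℝ, E) x x)) ∈
      (extChartAt 𝓘(ℝ, E) (f x)).source := by rw [hxx]; exact mem_extChartAt_source _
  have hfc : ContinuousAt f x := hf.self_of_nhds.continuousAt
  have hgood : ∀ᶠ e in 𝓝 (extChartAt 𝓘(ℝ, E) x x), e ∈ (extChartAt 𝓘(ℝ, E) x).target ∧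
      ContMDiffAt 𝓘(ℝ, E) 𝓘(ℝ, E) ∞ f ((extChartAt 𝓘(ℝ, E) x).symm e) ∧
      f ((extChartAt 𝓘(ℝ, E) x).symm e) ∈ (extChartAt 𝓘(ℝ, E) (f x)).source := by
    have h1 : ∀ᶠ y in 𝓝 x, ContMDiffAt 𝓘(ℝ, E) 𝓘(ℝ, E) ∞ f y ∧
        f y ∈ (extChartAt 𝓘(ℝ, E) (f x)).source :=
      hf.and (hfc.eventually (extChartAt_source_mem_nhds (f x)))
    filter_upwards [chart_target_mem_nhds ht, eventually_chart ht (by rwa [hxx])] with e h h'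
    exact ⟨h, h'⟩
  set F := reading (A := E) (B := E) x (f x) f with hF
  have hFx : F (extChartAt 𝓘(ℝ, E) x x) = extChartAt 𝓘(ℝ, E) (f x) (f x) := by
    rw [hF, reading, hxx]
  have hgood' := eventually_eventually_nhds.2 hgood
  have h1 : (α.pullback f).inChart x =ᶠ[𝓝 (extChartAt 𝓘(ℝ, E) x x)] fun e ↦
      (α.inChart (f x) (F e)).compContinuousLinearMap (fderiv ℝ F e) := by
    filter_upwards [hgood'] with e h
    obtain ⟨h2, h3, h4⟩ := h.self_of_nhds
    refine α.inChart_pullback h2 ((extChartAt 𝓘(ℝ, E) (f x)).map_source h4) ?_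
      ((contDiffAt_reading le_rfl h2 h3 h4).differentiableAt (by simp))
    filter_upwards [h] with e' h'
    exact ((extChartAt 𝓘(ℝ, E) (f x)).left_inv h'.2.2).symm
  obtain ⟨h2, h3, h4⟩ := hgood.self_of_nhds
  have h5 := extDeriv_pullback (𝕜 := ℝ) (r := ∞) (f := F)
    (x := extChartAt 𝓘(ℝ, E) x x) (show DifferentiableAt ℝ (α.inChart (f x)) _ by rwa [hFx])
    (contDiffAt_reading le_rfl h2 h3 h4) minSmoothness_two_le
  ext v
  change extDeriv ((α.pullback f).inChart x) (extChartAt 𝓘(ℝ, E) x x)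
    (fun i ↦ chartT x x (v i)) = extDeriv (α.inChart (f x)) (extChartAt 𝓘(ℝ, E) (f x) (f x))
      (fun i ↦ chartT (f x) (f x) (mfderiv 𝓘(ℝ, E) 𝓘(ℝ, E) f x (v i)))
  rw [h1.extDeriv_eq, h5, ContinuousAlternatingMap.compContinuousLinearMap_apply, hFx]
  congr 1
  ext i
  rw [Function.comp_apply, hF, fderiv_reading h2 (h3.mdifferentiableAt (by simp)) h4, chartS_self,
    chartT_self, hxx]
  rfl

theorem Form.d_congr {n : ℕ} {α β : Form E X n} {x : X} (h : ∀ᶠ y in 𝓝 x, α y = β y) :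
    α.d x = β.d x := by
  have ht := mem_extChartAt_target (I := 𝓘(ℝ, E)) x
  have h1 : α.inChart x =ᶠ[𝓝 (extChartAt 𝓘(ℝ, E) x x)] β.inChart x := by
    filter_upwards [eventually_chart ht (by rwa [extChartAt_to_inv])] with e he
    rw [Form.inChart, Form.inChart, he]
  rw [Form.d, Form.d, h1.extDeriv_eq]

theorem Form.inChart_congr {n : ℕ} {α β : Form E X n} {x₀ : X} {e : E}
    (he : e ∈ (extChartAt 𝓘(ℝ, E) x₀).target)
    (h : ∀ᶠ y in 𝓝 ((extChartAt 𝓘(ℝ, E) x₀).symm e), α y = β y) :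
    α.inChart x₀ =ᶠ[𝓝 e] β.inChart x₀ := by
  filter_upwards [eventually_chart he h] with e he
  rw [Form.inChart, Form.inChart, he]

/-! ### Smoothness of forms -/

theorem contDiffAt_twoForm_of_apply {F : Type*} [NormedAddCommGroup F] [NormedSpace ℝ F]
    [FiniteDimensional ℝ E] {n : ℕ} {f : F → E [⋀^Fin n]→L[ℝ] ℝ} {x : F}
    (hf : ∀ v, ContDiffAt ℝ ∞ (fun y ↦ f y v) x) : ContDiffAt ℝ ∞ f x := by
  obtain ⟨d, b, r, hr⟩ := exists_linearMap_of_alternating E n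
  have h2 : f = fun y ↦ r (fun i ↦ f y (b ∘ i)) := by
    ext1 y
    exact (hr _).symm
  rw [h2]
  exact r.contDiff.contDiffAt.comp x (contDiffAt_pi.2 fun i ↦ hf _)

theorem contDiffAt_twoForm_comp [FiniteDimensional ℝ E] {τ : E → E [⋀^Fin 2]→L[ℝ] ℝ} {f : E → E}
    {e : E} (hτ : ContDiffAt ℝ ∞ τ (f e)) (hf : ContDiffAt ℝ ∞ f e) :
    ContDiffAt ℝ ∞ (fun x ↦ (τ (f x)).compContinuousLinearMap (fderiv ℝ f x)) e := by
  refine contDiffAt_twoForm_of_apply fun v ↦ ?_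
  have hf' : ContDiffAt ℝ ∞ (fderiv ℝ f) e := hf.fderiv_right (by simp)
  have hb : ContDiff ℝ ∞ (fun a : E [⋀^Fin 2]→L[ℝ] ℝ ↦ bilin a) := isBoundedLinearMap_bilin.contDiff
  have h1 := hb.contDiffAt.comp e (hτ.comp e hf)
  have h2 := (h1.clm_apply (hf'.clm_apply (contDiffAt_const (c := v 0)))).clm_apply
    (hf'.clm_apply (contDiffAt_const (c := v 1)))
  refine h2.congr_of_eventuallyEq (Eventually.of_forall fun x ↦ ?_)
  simp only [Function.comp_apply]
  rw [ContinuousAlternatingMap.compContinuousLinearMap_apply, bilin_apply]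
  conv_lhs => rw [eq_vec_two v, comp_vec_two]

variable [FiniteDimensional ℝ E]

theorem Form.SmoothAt.contDiffAt_inChart {α : Form E X 2} {x₀ : X} {e : E}
    (he : e ∈ (extChartAt 𝓘(ℝ, E) x₀).target)
    (hα : α.SmoothAt ((extChartAt 𝓘(ℝ, E) x₀).symm e)) : ContDiffAt ℝ ∞ (α.inChart x₀) e := by
  have hs := mem_extChartAt_source (I := 𝓘(ℝ, E)) ((extChartAt 𝓘(ℝ, E) x₀).symm e)
  exact (contDiffAt_twoForm_comp (f := reading x₀ _ (fun x : X ↦ x)) hα (contDiffAt_transition he hs)).congr_of_eventuallyEq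
    (α.inChart_eventuallyEq he hs)

theorem Form.smoothAt_of_contDiffAt_inChart {α : Form E X 2} {x₀ : X} {e : E}
    (he : e ∈ (extChartAt 𝓘(ℝ, E) x₀).target) (hα : ContDiffAt ℝ ∞ (α.inChart x₀) e) :
    α.SmoothAt ((extChartAt 𝓘(ℝ, E) x₀).symm e) := by
  set x := (extChartAt 𝓘(ℝ, E) x₀).symm e with hx
  have hxx : (extChartAt 𝓘(ℝ, E) x).symm (extChartAt 𝓘(ℝ, E) x x) = x := extChartAt_to_inv x
  have hxs : (extChartAt 𝓘(ℝ, E) x).symm (extChartAt 𝓘(ℝ, E) x x) ∈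
      (extChartAt 𝓘(ℝ, E) x₀).source := by
    rw [hxx]; exact (extChartAt 𝓘(ℝ, E) x₀).map_target he
  have ht := mem_extChartAt_target (I := 𝓘(ℝ, E)) x
  have hr : reading (A := E) (B := E) x x₀ (fun x : X ↦ x) (extChartAt 𝓘(ℝ, E) x x) = e := by
    rw [reading, hxx, hx, (extChartAt 𝓘(ℝ, E) x₀).right_inv he]
  exact (contDiffAt_twoForm_comp (by rwa [hr]) (contDiffAt_transition ht hxs)
    ).congr_of_eventuallyEq (α.inChart_eventuallyEq ht hxs)

end FormCharts

/-! ### Actions and moment maps in charts -/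

section ActionCharts

variable {E : Type*} [NormedAddCommGroup E] [NormedSpace ℝ E] [FiniteDimensional ℝ E]
  {X : Type*} [TopologicalSpace X] [ChartedSpace E X] [IsManifold 𝓘(ℝ, E) ∞ X]
  {E_G : Type*} [NormedAddCommGroup E_G] [NormedSpace ℝ E_G] [FiniteDimensional ℝ E_G]
  {G : Type*} [TopologicalSpace G] [ChartedSpace E_G G] [Group G] [LieGroup 𝓘(ℝ, E_G) ∞ G]
  [MulAction G X] [ContMDiffSMul 𝓘(ℝ, E_G) 𝓘(ℝ, E) ∞ G X]

local notation "κ" => extChartAt 𝓘(ℝ, E)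

/-- The derivative of the action of `g` at `x`. -/
def smulT (E : Type*) [NormedAddCommGroup E] [NormedSpace ℝ E] [ChartedSpace E X] (g : G) (x : X) :
    E →L[ℝ] E :=
  (mfderiv 𝓘(ℝ, E) 𝓘(ℝ, E) (fun y : X ↦ g • y) x :)

variable (E_G) in
include E_G in
theorem contMDiff_smul_const (g : G) : ContMDiff 𝓘(ℝ, E) 𝓘(ℝ, E) ∞ (fun y : X ↦ g • y) :=
  ContMDiffSMul.contMDiff_const_smul (I := 𝓘(ℝ, E_G)) g

theorem contMDiff_orbit (x : X) : ContMDiff 𝓘(ℝ, E_G) 𝓘(ℝ, E) ∞ (fun g : G ↦ g • x) :=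
  (contMDiff_smul (I := 𝓘(ℝ, E_G)) (I' := 𝓘(ℝ, E)) (n := ∞) (G := G) (M := X)).comp
    (contMDiff_id.prodMk contMDiff_const)

variable (E_G) in
include E_G in
theorem hasMFDerivAt_smul (g : G) (x : X) :
    HasMFDerivAt 𝓘(ℝ, E) 𝓘(ℝ, E) (fun y : X ↦ g • y) x (smulT E g x) :=
  ((contMDiff_smul_const E_G g x).mdifferentiableAt (by simp)).hasMFDerivAt

theorem hasMFDerivAt_orbit (x : X) :
    HasMFDerivAt 𝓘(ℝ, E_G) 𝓘(ℝ, E) (fun g : G ↦ g • x) 1 (L E E_G G x : E_G →L[ℝ] E) := by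
  have h := ((contMDiff_orbit (E := E) (E_G := E_G) (G := G) x 1).mdifferentiableAt
    (by simp)).hasMFDerivAt
  have h2 : HasMFDerivAt 𝓘(ℝ, E_G) 𝓘(ℝ, E) (fun g : G ↦ g • x) 1
    (mfderiv 𝓘(ℝ, E_G) 𝓘(ℝ, E) (fun g : G ↦ g • x) 1) := h
  exact h2

variable (E_G) in
include E_G in
theorem smulT_mul (g h : G) (x : X) (v : E) :
    smulT E (g * h) x v = smulT E g (h • x) (smulT E h x v) := by
  have h1 := HasMFDerivAt.comp x (hasMFDerivAt_smul (E := E) E_G g (h • x))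
    (hasMFDerivAt_smul (E := E) E_G h x)
  have h2 := hasMFDerivAt_smul (E := E) E_G (g * h) x
  have h3 : (fun y : X ↦ (g * h) • y) = (fun y ↦ g • y) ∘ (fun y ↦ h • y) := by
    ext y; simp [mul_smul]
  rw [h3] at h2
  exact congrArg (fun L : E →L[ℝ] E ↦ L v) (hasMFDerivAt_unique h2 h1)

theorem smulT_one (x : X) (v : E) : smulT E (1 : G) x v = v := by
  have h3 : (fun y : X ↦ (1 : G) • y) = id := by ext y; simp
  have h1 : smulT E (1 : G) x = .id ℝ E := by
    rw [smulT, h3]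
    exact mfderiv_id
  rw [h1]; rfl

variable (E_G) in
include E_G in
theorem smulT_inv_smulT (g : G) (x : X) (v : E) : smulT E g⁻¹ (g • x) (smulT E g x v) = v := by
  rw [← smulT_mul (E := E) E_G, inv_mul_cancel, smulT_one]

variable (E_G) in
include E_G in
theorem smulT_smulT_inv (g : G) (x : X) (v : E) : smulT E g x (smulT E g⁻¹ (g • x) v) = v := by
  have h := smulT_mul (E := E) E_G g g⁻¹ (g • x) v
  rw [mul_inv_cancel, smulT_one, inv_smul_smul] at h
  exact h.symm

/-- Differentiate `(g h g⁻¹) • (g • x) = g • (h • x)` in `h` at `h = 1`. -/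
theorem L_smul (g : G) (x : X) (ξ : E_G) :
    (L E E_G G (g • x) (Ad g ξ) : E) = smulT E g x (L E E_G G x ξ) := by
  have h0 : HasMFDerivAt 𝓘(ℝ, E_G) 𝓘(ℝ, E_G) (fun h : G ↦ g * h * g⁻¹) 1 (Ad g : E_G →L[ℝ] E_G) := by
    have h1 : ContMDiff 𝓘(ℝ, E_G) 𝓘(ℝ, E_G) ∞ (fun h : G ↦ g * h * g⁻¹) :=
      (contMDiff_const.mul contMDiff_id).mul contMDiff_const
    have h2 : HasMFDerivAt 𝓘(ℝ, E_G) 𝓘(ℝ, E_G) (fun h : G ↦ g * h * g⁻¹) 1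
      (mfderiv 𝓘(ℝ, E_G) 𝓘(ℝ, E_G) (fun h : G ↦ g * h * g⁻¹) 1) :=
      ((h1 1).mdifferentiableAt (by simp)).hasMFDerivAt
    exact h2
  have hg : g * 1 * g⁻¹ = 1 := by simp
  have h1 : HasMFDerivAt 𝓘(ℝ, E_G) 𝓘(ℝ, E) (fun h : G ↦ h • (g • x)) (g * 1 * g⁻¹)
      (L E E_G G (g • x) : E_G →L[ℝ] E) := by
    rw [hg]; exact hasMFDerivAt_orbit (g • x)
  have h2 := HasMFDerivAt.comp (1 : G) h1 h0
  have h3 : HasMFDerivAt 𝓘(ℝ, E) 𝓘(ℝ, E) (fun y : X ↦ g • y) ((1 : G) • x) (smulT E g x) := by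
    rw [one_smul]; exact hasMFDerivAt_smul E_G g x
  have h4 := HasMFDerivAt.comp (1 : G) h3 (hasMFDerivAt_orbit (E := E) (E_G := E_G) (G := G) x)
  have h5 : (fun h : G ↦ h • (g • x)) ∘ (fun h : G ↦ g * h * g⁻¹) =
      (fun y : X ↦ g • y) ∘ (fun h : G ↦ h • x) := by
    ext h; simp [mul_smul]
  rw [h5] at h2
  exact congrArg (fun L : E_G →L[ℝ] E ↦ L ξ) (hasMFDerivAt_unique h2 h4)

/-! #### The tensors on the model space

Tangent spaces are identified with the model space `E`. -/

/-- The bilinear form on `E` given by the two-form `α` at `x`. -/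
def Form.bil (α : Form E X 2) (x : X) : E →L[ℝ] E →L[ℝ] ℝ := bilin (α x : E [⋀^Fin 2]→L[ℝ] ℝ)

theorem Form.bil_apply (α : Form E X 2) (x : X) (v w : E) : α.bil x v w = α x ![v, w] :=
  bilin_apply (E := E) (α x) v w

theorem Form.bil_swap (α : Form E X 2) (x : X) (v w : E) : α.bil x v w = -α.bil x w v :=
  bilin_swap (E := E) (α x) v w

/-- The bilinear form on `E` given by the two-form `α` in a chart. -/
def Form.hat (α : Form E X 2) (x₀ : X) (e : E) : E →L[ℝ] E →L[ℝ] ℝ := bilin (α.inChart x₀ e)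

theorem Form.hat_apply (α : Form E X 2) (x₀ : X) (e : E) (v w : E) :
    α.hat x₀ e v w = α.inChart x₀ e ![v, w] :=
  bilin_apply _ v w

theorem Form.hat_eq_bil (α : Form E X 2) (x₀ : X) (e : E) (v w : E) :
    α.hat x₀ e v w = α.bil ((κ x₀).symm e) (chartS x₀ e v) (chartS x₀ e w) := by
  rw [Form.hat_apply, Form.bil_apply, Form.inChart_apply]
  exact congrArg (α ((κ x₀).symm e)) (comp_vec_two (chartS (A := E) x₀ e) v w)

theorem Form.hat_swap (α : Form E X 2) (x₀ : X) (e : E) (v w : E) :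
    α.hat x₀ e v w = -α.hat x₀ e w v :=
  bilin_swap (α.inChart x₀ e) v w

/-- The almost complex structure at `x`. -/
def tensorJ (J : Π x : X, TangentSpace 𝓘(ℝ, E) x →L[ℝ] TangentSpace 𝓘(ℝ, E) x) (x : X) :
    E →L[ℝ] E := J x

/-- The metric at `x`. -/
def tensorMetric (ω_X : Form E X 2)
    (J : Π x : X, TangentSpace 𝓘(ℝ, E) x →L[ℝ] TangentSpace 𝓘(ℝ, E) x) (x : X) (v w : E) : ℝ :=
  ω_X.bil x v (tensorJ J x w)

variable (E E_G G) in
/-- The infinitesimal action at `x`. -/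
def tensorL (x : X) : E_G →L[ℝ] E := L E E_G G x

/-- The derivative of `f` at `x`. -/
def tensorD {F : Type*} [NormedAddCommGroup F] [NormedSpace ℝ F] (f : X → F) (x : X) : E →L[ℝ] F :=
  mvfderiv 𝓘(ℝ, E) f x

theorem tensorMetric_eq (ω_X : Form E X 2)
    (J : Π x : X, TangentSpace 𝓘(ℝ, E) x →L[ℝ] TangentSpace 𝓘(ℝ, E) x) (x : X) (v w : E) :
    tensorMetric ω_X J x v w = metric ω_X J x v w :=
  ω_X.bil_apply x v (tensorJ J x w)

/-! #### The almost complex structure -/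

/-- The almost complex structure in a chart. -/
def hatJ (J : Π x : X, TangentSpace 𝓘(ℝ, E) x →L[ℝ] TangentSpace 𝓘(ℝ, E) x) (x₀ : X) (e : E) :
    E →L[ℝ] E :=
  (chartT x₀ ((κ x₀).symm e)).comp ((tensorJ J ((κ x₀).symm e)).comp (chartS x₀ e))

variable {J : Π x : X, TangentSpace 𝓘(ℝ, E) x →L[ℝ] TangentSpace 𝓘(ℝ, E) x}
  {ω_X : Form E X 2} {μ : X → E_G} {B : E_G →L[ℝ] E_G →L[ℝ] ℝ}

theorem chartS_hatJ {x₀ : X} {e : E} (he : e ∈ (κ x₀).target) (v : E) :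
    chartS x₀ e (hatJ J x₀ e v) = tensorJ J ((κ x₀).symm e) (chartS x₀ e v) :=
  chartS_chartT' he _

theorem tensorJ_sq (hJ : IsCompatible G ω_X J) (x : X) (v : E) :
    tensorJ J x (tensorJ J x v) = -v := hJ.sq x v

theorem bil_tensorJ (hJ : IsCompatible G ω_X J) (x : X) (v w : E) :
    ω_X.bil x (tensorJ J x v) (tensorJ J x w) = ω_X.bil x v w := by
  rw [Form.bil_apply, Form.bil_apply]
  exact hJ.isometry x v w

theorem tensorMetric_pos (hJ : IsCompatible G ω_X J) (x : X) {v : E} (hv : v ≠ 0) :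
    0 < tensorMetric ω_X J x v v := by
  rw [tensorMetric_eq]
  exact hJ.pos x v hv

theorem tensorJ_smul (hJ : IsCompatible G ω_X J) (g : G) (x : X) (v : E) :
    tensorJ J (g • x) (smulT E g x v) = smulT E g x (tensorJ J x v) := hJ.invariant g x v

theorem tensorMetric_symm (hJ : IsCompatible G ω_X J) (x : X) (v w : E) :
    tensorMetric ω_X J x v w = tensorMetric ω_X J x w v := by
  rw [tensorMetric, tensorMetric, ← bil_tensorJ hJ, tensorJ_sq hJ, map_neg, Form.bil_swap, neg_neg]

/-- In the trivialization of the endomorphism bundle at `x₀`, the section `J` is conjugated by the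
derivatives of the chart and of its inverse, which is the definition of `hatJ`. -/
theorem IsCompatible.contDiffAt_hatJ (hJ : IsCompatible G ω_X J) {x₀ : X} {e : E}
    (he : e ∈ (κ x₀).target) : ContDiffAt ℝ ∞ (hatJ J x₀) e := by
  have hx := (κ x₀).map_target he
  have hx' : (κ x₀).symm e ∈ (chartAt E x₀).source := by simpa using hx
  have h1 := hJ.smooth ((κ x₀).symm e)
  rw [(trivializationAt (E →L[ℝ] E)
    (fun x : X ↦ TangentSpace 𝓘(ℝ, E) x →L[ℝ] TangentSpace 𝓘(ℝ, E) x) x₀).contMDiffAt_section_iff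
    (by simpa using hx')] at h1
  have h2 := h1.comp e (contMDiffAt_chart_symm he)
  rw [contMDiffAt_iff_contDiffAt] at h2
  refine h2.congr_of_eventuallyEq ?_
  filter_upwards [chart_target_mem_nhds he] with e' he'
  have hx1 := (κ x₀).map_target he'
  have hx1' : (κ x₀).symm e' ∈ (chartAt E x₀).source := by simpa using hx1
  have hb : (κ x₀).symm e' ∈ (trivializationAt E (TangentSpace 𝓘(ℝ, E)) x₀).baseSet := by
    simpa using hx1'
  simp only [Function.comp_apply, hom_trivializationAt_apply]
  rw [ContinuousLinearMap.inCoordinates, TangentBundle.symmL_trivializationAt hx1',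
    TangentBundle.continuousLinearMapAt_trivializationAt hx1']
  have h4 : mfderiv[range 𝓘(ℝ, E)] (κ x₀).symm (κ x₀ ((κ x₀).symm e')) =
      mfderiv 𝓘(ℝ, E) 𝓘(ℝ, E) (κ x₀).symm e' := by
    rw [(κ x₀).right_inv he', ModelWithCorners.range_eq_univ, mfderivWithin_univ]
  rw [h4]
  rfl

theorem hat_hatJ (hJ : IsCompatible G ω_X J) {x₀ : X} {e : E} (he : e ∈ (κ x₀).target) (v w : E) :
    ω_X.hat x₀ e (hatJ J x₀ e v) (hatJ J x₀ e w) = ω_X.hat x₀ e v w := by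
  rw [Form.hat_eq_bil, chartS_hatJ he, chartS_hatJ he, bil_tensorJ hJ, Form.hat_eq_bil]

/-- The metric in a chart. -/
def hatMetric (ω_X : Form E X 2) (J : Π x : X, TangentSpace 𝓘(ℝ, E) x →L[ℝ] TangentSpace 𝓘(ℝ, E) x)
    (x₀ : X) (e : E) : E →L[ℝ] E →L[ℝ] ℝ :=
  ((ContinuousLinearMap.compL ℝ E E ℝ).flip (hatJ J x₀ e)).comp (ω_X.hat x₀ e)

theorem hatMetric_apply (x₀ : X) (e v w : E) :
    hatMetric ω_X J x₀ e v w = ω_X.hat x₀ e v (hatJ J x₀ e w) := rfl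

theorem tensorMetric_chart {x₀ : X} {e : E} (he : e ∈ (κ x₀).target) (v w : E) :
    tensorMetric ω_X J ((κ x₀).symm e) (chartS x₀ e v) (chartS x₀ e w) =
      hatMetric ω_X J x₀ e v w := by
  rw [hatMetric_apply, Form.hat_eq_bil, chartS_hatJ he, tensorMetric]

theorem metricInChart_eq {x₀ : X} {e : E} (he : e ∈ (κ x₀).target) (v w : E) :
    metricInChart ω_X J x₀ e v w = hatMetric ω_X J x₀ e v w := by
  rw [← tensorMetric_chart he, tensorMetric_eq]
  rfl

theorem SmoothNear.of_target {F : Type*} [NormedAddCommGroup F] [NormedSpace ℝ F] {f : E → F}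
    {x₀ : X} {e : E} (he : e ∈ (κ x₀).target)
    (h : ∀ e ∈ (κ x₀).target, ContDiffAt ℝ ∞ f e) : SmoothNear f e := by
  filter_upwards [chart_target_mem_nhds he] with e' he' using h e' he'

theorem IsCompatible.smoothNear_hatJ (hJ : IsCompatible G ω_X J) {x₀ : X} {e : E}
    (he : e ∈ (κ x₀).target) : SmoothNear (hatJ J x₀) e :=
  .of_target he fun _ ↦ hJ.contDiffAt_hatJ

theorem smoothNear_inChart {ω_X : Form E X 2} (h : ∀ x, ω_X.SmoothAt x) {x₀ : X} {e : E}
    (he : e ∈ (κ x₀).target) : SmoothNear (ω_X.inChart x₀) e :=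
  .of_target he fun _ he' ↦ (h _).contDiffAt_inChart he'

theorem IsCompatible.smoothNear_hatMetric (hJ : IsCompatible G ω_X J) (h : ∀ x, ω_X.SmoothAt x)
    {x₀ : X} {e : E} (he : e ∈ (κ x₀).target) : SmoothNear (hatMetric ω_X J x₀) e := by
  refine SmoothNear.clm_of_apply fun v ↦ SmoothNear.clm_of_apply fun w ↦ ?_
  exact ((smoothNear_inChart h he).bilin.clm_apply (smoothNear_const v e)).clm_apply
    ((hJ.smoothNear_hatJ he).clm_apply (smoothNear_const w e))

theorem hatMetric_pos (hJ : IsCompatible G ω_X J) {x₀ : X} {e : E} (he : e ∈ (κ x₀).target)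
    {v : E} (hv : v ≠ 0) : 0 < hatMetric ω_X J x₀ e v v := by
  rw [← tensorMetric_chart he]
  refine tensorMetric_pos hJ _ fun h ↦ hv ?_
  rw [← chartT_chartS he v, h, map_zero]

theorem hatMetric_symm (hJ : IsCompatible G ω_X J) {x₀ : X} {e : E} (he : e ∈ (κ x₀).target)
    (v w : E) : hatMetric ω_X J x₀ e v w = hatMetric ω_X J x₀ e w v := by
  rw [← tensorMetric_chart he, tensorMetric_symm hJ, tensorMetric_chart he]

/-! #### The infinitesimal action -/

/-- The action in charts around `1` and `x₀`. -/
def actionChart (G : Type*) [TopologicalSpace G] [ChartedSpace E_G G] [Group G] [MulAction G X]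
    (x₀ : X) (p : E_G × E) : E :=
  κ x₀ ((extChartAt 𝓘(ℝ, E_G) (1 : G)).symm p.1 • (κ x₀).symm p.2)

/-- The infinitesimal action in a chart. -/
def hatL (G : Type*) [TopologicalSpace G] [ChartedSpace E_G G] [Group G] [MulAction G X]
    (x₀ : X) (e : E) : E_G →L[ℝ] E :=
  (chartT x₀ ((κ x₀).symm e)).comp (tensorL E E_G G ((κ x₀).symm e))

theorem chartS_hatL {x₀ : X} {e : E} (he : e ∈ (κ x₀).target) (η : E_G) :
    chartS x₀ e (hatL G x₀ e η) = tensorL E E_G G ((κ x₀).symm e) η :=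
  chartS_chartT' he _

variable (E_G G) in
/-- The coordinates of `1` in the chart around `1`. -/
def chartOne : E_G := extChartAt 𝓘(ℝ, E_G) (1 : G) 1

theorem actionChart_one {x₀ : X} {e : E} (he : e ∈ (κ x₀).target) :
    actionChart G x₀ (chartOne E_G G, e) = e := by
  rw [actionChart, chartOne]
  simp only [extChartAt_to_inv, one_smul]
  exact (κ x₀).right_inv he

theorem eventually_actionChart {x₀ : X} {e : E} (he : e ∈ (κ x₀).target) :
    ∀ᶠ p in 𝓝 (chartOne E_G G, e), p.1 ∈ (extChartAt 𝓘(ℝ, E_G) (1 : G)).target ∧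
      p.2 ∈ (κ x₀).target ∧
      (extChartAt 𝓘(ℝ, E_G) (1 : G)).symm p.1 • (κ x₀).symm p.2 ∈ (κ x₀).source := by
  have h1 : Tendsto (fun p : E_G × E ↦
      (extChartAt 𝓘(ℝ, E_G) (1 : G)).symm p.1 • (κ x₀).symm p.2) (𝓝 (chartOne E_G G, e))
      (𝓝 ((κ x₀).symm e)) := by
    have h2 : Continuous fun p : G × X ↦ p.1 • p.2 :=
      (contMDiff_smul (I := 𝓘(ℝ, E_G)) (I' := 𝓘(ℝ, E)) (n := ∞) (G := G) (M := X)).continuous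
    have h3 := (continuousAt_extChartAt_symm (I := 𝓘(ℝ, E_G)) (1 : G))
    have h4 : Tendsto (fun p : E_G × E ↦
      ((extChartAt 𝓘(ℝ, E_G) (1 : G)).symm p.1, (κ x₀).symm p.2)) (𝓝 (chartOne E_G G, e))
      (𝓝 ((1 : G), (κ x₀).symm e)) := by
      rw [nhds_prod_eq, nhds_prod_eq]
      refine Tendsto.prodMap ?_ (chart_continuousAt_symm he)
      have := h3.tendsto
      rwa [extChartAt_to_inv] at this
    have h5 := (h2.tendsto ((1 : G), (κ x₀).symm e)).comp h4
    rwa [one_smul] at h5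
  filter_upwards [h1.eventually (chart_source_mem_nhds ((κ x₀).map_target he)),
    continuous_fst.continuousAt.eventually
      (extChartAt_target_mem_nhds (I := 𝓘(ℝ, E_G)) (1 : G)),
    continuous_snd.continuousAt.eventually (chart_target_mem_nhds he)] with p h2 h3 h4
  exact ⟨h3, h4, h2⟩

theorem smoothNear_actionChart {x₀ : X} {e : E} (he : e ∈ (κ x₀).target) :
    SmoothNear (actionChart G x₀) (chartOne E_G G, e) := by
  filter_upwards [eventually_actionChart he] with p hp
  rw [← contMDiffAt_iff_contDiffAt]
  refine ContMDiffAt.comp p (I' := 𝓘(ℝ, E)) (contMDiffAt_chart hp.2.2) ?_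
  have h2 := (contMDiff_smul (I := 𝓘(ℝ, E_G)) (I' := 𝓘(ℝ, E)) (n := ∞) (G := G) (M := X))
    ((extChartAt 𝓘(ℝ, E_G) (1 : G)).symm p.1, (κ x₀).symm p.2)
  refine ContMDiffAt.comp p (f := fun p : E_G × E ↦
      ((extChartAt 𝓘(ℝ, E_G) (1 : G)).symm p.1, (κ x₀).symm p.2)) h2 ?_
  exact ((contMDiffAt_chart_symm hp.1).comp p contDiffAt_fst.contMDiffAt).prodMk
    ((contMDiffAt_chart_symm hp.2.1).comp p contDiffAt_snd.contMDiffAt)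

/-- The action restricts to the identity on `{1} × X` and to the orbit map on `G × {x}`, and the
derivative at `(1, x)` is the sum of the two partial derivatives. -/
theorem fderiv_actionChart {x₀ : X} {e : E} (he : e ∈ (κ x₀).target) (η : E_G) (v : E) :
    fderiv ℝ (actionChart G x₀) (chartOne E_G G, e) (η, v) = hatL G x₀ e η + v := by
  have hd := (smoothNear_actionChart (G := G) (E_G := E_G) he).differentiableAt.hasFDerivAt
  have h1 := hd.comp (chartOne E_G G) (hasFDerivAt_prodMk_left (𝕜 := ℝ) (chartOne E_G G) e)
  have h2 := hd.comp e (hasFDerivAt_prodMk_right (𝕜 := ℝ) (chartOne E_G G) e)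
  have h3 : HasFDerivAt (actionChart G x₀ ∘ fun e ↦ (chartOne E_G G, e)) (.id ℝ E) e := by
    refine (hasFDerivAt_id e).congr_of_eventuallyEq ?_
    filter_upwards [chart_target_mem_nhds he] with e' he' using actionChart_one he'
  have h4 : HasFDerivAt (actionChart G x₀ ∘ fun γ : E_G ↦ (γ, e)) (hatL G x₀ e)
      (chartOne E_G G) := by
    have hx := (κ x₀).map_target he
    have h5 := hasFDerivAt_reading (A := E_G) (B := E) (x₀ := (1 : G)) (y₀ := x₀)
      (f := fun g : G ↦ g • (κ x₀).symm e) (e := chartOne E_G G)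
      (f' := tensorL E E_G G ((κ x₀).symm e)) (mem_extChartAt_target _)
      (by rw [chartOne, extChartAt_to_inv]; exact hasMFDerivAt_orbit _)
      (by rw [chartOne, extChartAt_to_inv, one_smul]; exact hx)
    rw [chartOne, chartS_self, extChartAt_to_inv, one_smul] at h5
    exact h5
  have h6 := congrArg (fun L : E →L[ℝ] E ↦ L v) (h2.unique h3)
  have h7 := congrArg (fun L : E_G →L[ℝ] E ↦ L η) (h1.unique h4)
  simp only [ContinuousLinearMap.comp_apply, ContinuousLinearMap.inl_apply,
    ContinuousLinearMap.inr_apply, ContinuousLinearMap.id_apply] at h6 h7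
  rw [← h7]
  nth_rw 2 [← h6]
  rw [← map_add]
  simp

/-- The infinitesimal action is the partial derivative at `1` of the smooth action map, and so
depends smoothly on the base point. -/
theorem smoothNear_hatL {x₀ : X} {e : E} (he : e ∈ (κ x₀).target) :
    SmoothNear (hatL (E_G := E_G) G x₀) e := by
  refine SmoothNear.clm_of_apply fun η ↦ ?_
  have h1 := (smoothNear_actionChart (G := G) (E_G := E_G) he).fderiv
  have h2 : SmoothNear (fun e' : E ↦ fderiv ℝ (actionChart G x₀) (chartOne E_G G, e')
      ((η, 0) : E_G × E)) e :=
    SmoothNear.clm_apply (SmoothNear.comp (g := fderiv ℝ (actionChart G x₀)) h1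
      ((smoothNear_const _ _).prodMk (smoothNear_id _))) (smoothNear_const _ _)
  refine h2.congr ?_
  filter_upwards [chart_target_mem_nhds he] with e' he'
  rw [fderiv_actionChart he', add_zero]

/-! #### The moment map -/

/-- The moment map in a chart. -/
def hatMu (μ : X → E_G) (x₀ : X) (e : E) : E_G := μ ((κ x₀).symm e)

theorem IsHamiltonianOn.contDiffAt_hatMu (hμ : IsHamiltonianOn G B ω_X μ univ) {x₀ : X} {e : E}
    (he : e ∈ (κ x₀).target) : ContDiffAt ℝ ∞ (hatMu μ x₀) e := by
  rw [← contMDiffAt_iff_contDiffAt]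
  exact ((hμ.smooth_moment _ (mem_univ _)).contMDiffAt univ_mem).comp e (contMDiffAt_chart_symm he)

theorem IsHamiltonianOn.smoothNear_hatMu (hμ : IsHamiltonianOn G B ω_X μ univ) {x₀ : X} {e : E}
    (he : e ∈ (κ x₀).target) : SmoothNear (hatMu μ x₀) e :=
  .of_target he fun _ ↦ hμ.contDiffAt_hatMu

theorem fderiv_comp_chart_symm {F : Type*} [NormedAddCommGroup F] [NormedSpace ℝ F] {f : X → F}
    {x₀ : X} {e : E} (he : e ∈ (κ x₀).target)
    (hf : MDifferentiableAt 𝓘(ℝ, E) 𝓘(ℝ, F) f ((κ x₀).symm e)) (v : E) :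
    fderiv ℝ (fun e ↦ f ((κ x₀).symm e)) e v =
      tensorD f ((κ x₀).symm e) (chartS x₀ e v) := by
  have h1 := HasMFDerivAt.comp e hf.hasMFDerivAt (hasMFDerivAt_chart_symm he)
  have h2 : HasFDerivAt (fun e ↦ f ((κ x₀).symm e)) ((tensorD f ((κ x₀).symm e)).comp
    (chartS (A := E) x₀ e) : E →L[ℝ] F) e := h1.hasFDerivAt
  rw [h2.fderiv]
  rfl

theorem IsHamiltonianOn.mdifferentiableAt (hμ : IsHamiltonianOn G B ω_X μ univ) (x : X) :
    MDifferentiableAt 𝓘(ℝ, E) 𝓘(ℝ, E_G) μ x :=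
  ((hμ.smooth_moment _ (mem_univ _)).contMDiffAt univ_mem).mdifferentiableAt (by simp)

theorem IsHamiltonianOn.fderiv_hatMu (hμ : IsHamiltonianOn G B ω_X μ univ) {x₀ : X} {e : E}
    (he : e ∈ (κ x₀).target) (v : E) :
    fderiv ℝ (hatMu μ x₀) e v = tensorD μ ((κ x₀).symm e) (chartS x₀ e v) :=
  fderiv_comp_chart_symm he (hμ.mdifferentiableAt _) v

theorem IsHamiltonianOn.moment_chart (hμ : IsHamiltonianOn G B ω_X μ univ) {x₀ : X} {e : E}
    (he : e ∈ (κ x₀).target) (η : E_G) (v : E) :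
    ω_X.hat x₀ e (hatL G x₀ e η) v = B (fderiv ℝ (hatMu μ x₀) e v) η := by
  rw [hμ.fderiv_hatMu he, Form.hat_eq_bil, chartS_hatL he]
  rw [Form.bil_apply]
  exact hμ.moment _ (mem_univ _) η _

end ActionCharts

/-! ### Invariance of the tensors -/

section PartialDerivatives

variable {E F H : Type*} [NormedAddCommGroup E] [NormedSpace ℝ E] [NormedAddCommGroup F]
  [NormedSpace ℝ F] [NormedAddCommGroup H] [NormedSpace ℝ H]

theorem hasFDerivAt_snd_slice {f : E × F → H} {a : E} {b : F} (hf : DifferentiableAt ℝ f (a, b)) :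
    HasFDerivAt (fun y ↦ f (a, y)) ((fderiv ℝ f (a, b)).comp (.inr ℝ E F)) b :=
  hf.hasFDerivAt.comp b (hasFDerivAt_prodMk_right (𝕜 := ℝ) a b)

theorem hasFDerivAt_fst_slice {f : E × F → H} {a : E} {b : F} (hf : DifferentiableAt ℝ f (a, b)) :
    HasFDerivAt (fun x ↦ f (x, b)) ((fderiv ℝ f (a, b)).comp (.inl ℝ E F)) a :=
  hf.hasFDerivAt.comp a (hasFDerivAt_prodMk_left (𝕜 := ℝ) a b)

theorem fderiv_snd_slice {f : E × F → H} {a : E} {b : F} (hf : DifferentiableAt ℝ f (a, b))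
    (v : F) : fderiv ℝ (fun y ↦ f (a, y)) b v = fderiv ℝ f (a, b) (0, v) := by
  rw [(hasFDerivAt_snd_slice hf).fderiv]; rfl

theorem fderiv_fst_slice {f : E × F → H} {a : E} {b : F} (hf : DifferentiableAt ℝ f (a, b))
    (u : E) : fderiv ℝ (fun x ↦ f (x, b)) a u = fderiv ℝ f (a, b) (u, 0) := by
  rw [(hasFDerivAt_fst_slice hf).fderiv]; rfl

end PartialDerivatives

theorem hasMFDerivAt_zero_of_forall {A : Type*} [NormedAddCommGroup A] [NormedSpace ℝ A]
    {M : Type*} [TopologicalSpace M] [ChartedSpace A M] {f : M → ℝ} {x : M} {f' : A →L[ℝ] ℝ}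
    (hf : HasMFDerivAt 𝓘(ℝ, A) 𝓘(ℝ, ℝ) f x f') (h : ∀ v, f' v = 0) :
    HasMFDerivAt 𝓘(ℝ, A) 𝓘(ℝ, ℝ) f x (0 : A →L[ℝ] ℝ) := by
  have : f' = 0 := ContinuousLinearMap.ext h
  subst this
  exact hf

theorem eq_of_hasMFDerivAt_zero {A : Type*} [NormedAddCommGroup A] [NormedSpace ℝ A]
    {M : Type*} [TopologicalSpace M] [ChartedSpace A M] [IsManifold 𝓘(ℝ, A) ∞ M]
    [PreconnectedSpace M] {f : M → ℝ}
    (hf : ∀ x, HasMFDerivAt 𝓘(ℝ, A) 𝓘(ℝ, ℝ) f x (0 : A →L[ℝ] ℝ)) (x y : M) : f x = f y := by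
  have h : IsLocallyConstant f := by
    rw [IsLocallyConstant.iff_eventually_eq]
    intro x
    obtain ⟨r, hr, hb⟩ := Metric.mem_nhds_iff.1 (extChartAt_target_mem_nhds (I := 𝓘(ℝ, A)) x)
    have hd (e : A) (he : e ∈ Metric.ball (extChartAt 𝓘(ℝ, A) x x) r) :
        HasFDerivAt (fun e ↦ f ((extChartAt 𝓘(ℝ, A) x).symm e)) (0 : A →L[ℝ] ℝ) e := by
      have h1 := HasMFDerivAt.comp e (hf ((extChartAt 𝓘(ℝ, A) x).symm e))
        (hasMFDerivAt_chart_symm (hb he))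
      have h2 : HasFDerivAt (fun e ↦ f ((extChartAt 𝓘(ℝ, A) x).symm e))
        ((0 : A →L[ℝ] ℝ).comp (chartS (A := A) x e) : A →L[ℝ] ℝ) e := h1.hasFDerivAt
      simpa using h2
    refine eventually_of_chart (A := A) (mem_extChartAt_source (I := 𝓘(ℝ, A)) x) ?_
    filter_upwards [Metric.ball_mem_nhds _ hr] with e he
    have h3 := Metric.isOpen_ball.is_const_of_fderiv_eq_zero
      (convex_ball (extChartAt 𝓘(ℝ, A) x x) r).isPreconnected
      (fun e he ↦ (hd e he).differentiableAt.differentiableWithinAt)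
      (fun e he ↦ (hd e he).fderiv) he (Metric.mem_ball_self hr)
    simpa only [extChartAt_to_inv] using h3
  exact h.apply_eq_of_preconnectedSpace x y

section Invariance

variable {E : Type*} [NormedAddCommGroup E] [NormedSpace ℝ E] [FiniteDimensional ℝ E]
  {X : Type*} [TopologicalSpace X] [ChartedSpace E X] [IsManifold 𝓘(ℝ, E) ∞ X]
  {E_G : Type*} [NormedAddCommGroup E_G] [NormedSpace ℝ E_G] [FiniteDimensional ℝ E_G]
  {G : Type*} [TopologicalSpace G] [ChartedSpace E_G G] [Group G] [LieGroup 𝓘(ℝ, E_G) ∞ G]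
  [MulAction G X] [ContMDiffSMul 𝓘(ℝ, E_G) 𝓘(ℝ, E) ∞ G X]
  {J : Π x : X, TangentSpace 𝓘(ℝ, E) x →L[ℝ] TangentSpace 𝓘(ℝ, E) x}
  {ω_X : Form E X 2} {μ : X → E_G} {B : E_G →L[ℝ] E_G →L[ℝ] ℝ}

local notation "κ" => extChartAt 𝓘(ℝ, E)

/-- The pullback of a form in a chart by the action map. -/
def actionPullback (G : Type*) [TopologicalSpace G] [ChartedSpace E_G G] [Group G] [MulAction G X]
    {n : ℕ} (x₀ : X) (τ : E → E [⋀^Fin n]→L[ℝ] ℝ) (p : E_G × E) : (E_G × E) [⋀^Fin n]→L[ℝ] ℝ :=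
  (τ (actionChart G x₀ p)).compContinuousLinearMap (fderiv ℝ (actionChart G x₀) p)

theorem smoothNear_compContinuousLinearMap_two {F : Type*} [NormedAddCommGroup F] [NormedSpace ℝ F]
    [FiniteDimensional ℝ F] {τ : E → E [⋀^Fin 2]→L[ℝ] ℝ} {f : F → E} {p : F}
    (hτ : SmoothNear τ (f p)) (hf : SmoothNear f p) :
    SmoothNear (fun p ↦ (τ (f p)).compContinuousLinearMap (fderiv ℝ f p)) p := by
  refine SmoothNear.alternating_of_apply fun v ↦ ?_
  refine ((hτ.comp hf).alternating_apply (hf.fderiv.clm_apply (smoothNear_const (v 0) p))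
    (hf.fderiv.clm_apply (smoothNear_const (v 1) p))).congr (Eventually.of_forall fun q ↦ ?_)
  simp only [ContinuousAlternatingMap.compContinuousLinearMap_apply]
  conv_lhs => rw [eq_vec_two v, comp_vec_two]

theorem smoothNear_compContinuousLinearMap_one {F : Type*} [NormedAddCommGroup F] [NormedSpace ℝ F]
    [FiniteDimensional ℝ F] {τ : E → E [⋀^Fin 1]→L[ℝ] ℝ} {f : F → E} {p : F}
    (hτ : SmoothNear τ (f p)) (hf : SmoothNear f p) :
    SmoothNear (fun p ↦ (τ (f p)).compContinuousLinearMap (fderiv ℝ f p)) p := by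
  refine SmoothNear.alternating_of_apply fun v ↦ ?_
  have h1 : SmoothNear (fun q ↦ (ContinuousAlternatingMap.ofSubsingletonLIE (𝕜 := ℝ) (E := E)
      (F := ℝ) (0 : Fin 1)).symm (τ (f q))) p :=
    (SmoothNear.of_contDiff (LinearIsometryEquiv.contDiff _) _).comp (hτ.comp hf)
  refine (h1.clm_apply (hf.fderiv.clm_apply (smoothNear_const (v 0) p))).congr
    (Eventually.of_forall fun q ↦ ?_)
  simp only [ContinuousAlternatingMap.compContinuousLinearMap_apply]
  conv_lhs => rw [eq_vec_one v, comp_vec_one]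
  change _ = τ (f q) _
  congr 1
  ext i
  fin_cases i
  rfl

/-- Cartan's formula for the contraction of the differential of an invariant one-form with the
infinitesimal action. -/
theorem extDeriv_hatL_of_invariant {x₀ : X} {e : E} (he : e ∈ (κ x₀).target)
    {θ : E → E [⋀^Fin 1]→L[ℝ] ℝ} (hθ : SmoothNear θ e) (w : E)
    (hinv : ∀ᶠ γ in 𝓝 (chartOne E_G G), actionPullback G x₀ θ (γ, e) ![(0, w)] = θ e ![w])
    (η : E_G) :
    extDeriv θ e ![hatL G x₀ e η, w] = - fderiv ℝ (fun e ↦ θ e ![hatL G x₀ e η]) e w := by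
  have ha := smoothNear_actionChart (G := G) (E_G := E_G) he
  have hae := actionChart_one (G := G) (E_G := E_G) he
  have hσ : SmoothNear (actionPullback G x₀ θ) (chartOne E_G G, e) :=
    smoothNear_compContinuousLinearMap_one (by rwa [hae]) ha
  have h1 : extDeriv (actionPullback G x₀ θ) (chartOne E_G G, e) =
      (extDeriv θ (actionChart G x₀ (chartOne E_G G, e))).compContinuousLinearMap
        (fderiv ℝ (actionChart G x₀) (chartOne E_G G, e)) :=
    extDeriv_pullback (r := ∞) (by rw [hae]; exact hθ.differentiableAt) ha.contDiffAt
      minSmoothness_two_le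
  -- The pullback of `dθ` to `G × X` is evaluated on `(η, 0)` and `(0, w)`. Invariance kills the
  -- derivative along the group, leaving minus the derivative of `θ (L η)` along `w`.
  have h2 := extDeriv_oneForm_apply (actionPullback G x₀ θ) (chartOne E_G G, e)
    ((η, 0) : E_G × E) ((0, w) : E_G × E)
  rw [h1, hae, ContinuousAlternatingMap.compContinuousLinearMap_apply, comp_vec_two,
    fderiv_actionChart he, fderiv_actionChart he, map_zero, zero_add, add_zero,
    ← fderiv_alternating_apply hσ.differentiableAt, ← fderiv_alternating_apply hσ.differentiableAt,
    ← fderiv_fst_slice (f := fun p ↦ actionPullback G x₀ θ p ![((0 : E_G), w)]),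
    ← fderiv_snd_slice (f := fun p ↦ actionPullback G x₀ θ p ![(η, (0 : E))])] at h2
  · have h3 : (fun γ ↦ actionPullback G x₀ θ (γ, e) ![(0, w)]) =ᶠ[𝓝 (chartOne E_G G)]
      fun _ ↦ θ e ![w] := hinv
    have h4 : (fun y ↦ actionPullback G x₀ θ (chartOne E_G G, y) ![(η, (0 : E))]) =ᶠ[𝓝 e]
        fun e ↦ θ e ![hatL G x₀ e η] := by
      filter_upwards [chart_target_mem_nhds he] with y hy
      rw [actionPullback, ContinuousAlternatingMap.compContinuousLinearMap_apply, comp_vec_one,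
        fderiv_actionChart hy, actionChart_one hy, add_zero]
    rw [h3.fderiv_eq, h4.fderiv_eq] at h2
    rw [h2]
    simp
  · exact (ContinuousAlternatingMap.apply ℝ (E_G × E) ℝ _).differentiableAt.comp _
      hσ.differentiableAt
  · exact (ContinuousAlternatingMap.apply ℝ (E_G × E) ℝ _).differentiableAt.comp _
      hσ.differentiableAt

theorem IsHamiltonianOn.extDeriv_inChart (hμ : IsHamiltonianOn G B ω_X μ univ) {x₀ : X} {e : E}
    (he : e ∈ (κ x₀).target) : extDeriv (ω_X.inChart x₀) e = 0 :=
  (ω_X.d_eq_zero_iff he ((hμ.smooth _ (mem_univ _)).contDiffAt_inChart he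
    |>.differentiableAt (by simp))).1 (hμ.closed _ (mem_univ _))

/-- This is `L_{X_η} ω = d ι_{X_η} ω = d d⟨μ, η⟩ = 0`. Closedness of the pullback of `ω` to `G × X`
expresses the derivative along `G` through the second derivatives of `⟨μ, η⟩`, which cancel by
symmetry. -/
theorem IsHamiltonianOn.hasFDerivAt_actionPullback (hμ : IsHamiltonianOn G B ω_X μ univ)
    {x₀ : X} {e : E} (he : e ∈ (κ x₀).target) (v w : E) :
    HasFDerivAt (fun γ ↦ actionPullback G x₀ (ω_X.inChart x₀) (γ, e) ![(0, v), (0, w)])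
      (0 : E_G →L[ℝ] ℝ) (chartOne E_G G) := by
  have ha := smoothNear_actionChart (G := G) (E_G := E_G) he
  have hae := actionChart_one (G := G) (E_G := E_G) he
  have hω := smoothNear_inChart (fun x ↦ hμ.smooth x (mem_univ x)) he
  set σ := actionPullback (E_G := E_G) G x₀ (ω_X.inChart x₀) with hσdef
  have hσ : SmoothNear σ (chartOne E_G G, e) :=
    smoothNear_compContinuousLinearMap_two (by rwa [hae]) ha
  have hd (a b : E_G × E) : DifferentiableAt ℝ (fun p ↦ σ p ![a, b]) (chartOne E_G G, e) :=
    (ContinuousAlternatingMap.apply ℝ (E_G × E) ℝ ![a, b]).differentiableAt.comp _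
      hσ.differentiableAt
  have hs (η : E_G) (b : E) : (fun y ↦ σ (chartOne E_G G, y) ![(η, 0), (0, b)]) =ᶠ[𝓝 e]
      fun y ↦ B (fderiv ℝ (hatMu μ x₀) y b) η := by
    filter_upwards [chart_target_mem_nhds he] with y hy
    rw [hσdef, actionPullback, ContinuousAlternatingMap.compContinuousLinearMap_apply,
      comp_vec_two, fderiv_actionChart hy, fderiv_actionChart hy, actionChart_one hy, add_zero,
      map_zero, zero_add, ← Form.hat_apply, hμ.moment_chart hy]
  have hm := hμ.smoothNear_hatMu he
  have hB (η : E_G) (a b : E) : fderiv ℝ (fun y ↦ B (fderiv ℝ (hatMu μ x₀) y b) η) e a =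
      B (fderiv ℝ (fderiv ℝ (hatMu μ x₀)) e a b) η := by
    have h1 := hm.fderiv.differentiableAt.hasFDerivAt
    have h2 := ((B.flip η).hasFDerivAt (x := fderiv ℝ (hatMu μ x₀) e b)).comp e
      (h1.clm_apply (hasFDerivAt_const b e))
    have h3 := congrArg (fun L : E →L[ℝ] ℝ ↦ L a) h2.fderiv
    simpa [Function.comp_def] using h3
  have hsym (a b : E) : fderiv ℝ (fderiv ℝ (hatMu μ x₀)) e a b =
      fderiv ℝ (fderiv ℝ (hatMu μ x₀)) e b a :=
    (hm.contDiffAt.isSymmSndFDerivAt minSmoothness_two_le) a b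
  have h0 : extDeriv σ (chartOne E_G G, e) = 0 := by
    have h1 : extDeriv σ (chartOne E_G G, e) =
        (extDeriv (ω_X.inChart x₀) (actionChart G x₀ (chartOne E_G G, e))).compContinuousLinearMap
          (fderiv ℝ (actionChart G x₀) (chartOne E_G G, e)) :=
      extDeriv_pullback (r := ∞) (by rw [hae]; exact hω.differentiableAt) ha.contDiffAt
        minSmoothness_two_le
    rw [h1, hae, hμ.extDeriv_inChart he]
    rfl
  have h1 := hasFDerivAt_fst_slice (hd (0, v) (0, w))
  suffices hz : (fderiv ℝ (fun p ↦ σ p ![(0, v), (0, w)]) (chartOne E_G G, e)).comp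
      (.inl ℝ E_G E) = 0 by rwa [hz] at h1
  refine ContinuousLinearMap.ext fun η ↦ ?_
  have h2 := extDeriv_twoForm_apply σ (chartOne E_G G, e) (η, 0) (0, v) (0, w)
  rw [h0, ← fderiv_alternating_apply hσ.differentiableAt,
    ← fderiv_alternating_apply hσ.differentiableAt,
    ← fderiv_alternating_apply hσ.differentiableAt,
    ← fderiv_snd_slice (hd (η, 0) (0, w)), ← fderiv_snd_slice (hd (η, 0) (0, v)),
    (hs η w).fderiv_eq, (hs η v).fderiv_eq, hB, hB, hsym w v] at h2
  simp only [ContinuousLinearMap.comp_apply, ContinuousLinearMap.inl_apply]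
  have h3 : (0 : (E_G × E) [⋀^Fin 3]→L[ℝ] ℝ) ![(η, 0), (0, v), (0, w)] = 0 := rfl
  rw [h3] at h2
  change _ = (0 : ℝ)
  linarith

theorem fderiv_actionChart_snd {x₀ : X} {e : E} {γ : E_G}
    (he : e ∈ (κ x₀).target)
    (hx : (extChartAt 𝓘(ℝ, E_G) (1 : G)).symm γ • (κ x₀).symm e ∈ (κ x₀).source)
    (hd : DifferentiableAt ℝ (actionChart G x₀) (γ, e)) (v : E) :
    fderiv ℝ (actionChart G x₀) (γ, e) (0, v) =
      chartT x₀ ((extChartAt 𝓘(ℝ, E_G) (1 : G)).symm γ • (κ x₀).symm e)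
        (smulT E ((extChartAt 𝓘(ℝ, E_G) (1 : G)).symm γ) ((κ x₀).symm e) (chartS x₀ e v)) := by
  rw [← fderiv_snd_slice hd]
  have h := hasFDerivAt_reading (A := E) (B := E) (x₀ := x₀) (y₀ := x₀) (e := e)
    (f := fun y : X ↦ (extChartAt 𝓘(ℝ, E_G) (1 : G)).symm γ • y) he
    (hasMFDerivAt_smul E_G _ _) hx
  exact congrArg (fun L : E →L[ℝ] E ↦ L v) h.fderiv

theorem Form.bil_chartT (α : Form E X 2) {x₀ x : X} (hx : x ∈ (κ x₀).source) (v w : E) :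
    α.hat x₀ (κ x₀ x) (chartT x₀ x v) (chartT x₀ x w) = α.bil x v w := by
  rw [Form.hat_eq_bil, chartS_chartT hx, chartS_chartT hx, (κ x₀).left_inv hx]

/-- The symplectic form is invariant. -/
theorem IsHamiltonianOn.bil_smul [ConnectedSpace G] (hμ : IsHamiltonianOn G B ω_X μ univ) (g : G)
    (x : X) (v w : E) : ω_X.bil (g • x) (smulT E g x v) (smulT E g x w) = ω_X.bil x v w := by
  have hone (x : X) (v w : E) : HasMFDerivAt 𝓘(ℝ, E_G) 𝓘(ℝ, ℝ)
      (fun g : G ↦ ω_X.bil (g • x) (smulT E g x v) (smulT E g x w)) 1 (0 : E_G →L[ℝ] ℝ) := by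
    have he := mem_extChartAt_target (I := 𝓘(ℝ, E)) x
    have h1 := hμ.hasFDerivAt_actionPullback he (chartT x x v) (chartT x x w)
    have h2 : (fun g : G ↦ ω_X.bil (g • x) (smulT E g x v) (smulT E g x w)) =ᶠ[𝓝 1]
        (fun γ ↦ actionPullback G x (ω_X.inChart x) (γ, κ x x)
          ![(0, chartT x x v), (0, chartT x x w)]) ∘ extChartAt 𝓘(ℝ, E_G) (1 : G) := by
      refine eventually_of_chart (mem_extChartAt_source (I := 𝓘(ℝ, E_G)) (1 : G)) ?_
      have h3 : ∀ᶠ γ in 𝓝 (chartOne E_G G), (extChartAt 𝓘(ℝ, E_G) (1 : G)).symm γ •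
          (κ x).symm (κ x x) ∈ (κ x).source ∧ γ ∈ (extChartAt 𝓘(ℝ, E_G) (1 : G)).target ∧
          DifferentiableAt ℝ (actionChart G x) (γ, κ x x) := by
        have h4 : ContinuousAt (fun γ : E_G ↦ (γ, κ x x)) (chartOne E_G G) := by fun_prop
        filter_upwards [h4.eventually (eventually_actionChart he),
          h4.eventually (smoothNear_actionChart (G := G) (E_G := E_G) he)] with γ h5 h6
        exact ⟨h5.2.2, h5.1, h6.differentiableAt (by simp)⟩
      filter_upwards [h3] with γ ⟨h5, h6, h7⟩
      simp only [Function.comp_apply]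
      rw [(extChartAt 𝓘(ℝ, E_G) (1 : G)).right_inv h6, actionPullback,
        ContinuousAlternatingMap.compContinuousLinearMap_apply, comp_vec_two,
        fderiv_actionChart_snd he h5 h7, fderiv_actionChart_snd he h5 h7,
        chartS_chartT (mem_extChartAt_source x), chartS_chartT (mem_extChartAt_source x),
        ← Form.hat_apply, actionChart, Form.bil_chartT _ h5, extChartAt_to_inv]
    have h3 := HasMFDerivAt.comp (1 : G) (HasFDerivAt.hasMFDerivAt h1)
      (hasMFDerivAt_chart (mem_extChartAt_source (I := 𝓘(ℝ, E_G)) (1 : G)))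
    have h4 := h3.congr_of_eventuallyEq h2
    exact hasMFDerivAt_zero_of_forall h4 fun _ ↦ rfl
  -- The derivative at `g₁` is the derivative at `1` for the translated point `g₁ • x`, by right
  -- translation on `G`. Connectedness of `G` then makes the function constant.
  have hall (g₁ : G) : HasMFDerivAt 𝓘(ℝ, E_G) 𝓘(ℝ, ℝ)
      (fun g : G ↦ ω_X.bil (g • x) (smulT E g x v) (smulT E g x w)) g₁ (0 : E_G →L[ℝ] ℝ) := by
    have h1 : ContMDiff 𝓘(ℝ, E_G) 𝓘(ℝ, E_G) ∞ (fun h : G ↦ h * g₁⁻¹) :=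
      contMDiff_id.mul contMDiff_const
    have h2 := ((h1 g₁).mdifferentiableAt (by simp)).hasMFDerivAt
    have h3 : HasMFDerivAt 𝓘(ℝ, E_G) 𝓘(ℝ, ℝ)
      (fun g : G ↦ ω_X.bil (g • (g₁ • x)) (smulT E g (g₁ • x) (smulT E g₁ x v))
        (smulT E g (g₁ • x) (smulT E g₁ x w))) (g₁ * g₁⁻¹) (0 : E_G →L[ℝ] ℝ) := by
      rw [mul_inv_cancel]
      exact hone _ _ _
    have h4 := HasMFDerivAt.comp g₁ h3 h2
    have h5 : (fun g : G ↦ ω_X.bil (g • x) (smulT E g x v) (smulT E g x w)) =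
      (fun g : G ↦ ω_X.bil (g • (g₁ • x)) (smulT E g (g₁ • x) (smulT E g₁ x v))
        (smulT E g (g₁ • x) (smulT E g₁ x w))) ∘ fun h : G ↦ h * g₁⁻¹ := by
      ext g
      simp only [Function.comp_apply]
      rw [← smulT_mul (E := E) E_G, ← smulT_mul (E := E) E_G, smul_smul, inv_mul_cancel_right]
    rw [h5]
    exact hasMFDerivAt_zero_of_forall h4 fun _ ↦ rfl
  have := eq_of_hasMFDerivAt_zero hall g 1
  simpa [smulT_one] using this

theorem tensorMetric_smul [ConnectedSpace G] (hμ : IsHamiltonianOn G B ω_X μ univ)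
    (hJ : IsCompatible G ω_X J) (g : G) (x : X) (v w : E) :
    tensorMetric ω_X J (g • x) (smulT E g x v) (smulT E g x w) = tensorMetric ω_X J x v w := by
  rw [tensorMetric, tensorJ_smul hJ, hμ.bil_smul, tensorMetric]

theorem Ad_zero (g : G) : (Ad g : E_G →L[ℝ] E_G) 0 = 0 := map_zero _

theorem IsHamiltonianOn.smul_eq_zero (hμ : IsHamiltonianOn G B ω_X μ univ) (g : G) {z : X}
    (hz : μ z = 0) : μ (g • z) = 0 := by
  rw [hμ.equivariant g z (mem_univ _), hz, Ad_zero]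

/-- The moment map vanishes on the whole orbit of `z`. Together with the moment equation this says
that orbits in the zero level are isotropic. -/
theorem IsHamiltonianOn.tensorD_tensorL (hμ : IsHamiltonianOn G B ω_X μ univ) {z : X}
    (hz : μ z = 0) (η : E_G) : tensorD μ z (tensorL E E_G G z η) = 0 := by
  have h1 : HasMFDerivAt 𝓘(ℝ, E) 𝓘(ℝ, E_G) μ ((1 : G) • z) (tensorD μ z : E →L[ℝ] E_G) := by
    rw [one_smul]
    exact (hμ.mdifferentiableAt z).hasMFDerivAt
  have h2 := HasMFDerivAt.comp (1 : G) h1 (hasMFDerivAt_orbit (E := E) (E_G := E_G) z)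
  have h3 : μ ∘ (fun g : G ↦ g • z) = fun _ ↦ 0 := by
    ext1 g
    exact hμ.smul_eq_zero g hz
  rw [h3] at h2
  have h4 := hasMFDerivAt_unique h2 (hasMFDerivAt_const (0 : E_G) (1 : G))
  exact congrArg (fun L : E_G →L[ℝ] E_G ↦ L η) h4

theorem IsHamiltonianOn.bil_tensorL (hμ : IsHamiltonianOn G B ω_X μ univ) (x : X) (η : E_G)
    (v : E) : ω_X.bil x (tensorL E E_G G x η) v = B (tensorD μ x v) η := by
  rw [Form.bil_apply]
  exact hμ.moment x (mem_univ x) η v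

/-- If `L_z η = 0`, the moment equation makes `η` orthogonal to the image of `d_z μ`, which is all
of `𝔤` at a regular point. -/
theorem IsHamiltonianOn.tensorL_injective (hB : IsInvariantInner G B)
    (hμ : IsHamiltonianOn G B ω_X μ univ)
    (hreg : ∀ z, μ z = 0 → Function.Surjective (mvfderiv 𝓘(ℝ, E) μ z)) {z : X} (hz : μ z = 0)
    {η : E_G} (h : tensorL E E_G G z η = 0) : η = 0 := by
  by_contra hη
  obtain ⟨v, hv⟩ : ∃ v : E, tensorD μ z v = η := hreg z hz η
  have h1 := hμ.bil_tensorL z η v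
  rw [h, hv, map_zero] at h1
  exact (hB.pos η hη).ne h1

end Invariance

/-! ### The geodesic equation on a vector space -/

section Spray

variable {E : Type*} [NormedAddCommGroup E] [NormedSpace ℝ E]

/-- The derivative of a map into a normed space. -/
def normedFDeriv {F : Type*} [NormedAddCommGroup F] [NormedSpace ℝ F] (f : E → F) (e : E) :
    E →L[ℝ] F := fderiv ℝ f e

theorem SmoothNear.normedFDeriv {F : Type*} [NormedAddCommGroup F] [NormedSpace ℝ F] {f : E → F}
    {e : E} (hf : SmoothNear f e) : SmoothNear (normedFDeriv f) e := hf.fderiv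

theorem SmoothNear.hasFDerivAt {F : Type*} [NormedAddCommGroup F] [NormedSpace ℝ F] {f : E → F}
    {e : E} (hf : SmoothNear f e) : HasFDerivAt f (NormalForm.normedFDeriv f e) e :=
  hf.differentiableAt.hasFDerivAt

/-- The geodesic equation of the metric `m` for the curve `c`, paired with `w`. -/
def geodesicExpr (m : E → E →L[ℝ] E →L[ℝ] ℝ) (c : ℝ → E) (t : ℝ) (w : E) : ℝ :=
  m (c t) (deriv (deriv c) t) w + fderiv ℝ (fun e ↦ m e (deriv c t) w) (c t) (deriv c t)
    - (1 / 2) * fderiv ℝ (fun e ↦ m e (deriv c t) (deriv c t)) (c t) w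

theorem geodesicExpr_congr {m : E → E →L[ℝ] E →L[ℝ] ℝ} {c d : ℝ → E} {t : ℝ} (h : c =ᶠ[𝓝 t] d)
    (w : E) : geodesicExpr m c t w = geodesicExpr m d t w := by
  rw [geodesicExpr, geodesicExpr, h.self_of_nhds, h.deriv_eq, h.deriv.deriv_eq]

theorem hasFDerivAt_apply_apply {m : E → E →L[ℝ] E →L[ℝ] ℝ} {e : E} (hm : SmoothNear m e)
    (a b u : E) : fderiv ℝ (fun e ↦ m e a b) e u = normedFDeriv m e u a b := by
  have h := (hm.hasFDerivAt.clm_apply (hasFDerivAt_const a e)).clm_apply (hasFDerivAt_const b e)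
  have h2 := congrArg (fun L : E →L[ℝ] ℝ ↦ L u) h.fderiv
  simpa using h2

theorem eventually_differentiableAt_of_contDiffAt_two {F : Type*} [NormedAddCommGroup F]
    [NormedSpace ℝ F] {c : ℝ → F} {t : ℝ} (hc : ContDiffAt ℝ 2 c t) :
    (∀ᶠ s in 𝓝 t, DifferentiableAt ℝ c s) ∧ DifferentiableAt ℝ (deriv c) t := by
  refine ⟨?_, ?_⟩
  · filter_upwards [hc.eventually (by simp)] with s hs using hs.differentiableAt (by simp)
  · have h := (hc.fderiv_right (m := 1) (by norm_num)).differentiableAt (by simp)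
    exact h.clm_apply (differentiableAt_const 1)

/-- The geodesic equation is invariant under isometries. -/
theorem geodesicExpr_comp {m m₂ : E → E →L[ℝ] E →L[ℝ] ℝ} {F : E → E} {c : ℝ → E} {t : ℝ}
    (hm : ∀ᶠ e in 𝓝 (c t), ∀ v w, m e v w = m₂ (F e) (fderiv ℝ F e v) (fderiv ℝ F e w))
    (hm₂ : SmoothNear m₂ (F (c t))) (hsymm : ∀ v w, m₂ (F (c t)) v w = m₂ (F (c t)) w v)
    (hF : ContDiffAt ℝ ∞ F (c t)) (hc : ContDiffAt ℝ 2 c t) (w : E) :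
    geodesicExpr m c t w = geodesicExpr m₂ (F ∘ c) t (fderiv ℝ F (c t) w) := by
  obtain ⟨hc1, hc2⟩ := eventually_differentiableAt_of_contDiffAt_two hc
  have hF' : DifferentiableAt ℝ (fderiv ℝ F) (c t) :=
    (hF.fderiv_right (m := 1) (by norm_cast)).differentiableAt (by simp)
  have hFe : ∀ᶠ e in 𝓝 (c t), DifferentiableAt ℝ F e := by
    have h1 : ContDiffAt ℝ 1 F (c t) := hF.of_le (by norm_cast)
    filter_upwards [h1.eventually (by simp)] with e he using he.differentiableAt (by simp)
  have hd1 : deriv (F ∘ c) =ᶠ[𝓝 t] fun s ↦ fderiv ℝ F (c s) (deriv c s) := by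
    filter_upwards [hc1, hc.continuousAt.eventually hFe] with s h1 h2
    exact fderiv_comp_deriv s h2 h1
  have hd2 : deriv (deriv (F ∘ c)) t = fderiv ℝ (fderiv ℝ F) (c t) (deriv c t) (deriv c t) +
      fderiv ℝ F (c t) (deriv (deriv c) t) := by
    rw [hd1.deriv_eq]
    exact ((hF'.hasFDerivAt.comp_hasDerivAt t hc1.self_of_nhds.hasDerivAt).clm_apply
      hc2.hasDerivAt).deriv
  have hA (a b u : E) : fderiv ℝ (fun e ↦ m e a b) (c t) u =
      normedFDeriv m₂ (F (c t)) (fderiv ℝ F (c t) u) (fderiv ℝ F (c t) a) (fderiv ℝ F (c t) b) +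
      m₂ (F (c t)) (fderiv ℝ (fderiv ℝ F) (c t) u a) (fderiv ℝ F (c t) b) +
      m₂ (F (c t)) (fderiv ℝ F (c t) a) (fderiv ℝ (fderiv ℝ F) (c t) u b) := by
    have h1 : (fun e ↦ m e a b) =ᶠ[𝓝 (c t)]
        fun e ↦ m₂ (F e) (fderiv ℝ F e a) (fderiv ℝ F e b) := hm.mono fun e he ↦ he a b
    have h2 := (hm₂.hasFDerivAt.comp (c t) hFe.self_of_nhds.hasFDerivAt)
    have h3 := (h2.clm_apply (hF'.hasFDerivAt.clm_apply (hasFDerivAt_const a (c t)))).clm_apply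
      (hF'.hasFDerivAt.clm_apply (hasFDerivAt_const b (c t)))
    have h4 := congrArg (fun L : E →L[ℝ] ℝ ↦ L u) h3.fderiv
    rw [h1.fderiv_eq]
    refine h4.trans ?_
    simp
    ring
  have hs : ∀ a b, fderiv ℝ (fderiv ℝ F) (c t) a b = fderiv ℝ (fderiv ℝ F) (c t) b a :=
    hF.isSymmSndFDerivAt minSmoothness_two_le
  -- The second derivatives of `F` coming from the acceleration of `F ∘ c` and from the derivatives
  -- of the pulled back metric cancel, by symmetry of `D²F` and of the metric.
  rw [geodesicExpr, geodesicExpr, Function.comp_apply, hd2, hd1.self_of_nhds,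
    hasFDerivAt_apply_apply hm₂, hasFDerivAt_apply_apply hm₂, hA, hA, hm.self_of_nhds, map_add,
    add_apply, hs w (deriv c t), hsymm (fderiv ℝ (fderiv ℝ F) (c t) (deriv c t) w)]
  ring

/-- The operator whose quadratic form is the geodesic spray of the metric `m`. -/
def sprayOp (m : E → E →L[ℝ] E →L[ℝ] ℝ) (p : E × E) : E →L[ℝ] E :=
  -(m p.1).inverse.comp
    (normedFDeriv m p.1 p.2 - (1 / 2 : ℝ) • ((normedFDeriv m p.1).flip p.2).flip)

/-- The geodesic spray of the metric `m`. -/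
def spray (m : E → E →L[ℝ] E →L[ℝ] ℝ) (p : E × E) : E := sprayOp m p p.2

/-- The acceleration enters only through the metric, which is inverted to solve for it. -/
theorem geodesicExpr_eq_zero_iff {m : E → E →L[ℝ] E →L[ℝ] ℝ} {c : ℝ → E} {t : ℝ}
    (hm : SmoothNear m (c t)) (hi : (m (c t)).IsInvertible) :
    (∀ w, geodesicExpr m c t w = 0) ↔ deriv (deriv c) t = spray m (c t, deriv c t) := by
  obtain ⟨A, hA⟩ := hi
  rw [spray, sprayOp, ← hA, ContinuousLinearMap.inverse_equiv]
  have h1 : (-(A.symm : (E →L[ℝ] ℝ) →L[ℝ] E).comp (normedFDeriv m (c t) (deriv c t) - (1 / 2 : ℝ) •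
      ((normedFDeriv m (c t)).flip (deriv c t)).flip)) (deriv c t) =
      A.symm (-(normedFDeriv m (c t) (deriv c t) (deriv c t) - (1 / 2 : ℝ) •
      ((normedFDeriv m (c t)).flip (deriv c t)).flip (deriv c t))) := by
    rw [map_neg]; rfl
  rw [h1, ContinuousLinearEquiv.eq_symm_apply]
  have h2 : A (deriv (deriv c) t) = m (c t) (deriv (deriv c) t) := by rw [← hA]; rfl
  rw [h2, ContinuousLinearMap.ext_iff]
  refine forall_congr' fun w ↦ ?_
  rw [geodesicExpr, hasFDerivAt_apply_apply hm, hasFDerivAt_apply_apply hm]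
  simp only [neg_apply, sub_apply, smul_apply, ContinuousLinearMap.flip_apply, smul_eq_mul]
  constructor <;> intro h <;> linarith

variable [FiniteDimensional ℝ E]

theorem smoothNear_sprayOp {m : E → E →L[ℝ] E →L[ℝ] ℝ} {p : E × E} (hm : SmoothNear m p.1)
    (hi : (m p.1).IsInvertible) : SmoothNear (sprayOp m) p := by
  have h1 : SmoothNear (fun q : E × E ↦ q.1) p := (smoothNear_id p).fst
  have h2 : SmoothNear (fun q : E × E ↦ q.2) p := (smoothNear_id p).snd
  have h3 : SmoothNear (fun q : E × E ↦ (m q.1).inverse) p :=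
    SmoothNear.comp (f := Prod.fst) (hm.inverse hi).1 h1
  have h4 : SmoothNear (fun q : E × E ↦ normedFDeriv m q.1) p :=
    SmoothNear.comp (g := NormalForm.normedFDeriv m) (f := Prod.fst) hm.normedFDeriv h1
  have h5 : SmoothNear (fun q : E × E ↦ ((normedFDeriv m q.1).flip q.2).flip) p := by
    refine SmoothNear.clm_of_apply fun v ↦ SmoothNear.clm_of_apply fun w ↦ ?_
    exact ((h4.clm_apply (smoothNear_const w p)).clm_apply h2).clm_apply (smoothNear_const v p)
  exact (h3.clm_comp ((h4.clm_apply h2).sub ((smoothNear_const (1 / 2 : ℝ) p).smul h5))).neg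

theorem sprayOp_zero (m : E → E →L[ℝ] E →L[ℝ] ℝ) (e : E) : sprayOp m (e, 0) = 0 := by
  simp [sprayOp]

theorem smoothNear_spray {m : E → E →L[ℝ] E →L[ℝ] ℝ} {p : E × E} (hm : SmoothNear m p.1)
    (hi : (m p.1).IsInvertible) : SmoothNear (spray m) p :=
  (smoothNear_sprayOp hm hi).clm_apply (smoothNear_id p).snd

/-- The spray is quadratic in the velocity, so it has no linear part at zero vectors. -/
theorem hasFDerivAt_spray_zero {m : E → E →L[ℝ] E →L[ℝ] ℝ} {e : E} (hm : SmoothNear m e)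
    (hi : (m e).IsInvertible) : HasFDerivAt (spray m) (0 : E × E →L[ℝ] E) (e, 0) := by
  have h := (smoothNear_sprayOp (p := (e, 0)) hm hi).differentiableAt.hasFDerivAt.clm_apply
    (hasFDerivAt_snd (𝕜 := ℝ) (E := E) (F := E) (p := (e, 0)))
  refine HasFDerivAt.congr_fderiv (f := spray m) h (ContinuousLinearMap.ext fun v ↦ ?_)
  simp [sprayOp_zero]

theorem contDiffAt_two_of_hasDerivAt {c w q : ℝ → E} {s : Set ℝ} (hs : IsOpen s) {t : ℝ}
    (ht : t ∈ s) (hc : ∀ t ∈ s, HasDerivAt c (w t) t) (hw : ∀ t ∈ s, HasDerivAt w (q t) t)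
    (hq : ContinuousOn q s) : ContDiffAt ℝ 2 c t := by
  have h1 : ContDiffOn ℝ 1 w s := by
    rw [show (1 : WithTop ℕ∞) = 0 + 1 by simp, contDiffOn_succ_iff_deriv_of_isOpen hs]
    refine ⟨fun t ht ↦ (hw t ht).differentiableAt.differentiableWithinAt, by simp, ?_⟩
    rw [contDiffOn_zero]
    exact hq.congr fun t ht ↦ (hw t ht).deriv
  have h2 : ContDiffOn ℝ (1 + 1) c s := by
    rw [contDiffOn_succ_iff_deriv_of_isOpen hs]
    exact ⟨fun t ht ↦ (hc t ht).differentiableAt.differentiableWithinAt, by simp,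
      h1.congr fun t ht ↦ (hc t ht).deriv⟩
  have h3 := h2.contDiffAt (hs.mem_nhds ht)
  rwa [show (1 + 1 : WithTop ℕ∞) = 2 by norm_num] at h3

/-- The exponential map near the zero section, in coordinates. -/
theorem exists_exp_of_metric {m : E → E →L[ℝ] E →L[ℝ] ℝ} {e₀ : E} (hm : SmoothNear m e₀)
    (hi : (m e₀).IsInvertible) :
    ∃ (Ê : E × E → E) (c : ℝ → E × E → E), SmoothNear Ê (e₀, 0) ∧
      (∀ᶠ e in 𝓝 e₀, Ê (e, 0) = e) ∧ (∀ a b, fderiv ℝ Ê (e₀, 0) (a, b) = a + b) ∧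
      (∀ V ∈ 𝓝 e₀, ∀ᶠ p in 𝓝 (e₀, (0 : E)), ∀ t ∈ Time, c t p ∈ V) ∧
      ∀ᶠ p in 𝓝 (e₀, (0 : E)), c 0 p = p.1 ∧ c 1 p = Ê p ∧ deriv (fun s ↦ c s p) 0 = p.2 ∧
        ∀ t ∈ Ioo (-1 : ℝ) 2, ContDiffAt ℝ 2 (fun s ↦ c s p) t ∧
          deriv (deriv (fun s ↦ c s p)) t = spray m (c t p, deriv (fun s ↦ c s p) t) := by
  -- The geodesic system `c' = w`, `w' = spray (c, w)` has a nonzero linearization at zero vectors.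
  -- In the variables `(a, w)` with `c = a + t w` it becomes `a' = -t spray`, `w' = spray`, whose
  -- linearization vanishes there, so `exists_flow` applies for all of `Time`.
  let f : ℝ × (E × E) → E × E := fun q ↦
    (-(q.1 • spray m (q.2.1 + q.1 • q.2.2, q.2.2)), spray m (q.2.1 + q.1 • q.2.2, q.2.2))
  have hgood : ∀ᶠ e in 𝓝 e₀, SmoothNear m e ∧ (m e).IsInvertible :=
    hm.eventually.and (hm.inverse hi).2
  have hlin (q : ℝ × (E × E)) : SmoothNear (fun q : ℝ × (E × E) ↦ q.2.1 + q.1 • q.2.2) q :=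
    (smoothNear_id q).snd.fst.add ((smoothNear_id q).fst.smul (smoothNear_id q).snd.snd)
  have hpair (q : ℝ × (E × E)) :
      SmoothNear (fun q : ℝ × (E × E) ↦ (q.2.1 + q.1 • q.2.2, q.2.2)) q :=
    (hlin q).prodMk (smoothNear_id q).snd.snd
  have hfs {q : ℝ × (E × E)} (h1 : SmoothNear m (q.2.1 + q.1 • q.2.2))
      (h2 : (m (q.2.1 + q.1 • q.2.2)).IsInvertible) : SmoothNear f q := by
    have h3 : SmoothNear (fun q : ℝ × (E × E) ↦ spray m (q.2.1 + q.1 • q.2.2, q.2.2)) q :=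
      SmoothNear.comp (f := fun q : ℝ × (E × E) ↦ (q.2.1 + q.1 • q.2.2, q.2.2))
        (smoothNear_spray h1 h2) (hpair q)
    exact ((smoothNear_id q).fst.smul h3).neg.prodMk h3
  have hf (t : ℝ) {e : E} (h1 : SmoothNear m e) (h2 : (m e).IsInvertible) :
      SmoothNear f (t, (e, 0)) := by
    apply hfs <;> simpa
  have hf0 (t : ℝ) (e : E) : f (t, (e, 0)) = 0 := by simp [f, spray]
  have hf1 (t : ℝ) {e : E} (h1 : SmoothNear m e) (h2 : (m e).IsInvertible) :
      dsnd f (t, (e, 0)) = 0 := by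
    have h3 : HasFDerivAt (spray m) (0 : E × E →L[ℝ] E)
        ((fun q : ℝ × (E × E) ↦ (q.2.1 + q.1 • q.2.2, q.2.2)) (t, (e, 0))) := by
      simpa using hasFDerivAt_spray_zero h1 h2
    have h4 := h3.comp (t, (e, 0)) (hpair (t, (e, 0))).differentiableAt.hasFDerivAt
    have h5 := (((hasFDerivAt_fst (𝕜 := ℝ) (p := (t, ((e, 0) : E × E)))).smul h4).neg).prodMk h4
    have h6 : fderiv ℝ f (t, (e, 0)) = _ := h5.fderiv
    refine ContinuousLinearMap.ext fun v ↦ ?_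
    rw [dsnd_apply, h6]
    simp [spray]
  obtain ⟨Φ, hΦ1, hΦ2, hΦ3, hΦ4⟩ := exists_flow (f := f) (e := (e₀, (0 : E)))
    (fun t _ ↦ hf t hm hi) (fun t _ ↦ hf0 t e₀) (fun t _ ↦ hf1 t hm hi)
  let c : ℝ → E × E → E := fun t p ↦ (Φ t p).1 + t • (Φ t p).2
  have hstay : ∀ V ∈ 𝓝 e₀, ∀ᶠ p in 𝓝 (e₀, (0 : E)), ∀ t ∈ Time, c t p ∈ V := by
    intro V hV
    have h1 : ∀ t ∈ Time, ∀ᶠ q in 𝓝 (t, (e₀, (0 : E))), q.2.1 + q.1 • q.2.2 ∈ V := by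
      intro t _
      refine (hlin (t, (e₀, 0))).continuousAt.eventually ?_
      simpa using hV
    filter_upwards [hΦ1 _ (eventually_forall_time h1)] with p hp t ht
    exact hp t t ht
  refine ⟨fun p ↦ c 1 p, c, ?_, ?_, ?_, hstay, ?_⟩
  · have h1 := hΦ2.self_of_nhds 1
    exact h1.fst.add ((smoothNear_const (1 : ℝ) _).smul h1.snd)
  · have h1 : Tendsto (fun e : E ↦ (e, (0 : E))) (𝓝 e₀) (𝓝 (e₀, 0)) := by
      have : ContinuousAt (fun e : E ↦ (e, (0 : E))) e₀ := by fun_prop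
      exact this
    filter_upwards [h1.eventually hΦ4] with e he
    simp [c, (he fun t _ ↦ hf0 t e).1 1]
  -- The flow of the modified system has derivative the identity at `(e₀, 0)`, so the exponential
  -- map, which is the sum of its two components at time `1`, has derivative `(a, b) ↦ a + b`.
  · intro a b
    obtain ⟨-, h2⟩ := hΦ4.self_of_nhds fun t _ ↦ hf0 t e₀
    have h2 := h2 (fun t _ ↦ hf1 t hm hi) 1
    have h1 := (hΦ2.self_of_nhds 1).differentiableAt.hasFDerivAt
    rw [h2] at h1
    have h3 := (hasFDerivAt_fst (𝕜 := ℝ) (p := Φ 1 (e₀, 0))).comp (e₀, (0 : E)) h1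
    have h4 := (hasFDerivAt_snd (𝕜 := ℝ) (p := Φ 1 (e₀, 0))).comp (e₀, (0 : E)) h1
    have h5 : HasFDerivAt (fun p ↦ c 1 p) _ (e₀, (0 : E)) := h3.add (h4.const_smul (1 : ℝ))
    rw [h5.fderiv]
    simp
  · filter_upwards [hΦ3, hstay _ hgood] with p ⟨hp0, hp1, _⟩ hp2
    have hw (t : ℝ) (ht : t ∈ Ioo (-1 : ℝ) 2) : HasDerivAt (fun s ↦ (Φ s p).2)
        (spray m (c t p, (Φ t p).2)) t := (hp1 t ht).snd
    have hc (t : ℝ) (ht : t ∈ Ioo (-1 : ℝ) 2) : HasDerivAt (fun s ↦ c s p) (Φ t p).2 t := by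
      have h1 : HasDerivAt (fun s ↦ (Φ s p).1) (-(t • spray m (c t p, (Φ t p).2))) t :=
        (hp1 t ht).fst
      have h2 : HasDerivAt (fun s ↦ c s p) (-(t • spray m (c t p, (Φ t p).2)) +
          (t • spray m (c t p, (Φ t p).2) + (1 : ℝ) • (Φ t p).2)) t :=
        h1.add ((hasDerivAt_id t).smul (hw t ht))
      simpa using h2
    have h0 : (0 : ℝ) ∈ Ioo (-1 : ℝ) 2 := by norm_num
    refine ⟨by simp [c, hp0], rfl, by rw [(hc 0 h0).deriv, hp0], fun t ht ↦ ⟨?_, ?_⟩⟩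
    · refine contDiffAt_two_of_hasDerivAt isOpen_Ioo ht hc hw fun s hs ↦ ?_
      have h1 := hp2 s (Ioo_subset_Icc_self hs)
      have h2 := (smoothNear_spray (p := (c s p, (Φ s p).2)) h1.1 h1.2).continuousAt
      exact (ContinuousAt.comp (f := fun s ↦ (c s p, (Φ s p).2)) h2
        ((hc s hs).continuousAt.prodMk (hw s hs).continuousAt)).continuousWithinAt
    · have h1 : deriv (fun s ↦ c s p) =ᶠ[𝓝 t] fun s ↦ (Φ s p).2 := by
        filter_upwards [isOpen_Ioo.mem_nhds ht] with s hs using (hc s hs).deriv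
      rw [h1.deriv_eq, h1.self_of_nhds, (hw t ht).deriv]

/-- Uniqueness of solutions of an autonomous ordinary differential equation to the right of the
initial time. -/
theorem eventuallyEq_right_of_hasDerivAt {E : Type*} [NormedAddCommGroup E] [NormedSpace ℝ E]
    {v : E → E} {c₁ c₂ : ℝ → E} {t₀ : ℝ} (hv : ContDiffAt ℝ 1 v (c₁ t₀)) (h0 : c₁ t₀ = c₂ t₀)
    (h1 : ∀ᶠ t in 𝓝[≥] t₀, HasDerivAt c₁ (v (c₁ t)) t)
    (h2 : ∀ᶠ t in 𝓝[≥] t₀, HasDerivAt c₂ (v (c₂ t)) t) : c₁ =ᶠ[𝓝[≥] t₀] c₂ := by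
  obtain ⟨K, s, hs, hK⟩ := hv.exists_lipschitzOnWith
  have h1t : HasDerivAt c₁ (v (c₁ t₀)) t₀ := h1.self_of_nhdsWithin self_mem_Ici
  have h2t : HasDerivAt c₂ (v (c₂ t₀)) t₀ := h2.self_of_nhdsWithin self_mem_Ici
  have h3 : ∀ᶠ t in 𝓝[≥] t₀, HasDerivAt c₁ (v (c₁ t)) t ∧ HasDerivAt c₂ (v (c₂ t)) t ∧ c₁ t ∈ s ∧
      c₂ t ∈ s := by
    filter_upwards [h1, h2, mem_nhdsWithin_of_mem_nhds (h1t.continuousAt.eventually hs),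
      mem_nhdsWithin_of_mem_nhds (h2t.continuousAt.eventually (h0 ▸ hs))] with t a b c d
    exact ⟨a, b, c, d⟩
  obtain ⟨b, hb, hI⟩ := (mem_nhdsGE_iff_exists_Icc_subset (a := t₀)).1 h3
  have h4 := ODE_solution_unique_of_mem_Icc_right (v := fun _ ↦ v) (s := fun _ ↦ s) (K := K)
    (a := t₀) (b := b) (f := c₁) (g := c₂) (fun _ _ ↦ hK)
    (fun t ht ↦ (hI ht).1.continuousAt.continuousWithinAt)
    (fun t ht ↦ (hI (Ico_subset_Icc_self ht)).1.hasDerivWithinAt)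
    (fun t ht ↦ (hI (Ico_subset_Icc_self ht)).2.2.1)
    (fun t ht ↦ (hI ht).2.1.continuousAt.continuousWithinAt)
    (fun t ht ↦ (hI (Ico_subset_Icc_self ht)).2.1.hasDerivWithinAt)
    (fun t ht ↦ (hI (Ico_subset_Icc_self ht)).2.2.2) h0
  filter_upwards [Icc_mem_nhdsGE hb] with t ht using h4 ht

end Spray

/-! ### Geodesics on a manifold -/

theorem isInvertible_of_pos {E : Type*} [NormedAddCommGroup E] [NormedSpace ℝ E]
    [FiniteDimensional ℝ E] {m : E →L[ℝ] E →L[ℝ] ℝ} (h : ∀ v, v ≠ 0 → 0 < m v v) :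
    m.IsInvertible := by
  have hinj : Function.Injective m := by
    rw [injective_iff_map_eq_zero]
    intro v hv
    by_contra h0
    have := h v h0
    simp [hv] at this
  have hdim : Module.finrank ℝ E = Module.finrank ℝ (E →L[ℝ] ℝ) := by
    rw [← LinearMap.toContinuousLinearMap.finrank_eq, Module.finrank_linearMap,
      Module.finrank_self, mul_one]
  exact ⟨(LinearEquiv.ofInjectiveOfFinrankEq m.toLinearMap hinj hdim).toContinuousLinearEquiv,
    by ext; rfl⟩

section Geodesics

variable {E : Type*} [NormedAddCommGroup E] [NormedSpace ℝ E] [FiniteDimensional ℝ E]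
  {X : Type*} [TopologicalSpace X] [ChartedSpace E X] [IsManifold 𝓘(ℝ, E) ∞ X]

local notation "κ" => extChartAt 𝓘(ℝ, E)

/-- The velocity of a curve. -/
def velocity (E : Type*) [NormedAddCommGroup E] [NormedSpace ℝ E] [ChartedSpace E X] (γ : ℝ → X)
    (t : ℝ) : E :=
  (mfderiv 𝓘(ℝ, ℝ) 𝓘(ℝ, E) γ t : ℝ →L[ℝ] E) (1 : ℝ)

theorem hasDerivAt_chart_comp {γ : ℝ → X} {t : ℝ} {x₀ : X}
    (hγ : MDifferentiableAt 𝓘(ℝ, ℝ) 𝓘(ℝ, E) γ t) (h : γ t ∈ (κ x₀).source) :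
    HasDerivAt (κ x₀ ∘ γ) (chartT x₀ (γ t) (velocity E γ t)) t := by
  have h1 := HasMFDerivAt.comp t (hasMFDerivAt_chart h) hγ.hasMFDerivAt
  have h2 : HasFDerivAt (κ x₀ ∘ γ) ((chartT x₀ (γ t)).comp
    (mfderiv 𝓘(ℝ, ℝ) 𝓘(ℝ, E) γ t : ℝ →L[ℝ] E)) t := h1.hasFDerivAt
  exact h2.hasDerivAt

theorem hasMFDerivAt_chart_symm_comp {c : ℝ → E} {c' : E} {t : ℝ} {x₀ : X}
    (h : c t ∈ (κ x₀).target) (hc : HasDerivAt c c' t) :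
    MDifferentiableAt 𝓘(ℝ, ℝ) 𝓘(ℝ, E) (fun s ↦ (κ x₀).symm (c s)) t ∧
      velocity E (fun s ↦ (κ x₀).symm (c s)) t = chartS x₀ (c t) c' := by
  have h1 := HasMFDerivAt.comp t (hasMFDerivAt_chart_symm h) hc.hasFDerivAt.hasMFDerivAt
  have h2 : HasMFDerivAt 𝓘(ℝ, ℝ) 𝓘(ℝ, E) (fun s ↦ (κ x₀).symm (c s)) t
    ((chartS x₀ (c t)).comp (ContinuousLinearMap.toSpanSingleton ℝ c') : ℝ →L[ℝ] E) := h1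
  refine ⟨h2.mdifferentiableAt, ?_⟩
  rw [velocity, h2.mfderiv]
  change chartS x₀ (c t) ((1 : ℝ) • c') = _
  rw [one_smul]

theorem contDiffAt_chart_comp {γ : ℝ → X} {t : ℝ} {x₀ : X}
    (hγ : ContMDiffAt 𝓘(ℝ, ℝ) 𝓘(ℝ, E) 2 γ t) (h : γ t ∈ (κ x₀).source) :
    ContDiffAt ℝ 2 (κ x₀ ∘ γ) t := by
  rw [← contMDiffAt_iff_contDiffAt]
  exact ((contMDiffAt_chart h).of_le (by norm_cast)).comp t hγ

variable {G : Type*} [TopologicalSpace G] [Group G] [MulAction G X]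
  {J : Π x : X, TangentSpace 𝓘(ℝ, E) x →L[ℝ] TangentSpace 𝓘(ℝ, E) x} {ω_X : Form E X 2}

theorem isGeodesicAt_iff {γ : ℝ → X} {t : ℝ} : IsGeodesicAt ω_X J γ t ↔
    ContMDiffAt 𝓘(ℝ, ℝ) 𝓘(ℝ, E) 2 γ t ∧
      ∀ w, geodesicExpr (hatMetric ω_X J (γ t)) (κ (γ t) ∘ γ) t w = 0 := by
  have ht := mem_extChartAt_target (I := 𝓘(ℝ, E)) (γ t)
  have h (a b : E) : (fun e ↦ metricInChart ω_X J (γ t) e a b) =ᶠ[𝓝 (κ (γ t) (γ t))]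
      fun e ↦ hatMetric ω_X J (γ t) e a b := by
    filter_upwards [chart_target_mem_nhds ht] with e he using metricInChart_eq he a b
  refine and_congr Iff.rfl (forall_congr' fun w ↦ ?_)
  simp only [geodesicExpr]
  rw [(h _ _).fderiv_eq, (h _ _).fderiv_eq, metricInChart_eq ht]
  rfl

theorem isInvertible_hatMetric (hJ : IsCompatible G ω_X J) {x₀ : X} {e : E}
    (he : e ∈ (κ x₀).target) : (hatMetric ω_X J x₀ e).IsInvertible :=
  isInvertible_of_pos fun _ ↦ hatMetric_pos hJ he

/-- The geodesic equation is invariant under isometries. -/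
theorem geodesicExpr_isometry (hJ : IsCompatible G ω_X J) (hω : ∀ x, ω_X.SmoothAt x) {f : X → X}
    (hf : ContMDiff 𝓘(ℝ, E) 𝓘(ℝ, E) ∞ f) {f' : X → E →L[ℝ] E}
    (hf' : ∀ x, HasMFDerivAt 𝓘(ℝ, E) 𝓘(ℝ, E) f x (f' x))
    (hiso : ∀ x v w, tensorMetric ω_X J (f x) (f' x v) (f' x w) = tensorMetric ω_X J x v w)
    {γ : ℝ → X} {t : ℝ} (hγ : ContMDiffAt 𝓘(ℝ, ℝ) 𝓘(ℝ, E) 2 γ t) {x₀ y₀ : X}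
    (hx : γ t ∈ (κ x₀).source) (hy : f (γ t) ∈ (κ y₀).source) (w : E) :
    geodesicExpr (hatMetric ω_X J x₀) (κ x₀ ∘ γ) t w =
      geodesicExpr (hatMetric ω_X J y₀) (κ y₀ ∘ f ∘ γ) t
        (chartT y₀ (f (γ t)) (f' (γ t) (chartS x₀ (κ x₀ (γ t)) w))) := by
  have he := (κ x₀).map_source hx
  have hxx := (κ x₀).left_inv hx
  have hgood : ∀ᶠ e in 𝓝 (κ x₀ (γ t)), e ∈ (κ x₀).target ∧ f ((κ x₀).symm e) ∈ (κ y₀).source := by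
    have h1 : ∀ᶠ y in 𝓝 ((κ x₀).symm (κ x₀ (γ t))), f y ∈ (κ y₀).source := by
      rw [hxx]
      exact hf.continuous.continuousAt.eventually (chart_source_mem_nhds hy)
    filter_upwards [chart_target_mem_nhds he, eventually_chart he h1] with e a b using ⟨a, b⟩
  obtain ⟨F, hFdef⟩ : ∃ F : E → E, F = reading (A := E) (B := E) x₀ y₀ f := ⟨_, rfl⟩
  have hd {e : E} (h1 : e ∈ (κ x₀).target) (h2 : f ((κ x₀).symm e) ∈ (κ y₀).source) :
      fderiv ℝ F e = ((chartT (A := E) y₀ (f ((κ x₀).symm e))).comp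
        ((f' ((κ x₀).symm e)).comp (chartS x₀ e)) : E →L[ℝ] E) := by
    rw [hFdef]
    exact (hasFDerivAt_reading (A := E) (B := E) h1 (hf' _) h2).fderiv
  have hFe (e : E) : F e = κ y₀ (f ((κ x₀).symm e)) := by rw [hFdef]; rfl
  have hy' : f ((κ x₀).symm (κ x₀ (γ t))) ∈ (κ y₀).source := by rwa [hxx]
  have hF : F (κ x₀ (γ t)) ∈ (κ y₀).target := by
    rw [hFe]
    exact (κ y₀).map_source hy'
  have hFs : ContDiffAt ℝ ∞ F (κ x₀ (γ t)) := by
    rw [hFdef]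
    exact contDiffAt_reading le_rfl he (hf _) hy'
  have hmet : ∀ᶠ e in 𝓝 (κ x₀ (γ t)), ∀ v w, hatMetric ω_X J x₀ e v w =
      hatMetric ω_X J y₀ (F e) (fderiv ℝ F e v) (fderiv ℝ F e w) := by
    filter_upwards [hgood] with e ⟨h1, h2⟩ v w
    rw [hd h1 h2, hFe, ← tensorMetric_chart ((κ y₀).map_source h2)]
    simp only [ContinuousLinearMap.comp_apply]
    rw [← tensorMetric_chart h1, ← hiso]
    have h3 (u : E) : chartS y₀ (κ y₀ (f ((κ x₀).symm e))) (chartT y₀ (f ((κ x₀).symm e)) u) = u :=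
      chartS_chartT h2 u
    rw [h3, h3, (κ y₀).left_inv h2]
  have h1 := geodesicExpr_comp (c := κ x₀ ∘ γ) (t := t) hmet (hJ.smoothNear_hatMetric hω hF)
    (hatMetric_symm hJ hF) hFs (contDiffAt_chart_comp hγ hx) w
  rw [h1]
  have h2 : fderiv ℝ F ((κ x₀ ∘ γ) t) w =
      chartT y₀ (f (γ t)) (f' (γ t) (chartS x₀ (κ x₀ (γ t)) w)) := by
    have h3 := hd he hy'
    rw [hxx] at h3
    exact congrArg (fun L : E →L[ℝ] E ↦ L w) h3
  rw [h2]
  refine geodesicExpr_congr ?_ _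
  filter_upwards [hγ.continuousAt.eventually (chart_source_mem_nhds hx)] with s hs
  simp only [Function.comp_apply, hFe]
  rw [(κ x₀).left_inv hs]

/-- The geodesic equation in an arbitrary chart. -/
theorem isGeodesicAt_iff_chart (hJ : IsCompatible G ω_X J) (hω : ∀ x, ω_X.SmoothAt x) {γ : ℝ → X}
    {t : ℝ} {x₀ : X} (hx : γ t ∈ (κ x₀).source) : IsGeodesicAt ω_X J γ t ↔
    ContMDiffAt 𝓘(ℝ, ℝ) 𝓘(ℝ, E) 2 γ t ∧ deriv (deriv (κ x₀ ∘ γ)) t =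
      spray (hatMetric ω_X J x₀) (κ x₀ (γ t), deriv (κ x₀ ∘ γ) t) := by
  rw [isGeodesicAt_iff]
  refine and_congr_right fun hγ ↦ ?_
  have he := (κ x₀).map_source hx
  have h0 := geodesicExpr_eq_zero_iff (c := κ x₀ ∘ γ) (t := t) (hJ.smoothNear_hatMetric hω he)
    (isInvertible_hatMetric hJ he)
  rw [Function.comp_apply] at h0
  rw [← h0]
  -- Independence of the chart is invariance under isometries applied to the identity map, read in
  -- two different charts.
  have h1 {x y : X} (h1 : γ t ∈ (κ x).source) (h2 : γ t ∈ (κ y).source) (w : E) :=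
    geodesicExpr_isometry hJ hω (f := id) contMDiff_id
      (f' := fun _ ↦ .id ℝ E) (fun x ↦ hasMFDerivAt_id x) (fun _ _ _ ↦ rfl) hγ h1 h2 w
  constructor
  · intro h w
    exact (h1 hx (mem_extChartAt_source _) w).trans (h _)
  · intro h w
    exact (h1 (mem_extChartAt_source _) hx w).trans (h _)

theorem IsGeodesicAt.isometry (hJ : IsCompatible G ω_X J) (hω : ∀ x, ω_X.SmoothAt x) {f : X → X}
    (hf : ContMDiff 𝓘(ℝ, E) 𝓘(ℝ, E) ∞ f) {f' : X → E →L[ℝ] E}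
    (hf' : ∀ x, HasMFDerivAt 𝓘(ℝ, E) 𝓘(ℝ, E) f x (f' x))
    (hiso : ∀ x v w, tensorMetric ω_X J (f x) (f' x v) (f' x w) = tensorMetric ω_X J x v w)
    (hsurj : ∀ x, Function.Surjective (f' x))
    {γ : ℝ → X} {t : ℝ} (h : IsGeodesicAt ω_X J γ t) : IsGeodesicAt ω_X J (f ∘ γ) t := by
  rw [isGeodesicAt_iff] at h ⊢
  have hx := mem_extChartAt_source (I := 𝓘(ℝ, E)) (γ t)
  have hy := mem_extChartAt_source (I := 𝓘(ℝ, E)) (f (γ t))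
  refine ⟨((hf _).of_le (by norm_cast)).comp t h.1, fun w ↦ ?_⟩
  -- Surjectivity of the derivative ensures that every test vector at the image point comes from one
  -- at `γ t`.
  obtain ⟨u, hu⟩ := hsurj (γ t) (chartS (f (γ t)) (κ (f (γ t)) (f (γ t))) w)
  have h1 := geodesicExpr_isometry hJ hω hf hf' hiso h.1 hx hy (chartT (γ t) (γ t) u)
  rw [chartS_chartT hx, hu, h.2] at h1
  have h2 := chartT_chartS ((κ (f (γ t))).map_source hy) w
  rw [(κ (f (γ t))).left_inv hy] at h2
  rw [h2] at h1
  exact h1.symm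

theorem continuous_deriv_chart {γ : ℝ → X} {t : ℝ} {x₀ : X}
    (hγ : ContMDiffAt 𝓘(ℝ, ℝ) 𝓘(ℝ, E) 2 γ t) (h : γ t ∈ (κ x₀).source) :
    ContinuousAt (deriv (κ x₀ ∘ γ)) t :=
  (eventually_differentiableAt_of_contDiffAt_two (contDiffAt_chart_comp hγ h)).2.continuousAt

/-- Uniqueness of geodesics. -/
theorem geodesic_unique [T2Space X] (hJ : IsCompatible G ω_X J) (hω : ∀ x, ω_X.SmoothAt x)
    {γ₁ γ₂ : ℝ → X} (h₁ : ∀ t ∈ Icc (0 : ℝ) 1, IsGeodesicAt ω_X J γ₁ t)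
    (h₂ : ∀ t ∈ Icc (0 : ℝ) 1, IsGeodesicAt ω_X J γ₂ t) (h0 : γ₁ 0 = γ₂ 0)
    (hv : velocity E γ₁ 0 = velocity E γ₂ 0) : ∀ t ∈ Icc (0 : ℝ) 1, γ₁ t = γ₂ t := by
  let s : Set ℝ := {t | γ₁ t = γ₂ t ∧ velocity E γ₁ t = velocity E γ₂ t}
  suffices h : Icc (0 : ℝ) 1 ⊆ s from fun t ht ↦ (h ht).1
  -- equality of velocities can be read off in any chart
  have hvel {t : ℝ} (ht : t ∈ Icc (0 : ℝ) 1) {x₀ : X} (hx : γ₁ t ∈ (κ x₀).source)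
      (he : γ₁ t = γ₂ t) : velocity E γ₁ t = velocity E γ₂ t ↔
      deriv (κ x₀ ∘ γ₁) t = deriv (κ x₀ ∘ γ₂) t := by
    rw [(hasDerivAt_chart_comp ((h₁ t ht).1.mdifferentiableAt (by simp)) hx).deriv,
      (hasDerivAt_chart_comp ((h₂ t ht).1.mdifferentiableAt (by simp)) (he ▸ hx)).deriv, ← he]
    refine ⟨fun h ↦ by rw [h], fun h ↦ ?_⟩
    rw [← chartS_chartT hx (velocity E γ₁ t), h, chartS_chartT hx]
  -- Continuous induction on `[0, 1]`: the times at which positions and velocities agree form a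
  -- closed set, which contains a right neighbourhood of each of its points other than `1` by
  -- uniqueness for the first order equation.
  refine IsClosed.Icc_subset_of_forall_mem_nhdsWithin ?_ ⟨h0, hv⟩ ?_
  · rw [← closure_subset_iff_isClosed]
    intro t ht
    have htI : t ∈ Icc (0 : ℝ) 1 := by
      have := closure_mono (inter_subset_right (s := s)) ht
      rwa [isClosed_Icc.closure_eq] at this
    have hf := mem_closure_iff_frequently.1 ht
    have hc₁ := (h₁ t htI).1.continuousAt
    have hc₂ := (h₂ t htI).1.continuousAt
    have he : γ₁ t = γ₂ t :=
      tendsto_nhds_unique_of_frequently_eq hc₁ hc₂ (hf.mono fun _ h ↦ h.1.1)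
    have hx := mem_extChartAt_source (I := 𝓘(ℝ, E)) (γ₁ t)
    refine ⟨⟨he, (hvel htI hx he).2 ?_⟩, htI⟩
    refine tendsto_nhds_unique_of_frequently_eq (continuous_deriv_chart (h₁ t htI).1 hx)
      (continuous_deriv_chart (h₂ t htI).1 (he ▸ hx)) ?_
    refine (hf.and_eventually (hc₁.eventually (chart_source_mem_nhds hx))).mono fun u hu ↦ ?_
    exact (hvel hu.1.2 hu.2 hu.1.1.1).1 hu.1.1.2
  · rintro t ⟨⟨he, hve⟩, ht⟩
    have htI := Ico_subset_Icc_self ht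
    have hx := mem_extChartAt_source (I := 𝓘(ℝ, E)) (γ₁ t)
    have het := mem_extChartAt_target (I := 𝓘(ℝ, E)) (γ₁ t)
    have hI : ∀ᶠ u in 𝓝[≥] t, u ∈ Icc (0 : ℝ) 1 := by
      filter_upwards [Icc_mem_nhdsGE ht.2] with u hu using ⟨ht.1.trans hu.1, hu.2⟩
    set m := hatMetric ω_X J (γ₁ t) with hm
    -- the geodesic equation as a first order equation
    have key {γ : ℝ → X} (h : ∀ t ∈ Icc (0 : ℝ) 1, IsGeodesicAt ω_X J γ t) (hγ : γ t = γ₁ t) :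
        ∀ᶠ u in 𝓝[≥] t, HasDerivAt (fun u ↦ ((κ (γ₁ t) ∘ γ) u, deriv (κ (γ₁ t) ∘ γ) u))
          ((fun p : E × E ↦ (p.2, spray m p)) ((κ (γ₁ t) ∘ γ) u, deriv (κ (γ₁ t) ∘ γ) u)) u := by
      have hγc : ContinuousAt γ t := (h t htI).1.continuousAt
      have hx' : γ t ∈ (κ (γ₁ t)).source := by rw [hγ]; exact hx
      filter_upwards [hI, mem_nhdsWithin_of_mem_nhds
        (hγc.eventually (chart_source_mem_nhds (A := E) hx'))] with u hu hus
      obtain ⟨h1, h2⟩ := (isGeodesicAt_iff_chart hJ hω hus).1 (h u hu)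
      obtain ⟨h3, h4⟩ :=
        eventually_differentiableAt_of_contDiffAt_two (F := E)
          (contDiffAt_chart_comp (E := E) h1 hus)
      have h5 := h4.hasDerivAt
      rw [h2] at h5
      have h6 : HasDerivAt (κ (γ₁ t) ∘ γ) (deriv (κ (γ₁ t) ∘ γ) u) u :=
        (h3.self_of_nhds : DifferentiableAt ℝ (κ (γ₁ t) ∘ γ) u).hasDerivAt
      exact h6.prodMk h5
    have hsm : ContDiffAt ℝ 1 (fun p : E × E ↦ (p.2, spray m p))
        ((κ (γ₁ t) ∘ γ₁) t, deriv (κ (γ₁ t) ∘ γ₁) t) := by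
      refine (contDiffAt_snd (𝕜 := ℝ) (E := E) (F := E)).prodMk ?_
      exact (smoothNear_spray (p := ((κ (γ₁ t) ∘ γ₁) t, deriv (κ (γ₁ t) ∘ γ₁) t))
        (hJ.smoothNear_hatMetric hω het) (isInvertible_hatMetric hJ het)).contDiffAt.of_le
        (by norm_cast)
    have h5 := eventuallyEq_right_of_hasDerivAt (E := E × E) (t₀ := t)
      (c₁ := fun u ↦ ((κ (γ₁ t) ∘ γ₁) u, deriv (κ (γ₁ t) ∘ γ₁) u))
      (c₂ := fun u ↦ ((κ (γ₁ t) ∘ γ₂) u, deriv (κ (γ₁ t) ∘ γ₂) u)) hsm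
      (by simp only [Function.comp_apply, he, Prod.mk.injEq, true_and]
          rw [← he]
          exact (hvel htI hx he).1 hve) (key h₁ rfl) (key h₂ he.symm)
    have hx2 : γ₂ t ∈ (κ (γ₁ t)).source := by rw [← he]; exact hx
    have h6 := nhdsWithin_mono t (Ioi_subset_Ici_self (a := t))
    filter_upwards [h6 h5, h6 hI, h6 (mem_nhdsWithin_of_mem_nhds
      ((h₁ t htI).1.continuousAt.eventually (chart_source_mem_nhds hx))),
      h6 (mem_nhdsWithin_of_mem_nhds ((h₂ t htI).1.continuousAt.eventually
        (chart_source_mem_nhds hx2)))] with u hu huI hu1 hu2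
    obtain ⟨h7, h8⟩ := Prod.mk.inj hu
    have h9 : γ₁ u = γ₂ u := (κ (γ₁ t)).injOn hu1 hu2 h7
    exact ⟨h9, (hvel huI hu1 h9).2 h8⟩

theorem isGeodesicFrom_iff {γ : ℝ → X} {x : X} {v : E} :
    IsGeodesicFrom ω_X J γ ⟨x, v⟩ ↔ (∀ t ∈ Icc (0 : ℝ) 1, IsGeodesicAt ω_X J γ t) ∧
      γ 0 = x ∧ velocity E γ 0 = v := by
  refine and_congr_right fun _ ↦ ?_
  constructor
  · intro h
    have h1 : γ 0 = x := congrArg Bundle.TotalSpace.proj h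
    subst h1
    refine ⟨rfl, ?_⟩
    have h2 := congrArg (fun q : TangentBundle 𝓘(ℝ, E) X ↦ (q.2 : E)) h
    exact h2
  · rintro ⟨rfl, rfl⟩
    rfl

/-- By uniqueness of geodesics, the choice in the definition of `expMap` does not matter. -/
theorem expMap_eq [T2Space X] (hJ : IsCompatible G ω_X J) (hω : ∀ x, ω_X.SmoothAt x) {γ : ℝ → X}
    {p : TangentBundle 𝓘(ℝ, E) X} (h : IsGeodesicFrom ω_X J γ p) : expMap ω_X J p = γ 1 := by
  have hex : ∃ γ : ℝ → X, IsGeodesicFrom ω_X J γ p := ⟨γ, h⟩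
  rw [expMap, dif_pos hex]
  obtain ⟨x, v⟩ := p
  obtain ⟨h1, h2, h3⟩ := isGeodesicFrom_iff.1 h
  obtain ⟨k1, k2, k3⟩ := isGeodesicFrom_iff.1 hex.choose_spec
  exact geodesic_unique hJ hω k1 h1 (k2.trans h2.symm) (k3.trans h3.symm) 1 (by simp)

theorem IsGeodesicFrom.isometry (hJ : IsCompatible G ω_X J) (hω : ∀ x, ω_X.SmoothAt x) {f : X → X}
    (hf : ContMDiff 𝓘(ℝ, E) 𝓘(ℝ, E) ∞ f) {f' : X → E →L[ℝ] E}
    (hf' : ∀ x, HasMFDerivAt 𝓘(ℝ, E) 𝓘(ℝ, E) f x (f' x))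
    (hiso : ∀ x v w, tensorMetric ω_X J (f x) (f' x v) (f' x w) = tensorMetric ω_X J x v w)
    (hsurj : ∀ x, Function.Surjective (f' x))
    {γ : ℝ → X} {p : TangentBundle 𝓘(ℝ, E) X} (h : IsGeodesicFrom ω_X J γ p) :
    IsGeodesicFrom ω_X J (f ∘ γ) (tangentMap 𝓘(ℝ, E) 𝓘(ℝ, E) f p) := by
  refine ⟨fun t ht ↦ (h.1 t ht).isometry hJ hω hf hf' hiso hsurj, ?_⟩
  have h1 := h.1 0 (by simp)
  rw [← h.2, tangentMap_comp_at (I' := 𝓘(ℝ, E)) _ (hf' _).mdifferentiableAt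
    (h1.1.mdifferentiableAt (by simp))]

/-- The exponential map, as a function of the base point and the vector. -/
def expAt (ω_X : Form E X 2) (J : Π x : X, TangentSpace 𝓘(ℝ, E) x →L[ℝ] TangentSpace 𝓘(ℝ, E) x)
    (x : X) (v : E) : X :=
  expMap ω_X J ⟨x, v⟩

/-- The exponential map in a chart. -/
theorem exists_exp_chart [T2Space X] (hJ : IsCompatible G ω_X J) (hω : ∀ x, ω_X.SmoothAt x)
    {x₀ : X} {e₀ : E} (he₀ : e₀ ∈ (κ x₀).target) :
    ∃ Ê : E × E → E, SmoothNear Ê (e₀, 0) ∧ (∀ᶠ e in 𝓝 e₀, Ê (e, 0) = e) ∧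
      (∀ a b, fderiv ℝ Ê (e₀, 0) (a, b) = a + b) ∧
      ∀ᶠ p in 𝓝 (e₀, (0 : E)), p.1 ∈ (κ x₀).target ∧ Ê p ∈ (κ x₀).target ∧
        expAt ω_X J ((κ x₀).symm p.1) (chartS x₀ p.1 p.2) = (κ x₀).symm (Ê p) := by
  obtain ⟨Ê, c, h1, h2, h3, h4, h5⟩ := exists_exp_of_metric (hJ.smoothNear_hatMetric hω he₀)
    (isInvertible_hatMetric hJ he₀)
  refine ⟨Ê, h1, h2, h3, ?_⟩
  filter_upwards [h4 _ (chart_target_mem_nhds he₀), h5] with p hp ⟨h0, hone, hv, hode⟩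
  have h01 : ∀ t ∈ Icc (0 : ℝ) 1, t ∈ Ioo (-1 : ℝ) 2 := fun t ht ↦
    ⟨by linarith [ht.1], by linarith [ht.2]⟩
  have hmem : ∀ t ∈ Icc (0 : ℝ) 1, c t p ∈ (κ x₀).target := fun t ht ↦
    hp t (Ioo_subset_Icc_self (h01 t ht))
  have z0 : (0 : ℝ) ∈ Icc (0 : ℝ) 1 := by simp
  have z1 : (1 : ℝ) ∈ Icc (0 : ℝ) 1 := by simp
  refine ⟨h0 ▸ hmem 0 z0, hone ▸ hmem 1 z1, ?_⟩
  rw [← hone]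
  refine expMap_eq hJ hω (γ := fun t ↦ (κ x₀).symm (c t p)) (isGeodesicFrom_iff.2 ⟨?_, ?_, ?_⟩)
  · intro t ht
    obtain ⟨h6, h7⟩ := hode t (h01 t ht)
    have h8 := hmem t ht
    rw [isGeodesicAt_iff_chart hJ hω ((κ x₀).map_target h8)]
    have h9 : κ x₀ ∘ (fun t ↦ (κ x₀).symm (c t p)) =ᶠ[𝓝 t] fun t ↦ c t p := by
      filter_upwards [h6.continuousAt.eventually (chart_target_mem_nhds h8)] with s hs
      exact (κ x₀).right_inv hs
    refine ⟨((contMDiffAt_chart_symm h8).of_le (by norm_cast)).comp t h6.contMDiffAt, ?_⟩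
    rw [h9.deriv.deriv_eq, h9.deriv_eq, (κ x₀).right_inv h8, h7]
  · rw [h0]
  · have h6 := (hode 0 (h01 0 z0)).1.differentiableAt (by simp)
    rw [(hasMFDerivAt_chart_symm_comp (hmem 0 z0) h6.hasDerivAt).2, hv, h0]

end Geodesics

/-! ### Equivariance of the exponential map -/

section Equivariance

variable {E : Type*} [NormedAddCommGroup E] [NormedSpace ℝ E] [FiniteDimensional ℝ E]
  {X : Type*} [TopologicalSpace X] [ChartedSpace E X] [IsManifold 𝓘(ℝ, E) ∞ X] [T2Space X]
  {E_G : Type*} [NormedAddCommGroup E_G] [NormedSpace ℝ E_G] [FiniteDimensional ℝ E_G]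
  {G : Type*} [TopologicalSpace G] [ChartedSpace E_G G] [Group G] [LieGroup 𝓘(ℝ, E_G) ∞ G]
  [ConnectedSpace G] [MulAction G X] [ContMDiffSMul 𝓘(ℝ, E_G) 𝓘(ℝ, E) ∞ G X]
  {J : Π x : X, TangentSpace 𝓘(ℝ, E) x →L[ℝ] TangentSpace 𝓘(ℝ, E) x}
  {ω_X : Form E X 2} {μ : X → E_G} {B : E_G →L[ℝ] E_G →L[ℝ] ℝ}

theorem IsHamiltonianOn.isGeodesicFrom_smul (hμ : IsHamiltonianOn G B ω_X μ univ)
    (hJ : IsCompatible G ω_X J) (g : G) {γ : ℝ → X} {p : TangentBundle 𝓘(ℝ, E) X}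
    (h : IsGeodesicFrom ω_X J γ p) : IsGeodesicFrom ω_X J ((fun x : X ↦ g • x) ∘ γ)
      (tangentMap 𝓘(ℝ, E) 𝓘(ℝ, E) (fun x : X ↦ g • x) p) :=
  h.isometry hJ (fun x ↦ hμ.smooth x (mem_univ x)) (contMDiff_smul_const E_G g)
    (hasMFDerivAt_smul E_G g) (tensorMetric_smul hμ hJ g)
    (fun x v ↦ ⟨smulT E g⁻¹ (g • x) v, smulT_smulT_inv E_G g x v⟩)

/-- The exponential map is equivariant. -/
theorem IsHamiltonianOn.expMap_smul (hμ : IsHamiltonianOn G B ω_X μ univ)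
    (hJ : IsCompatible G ω_X J) (g : G) (x : X) (v : E) :
    expAt ω_X J (g • x) (smulT E g x v) = g • expAt ω_X J x v := by
  rw [expAt, expAt]
  have hω := fun x ↦ hμ.smooth x (mem_univ x)
  by_cases h : ∃ γ : ℝ → X, IsGeodesicFrom ω_X J γ ⟨x, v⟩
  · obtain ⟨γ, hγ⟩ := h
    rw [expMap_eq hJ hω hγ]
    exact expMap_eq hJ hω (hμ.isGeodesicFrom_smul hJ g hγ)
  -- Geodesics from `g • x` are carried back by `g⁻¹`, so there is none on this side either. Both
  -- values are then the default base points, which also correspond under `g`.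
  · have h' : ¬ ∃ γ : ℝ → X, IsGeodesicFrom ω_X J γ ⟨g • x, smulT E g x v⟩ := by
      rintro ⟨γ, hγ⟩
      refine h ⟨(fun x : X ↦ g⁻¹ • x) ∘ γ, ?_⟩
      have h1 := hμ.isGeodesicFrom_smul hJ g⁻¹ hγ
      have h2 : tangentMap 𝓘(ℝ, E) 𝓘(ℝ, E) (fun x : X ↦ g⁻¹ • x)
          (⟨g • x, smulT E g x v⟩ : TangentBundle 𝓘(ℝ, E) X) =
          (⟨g⁻¹ • g • x, smulT E g⁻¹ (g • x) (smulT E g x v)⟩ : TangentBundle 𝓘(ℝ, E) X) := rfl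
      rw [h2, smulT_inv_smulT E_G, inv_smul_smul] at h1
      exact h1
    rw [expMap, expMap, dif_neg h, dif_neg h']

end Equivariance

/-! ### The normal exponential map near a point of the zero level -/

section NormalExp

universe u

variable {E : Type u} [NormedAddCommGroup E] [NormedSpace ℝ E] [FiniteDimensional ℝ E]
  {X : Type*} [TopologicalSpace X] [ChartedSpace E X] [IsManifold 𝓘(ℝ, E) ∞ X] [T2Space X]
  {E_G : Type*} [NormedAddCommGroup E_G] [NormedSpace ℝ E_G] [FiniteDimensional ℝ E_G]
  {G : Type*} [TopologicalSpace G] [ChartedSpace E_G G] [Group G] [LieGroup 𝓘(ℝ, E_G) ∞ G]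
  [ConnectedSpace G] [MulAction G X] [ContMDiffSMul 𝓘(ℝ, E_G) 𝓘(ℝ, E) ∞ G X]
  {J : Π x : X, TangentSpace 𝓘(ℝ, E) x →L[ℝ] TangentSpace 𝓘(ℝ, E) x}
  {ω_X : Form E X 2} {μ : X → E_G} {B : E_G →L[ℝ] E_G →L[ℝ] ℝ}

local notation "κ" => extChartAt 𝓘(ℝ, E)

/-- A Hamiltonian action with regular value `0`, and a compatible almost complex structure. -/
structure IsRegular (G : Type*) [TopologicalSpace G] [ChartedSpace E_G G] [Group G]
    [MulAction G X] (B : E_G →L[ℝ] E_G →L[ℝ] ℝ) (ω_X : Form E X 2) (μ : X → E_G)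
    (J : Π x : X, TangentSpace 𝓘(ℝ, E) x →L[ℝ] TangentSpace 𝓘(ℝ, E) x) : Prop where
  inner : IsInvariantInner G B
  ham : IsHamiltonianOn G B ω_X μ univ
  regular : ∀ z, μ z = 0 → Function.Surjective (mvfderiv 𝓘(ℝ, E) μ z)
  compatible : IsCompatible G ω_X J

theorem IsRegular.smooth (h : IsRegular G B ω_X μ J) (x : X) : ω_X.SmoothAt x :=
  h.ham.smooth x (mem_univ x)

/-- The normal vector `J L_z ξ`. -/
def normalVec (G : Type*) [TopologicalSpace G] [ChartedSpace E_G G] [Group G] [MulAction G X]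
    (J : Π x : X, TangentSpace 𝓘(ℝ, E) x →L[ℝ] TangentSpace 𝓘(ℝ, E) x) (z : X) (ξ : E_G) : E :=
  tensorJ J z (tensorL E E_G G z ξ)

/-- The point `exp_z (J L_z ξ)`. -/
def normalExp (G : Type*) [TopologicalSpace G] [ChartedSpace E_G G] [Group G] [MulAction G X]
    (ω_X : Form E X 2) (J : Π x : X, TangentSpace 𝓘(ℝ, E) x →L[ℝ] TangentSpace 𝓘(ℝ, E) x)
    (z : X) (ξ : E_G) : X :=
  expAt ω_X J z (normalVec G J z ξ)

/-- The map `ξ ↦ J L ξ` in a chart. -/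
def hatN (G : Type*) [TopologicalSpace G] [ChartedSpace E_G G] [Group G] [MulAction G X]
    (J : Π x : X, TangentSpace 𝓘(ℝ, E) x →L[ℝ] TangentSpace 𝓘(ℝ, E) x) (x₀ : X) (e : E) :
    E_G →L[ℝ] E :=
  (hatJ J x₀ e).comp (hatL G x₀ e)

theorem chartS_hatN {x₀ : X} {e : E} (he : e ∈ (κ x₀).target) (ξ : E_G) :
    chartS x₀ e (hatN G J x₀ e ξ) = normalVec G J ((κ x₀).symm e) ξ := by
  rw [hatN, ContinuousLinearMap.comp_apply, chartS_hatJ he, chartS_hatL he, normalVec]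

theorem IsRegular.smoothNear_hatN (h : IsRegular G B ω_X μ J) {x₀ : X} {e : E}
    (he : e ∈ (κ x₀).target) : SmoothNear (hatN (E_G := E_G) G J x₀) e :=
  (h.compatible.smoothNear_hatJ he).clm_comp (smoothNear_hatL he)

theorem IsRegular.tensorMetric_normalVec (h : IsRegular G B ω_X μ J) (z : X) (ξ : E_G) :
    tensorMetric ω_X J z (normalVec G J z ξ) (normalVec G J z ξ) =
      tensorMetric ω_X J z (tensorL E E_G G z ξ) (tensorL E E_G G z ξ) := by
  rw [tensorMetric, tensorMetric, normalVec, bil_tensorJ h.compatible]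

theorem mem_tube_iff {z : X} {v : E} {ε : ℝ} :
    (⟨z, v⟩ : TangentBundle 𝓘(ℝ, E) X) ∈ tube G ω_X J μ ε ↔ μ z = 0 ∧
      (∃ ξ : E_G, v = normalVec G J z ξ) ∧ tensorMetric ω_X J z v v < ε ^ 2 := by
  rw [tensorMetric_eq]
  rfl

theorem normalVec_smul (hJ : IsCompatible G ω_X J) (g : G) (z : X) (ξ : E_G) :
    normalVec G J (g • z) (Ad g ξ) = smulT E g z (normalVec G J z ξ) := by
  rw [normalVec, normalVec, ← tensorJ_smul hJ]
  exact congrArg _ (L_smul g z ξ)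

/-- The normal exponential map and its inverse, in the chart around a point of the zero level. -/
theorem IsRegular.exists_normal_chart (h : IsRegular G B ω_X μ J) {z₀ : X} (hz₀ : μ z₀ = 0) :
    ∃ (Ê : E × E → E) (zh : E → E) (ξh : E → E_G),
      SmoothNear Ê (κ z₀ z₀, 0) ∧ (∀ᶠ e in 𝓝 (κ z₀ z₀), Ê (e, 0) = e) ∧
      (∀ a b, fderiv ℝ Ê (κ z₀ z₀, 0) (a, b) = a + b) ∧
      (∀ᶠ p in 𝓝 (κ z₀ z₀, (0 : E)), p.1 ∈ (κ z₀).target ∧ Ê p ∈ (κ z₀).target ∧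
        expAt ω_X J ((κ z₀).symm p.1) (chartS z₀ p.1 p.2) = (κ z₀).symm (Ê p)) ∧
      SmoothNear zh (κ z₀ z₀) ∧ SmoothNear ξh (κ z₀ z₀) ∧
      zh (κ z₀ z₀) = κ z₀ z₀ ∧ ξh (κ z₀ z₀) = 0 ∧
      (∀ᶠ e in 𝓝 (κ z₀ z₀), hatMu μ z₀ (zh e) = 0 ∧
        Ê (zh e, hatN G J z₀ (zh e) (ξh e)) = e) ∧
      (∀ᶠ q in 𝓝 (κ z₀ z₀, (0 : E_G)), hatMu μ z₀ q.1 = 0 →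
        zh (Ê (q.1, hatN G J z₀ q.1 q.2)) = q.1 ∧ ξh (Ê (q.1, hatN G J z₀ q.1 q.2)) = q.2) ∧
      ∃ u ∈ 𝓝 (κ z₀ z₀, (0 : E_G)),
        InjOn (fun q : E × E_G ↦ (Ê (q.1, hatN G J z₀ q.1 q.2), hatMu μ z₀ q.1)) u := by
  have he₀ := mem_extChartAt_target (I := 𝓘(ℝ, E)) z₀
  obtain ⟨Ê, h1, h2, h3, h4⟩ := exists_exp_chart h.compatible h.smooth he₀
  set e₀ : E := κ z₀ z₀ with he₀def
  have hz₀' : (κ z₀).symm e₀ = z₀ := extChartAt_to_inv z₀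
  -- The base point ranges over a full chart, and the value of `μ` is recorded in the second
  -- component. This avoids a parametrization of the level set: the inverse is afterwards restricted
  -- to second component `0`.
  set Ψ : E × E_G → E × E_G :=
    fun q ↦ (Ê (q.1, hatN G J z₀ q.1 q.2), hatMu μ z₀ q.1) with hΨ
  have hfst : SmoothNear (fun q : E × E_G ↦ q.1) (e₀, (0 : E_G)) := .of_contDiff contDiff_fst _
  have hsnd : SmoothNear (fun q : E × E_G ↦ q.2) (e₀, (0 : E_G)) := .of_contDiff contDiff_snd _
  have hN : SmoothNear (fun q : E × E_G ↦ hatN G J z₀ q.1) (e₀, (0 : E_G)) :=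
    SmoothNear.comp (g := hatN G J z₀) (f := fun q : E × E_G ↦ q.1) (h.smoothNear_hatN he₀) hfst
  have hM := h.ham.smoothNear_hatMu he₀
  have hin : SmoothNear (fun q : E × E_G ↦ (q.1, hatN G J z₀ q.1 q.2)) (e₀, (0 : E_G)) :=
    hfst.prodMk (hN.clm_apply hsnd)
  have hÊ : SmoothNear Ê ((fun q : E × E_G ↦ (q.1, hatN G J z₀ q.1 q.2)) (e₀, (0 : E_G))) := by
    simpa using h1
  have hΨs : SmoothNear Ψ (e₀, (0 : E_G)) :=
    (SmoothNear.comp (g := Ê) (f := fun q : E × E_G ↦ (q.1, hatN G J z₀ q.1 q.2)) hÊ hin).prodMk (SmoothNear.comp (g := hatMu μ z₀) (f := fun q : E × E_G ↦ q.1) hM hfst)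
  have hΨ0 : Ψ (e₀, 0) = (e₀, 0) := by
    simp only [hΨ, map_zero, h2.self_of_nhds, hatMu, hz₀', hz₀]
  have hder (v : E) (η : E_G) : fderiv ℝ Ψ (e₀, 0) (v, η) =
      (v + hatN G J z₀ e₀ η, fderiv ℝ (hatMu μ z₀) e₀ v) := by
    have d1 : HasFDerivAt (fun q : E × E_G ↦ hatN G J z₀ q.1 q.2) _ (e₀, (0 : E_G)) :=
      hN.differentiableAt.hasFDerivAt.clm_apply hasFDerivAt_snd
    have d2 := (hasFDerivAt_fst (𝕜 := ℝ) (p := (e₀, (0 : E_G)))).prodMk d1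
    have d3 : HasFDerivAt Ê (fderiv ℝ Ê (e₀, 0))
        ((fun q : E × E_G ↦ (q.1, hatN G J z₀ q.1 q.2)) (e₀, (0 : E_G))) := by
      simpa using h1.differentiableAt.hasFDerivAt
    have d4 := d3.comp (e₀, (0 : E_G)) d2
    have d5 := HasFDerivAt.comp (e₀, (0 : E_G)) (g := hatMu μ z₀)
      hM.differentiableAt.hasFDerivAt (hasFDerivAt_fst (𝕜 := ℝ) (p := (e₀, (0 : E_G))))
    have d6 := (d4.prodMk d5).fderiv
    have d7 := congrArg (fun T : E × E_G →L[ℝ] E × E_G ↦ T (v, η)) d6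
    refine (show fderiv ℝ Ψ (e₀, 0) (v, η) = _ from d7).trans ?_
    simp [h3]
  -- A kernel vector has `v = -J L η` and `dμ v = 0`. The moment equation then gives `ω(L η, J L η)
  -- = 0`, so `L η = 0` by positivity and `η = 0` by regularity.
  have hinj : Function.Injective (fderiv ℝ Ψ (e₀, (0 : E_G))) := by
    rw [injective_iff_map_eq_zero]
    rintro ⟨v, η⟩ hv
    rw [hder, Prod.mk_eq_zero] at hv
    have k1 := h.ham.moment_chart he₀ η v
    rw [hv.2, map_zero, zero_apply, eq_neg_of_add_eq_zero_left hv.1, map_neg,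
      neg_eq_zero] at k1
    have k2 : hatL (E_G := E_G) G z₀ e₀ η = 0 := by
      by_contra hne
      have k3 := hatMetric_pos h.compatible he₀ hne
      rw [hatMetric_apply] at k3
      exact k3.ne' k1
    have k4 := chartS_hatL (G := G) he₀ η
    rw [k2, map_zero, hz₀'] at k4
    have k5 := h.ham.tensorL_injective h.inner h.regular hz₀ k4.symm
    rw [k5, map_zero, add_zero] at hv
    rw [k5, hv.1, Prod.mk_zero_zero]
  have hinv : (fderiv ℝ Ψ (e₀, (0 : E_G))).IsInvertible :=
    ⟨(LinearEquiv.ofInjectiveEndo (fderiv ℝ Ψ (e₀, (0 : E_G))).toLinearMap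
      hinj).toContinuousLinearEquiv, by ext <;> rfl⟩
  obtain ⟨P, hP1, hP2, hP3⟩ := hΨs.exists_openPartialHomeomorph hinv
  have hPt : (e₀, (0 : E_G)) ∈ P.target := by
    have := P.map_source hP1
    rwa [hP2, hΨ0] at this
  have hsym : P.symm (e₀, 0) = (e₀, 0) := by
    rw [← hΨ0, ← hP2, P.left_inv hP1, hP2, hΨ0]
  have hcut : SmoothNear (fun e : E ↦ (e, (0 : E_G))) e₀ :=
    (smoothNear_id _).prodMk (smoothNear_const _ _)
  have hsec : SmoothNear (fun e : E ↦ P.symm (e, (0 : E_G))) e₀ :=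
    SmoothNear.comp (g := P.symm) (hP3 _ hPt) hcut
  refine ⟨Ê, fun e ↦ (P.symm (e, 0)).1, fun e ↦ (P.symm (e, 0)).2, h1, h2, h3, h4,
    hsec.clm_const (.fst ℝ E E_G), hsec.clm_const (.snd ℝ E E_G), congrArg Prod.fst hsym, congrArg Prod.snd hsym,
    ?_, ?_, ?_⟩
  · filter_upwards [hcut.continuousAt.eventually (P.open_target.mem_nhds hPt)] with e he
    have := P.right_inv he
    rw [hP2] at this
    exact ⟨congrArg Prod.snd this, congrArg Prod.fst this⟩
  · filter_upwards [P.open_source.mem_nhds hP1] with q hq hq0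
    have := P.left_inv hq
    rw [hP2, hΨ] at this
    simp only [hq0] at this
    simp only [this, and_self]
  · refine ⟨P.source, P.open_source.mem_nhds hP1, fun q hq q' hq' hqq ↦ P.injOn hq hq' ?_⟩
    rw [hP2, hP2]
    exact hqq

/-- `normalExp` in a chart. -/
theorem normalExp_chart {z₀ : X} {Ê : E × E → E} {e : E} {ξ : E_G} (he : e ∈ (κ z₀).target)
    (h : expAt ω_X J ((κ z₀).symm e) (chartS z₀ e (hatN G J z₀ e ξ)) =
      (κ z₀).symm (Ê (e, hatN G J z₀ e ξ))) :
    normalExp G ω_X J ((κ z₀).symm e) ξ = (κ z₀).symm (Ê (e, hatN G J z₀ e ξ)) := by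
  rw [normalExp, ← h, chartS_hatN he]

end NormalExp

/-! ### The tangent bundle in charts -/

section TangentCharts

variable {E : Type*} [NormedAddCommGroup E] [NormedSpace ℝ E]
  {X : Type*} [TopologicalSpace X] [ChartedSpace E X] [IsManifold 𝓘(ℝ, E) ∞ X]

local notation "κ" => extChartAt 𝓘(ℝ, E)

/-- The tangent vector `v` at `x`. -/
def tangentPoint (x : X) (v : E) : TangentBundle 𝓘(ℝ, E) X := ⟨x, v⟩

theorem tangentBundle_mk_eq {x y : X} {v w : E} (h : x = y) (h' : v = w) :
    (⟨x, v⟩ : TangentBundle 𝓘(ℝ, E) X) = ⟨y, w⟩ := by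
  subst h h'
  rfl

theorem tangentBundle_mem_source {x₀ : X} {p : TangentBundle 𝓘(ℝ, E) X}
    (hp : p.1 ∈ (κ x₀).source) :
    p ∈ (trivializationAt E (TangentSpace 𝓘(ℝ, E)) x₀).source := by
  rw [TangentBundle.trivializationAt_source]
  simpa using hp

theorem trivializationAt_snd {x₀ : X} {p : TangentBundle 𝓘(ℝ, E) X} (hp : p.1 ∈ (κ x₀).source) :
    (trivializationAt E (TangentSpace 𝓘(ℝ, E)) x₀ p).2 = chartT (A := E) x₀ p.1 p.2 := by
  have hp' : p.1 ∈ (chartAt E x₀).source := by simpa using hp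
  have hb : p.1 ∈ (trivializationAt E (TangentSpace 𝓘(ℝ, E)) x₀).baseSet := by simpa using hp'
  have h1 := TangentBundle.continuousLinearMapAt_trivializationAt (I := 𝓘(ℝ, E)) hp'
  have h2 := congrArg (fun T ↦ T p.2) h1
  rw [Bundle.Trivialization.continuousLinearMapAt_apply,
    Bundle.Trivialization.coe_linearMapAt_of_mem _ hb] at h2
  exact h2

/-- The fibre coordinate of the tangent bundle in the trivialization at `y₀` is the derivative of
the chart, so a map of this form has coordinates `zh` and `vh`. -/
theorem contMDiffAt_tangent_of_chart {f : X → TangentBundle 𝓘(ℝ, E) X} {x₀ y₀ : X} {zh vh : E → E}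
    {e : E} (he : e ∈ (κ x₀).target) (hz : SmoothNear zh e) (hv : SmoothNear vh e)
    (hze : zh e ∈ (κ y₀).target)
    (hf : ∀ᶠ e' in 𝓝 e, f ((κ x₀).symm e') = ⟨(κ y₀).symm (zh e'), chartS (A := E) y₀ (zh e') (vh e')⟩) :
    ContMDiffAt 𝓘(ℝ, E) 𝓘(ℝ, E).tangent ∞ f ((κ x₀).symm e) := by
  have hx := (κ x₀).map_target he
  have h0 := hf.self_of_nhds
  have hs : f ((κ x₀).symm e) ∈ (trivializationAt E (TangentSpace 𝓘(ℝ, E)) y₀).source := by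
    apply tangentBundle_mem_source
    rw [h0]
    exact (κ y₀).map_target hze
  have hright := (κ x₀).right_inv he
  have hev : ∀ᶠ y in 𝓝 ((κ x₀).symm e), f y = ⟨(κ y₀).symm (zh (κ x₀ y)),
      chartS (A := E) y₀ (zh (κ x₀ y)) (vh (κ x₀ y))⟩ ∧ zh (κ x₀ y) ∈ (κ y₀).target := by
    refine eventually_of_chart (A := E) hx ?_
    rw [hright]
    filter_upwards [hf, chart_target_mem_nhds he,
      hz.continuousAt.eventually (chart_target_mem_nhds hze)] with e' h1 h2 h3
    rw [(κ x₀).right_inv h2]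
    exact ⟨h1, h3⟩
  have hc := contMDiffAt_chart hx
  have hzc : ContMDiffAt 𝓘(ℝ, E) 𝓘(ℝ, E) ∞ (fun y ↦ zh (κ x₀ y)) ((κ x₀).symm e) := by
    refine ContMDiffAt.comp (I' := 𝓘(ℝ, E)) (g := zh) _ ?_ hc
    rw [hright]
    exact hz.contDiffAt.contMDiffAt
  have hvc : ContMDiffAt 𝓘(ℝ, E) 𝓘(ℝ, E) ∞ (fun y ↦ vh (κ x₀ y)) ((κ x₀).symm e) := by
    refine ContMDiffAt.comp (I' := 𝓘(ℝ, E)) (g := vh) _ ?_ hc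
    rw [hright]
    exact hv.contDiffAt.contMDiffAt
  refine (Bundle.Trivialization.contMDiffAt_iff hs).2 ⟨?_, ?_⟩
  · have h1 : ContMDiffAt 𝓘(ℝ, E) 𝓘(ℝ, E) ∞ (fun y ↦ (κ y₀).symm (zh (κ x₀ y))) ((κ x₀).symm e) := by
      refine ContMDiffAt.comp (I' := 𝓘(ℝ, E)) (g := (κ y₀).symm) _ ?_ hzc
      rw [hright]
      exact contMDiffAt_chart_symm hze
    refine h1.congr_of_eventuallyEq ?_
    filter_upwards [hev] with y hy
    rw [hy.1]
  · refine hvc.congr_of_eventuallyEq ?_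
    filter_upwards [hev] with y hy
    rw [hy.1, trivializationAt_snd ((κ y₀).map_target hy.2)]
    exact chartT_chartS hy.2 _

theorem contMDiffAt_of_tangent_chart {f : TangentBundle 𝓘(ℝ, E) X → X} {x₀ : X}
    {p : TangentBundle 𝓘(ℝ, E) X} {F : E × E → E} (hp : p.1 ∈ (κ x₀).source)
    (hF : SmoothNear F (κ x₀ p.1, chartT (A := E) x₀ p.1 p.2))
    (hf : ∀ᶠ q in 𝓝 (κ x₀ p.1, chartT (A := E) x₀ p.1 p.2), F q ∈ (κ x₀).target ∧
      f (⟨(κ x₀).symm q.1, chartS (A := E) x₀ q.1 q.2⟩ : TangentBundle 𝓘(ℝ, E) X) =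
        (κ x₀).symm (F q)) :
    ContMDiffAt 𝓘(ℝ, E).tangent 𝓘(ℝ, E) ∞ f p := by
  have h1 := (Bundle.Trivialization.contMDiffAt_iff (IM := 𝓘(ℝ, E).tangent) (IB := 𝓘(ℝ, E))
    (n := ∞) (f := fun q : TangentBundle 𝓘(ℝ, E) X ↦ q) (tangentBundle_mem_source hp)).1
    contMDiffAt_id
  have h2 : ContMDiffAt 𝓘(ℝ, E).tangent 𝓘(ℝ, E) ∞
      (fun q : TangentBundle 𝓘(ℝ, E) X ↦ κ x₀ q.1) p :=
    ContMDiffAt.comp (I' := 𝓘(ℝ, E)) (g := κ x₀) p (contMDiffAt_chart hp) h1.1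
  have hsrc : ∀ᶠ q : TangentBundle 𝓘(ℝ, E) X in 𝓝 p, q.1 ∈ (κ x₀).source :=
    h1.1.continuousAt.eventually (chart_source_mem_nhds hp)
  have h3 : ContMDiffAt 𝓘(ℝ, E).tangent 𝓘(ℝ, E) ∞
      (fun q : TangentBundle 𝓘(ℝ, E) X ↦ chartT (A := E) x₀ q.1 q.2) p := by
    refine h1.2.congr_of_eventuallyEq ?_
    filter_upwards [hsrc] with q hq
    exact (trivializationAt_snd hq).symm
  have h4 := h2.prodMk_space h3
  have h5 : ContMDiffAt 𝓘(ℝ, E).tangent 𝓘(ℝ, E) ∞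
      (fun q : TangentBundle 𝓘(ℝ, E) X ↦ (κ x₀).symm (F (κ x₀ q.1, chartT (A := E) x₀ q.1 q.2))) p := by
    refine ContMDiffAt.comp (I' := 𝓘(ℝ, E)) (g := (κ x₀).symm) p
      (contMDiffAt_chart_symm hf.self_of_nhds.1) ?_
    exact ContMDiffAt.comp (I' := 𝓘(ℝ, E × E)) (g := F) p hF.contDiffAt.contMDiffAt h4
  refine h5.congr_of_eventuallyEq ?_
  filter_upwards [hsrc, h4.continuousAt.eventually hf] with q hq hqf
  rw [← hqf.2]
  have h6 : chartS (A := E) x₀ (κ x₀ q.1) (chartT (A := E) x₀ q.1 q.2) = q.2 := chartS_chartT hq _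
  have h7 : (κ x₀).symm (κ x₀ q.1) = q.1 := (κ x₀).left_inv hq
  exact congrArg f (tangentBundle_mk_eq h7 h6).symm

theorem contMDiffAt_of_tangentPoint {f : TangentBundle 𝓘(ℝ, E) X → X} {x₀ x : X} {v w : E}
    {F : E × E → E} (hx : x ∈ (κ x₀).source) (hv : chartT x₀ x v = w)
    (hF : SmoothNear F (κ x₀ x, w))
    (hf : ∀ᶠ q in 𝓝 (κ x₀ x, w), F q ∈ (κ x₀).target ∧
      f (tangentPoint ((κ x₀).symm q.1) (chartS x₀ q.1 q.2)) = (κ x₀).symm (F q)) :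
    ContMDiffAt 𝓘(ℝ, E).tangent 𝓘(ℝ, E) ∞ f (tangentPoint x v) := by
  subst hv
  exact contMDiffAt_of_tangent_chart (p := tangentPoint x v) hx hF hf

end TangentCharts

/-! ### The tubular neighbourhood -/

section Tube

universe u

variable {E : Type u} [NormedAddCommGroup E] [NormedSpace ℝ E] [FiniteDimensional ℝ E]
  {X : Type*} [TopologicalSpace X] [ChartedSpace E X] [IsManifold 𝓘(ℝ, E) ∞ X] [T2Space X]
  {E_G : Type*} [NormedAddCommGroup E_G] [NormedSpace ℝ E_G] [FiniteDimensional ℝ E_G]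
  {G : Type*} [TopologicalSpace G] [ChartedSpace E_G G] [Group G] [LieGroup 𝓘(ℝ, E_G) ∞ G]
  [ConnectedSpace G] [MulAction G X] [ContMDiffSMul 𝓘(ℝ, E_G) 𝓘(ℝ, E) ∞ G X]
  {J : Π x : X, TangentSpace 𝓘(ℝ, E) x →L[ℝ] TangentSpace 𝓘(ℝ, E) x}
  {ω_X : Form E X 2} {μ : X → E_G} {B : E_G →L[ℝ] E_G →L[ℝ] ℝ}

local notation "κ" => extChartAt 𝓘(ℝ, E)

theorem IsRegular.continuous_moment (h : IsRegular G B ω_X μ J) : Continuous μ :=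
  continuousOn_univ.1 h.ham.smooth_moment.continuousOn

theorem IsRegular.isCompact_zero [CompactSpace X] (h : IsRegular G B ω_X μ J) :
    IsCompact {z | μ z = 0} :=
  (isClosed_singleton.preimage h.continuous_moment).isCompact

/-- The squared length of `J L_z ξ`. -/
def normSq (G : Type*) [TopologicalSpace G] [ChartedSpace E_G G] [Group G] [MulAction G X]
    (ω_X : Form E X 2) (J : Π x : X, TangentSpace 𝓘(ℝ, E) x →L[ℝ] TangentSpace 𝓘(ℝ, E) x)
    (z : X) (ξ : E_G) : ℝ :=
  tensorMetric ω_X J z (tensorL E E_G G z ξ) (tensorL E E_G G z ξ)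

theorem normSq_chart {x₀ : X} {e : E} (he : e ∈ (κ x₀).target) (ξ : E_G) :
    normSq G ω_X J ((κ x₀).symm e) ξ =
      hatMetric ω_X J x₀ e (hatL G x₀ e ξ) (hatL G x₀ e ξ) := by
  rw [normSq, ← tensorMetric_chart he, chartS_hatL he]

theorem IsRegular.continuousAt_normSq (h : IsRegular G B ω_X μ J) {x₀ : X} {e : E}
    (he : e ∈ (κ x₀).target) (ξ : E_G) :
    ContinuousAt (fun q : E × E_G ↦ hatMetric ω_X J x₀ q.1 (hatL G x₀ q.1 q.2)
      (hatL G x₀ q.1 q.2)) (e, ξ) := by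
  have h1 : ContinuousAt (fun q : E × E_G ↦ hatMetric ω_X J x₀ q.1) (e, ξ) :=
    ContinuousAt.comp (g := hatMetric ω_X J x₀) (f := fun q : E × E_G ↦ q.1)
      (h.compatible.smoothNear_hatMetric h.smooth he).continuousAt continuousAt_fst
  have h2 : ContinuousAt (fun q : E × E_G ↦ hatL (E_G := E_G) G x₀ q.1) (e, ξ) :=
    ContinuousAt.comp (g := hatL (E_G := E_G) G x₀) (f := fun q : E × E_G ↦ q.1)
      (smoothNear_hatL he).continuousAt continuousAt_fst
  have h3 := h2.clm_apply continuousAt_snd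
  exact (h1.clm_apply h3).clm_apply h3

theorem IsRegular.normSq_pos (h : IsRegular G B ω_X μ J) {z : X} (hz : μ z = 0) {ξ : E_G}
    (hξ : ξ ≠ 0) : 0 < normSq G ω_X J z ξ :=
  tensorMetric_pos h.compatible z fun h0 ↦
    hξ (h.ham.tensorL_injective h.inner h.regular hz h0)

theorem normSq_smul (c : ℝ) (z : X) (ξ : E_G) :
    normSq G ω_X J z (c • ξ) = c ^ 2 * normSq G ω_X J z ξ := by
  simp only [normSq, tensorMetric, map_smul, smul_apply, smul_eq_mul]
  ring

/-- A property which holds near the zero section holds in a disc bundle. -/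
theorem IsRegular.exists_radius [CompactSpace X] (h : IsRegular G B ω_X μ J)
    {P : X → E_G → Prop}
    (hP : ∀ z₀, μ z₀ = 0 → ∀ᶠ p in 𝓝 (z₀, (0 : E_G)), P p.1 p.2) :
    ∃ ε > 0, ∀ z ξ, μ z = 0 → normSq G ω_X J z ξ < ε ^ 2 → P z ξ := by
  suffices hs : ∃ ε > 0, ∀ z ∈ {z | μ z = 0}, ∀ ξ, μ z = 0 → normSq G ω_X J z ξ < ε ^ 2 → P z ξ by
    obtain ⟨ε, h1, h2⟩ := hs
    exact ⟨ε, h1, fun z ξ hz ↦ h2 z hz ξ hz⟩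
  -- Compactness of the zero level reduces the existence of a common radius to neighbourhoods of
  -- single points.
  refine h.isCompact_zero.induction_on (p := fun s ↦ ∃ ε > 0, ∀ z ∈ s, ∀ ξ, μ z = 0 →
    normSq G ω_X J z ξ < ε ^ 2 → P z ξ) ⟨1, one_pos, by simp⟩ ?_ ?_ ?_
  · rintro s t hst ⟨ε, h1, h2⟩
    exact ⟨ε, h1, fun z hz ↦ h2 z (hst hz)⟩
  · rintro s t ⟨ε, h1, h2⟩ ⟨ε', h1', h2'⟩
    have hpos := lt_min h1 h1'
    refine ⟨min ε ε', hpos, ?_⟩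
    rintro z (hz | hz) ξ hμ hξ
    · exact h2 z hz ξ hμ (hξ.trans_le (pow_le_pow_left₀ hpos.le (min_le_left _ _) 2))
    · exact h2' z hz ξ hμ (hξ.trans_le (pow_le_pow_left₀ hpos.le (min_le_right _ _) 2))
  intro z₀ hz₀
  have he₀ := mem_extChartAt_target (I := 𝓘(ℝ, E)) z₀
  have hback : (κ z₀).symm (κ z₀ z₀) = z₀ := extChartAt_to_inv z₀
  have hP₀ := hP z₀ hz₀
  rw [nhds_prod_eq, Filter.eventually_prod_iff] at hP₀
  obtain ⟨pa, hpa, pb, hpb, hab⟩ := hP₀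
  obtain ⟨r, hr, hrb⟩ := Metric.eventually_nhds_iff.1 hpb
  -- A disc of small radius in the metric has to be compared with a ball in the norm of `𝔤`,
  -- uniformly in the base point. This is done by bounding `normSq` from below on the compact sphere
  -- of radius `r / 2`, with the bound `ε` kept as a variable tending to `0`.
  have hsphere : ∀ ξ ∈ Metric.sphere (0 : E_G) (r / 2), ∀ᶠ a : (ℝ × E) × E_G in
      𝓝 (((0 : ℝ), κ z₀ z₀), ξ), a.1.1 ^ 2 <
        hatMetric ω_X J z₀ a.1.2 (hatL G z₀ a.1.2 a.2) (hatL G z₀ a.1.2 a.2) := by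
    intro ξ hξ
    have hξ0 : ξ ≠ 0 := by
      rintro rfl
      rw [mem_sphere_iff_norm, sub_zero, norm_zero] at hξ
      linarith
    have c1 : ContinuousAt (fun a : (ℝ × E) × E_G ↦ a.1.1 ^ 2) (((0 : ℝ), κ z₀ z₀), ξ) := by
      fun_prop
    have c2 : ContinuousAt (fun a : (ℝ × E) × E_G ↦ hatMetric ω_X J z₀ a.1.2
        (hatL G z₀ a.1.2 a.2) (hatL G z₀ a.1.2 a.2)) (((0 : ℝ), κ z₀ z₀), ξ) :=
      ContinuousAt.comp (g := fun q : E × E_G ↦ hatMetric ω_X J z₀ q.1 (hatL G z₀ q.1 q.2)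
        (hatL G z₀ q.1 q.2)) (f := fun a : (ℝ × E) × E_G ↦ (a.1.2, a.2))
        (h.continuousAt_normSq he₀ ξ) (by fun_prop)
    refine c1.eventually_lt c2 ?_
    simp only
    rw [← normSq_chart he₀, hback]
    simpa using h.normSq_pos (G := G) hz₀ hξ0
  have h1 := (isCompact_sphere (0 : E_G) (r / 2)).eventually_forall_of_forall_eventually
    (P := fun (a : ℝ × E) (ξ : E_G) ↦ a.1 ^ 2 <
      hatMetric ω_X J z₀ a.2 (hatL G z₀ a.2 ξ) (hatL G z₀ a.2 ξ)) hsphere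
  obtain ⟨ε, hε, hε0⟩ := ((h1.curry_nhds.filter_mono nhdsWithin_le_nhds :
    ∀ᶠ ε in 𝓝[>] (0 : ℝ), _).and self_mem_nhdsWithin).exists
  have h2 : ∀ᶠ z in 𝓝 z₀, ∀ ξ ∈ Metric.sphere (0 : E_G) (r / 2), ε ^ 2 < normSq G ω_X J z ξ := by
    refine eventually_of_chart (A := E) (mem_extChartAt_source (I := 𝓘(ℝ, E)) z₀) ?_
    filter_upwards [hε, chart_target_mem_nhds he₀] with e h3 h4 ξ hξ
    rw [normSq_chart h4]
    exact h3 ξ hξ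
  refine ⟨{z | pa z ∧ ∀ ξ ∈ Metric.sphere (0 : E_G) (r / 2), ε ^ 2 < normSq G ω_X J z ξ},
    mem_nhdsWithin_of_mem_nhds (hpa.and h2), ε, hε0, ?_⟩
  rintro z ⟨hz1, hz2⟩ ξ hμ hξ
  refine hab hz1 (hrb ?_)
  rw [dist_zero_right]
  by_contra hlt
  rw [not_lt] at hlt
  have hn : 0 < ‖ξ‖ := hr.trans_le hlt
  -- If `‖ξ‖ ≥ r`, shrinking `ξ` to the sphere only decreases `normSq`, which contradicts the lower
  -- bound there.
  have h3 := hz2 ((r / 2 / ‖ξ‖) • ξ) (by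
    rw [mem_sphere_iff_norm, sub_zero, norm_smul, Real.norm_of_nonneg (by positivity),
      div_mul_cancel₀ _ hn.ne'])
  rw [normSq_smul] at h3
  have h4 : (r / 2 / ‖ξ‖) ^ 2 ≤ 1 := by
    apply pow_le_one₀ (by positivity)
    rw [div_le_one hn]
    linarith
  have h5 : 0 < normSq G ω_X J z ξ := h.normSq_pos hμ (norm_pos_iff.1 hn)
  nlinarith

end Tube

/-! ### Local sections and injectivity of the normal exponential map -/

section TubeRadius

universe u

variable {E : Type u} [NormedAddCommGroup E] [NormedSpace ℝ E] [FiniteDimensional ℝ E]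
  {X : Type*} [TopologicalSpace X] [ChartedSpace E X] [IsManifold 𝓘(ℝ, E) ∞ X] [T2Space X]
  {E_G : Type*} [NormedAddCommGroup E_G] [NormedSpace ℝ E_G] [FiniteDimensional ℝ E_G]
  {G : Type*} [TopologicalSpace G] [ChartedSpace E_G G] [Group G] [LieGroup 𝓘(ℝ, E_G) ∞ G]
  [ConnectedSpace G] [MulAction G X] [ContMDiffSMul 𝓘(ℝ, E_G) 𝓘(ℝ, E) ∞ G X]
  {J : Π x : X, TangentSpace 𝓘(ℝ, E) x →L[ℝ] TangentSpace 𝓘(ℝ, E) x}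
  {ω_X : Form E X 2} {μ : X → E_G} {B : E_G →L[ℝ] E_G →L[ℝ] ℝ}

local notation "κ" => extChartAt 𝓘(ℝ, E)

theorem chartT_normalVec {x₀ z : X} (hz : z ∈ (κ x₀).source) (ξ : E_G) :
    chartT x₀ z (normalVec G J z ξ) = hatN G J x₀ (κ x₀ z) ξ := by
  have h1 := chartS_hatN (G := G) (J := J) ((κ x₀).map_source hz) ξ
  rw [(κ x₀).left_inv hz] at h1
  have h2 := chartT_chartS ((κ x₀).map_source hz) (hatN G J x₀ (κ x₀ z) ξ)
  rw [h1, (κ x₀).left_inv hz] at h2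
  exact h2

/-- In the chart around `x₀`, `e ↦ (zh e, ξh e)` is near `e` a smooth section of the normal
exponential map. -/
structure IsNormalSection (G : Type*) [TopologicalSpace G] [ChartedSpace E_G G] [Group G]
    [MulAction G X] (ω_X : Form E X 2) (μ : X → E_G)
    (J : Π x : X, TangentSpace 𝓘(ℝ, E) x →L[ℝ] TangentSpace 𝓘(ℝ, E) x)
    (x₀ : X) (zh : E → E) (ξh : E → E_G) (e : E) : Prop where
  mem : e ∈ (κ x₀).target
  zh_mem : zh e ∈ (κ x₀).target
  smooth_zh : SmoothNear zh e
  smooth_ξh : SmoothNear ξh e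
  level : hatMu μ x₀ (zh e) = 0
  exp_eq : normalExp G ω_X J ((κ x₀).symm (zh e)) (ξh e) = (κ x₀).symm e

theorem eventually_zero_section {z₀ : X} {Q : E × E_G → Prop}
    (hQ : ∀ᶠ q in 𝓝 (κ z₀ z₀, (0 : E_G)), Q q) :
    ∀ᶠ p in 𝓝 (z₀, (0 : E_G)), p.1 ∈ (κ z₀).source ∧ Q (κ z₀ p.1, p.2) := by
  have hs := mem_extChartAt_source (I := 𝓘(ℝ, E)) z₀
  have c1 : ContinuousAt (fun p : X × E_G ↦ (κ z₀ p.1, p.2)) (z₀, (0 : E_G)) :=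
    (ContinuousAt.comp (g := κ z₀) (f := fun p : X × E_G ↦ p.1) (chart_continuousAt hs)
      continuousAt_fst).prodMk continuousAt_snd
  filter_upwards [continuousAt_fst.eventually (chart_source_mem_nhds (A := E) hs),
    c1.eventually hQ] with p h1 h2 using ⟨h1, h2⟩

theorem IsRegular.continuousAt_hatN (h : IsRegular G B ω_X μ J) {z₀ : X} {e : E}
    (he : e ∈ (κ z₀).target) :
    Tendsto (fun q : E × E_G ↦ (q.1, hatN G J z₀ q.1 q.2)) (𝓝 (e, 0)) (𝓝 (e, 0)) := by
  have c1 : ContinuousAt (fun q : E × E_G ↦ hatN (E_G := E_G) G J z₀ q.1) (e, (0 : E_G)) :=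
    ContinuousAt.comp (g := hatN (E_G := E_G) G J z₀) (f := fun q : E × E_G ↦ q.1)
      (h.smoothNear_hatN he).continuousAt continuousAt_fst
  have c2 := (continuousAt_fst (p := (e, (0 : E_G)))).prodMk (c1.clm_apply continuousAt_snd)
  have c3 := c2.tendsto
  simpa using c3

/-- Local sections of the normal exponential map. -/
theorem IsRegular.exists_normal_section (h : IsRegular G B ω_X μ J) {z₀ : X} (hz₀ : μ z₀ = 0) :
    ∃ (Ê : E × E → E) (zh : E → E) (ξh : E → E_G),
      SmoothNear Ê (κ z₀ z₀, 0) ∧ (∀ᶠ e in 𝓝 (κ z₀ z₀), Ê (e, 0) = e) ∧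
      (∀ a b, fderiv ℝ Ê (κ z₀ z₀, 0) (a, b) = a + b) ∧
      (∀ᶠ p in 𝓝 (κ z₀ z₀, (0 : E)), p.1 ∈ (κ z₀).target ∧ Ê p ∈ (κ z₀).target ∧
        expAt ω_X J ((κ z₀).symm p.1) (chartS z₀ p.1 p.2) = (κ z₀).symm (Ê p)) ∧
      zh (κ z₀ z₀) = κ z₀ z₀ ∧ ξh (κ z₀ z₀) = 0 ∧
      (∀ᶠ e in 𝓝 (κ z₀ z₀), IsNormalSection G ω_X μ J z₀ zh ξh e ∧
        Ê (zh e, hatN G J z₀ (zh e) (ξh e)) = e) ∧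
      (∀ᶠ p in 𝓝 (z₀, (0 : E_G)), p.1 ∈ (κ z₀).source ∧
        normalExp G ω_X J p.1 p.2 ∈ (κ z₀).source ∧
        κ z₀ (normalExp G ω_X J p.1 p.2) = Ê (κ z₀ p.1, hatN G J z₀ (κ z₀ p.1) p.2)) ∧
      (∀ᶠ p in 𝓝 (z₀, (0 : E_G)), μ p.1 = 0 →
        zh (κ z₀ (normalExp G ω_X J p.1 p.2)) = κ z₀ p.1 ∧
        ξh (κ z₀ (normalExp G ω_X J p.1 p.2)) = p.2) ∧
      ∃ u ∈ 𝓝 (z₀, (0 : E_G)),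
        InjOn (fun p : X × E_G ↦ (normalExp G ω_X J p.1 p.2, μ p.1)) u := by
  have he₀ := mem_extChartAt_target (I := 𝓘(ℝ, E)) z₀
  have hs₀ := mem_extChartAt_source (I := 𝓘(ℝ, E)) z₀
  obtain ⟨Ê, zh, ξh, h1, h2, h3, h4, h5, h6, h7, h8, h9, h10, u, hu, hinj⟩ :=
    h.exists_normal_chart hz₀
  have h4' := (h.continuousAt_hatN he₀).eventually h4
  have hexp : ∀ᶠ p in 𝓝 (z₀, (0 : E_G)), p.1 ∈ (κ z₀).source ∧
      normalExp G ω_X J p.1 p.2 ∈ (κ z₀).source ∧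
      κ z₀ (normalExp G ω_X J p.1 p.2) = Ê (κ z₀ p.1, hatN G J z₀ (κ z₀ p.1) p.2) := by
    filter_upwards [eventually_zero_section h4'] with p ⟨k1, k2, k3, k4⟩
    have k5 := normalExp_chart k2 k4
    rw [(κ z₀).left_inv k1] at k5
    rw [k5]
    exact ⟨k1, (κ z₀).map_target k3, (κ z₀).right_inv k3⟩
  refine ⟨Ê, zh, ξh, h1, h2, h3, h4, h7, h8, ?_, hexp, ?_, ?_⟩
  · have c1 : Tendsto (fun e ↦ (zh e, ξh e)) (𝓝 (κ z₀ z₀)) (𝓝 (κ z₀ z₀, 0)) := by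
      have := (h5.continuousAt.prodMk h6.continuousAt).tendsto
      rwa [h7, h8] at this
    filter_upwards [c1.eventually h4', h9, h5.eventually, h6.eventually,
      chart_target_mem_nhds he₀] with e ⟨k1, k2, k3⟩ ⟨k4, k5⟩ k6 k7 k8
    refine ⟨⟨k8, k1, k6, k7, k4, ?_⟩, k5⟩
    have k9 := normalExp_chart k1 k3
    rw [k5] at k9
    exact k9
  · filter_upwards [hexp, eventually_zero_section h10] with p ⟨k1, k2, k3⟩ ⟨_, k4⟩ k5
    rw [k3]
    apply k4
    rw [hatMu, (κ z₀).left_inv k1, k5]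
  · refine ⟨_, hexp.and (eventually_zero_section hu), ?_⟩
    rintro p ⟨⟨k1, k2, k3⟩, ⟨_, k4⟩⟩ p' ⟨⟨k1', k2', k3'⟩, ⟨_, k4'⟩⟩ hpp
    simp only [Prod.mk.injEq] at hpp
    have k5 : (κ z₀ p.1, p.2) = (κ z₀ p'.1, p'.2) := by
      refine hinj k4 k4' ?_
      simp only [hatMu]
      rw [← k3, ← k3', (κ z₀).left_inv k1, (κ z₀).left_inv k1', hpp.1, hpp.2]
    obtain ⟨k6, k7⟩ := Prod.mk.inj k5
    exact Prod.ext ((κ z₀).injOn k1 k1' k6) k7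

/-- On the disc bundle of radius `ε` the exponential map is injective, smooth, and has smooth local
sections. -/
structure IsTubeRadius (G : Type*) [TopologicalSpace G] [ChartedSpace E_G G] [Group G]
    [MulAction G X] (ω_X : Form E X 2) (μ : X → E_G)
    (J : Π x : X, TangentSpace 𝓘(ℝ, E) x →L[ℝ] TangentSpace 𝓘(ℝ, E) x) (ε : ℝ) : Prop where
  pos : 0 < ε
  injective : ∀ {z z' : X} {ξ ξ' : E_G}, μ z = 0 → normSq G ω_X J z ξ < ε ^ 2 → μ z' = 0 →
    normSq G ω_X J z' ξ' < ε ^ 2 → normalExp G ω_X J z ξ = normalExp G ω_X J z' ξ' →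
    z = z' ∧ ξ = ξ'
  exists_section : ∀ {z : X} {ξ : E_G}, μ z = 0 → normSq G ω_X J z ξ < ε ^ 2 →
    ∃ (x₀ : X) (zh : E → E) (ξh : E → E_G), normalExp G ω_X J z ξ ∈ (κ x₀).source ∧
      z ∈ (κ x₀).source ∧ zh (κ x₀ (normalExp G ω_X J z ξ)) = κ x₀ z ∧
      ξh (κ x₀ (normalExp G ω_X J z ξ)) = ξ ∧
      ∀ᶠ e in 𝓝 (κ x₀ (normalExp G ω_X J z ξ)), IsNormalSection G ω_X μ J x₀ zh ξh e
  smooth : ∀ {z : X} {ξ : E_G}, μ z = 0 → normSq G ω_X J z ξ < ε ^ 2 →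
    ContMDiffAt 𝓘(ℝ, E).tangent 𝓘(ℝ, E) ∞ (expMap ω_X J)
      (tangentPoint z (normalVec G J z ξ))

theorem normalExp_zero_of_chart {z₀ : X} {p : X × E_G} {Ê : E × E → E}
    (h : p.1 ∈ (κ z₀).source ∧ normalExp G ω_X J p.1 p.2 ∈ (κ z₀).source ∧
        κ z₀ (normalExp G ω_X J p.1 p.2) = Ê (κ z₀ p.1, hatN G J z₀ (κ z₀ p.1) p.2)) :
    normalExp G ω_X J p.1 p.2 = (κ z₀).symm (Ê (κ z₀ p.1, hatN G J z₀ (κ z₀ p.1) p.2)) := by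
  rw [← h.2.2, (κ z₀).left_inv h.2.1]

theorem IsRegular.normalExp_zero (h : IsRegular G B ω_X μ J) {z : X} (hz : μ z = 0) :
    normalExp G ω_X J z (0 : E_G) = z := by
  obtain ⟨Ê, zh, ξh, h1, h2, h3, h4, h5, h6, h7, h8, h9, h10⟩ := h.exists_normal_section hz
  have h11 := normalExp_zero_of_chart h8.self_of_nhds
  simp only [map_zero, h2.self_of_nhds] at h11
  exact h11.trans (extChartAt_to_inv z)

theorem IsRegular.continuousAt_normalExp (h : IsRegular G B ω_X μ J) {z : X} (hz : μ z = 0) :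
    Tendsto (fun p : X × E_G ↦ normalExp G ω_X J p.1 p.2) (𝓝 (z, 0)) (𝓝 z) := by
  have he := mem_extChartAt_target (I := 𝓘(ℝ, E)) z
  have hs := mem_extChartAt_source (I := 𝓘(ℝ, E)) z
  obtain ⟨Ê, zh, ξh, h1, h2, h3, h4, h5, h6, h7, h8, h9, h10⟩ := h.exists_normal_section hz
  have c1 : Tendsto (fun p : X × E_G ↦ (κ z p.1, p.2)) (𝓝 (z, (0 : E_G))) (𝓝 (κ z z, 0)) :=
    ((ContinuousAt.comp (g := κ z) (f := fun p : X × E_G ↦ p.1) (x := (z, (0 : E_G)))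
      (chart_continuousAt hs) continuousAt_fst).prodMk continuousAt_snd).tendsto
  have c2 : Tendsto Ê (𝓝 (κ z z, 0)) (𝓝 (κ z z)) := by
    have := h1.continuousAt.tendsto
    rwa [h2.self_of_nhds] at this
  have c3 : Tendsto (κ z).symm (𝓝 (κ z z)) (𝓝 z) := by
    have := (chart_continuousAt_symm he).tendsto
    rwa [extChartAt_to_inv] at this
  refine (c3.comp (c2.comp ((h.continuousAt_hatN he).comp c1))).congr' ?_
  filter_upwards [h8] with p hp
  exact (normalExp_zero_of_chart hp).symm

/-- The map `(z, ξ) ↦ (exp_z (J L_z ξ), μ z)` is injective on the compact zero section over `μ⁻¹(0)`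
and locally injective at each of its points, hence injective near it. The component `μ z` is what
makes local injectivity true, as `z` varies in `X` and not only in the level set. -/
theorem IsRegular.exists_isTubeRadius [CompactSpace X] (h : IsRegular G B ω_X μ J) :
    ∃ ε, IsTubeRadius G ω_X μ J ε := by
  have hK : IsCompact ({z | μ z = 0} ×ˢ {(0 : E_G)}) := h.isCompact_zero.prod isCompact_singleton
  obtain ⟨t, ht, hinj⟩ := InjOn.exists_mem_nhdsSet
    (f := fun p : X × E_G ↦ (normalExp G ω_X J p.1 p.2, μ p.1)) (s := {z | μ z = 0} ×ˢ {(0 : E_G)})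
    (by
      rintro ⟨z, ξ⟩ ⟨hz, rfl : ξ = 0⟩ ⟨z', ξ'⟩ ⟨hz', rfl : ξ' = 0⟩ hzz
      have := congrArg Prod.fst hzz
      simp only at this
      rw [h.normalExp_zero hz, h.normalExp_zero hz'] at this
      exact Prod.ext this rfl) hK
    (by
      rintro ⟨z, ξ⟩ ⟨hz, rfl : ξ = 0⟩
      refine ContinuousAt.prodMk ?_ (h.continuous_moment.comp continuous_fst).continuousAt
      have := h.continuousAt_normalExp hz
      rw [ContinuousAt]
      simp only
      rwa [h.normalExp_zero hz])
    (by
      rintro ⟨z, ξ⟩ ⟨hz, rfl : ξ = 0⟩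
      obtain ⟨Ê, zh, ξh, h1, h2, h3, h4, h5, h6, h7, h8, h9, h10⟩ := h.exists_normal_section hz
      exact h10)
  rw [mem_nhdsSet_iff_forall] at ht
  obtain ⟨ε, hε, hP⟩ := h.exists_radius (P := fun z ξ ↦ (z, ξ) ∈ t ∧ (μ z = 0 →
    ∃ (x₀ : X) (zh : E → E) (ξh : E → E_G), normalExp G ω_X J z ξ ∈ (κ x₀).source ∧
      z ∈ (κ x₀).source ∧ zh (κ x₀ (normalExp G ω_X J z ξ)) = κ x₀ z ∧
      ξh (κ x₀ (normalExp G ω_X J z ξ)) = ξ ∧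
      ∀ᶠ e in 𝓝 (κ x₀ (normalExp G ω_X J z ξ)), IsNormalSection G ω_X μ J x₀ zh ξh e) ∧
    ContMDiffAt 𝓘(ℝ, E).tangent 𝓘(ℝ, E) ∞ (expMap ω_X J)
      (tangentPoint z (normalVec G J z ξ))) (by
    intro z₀ hz₀
    have he₀ := mem_extChartAt_target (I := 𝓘(ℝ, E)) z₀
    obtain ⟨Ê, zh, ξh, h1, h2, h3, h4, h5, h6, h7, h8, h9, h10⟩ := h.exists_normal_section hz₀
    have h7' : ∀ᶠ y in 𝓝 z₀, ∀ᶠ e in 𝓝 (κ z₀ y), IsNormalSection G ω_X μ J z₀ zh ξh e :=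
      (chart_continuousAt (mem_extChartAt_source (I := 𝓘(ℝ, E)) z₀)).eventually
        (h7.mono fun e he ↦ he.1).eventually_nhds
    have hÊ := (h.continuousAt_hatN he₀).eventually h1.eventually
    have h4' := (h.continuousAt_hatN he₀).eventually h4.eventually_nhds
    filter_upwards [ht (z₀, 0) ⟨hz₀, rfl⟩, h8, h9, (h.continuousAt_normalExp hz₀).eventually h7',
      eventually_zero_section hÊ, eventually_zero_section h4'] with p k1 k2 k3 k4 k5 k6
    refine ⟨k1, fun k7 ↦ ⟨z₀, zh, ξh, k2.2.1, k2.1, (k3 k7).1, (k3 k7).2, k4⟩, ?_⟩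
    have k8 : chartT (A := E) z₀ p.1 (normalVec G J p.1 p.2) = hatN G J z₀ (κ z₀ p.1) p.2 :=
      chartT_normalVec k2.1 p.2
    refine contMDiffAt_of_tangentPoint (x₀ := z₀) (F := Ê) k2.1 k8 k5.2 ?_
    filter_upwards [k6.2] with q hq using hq.2)
  exact ⟨ε, hε, fun hz hξ hz' hξ' heq ↦ Prod.mk.inj (hinj (hP _ _ hz hξ).1 (hP _ _ hz' hξ').1
    (Prod.ext heq (hz.trans hz'.symm))), fun hz hξ ↦ (hP _ _ hz hξ).2.1 hz,
    fun hz hξ ↦ (hP _ _ hz hξ).2.2⟩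

end TubeRadius

/-! ### Disc bundles below the tube radius -/

section IsTube

universe u

variable {E : Type u} [NormedAddCommGroup E] [NormedSpace ℝ E] [FiniteDimensional ℝ E]
  {X : Type*} [TopologicalSpace X] [ChartedSpace E X] [IsManifold 𝓘(ℝ, E) ∞ X] [T2Space X]
  {E_G : Type*} [NormedAddCommGroup E_G] [NormedSpace ℝ E_G] [FiniteDimensional ℝ E_G]
  {G : Type*} [TopologicalSpace G] [ChartedSpace E_G G] [Group G] [LieGroup 𝓘(ℝ, E_G) ∞ G]
  [ConnectedSpace G] [MulAction G X] [ContMDiffSMul 𝓘(ℝ, E_G) 𝓘(ℝ, E) ∞ G X]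
  {J : Π x : X, TangentSpace 𝓘(ℝ, E) x →L[ℝ] TangentSpace 𝓘(ℝ, E) x}
  {ω_X : Form E X 2} {μ : X → E_G} {B : E_G →L[ℝ] E_G →L[ℝ] ℝ}

local notation "κ" => extChartAt 𝓘(ℝ, E)

theorem IsRegular.mem_tube_iff (h : IsRegular G B ω_X μ J) {ε : ℝ}
    {p : TangentBundle 𝓘(ℝ, E) X} : p ∈ tube G ω_X J μ ε ↔
      ∃ (z : X) (ξ : E_G), p = tangentPoint z (normalVec G J z ξ) ∧ μ z = 0 ∧
        normSq G ω_X J z ξ < ε ^ 2 := by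
  constructor
  · obtain ⟨z, v⟩ := p
    intro hp
    obtain ⟨h1, ⟨ξ, h2⟩, h3⟩ := NormalForm.mem_tube_iff.1 hp
    rw [h2, h.tensorMetric_normalVec] at h3
    exact ⟨z, ξ, tangentBundle_mk_eq rfl h2, h1, h3⟩
  · rintro ⟨z, ξ, rfl, h1, h2⟩
    refine NormalForm.mem_tube_iff.2 ⟨h1, ⟨ξ, rfl⟩, ?_⟩
    rwa [h.tensorMetric_normalVec]

theorem IsRegular.mem_tubeImage_iff (h : IsRegular G B ω_X μ J) {ε : ℝ} {y : X} :
    y ∈ tubeImage G ω_X J μ ε ↔ ∃ (z : X) (ξ : E_G), μ z = 0 ∧ normSq G ω_X J z ξ < ε ^ 2 ∧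
      normalExp G ω_X J z ξ = y := by
  constructor
  · rintro ⟨p, hp, rfl⟩
    obtain ⟨z, ξ, rfl, h1, h2⟩ := h.mem_tube_iff.1 hp
    exact ⟨z, ξ, h1, h2, rfl⟩
  · rintro ⟨z, ξ, h1, h2, rfl⟩
    exact ⟨_, h.mem_tube_iff.2 ⟨z, ξ, rfl, h1, h2⟩, rfl⟩

theorem IsRegular.tubeInv_normalExp (h : IsRegular G B ω_X μ J) {ε₁ ε : ℝ}
    (hr : IsTubeRadius G ω_X μ J ε₁) (h0 : 0 < ε) (hε : ε ≤ ε₁) {z : X} {ξ : E_G} (hz : μ z = 0)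
    (hξ : normSq G ω_X J z ξ < ε ^ 2) :
    tubeInv G ω_X J μ ε (normalExp G ω_X J z ξ) = tangentPoint z (normalVec G J z ξ) := by
  have hex : ∃ p ∈ tube G ω_X J μ ε, expMap ω_X J p = normalExp G ω_X J z ξ :=
    ⟨_, h.mem_tube_iff.2 ⟨z, ξ, rfl, hz, hξ⟩, rfl⟩
  rw [tubeInv, dif_pos hex]
  obtain ⟨h1, h2⟩ := hex.choose_spec
  obtain ⟨z', ξ', h3, h4, h5⟩ := h.mem_tube_iff.1 h1
  rw [h3] at h2 ⊢
  have hle : ε ^ 2 ≤ ε₁ ^ 2 := pow_le_pow_left₀ h0.le hε 2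
  obtain ⟨rfl, rfl⟩ := hr.injective h4 (h5.trans_le hle) hz (hξ.trans_le hle) h2
  rfl

/-- The inverse of the exponential map on the tube in terms of local sections. -/
theorem IsRegular.exists_tubeInv_chart (h : IsRegular G B ω_X μ J) {ε₁ ε : ℝ}
    (hr : IsTubeRadius G ω_X μ J ε₁) (h0 : 0 < ε) (hε : ε ≤ ε₁) {y : X}
    (hy : y ∈ tubeImage G ω_X J μ ε) :
    ∃ (x₀ : X) (zh : E → E) (ξh : E → E_G), y ∈ (κ x₀).source ∧
      ∀ᶠ e in 𝓝 (κ x₀ y), IsNormalSection G ω_X μ J x₀ zh ξh e ∧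
        (κ x₀).symm e ∈ tubeImage G ω_X J μ ε ∧
        tubeInv G ω_X J μ ε ((κ x₀).symm e) =
          tangentPoint ((κ x₀).symm (zh e)) (chartS x₀ (zh e) (hatN G J x₀ (zh e) (ξh e))) := by
  obtain ⟨z, ξ, hz, hξ, rfl⟩ := h.mem_tubeImage_iff.1 hy
  have hle : ε ^ 2 ≤ ε₁ ^ 2 := pow_le_pow_left₀ h0.le hε 2
  obtain ⟨x₀, zh, ξh, h1, h2, h3, h4, h5⟩ := hr.exists_section hz (hξ.trans_le hle)
  refine ⟨x₀, zh, ξh, h1, ?_⟩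
  have h6 := h5.self_of_nhds
  have c1 : ContinuousAt (fun e ↦ (zh e, ξh e)) (κ x₀ (normalExp G ω_X J z ξ)) :=
    h6.smooth_zh.continuousAt.prodMk h6.smooth_ξh.continuousAt
  have c2 := ContinuousAt.comp (g := fun q : E × E_G ↦ hatMetric ω_X J x₀ q.1 (hatL G x₀ q.1 q.2)
      (hatL G x₀ q.1 q.2)) (f := fun e ↦ (zh e, ξh e)) (x := κ x₀ (normalExp G ω_X J z ξ))
      (h.continuousAt_normSq h6.zh_mem _) c1
  have h7 := c2.eventually_lt (continuousAt_const (y := ε ^ 2)) (by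
    simp only [Function.comp_apply]
    rw [← normSq_chart h6.zh_mem, h3, h4, (κ x₀).left_inv h2]
    exact hξ)
  filter_upwards [h5, h7] with e k1 k2
  simp only [Function.comp_apply] at k2
  rw [← normSq_chart k1.zh_mem] at k2
  refine ⟨k1, h.mem_tubeImage_iff.2 ⟨_, _, k1.level, k2, k1.exp_eq⟩, ?_⟩
  rw [← k1.exp_eq, h.tubeInv_normalExp hr h0 hε k1.level k2, chartS_hatN k1.zh_mem]

theorem IsRegular.isOpen_tubeImage (h : IsRegular G B ω_X μ J) {ε₁ ε : ℝ}
    (hr : IsTubeRadius G ω_X μ J ε₁) (h0 : 0 < ε) (hε : ε ≤ ε₁) :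
    IsOpen (tubeImage G ω_X J μ ε) := by
  rw [isOpen_iff_mem_nhds]
  intro y hy
  obtain ⟨x₀, zh, ξh, h1, h2⟩ := h.exists_tubeInv_chart hr h0 hε hy
  exact eventually_of_chart (A := E) h1 (h2.mono fun e he ↦ he.2.1)

theorem IsRegular.contMDiffAt_tubeInv (h : IsRegular G B ω_X μ J) {ε₁ ε : ℝ}
    (hr : IsTubeRadius G ω_X μ J ε₁) (h0 : 0 < ε) (hε : ε ≤ ε₁) {y : X}
    (hy : y ∈ tubeImage G ω_X J μ ε) :
    ContMDiffAt 𝓘(ℝ, E) 𝓘(ℝ, E).tangent ∞ (tubeInv G ω_X J μ ε) y := by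
  obtain ⟨x₀, zh, ξh, h1, h2⟩ := h.exists_tubeInv_chart hr h0 hε hy
  have h3 := h2.self_of_nhds.1
  have h4 := contMDiffAt_tangent_of_chart (f := tubeInv G ω_X J μ ε) (y₀ := x₀)
    (vh := fun e ↦ hatN G J x₀ (zh e) (ξh e)) h3.mem h3.smooth_zh
    (((SmoothNear.comp (g := hatN (E_G := E_G) G J x₀) (h.smoothNear_hatN h3.zh_mem)
      h3.smooth_zh)).clm_apply h3.smooth_ξh) h3.zh_mem (h2.mono fun e he ↦ he.2.2)
  rwa [(κ x₀).left_inv h1] at h4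

theorem IsRegular.normSq_smul (h : IsRegular G B ω_X μ J) (g : G) (z : X) (ξ : E_G) :
    normSq G ω_X J (g • z) (Ad g ξ) = normSq G ω_X J z ξ := by
  have h1 : tensorL E E_G G (g • z) (Ad g ξ) = smulT E g z (tensorL E E_G G z ξ) := L_smul g z ξ
  rw [normSq, h1, tensorMetric_smul h.ham h.compatible, normSq]

theorem IsRegular.normalExp_smul (h : IsRegular G B ω_X μ J) (g : G) (z : X) (ξ : E_G) :
    normalExp G ω_X J (g • z) (Ad g ξ) = g • normalExp G ω_X J z ξ := by
  rw [normalExp, normalExp, normalVec_smul h.compatible, h.ham.expMap_smul h.compatible]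

theorem IsRegular.isTube (h : IsRegular G B ω_X μ J) {ε₁ ε : ℝ}
    (hr : IsTubeRadius G ω_X μ J ε₁) (h0 : 0 < ε) (hε : ε ≤ ε₁) : IsTube G ω_X J μ ε := by
  have hle : ε ^ 2 ≤ ε₁ ^ 2 := pow_le_pow_left₀ h0.le hε 2
  refine ⟨?_, h.isOpen_tubeImage hr h0 hε, ?_,
    fun y hy ↦ (h.contMDiffAt_tubeInv hr h0 hε hy).contMDiffWithinAt, ?_⟩
  · intro p hp p' hp' hpp
    obtain ⟨z, ξ, rfl, hz, hξ⟩ := h.mem_tube_iff.1 hp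
    obtain ⟨z', ξ', rfl, hz', hξ'⟩ := h.mem_tube_iff.1 hp'
    obtain ⟨rfl, rfl⟩ := hr.injective hz (hξ.trans_le hle) hz' (hξ'.trans_le hle) hpp
    rfl
  · intro p hp
    obtain ⟨z, ξ, rfl, hz, hξ⟩ := h.mem_tube_iff.1 hp
    exact (hr.smooth hz (hξ.trans_le hle)).contMDiffWithinAt
  · intro g p hp
    obtain ⟨z, ξ, rfl, hz, hξ⟩ := h.mem_tube_iff.1 hp
    have h1 : tangentMap 𝓘(ℝ, E) 𝓘(ℝ, E) (fun x : X ↦ g • x)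
        (tangentPoint z (normalVec G J z ξ)) =
        tangentPoint (g • z) (smulT E g z (normalVec G J z ξ)) := rfl
    rw [h1, ← normalVec_smul h.compatible]
    refine ⟨h.mem_tube_iff.2 ⟨_, _, rfl, h.ham.smul_eq_zero g hz, ?_⟩, h.normalExp_smul g z ξ⟩
    rwa [h.normSq_smul]

theorem tubeImage_mono {ε ε' : ℝ} (h0 : 0 < ε) (hε : ε ≤ ε') :
    tubeImage G ω_X J μ ε ⊆ tubeImage G ω_X J μ ε' := by
  rintro y ⟨p, ⟨h1, h2, h3⟩, rfl⟩
  exact ⟨p, ⟨h1, h2, h3.trans_le (pow_le_pow_left₀ h0.le hε 2)⟩, rfl⟩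

/-- By injectivity on the large disc bundle, the preimage of a point does not depend on the radius.
The objects built from `tubeInv` may thus be studied for one fixed radius. -/
theorem IsRegular.tubeInv_eq (h : IsRegular G B ω_X μ J) {ε₁ ε : ℝ}
    (hr : IsTubeRadius G ω_X μ J ε₁) (h0 : 0 < ε) (hε : ε ≤ ε₁) {y : X}
    (hy : y ∈ tubeImage G ω_X J μ ε) : tubeInv G ω_X J μ ε y = tubeInv G ω_X J μ ε₁ y := by
  obtain ⟨z, ξ, hz, hξ, rfl⟩ := h.mem_tubeImage_iff.1 hy
  rw [h.tubeInv_normalExp hr h0 hε hz hξ, h.tubeInv_normalExp hr hr.pos le_rfl hz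
    (hξ.trans_le (pow_le_pow_left₀ h0.le hε 2))]

/-- This turns statements proved in charts around points of the zero level into statements on a
whole tube. -/
theorem IsRegular.exists_tubeImage_subset [CompactSpace X] (h : IsRegular G B ω_X μ J)
    {Q : X → Prop} (hQ : ∀ z, μ z = 0 → ∀ᶠ y in 𝓝 z, Q y) :
    ∃ ε > 0, ∀ y ∈ tubeImage G ω_X J μ ε, Q y := by
  obtain ⟨ε, h0, h1⟩ := h.exists_radius (P := fun z ξ ↦ Q (normalExp G ω_X J z ξ))
    fun z hz ↦ (h.continuousAt_normalExp hz).eventually (hQ z hz)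
  refine ⟨ε, h0, fun y hy ↦ ?_⟩
  obtain ⟨z, ξ, hz, hξ, rfl⟩ := h.mem_tubeImage_iff.1 hy
  exact h1 z ξ hz hξ

theorem IsRegular.mem_tubeImage (h : IsRegular G B ω_X μ J) {ε : ℝ} (h0 : 0 < ε) {z : X}
    (hz : μ z = 0) : z ∈ tubeImage G ω_X J μ ε := by
  refine h.mem_tubeImage_iff.2 ⟨z, 0, hz, ?_, h.normalExp_zero hz⟩
  rw [normSq, map_zero, tensorMetric, map_zero, zero_apply]
  positivity

theorem IsRegular.smul_mem_tubeImage (h : IsRegular G B ω_X μ J) {ε : ℝ} (g : G) {y : X}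
    (hy : y ∈ tubeImage G ω_X J μ ε) : g • y ∈ tubeImage G ω_X J μ ε := by
  obtain ⟨z, ξ, hz, hξ, rfl⟩ := h.mem_tubeImage_iff.1 hy
  exact h.mem_tubeImage_iff.2 ⟨g • z, Ad g ξ, h.ham.smul_eq_zero g hz,
    by rwa [h.normSq_smul], h.normalExp_smul g z ξ⟩

end IsTube

/-! ### The tubular neighbourhood in charts -/

section TubeChart

universe u

variable {E : Type u} [NormedAddCommGroup E] [NormedSpace ℝ E] [FiniteDimensional ℝ E]
  {X : Type*} [TopologicalSpace X] [ChartedSpace E X] [IsManifold 𝓘(ℝ, E) ∞ X] [T2Space X]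
  {E_G : Type*} [NormedAddCommGroup E_G] [NormedSpace ℝ E_G] [FiniteDimensional ℝ E_G]
  {G : Type*} [TopologicalSpace G] [ChartedSpace E_G G] [Group G] [LieGroup 𝓘(ℝ, E_G) ∞ G]
  [ConnectedSpace G] [MulAction G X] [ContMDiffSMul 𝓘(ℝ, E_G) 𝓘(ℝ, E) ∞ G X]
  {J : Π x : X, TangentSpace 𝓘(ℝ, E) x →L[ℝ] TangentSpace 𝓘(ℝ, E) x}
  {ω_X : Form E X 2} {μ : X → E_G} {B : E_G →L[ℝ] E_G →L[ℝ] ℝ}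

local notation "κ" => extChartAt 𝓘(ℝ, E)

/-- The vector component of the point of `N^ε` corresponding to `y`. -/
def fibreVec (G : Type*) [TopologicalSpace G] [ChartedSpace E_G G] [Group G] [MulAction G X]
    (ω_X : Form E X 2) (J : Π x : X, TangentSpace 𝓘(ℝ, E) x →L[ℝ] TangentSpace 𝓘(ℝ, E) x)
    (μ : X → E_G) (ε : ℝ) (y : X) : E :=
  (tubeInv G ω_X J μ ε y).2

theorem proj_fibreVec_of_eq {ε : ℝ} {y z : X} {v : E}
    (h : tubeInv G ω_X J μ ε y = tangentPoint z v) :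
    proj G ω_X J μ ε y = z ∧ fibreVec G ω_X J μ ε y = v := by
  rw [proj, fibreVec, h]
  exact ⟨rfl, rfl⟩

/-- In the chart around `z₀`, `(zh, vh)` expresses the inverse of the exponential map `Ê` on the
tube at `e`. -/
structure IsTubePoint (G : Type*) [TopologicalSpace G] [ChartedSpace E_G G] [Group G]
    [MulAction G X] (ω_X : Form E X 2)
    (J : Π x : X, TangentSpace 𝓘(ℝ, E) x →L[ℝ] TangentSpace 𝓘(ℝ, E) x) (μ : X → E_G) (ε : ℝ)
    (z₀ : X) (Ê : E × E → E) (zh vh : E → E) (e : E) : Prop where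
  mem : e ∈ (κ z₀).target
  zh_mem : zh e ∈ (κ z₀).target
  mem_image : (κ z₀).symm e ∈ tubeImage G ω_X J μ ε
  proj_eq : proj G ω_X J μ ε ((κ z₀).symm e) = (κ z₀).symm (zh e)
  fibreVec_eq : fibreVec G ω_X J μ ε ((κ z₀).symm e) = chartS z₀ (zh e) (vh e)
  level : μ ((κ z₀).symm (zh e)) = 0
  exp_eq : Ê (zh e, vh e) = e

/-- A chart of the tubular neighbourhood near the point `z₀` of the zero level. -/
structure IsTubeChart (G : Type*) [TopologicalSpace G] [ChartedSpace E_G G] [Group G]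
    [MulAction G X] (ω_X : Form E X 2)
    (J : Π x : X, TangentSpace 𝓘(ℝ, E) x →L[ℝ] TangentSpace 𝓘(ℝ, E) x) (μ : X → E_G) (ε : ℝ)
    (z₀ : X) (Ê : E × E → E) (zh vh : E → E) : Prop where
  smooth_exp : SmoothNear Ê (κ z₀ z₀, 0)
  exp_zero : ∀ᶠ e in 𝓝 (κ z₀ z₀), Ê (e, 0) = e
  expAt_eq : ∀ᶠ p in 𝓝 (κ z₀ z₀, (0 : E)), p.1 ∈ (κ z₀).target ∧ Ê p ∈ (κ z₀).target ∧
    expAt ω_X J ((κ z₀).symm p.1) (chartS z₀ p.1 p.2) = (κ z₀).symm (Ê p)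
  smooth_zh : SmoothNear zh (κ z₀ z₀)
  smooth_vh : SmoothNear vh (κ z₀ z₀)
  zh_self : zh (κ z₀ z₀) = κ z₀ z₀
  vh_self : vh (κ z₀ z₀) = 0
  fderiv_add : ∀ v, fderiv ℝ zh (κ z₀ z₀) v + fderiv ℝ vh (κ z₀ z₀) v = v
  fderiv_vh : ∀ v, ∃ η : E_G, fderiv ℝ vh (κ z₀ z₀) v = hatN G J z₀ (κ z₀ z₀) η
  eventually : ∀ᶠ e in 𝓝 (κ z₀ z₀), IsTubePoint G ω_X J μ ε z₀ Ê zh vh e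
  zero : ∀ᶠ e in 𝓝 (κ z₀ z₀), μ ((κ z₀).symm e) = 0 → zh e = e ∧ vh e = 0

/-- Here `vh` is the normal vector `J L ξh` at `zh`. Differentiating `Ê (zh, vh) = id` at the
centre, where the derivative of `Ê` is `a + b`, gives the splitting of each tangent vector into a
base part and a fibre part. -/
theorem IsRegular.exists_isTubeChart (h : IsRegular G B ω_X μ J) {ε : ℝ}
    (hr : IsTubeRadius G ω_X μ J ε) {z₀ : X} (hz₀ : μ z₀ = 0) :
    ∃ (Ê : E × E → E) (zh vh : E → E), IsTubeChart G ω_X J μ ε z₀ Ê zh vh := by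
  have he₀ := mem_extChartAt_target (I := 𝓘(ℝ, E)) z₀
  have hback : (κ z₀).symm (κ z₀ z₀) = z₀ := extChartAt_to_inv z₀
  obtain ⟨Ê, zh, ξh, h1, h2, h3, h4, h5, h6, h7, -⟩ := h.exists_normal_section hz₀
  set e₀ : E := κ z₀ z₀ with he₀def
  have h8 := h7.self_of_nhds.1
  have c1 : ContinuousAt (fun e ↦ (zh e, ξh e)) e₀ :=
    h8.smooth_zh.continuousAt.prodMk h8.smooth_ξh.continuousAt
  have c2 := ContinuousAt.comp (g := fun q : E × E_G ↦ hatMetric ω_X J z₀ q.1 (hatL G z₀ q.1 q.2)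
      (hatL G z₀ q.1 q.2)) (f := fun e ↦ (zh e, ξh e)) (x := e₀)
      (h.continuousAt_normSq h8.zh_mem _) c1
  have hsmall := c2.eventually_lt (continuousAt_const (y := ε ^ 2)) (by
    simp only [Function.comp_apply, h6, map_zero]
    exact pow_pos hr.pos 2)
  have hN : SmoothNear (fun e ↦ hatN (E_G := E_G) G J z₀ (zh e)) e₀ :=
    SmoothNear.comp (g := hatN (E_G := E_G) G J z₀) (h.smoothNear_hatN h8.zh_mem) h8.smooth_zh
  have hv : SmoothNear (fun e ↦ hatN G J z₀ (zh e) (ξh e)) e₀ := hN.clm_apply h8.smooth_ξh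
  have hv0 : hatN G J z₀ (zh e₀) (ξh e₀) = 0 := by rw [h6, map_zero]
  have hpoint : ∀ᶠ e in 𝓝 e₀, IsTubePoint G ω_X J μ ε z₀ Ê zh
      (fun e ↦ hatN G J z₀ (zh e) (ξh e)) e ∧ IsNormalSection G ω_X μ J z₀ zh ξh e := by
    filter_upwards [h7, hsmall] with e ⟨k1, k2⟩ k3
    simp only [Function.comp_apply] at k3
    rw [← normSq_chart k1.zh_mem] at k3
    have k4 := h.tubeInv_normalExp hr hr.pos le_rfl k1.level k3
    rw [k1.exp_eq, ← chartS_hatN k1.zh_mem] at k4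
    obtain ⟨k5, k6⟩ := proj_fibreVec_of_eq k4
    exact ⟨⟨k1.mem, k1.zh_mem, h.mem_tubeImage_iff.2 ⟨_, _, k1.level, k3, k1.exp_eq⟩, k5, k6,
      k1.level, k2⟩, k1⟩
  refine ⟨Ê, zh, fun e ↦ hatN G J z₀ (zh e) (ξh e), h1, h2, h4, h8.smooth_zh, hv, h5, hv0, ?_, ?_,
    hpoint.mono fun e he ↦ he.1, ?_⟩
  · intro v
    have d1 : HasFDerivAt Ê (fderiv ℝ Ê (e₀, 0)) (zh e₀, hatN G J z₀ (zh e₀) (ξh e₀)) := by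
      rw [h5, h6, map_zero]
      exact h1.differentiableAt.hasFDerivAt
    have d2 := d1.comp e₀ (h8.smooth_zh.differentiableAt.hasFDerivAt.prodMk
      hv.differentiableAt.hasFDerivAt)
    have d3 : (fun e ↦ Ê (zh e, hatN G J z₀ (zh e) (ξh e))) =ᶠ[𝓝 e₀] fun e ↦ e :=
      h7.mono fun e he ↦ he.2
    have d4 := congrArg (fun T : E →L[ℝ] E ↦ T v)
      (d2.unique ((hasFDerivAt_id e₀).congr_of_eventuallyEq d3))
    simp only [ContinuousLinearMap.comp_apply, ContinuousLinearMap.prod_apply, h5, hv0] at d4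
    exact (h3 _ _).symm.trans d4
  -- At the centre `ξh` vanishes, so the product rule for `vh` leaves only the term with the
  -- derivative of `ξh`.
  · intro v
    refine ⟨fderiv ℝ ξh e₀ v, ?_⟩
    have d1 := (hN.differentiableAt.hasFDerivAt.clm_apply
      h8.smooth_ξh.differentiableAt.hasFDerivAt).fderiv
    have d2 := congrArg (fun T : E →L[ℝ] E ↦ T v) d1
    refine d2.trans (?_ : _ = hatN G J z₀ e₀ _)
    simp only [add_apply, ContinuousLinearMap.comp_apply, ContinuousLinearMap.flip_apply, h5, h6,
      map_zero, add_zero]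
  -- A point of the zero level is the exponential of its own zero vector, which is its only preimage
  -- in the disc bundle.
  · filter_upwards [hpoint] with e ⟨k1, k2⟩ k3
    have k4 := h.tubeInv_normalExp hr hr.pos le_rfl k3 (ξ := (0 : E_G)) (by
      rw [normSq, map_zero, tensorMetric, map_zero, zero_apply]
      exact pow_pos hr.pos 2)
    rw [h.normalExp_zero k3] at k4
    obtain ⟨k5, k6⟩ := proj_fibreVec_of_eq k4
    rw [k1.proj_eq] at k5
    rw [k1.fibreVec_eq, normalVec, map_zero, map_zero] at k6
    refine ⟨(κ z₀).symm.injOn k1.zh_mem k1.mem k5, ?_⟩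
    have k7 := chartT_chartS k1.zh_mem (hatN G J z₀ (zh e) (ξh e))
    rw [k6, map_zero] at k7
    exact k7.symm

end TubeChart

/-! ### The form `ω₀` in charts -/

section FormCalculus

variable {E : Type*} [NormedAddCommGroup E] [NormedSpace ℝ E] [FiniteDimensional ℝ E]

theorem smoothNear_extDeriv_oneForm {θ : E → E [⋀^Fin 1]→L[ℝ] ℝ} {e : E} (h : SmoothNear θ e) :
    SmoothNear (extDeriv θ) e := by
  have h1 (v w : E) : SmoothNear (fun e ↦ fderiv ℝ θ e v ![w]) e := by
    have h2 : SmoothNear (fun e ↦ θ e ![w]) e := by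
      filter_upwards [h] with x hx
      exact (ContinuousAlternatingMap.apply ℝ E ℝ ![w]).contDiff.contDiffAt.comp x hx
    refine (h2.fderiv.clm_apply (smoothNear_const v e)).congr ?_
    filter_upwards [h.eventually] with x hx
    rw [fderiv_alternating_apply hx.differentiableAt]
  refine SmoothNear.alternating_of_apply fun v ↦ ?_
  refine ((h1 (v 0) (v 1)).sub (h1 (v 1) (v 0))).congr (.of_forall fun x ↦ ?_)
  conv_lhs => rw [eq_vec_two v]
  exact extDeriv_oneForm_apply θ x (v 0) (v 1)

theorem fderiv_clm_apply_apply_of_eq_zero {F : Type*} [NormedAddCommGroup F] [NormedSpace ℝ F]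
    {A : E → F →L[ℝ] F →L[ℝ] ℝ} {u w : E → F} {e : E} (hA : SmoothNear A e) (hu : SmoothNear u e)
    (hw : SmoothNear w e) (h0 : u e = 0) (v : E) :
    fderiv ℝ (fun e ↦ A e (u e) (w e)) e v = A e (fderiv ℝ u e v) (w e) := by
  have h1 := ((hA.differentiableAt.hasFDerivAt.clm_apply
    hu.differentiableAt.hasFDerivAt).clm_apply hw.differentiableAt.hasFDerivAt).fderiv
  have h2 := congrArg (fun T : E →L[ℝ] ℝ ↦ T v) h1
  refine h2.trans ?_
  simp [h0]

end FormCalculus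

/-! ### The form `ω₀` in a tube chart -/

section Omega0

universe u

variable {E : Type u} [NormedAddCommGroup E] [NormedSpace ℝ E] [FiniteDimensional ℝ E]
  {X : Type*} [TopologicalSpace X] [ChartedSpace E X] [IsManifold 𝓘(ℝ, E) ∞ X] [T2Space X]
  {E_G : Type*} [NormedAddCommGroup E_G] [NormedSpace ℝ E_G] [FiniteDimensional ℝ E_G]
  {G : Type*} [TopologicalSpace G] [ChartedSpace E_G G] [Group G] [LieGroup 𝓘(ℝ, E_G) ∞ G]
  [ConnectedSpace G] [MulAction G X] [ContMDiffSMul 𝓘(ℝ, E_G) 𝓘(ℝ, E) ∞ G X]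
  {J : Π x : X, TangentSpace 𝓘(ℝ, E) x →L[ℝ] TangentSpace 𝓘(ℝ, E) x}
  {ω_X : Form E X 2} {μ : X → E_G} {B : E_G →L[ℝ] E_G →L[ℝ] ℝ}
  {ε : ℝ} {z₀ : X} {Ê : E × E → E} {zh vh : E → E}

local notation "κ" => extChartAt 𝓘(ℝ, E)

/-- The derivative of the projection. -/
def projT (G : Type*) [TopologicalSpace G] [ChartedSpace E_G G] [Group G] [MulAction G X]
    (ω_X : Form E X 2) (J : Π x : X, TangentSpace 𝓘(ℝ, E) x →L[ℝ] TangentSpace 𝓘(ℝ, E) x)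
    (μ : X → E_G) (ε : ℝ) (y : X) : E →L[ℝ] E :=
  (mfderiv 𝓘(ℝ, E) 𝓘(ℝ, E) (proj G ω_X J μ ε) y :)

theorem oneForm_apply (y : X) (w : E) : (oneForm G ω_X J μ ε y ![w] : ℝ) =
    ω_X.bil (proj G ω_X J μ ε y) (fibreVec G ω_X J μ ε y) (projT G ω_X J μ ε y w) := by
  have key (v : E) (a : E [⋀^Fin 2]→L[ℝ] ℝ) (u : Fin 1 → E) : contract v a u = a ![v, u 0] :=
    contract_apply v a u
  rw [Form.bil_apply]
  exact key (fibreVec G ω_X J μ ε y) (ω_X (proj G ω_X J μ ε y)) (projT G ω_X J μ ε y ∘ ![w])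

theorem mu₀_apply (y : X) : mu₀ G ω_X J μ ε y =
    tensorD μ (proj G ω_X J μ ε y) (fibreVec G ω_X J μ ε y) := rfl

theorem projT_chart {e : E} (h : ∀ᶠ e' in 𝓝 e, IsTubePoint G ω_X J μ ε z₀ Ê zh vh e')
    (hz : DifferentiableAt ℝ zh e) (w : E) :
    projT G ω_X J μ ε ((κ z₀).symm e) (chartS z₀ e w) = chartS z₀ (zh e) (fderiv ℝ zh e w) :=
  chartT_mfderiv_of_reading h.self_of_nhds.mem h.self_of_nhds.zh_mem
    (h.mono fun _ he ↦ he.proj_eq) hz w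

theorem oneForm_inChart {e : E} (h : ∀ᶠ e' in 𝓝 e, IsTubePoint G ω_X J μ ε z₀ Ê zh vh e')
    (hz : DifferentiableAt ℝ zh e) (w : E) :
    (oneForm G ω_X J μ ε).inChart z₀ e ![w] =
      ω_X.hat z₀ (zh e) (vh e) (fderiv ℝ zh e w) := by
  have h1 : (oneForm G ω_X J μ ε).inChart z₀ e ![w] =
      oneForm G ω_X J μ ε ((κ z₀).symm e) ![chartS (A := E) z₀ e w] := by
    rw [Form.inChart_apply]
    exact congrArg _ (eq_vec_one _)
  rw [h1, oneForm_apply, projT_chart h hz, h.self_of_nhds.fibreVec_eq, h.self_of_nhds.proj_eq,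
    Form.hat_eq_bil]

theorem IsTubeChart.eventually_nhds (hc : IsTubeChart G ω_X J μ ε z₀ Ê zh vh) :
    ∀ᶠ e in 𝓝 (κ z₀ z₀), ∀ᶠ e' in 𝓝 e, IsTubePoint G ω_X J μ ε z₀ Ê zh vh e' :=
  hc.eventually.eventually_nhds

theorem IsTubeChart.smoothNear_hat (h : IsRegular G B ω_X μ J)
    (hc : IsTubeChart G ω_X J μ ε z₀ Ê zh vh) : SmoothNear (fun e ↦ ω_X.hat z₀ (zh e)) (κ z₀ z₀) :=
  SmoothNear.comp (g := ω_X.hat z₀) (smoothNear_inChart h.smooth hc.eventually.self_of_nhds.zh_mem).bilin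
    hc.smooth_zh

theorem IsTubeChart.smoothNear_oneForm_apply (h : IsRegular G B ω_X μ J)
    (hc : IsTubeChart G ω_X J μ ε z₀ Ê zh vh) (w : E) :
    SmoothNear (fun e ↦ ω_X.hat z₀ (zh e) (vh e) (fderiv ℝ zh e w)) (κ z₀ z₀) :=
  ((hc.smoothNear_hat h).clm_apply hc.smooth_vh).clm_apply
    (hc.smooth_zh.fderiv.clm_apply (smoothNear_const w _))

theorem IsTubeChart.oneForm_eventuallyEq (hc : IsTubeChart G ω_X J μ ε z₀ Ê zh vh) (w : E) :
    (fun e ↦ (oneForm G ω_X J μ ε).inChart z₀ e ![w]) =ᶠ[𝓝 (κ z₀ z₀)]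
      fun e ↦ ω_X.hat z₀ (zh e) (vh e) (fderiv ℝ zh e w) := by
  filter_upwards [hc.eventually_nhds, hc.smooth_zh.eventually] with e h1 h2
  exact oneForm_inChart h1 h2.differentiableAt w

theorem IsTubeChart.smoothNear_oneForm (h : IsRegular G B ω_X μ J)
    (hc : IsTubeChart G ω_X J μ ε z₀ Ê zh vh) :
    SmoothNear ((oneForm G ω_X J μ ε).inChart z₀) (κ z₀ z₀) := by
  refine SmoothNear.alternating_of_apply fun v ↦ ?_
  rw [eq_vec_one v]
  exact (hc.smoothNear_oneForm_apply h (v 0)).congr (hc.oneForm_eventuallyEq (v 0))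

theorem IsTubeChart.omega₀_inChart (h : IsRegular G B ω_X μ J)
    (hc : IsTubeChart G ω_X J μ ε z₀ Ê zh vh) :
    (omega₀ G ω_X J μ ε).inChart z₀ =ᶠ[𝓝 (κ z₀ z₀)] fun e ↦
      (ω_X.inChart z₀ (zh e)).compContinuousLinearMap (fderiv ℝ zh e) +
        extDeriv ((oneForm G ω_X J μ ε).inChart z₀) e := by
  filter_upwards [hc.eventually_nhds, hc.smooth_zh.eventually,
    (hc.smoothNear_oneForm h).eventually] with e h1 h2 h3
  have h4 := h1.self_of_nhds
  have h5 := Form.inChart_pullback ω_X (f := proj G ω_X J μ ε) h4.mem h4.zh_mem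
    (h1.mono fun _ he ↦ he.proj_eq) h2.differentiableAt
  have h6 := Form.inChart_d (oneForm G ω_X J μ ε) h4.mem h3.differentiableAt
  rw [← h5, ← h6]
  rfl

theorem IsTubeChart.smoothNear_omega₀ (h : IsRegular G B ω_X μ J)
    (hc : IsTubeChart G ω_X J μ ε z₀ Ê zh vh) :
    SmoothNear ((omega₀ G ω_X J μ ε).inChart z₀) (κ z₀ z₀) := by
  have h1 := smoothNear_compContinuousLinearMap_two (τ := ω_X.inChart z₀) (f := zh)
    (p := κ z₀ z₀) (smoothNear_inChart h.smooth hc.eventually.self_of_nhds.zh_mem) hc.smooth_zh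
  exact (h1.add (smoothNear_extDeriv_oneForm (hc.smoothNear_oneForm h))).congr (hc.omega₀_inChart h)

/-- In the chart `ω₀` is the pullback of a closed form plus an exact form. -/
theorem IsTubeChart.extDeriv_omega₀ (h : IsRegular G B ω_X μ J)
    (hc : IsTubeChart G ω_X J μ ε z₀ Ê zh vh) :
    ∀ᶠ e in 𝓝 (κ z₀ z₀), extDeriv ((omega₀ G ω_X J μ ε).inChart z₀) e = 0 := by
  have h1 := smoothNear_compContinuousLinearMap_two (τ := ω_X.inChart z₀) (f := zh)
    (p := κ z₀ z₀) (smoothNear_inChart h.smooth hc.eventually.self_of_nhds.zh_mem) hc.smooth_zh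
  have h2 := hc.smoothNear_oneForm h
  filter_upwards [(hc.omega₀_inChart h).eventually_nhds, h1.eventually, h2.eventually,
    (smoothNear_extDeriv_oneForm h2).eventually, hc.smooth_zh.eventually, hc.eventually]
    with e k1 k2 k3 k4 k5 k6
  rw [Filter.EventuallyEq.extDeriv_eq k1, extDeriv_fun_add k2.differentiableAt k4.differentiableAt,
    extDeriv_extDeriv_apply k3.contDiffAt minSmoothness_two_le,
    extDeriv_pullback (smoothNear_inChart h.smooth k6.zh_mem).differentiableAt k5.contDiffAt
      minSmoothness_two_le, h.ham.extDeriv_inChart k6.zh_mem, add_zero]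
  rfl

/-- Along the zero level, the form `ω₀` is `ω`. -/
theorem IsTubeChart.omega₀_self (h : IsRegular G B ω_X μ J)
    (hc : IsTubeChart G ω_X J μ ε z₀ Ê zh vh) (hz₀ : μ z₀ = 0) :
    (omega₀ G ω_X J μ ε).inChart z₀ (κ z₀ z₀) = ω_X.inChart z₀ (κ z₀ z₀) := by
  have he₀ := mem_extChartAt_target (I := 𝓘(ℝ, E)) z₀
  have hback : (κ z₀).symm (κ z₀ z₀) = z₀ := extChartAt_to_inv z₀
  have hθ := (hc.smoothNear_oneForm h).differentiableAt
  -- The fibre vector vanishes on the zero level, so only its own derivative survives in the product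
  -- rule for `Θ`.
  have hd (v w : E) : fderiv ℝ ((oneForm G ω_X J μ ε).inChart z₀) (κ z₀ z₀) v ![w] =
      ω_X.hat z₀ (κ z₀ z₀) (fderiv ℝ vh (κ z₀ z₀) v) (fderiv ℝ zh (κ z₀ z₀) w) := by
    rw [← fderiv_alternating_apply hθ, (hc.oneForm_eventuallyEq w).fderiv_eq,
      fderiv_clm_apply_apply_of_eq_zero (hc.smoothNear_hat h) hc.smooth_vh
        (hc.smooth_zh.fderiv.clm_apply (smoothNear_const w _)) hc.vh_self, hc.zh_self]
  -- Fibre directions have the form `J L ξ`. As `J` preserves `ω`, they are isotropic together with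
  -- the orbit directions `L ξ`.
  have hvv (v w : E) : ω_X.hat z₀ (κ z₀ z₀) (fderiv ℝ vh (κ z₀ z₀) v)
      (fderiv ℝ vh (κ z₀ z₀) w) = 0 := by
    obtain ⟨ξ, hξ⟩ := hc.fderiv_vh v
    obtain ⟨η, hη⟩ := hc.fderiv_vh w
    rw [hξ, hη, hatN, ContinuousLinearMap.comp_apply, ContinuousLinearMap.comp_apply,
      hat_hatJ h.compatible he₀, Form.hat_eq_bil, chartS_hatL he₀, chartS_hatL he₀, hback,
      h.ham.bil_tensorL, h.ham.tensorD_tensorL hz₀, map_zero, zero_apply]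
  refine bilin_ext fun v w ↦ ?_
  rw [(hc.omega₀_inChart h).self_of_nhds]
  have h1 : ((ω_X.inChart z₀ (zh (κ z₀ z₀))).compContinuousLinearMap (fderiv ℝ zh (κ z₀ z₀)) +
      extDeriv ((oneForm G ω_X J μ ε).inChart z₀) (κ z₀ z₀)) ![v, w] =
      ω_X.hat z₀ (κ z₀ z₀) (fderiv ℝ zh (κ z₀ z₀) v) (fderiv ℝ zh (κ z₀ z₀) w) +
      extDeriv ((oneForm G ω_X J μ ε).inChart z₀) (κ z₀ z₀) ![v, w] := by
    rw [Form.hat_apply, ← comp_vec_two, hc.zh_self]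
    rfl
  -- Splitting both vectors into base and fibre parts, the pulled back form gives the base-base
  -- term, `dΘ` gives the two mixed terms, and the fibre-fibre term is zero.
  rw [h1, extDeriv_oneForm_apply, hd, hd, ← Form.hat_apply]
  have h2 := hc.fderiv_add v
  have h3 := hc.fderiv_add w
  have h4 := hvv v w
  have h5 := ω_X.hat_swap z₀ (κ z₀ z₀) (fderiv ℝ vh (κ z₀ z₀) w) (fderiv ℝ zh (κ z₀ z₀) v)
  conv_rhs => rw [← h2, ← h3]
  simp only [map_add, add_apply]
  rw [h4, h5]
  ring

end Omega0

/-! ### The Hamiltonian action on the normal form -/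

section Omega0Hamiltonian

universe u

variable {E : Type u} [NormedAddCommGroup E] [NormedSpace ℝ E] [FiniteDimensional ℝ E]
  {X : Type*} [TopologicalSpace X] [ChartedSpace E X] [IsManifold 𝓘(ℝ, E) ∞ X] [T2Space X]
  {E_G : Type*} [NormedAddCommGroup E_G] [NormedSpace ℝ E_G] [FiniteDimensional ℝ E_G]
  {G : Type*} [TopologicalSpace G] [ChartedSpace E_G G] [Group G] [LieGroup 𝓘(ℝ, E_G) ∞ G]
  [ConnectedSpace G] [MulAction G X] [ContMDiffSMul 𝓘(ℝ, E_G) 𝓘(ℝ, E) ∞ G X]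
  {J : Π x : X, TangentSpace 𝓘(ℝ, E) x →L[ℝ] TangentSpace 𝓘(ℝ, E) x}
  {ω_X : Form E X 2} {μ : X → E_G} {B : E_G →L[ℝ] E_G →L[ℝ] ℝ}
  {ε : ℝ} {z₀ : X} {Ê : E × E → E} {zh vh : E → E}

local notation "κ" => extChartAt 𝓘(ℝ, E)

theorem inChart_nondegenerate_iff {α : Form E X 2} {x₀ : X} {e : E} (he : e ∈ (κ x₀).target) :
    (∀ v : E, (∀ w : E, α.inChart x₀ e ![v, w] = 0) → v = 0) ↔
      ∀ v : E, (∀ w : E, α.bil ((κ x₀).symm e) v w = 0) → v = 0 := by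
  simp only [← Form.hat_apply, Form.hat_eq_bil]
  constructor
  · intro h v hv
    have h1 := h (chartT x₀ ((κ x₀).symm e) v) fun w ↦ by rw [chartS_chartT' he]; exact hv _
    have h2 := chartS_chartT' he v
    rw [h1, map_zero] at h2
    exact h2.symm
  · intro h v hv
    have h1 := h (chartS x₀ e v) fun w ↦ by
      have := hv (chartT x₀ ((κ x₀).symm e) w)
      rwa [chartS_chartT' he] at this
    rw [← chartT_chartS he v, h1, map_zero]

theorem IsRegular.nondegenerate (h : IsRegular G B ω_X μ J) {x : X} {v : E}
    (hv : ∀ w : E, ω_X.bil x v w = 0) : v = 0 :=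
  h.ham.nondegenerate x (mem_univ x) v fun w ↦ (ω_X.bil_apply x v w).symm.trans (hv w)

theorem IsRegular.inChart_nondegenerate (h : IsRegular G B ω_X μ J) {x₀ : X} {e : E}
    (he : e ∈ (κ x₀).target) (v : E) (hv : ∀ w : E, ω_X.inChart x₀ e ![v, w] = 0) : v = 0 :=
  (inChart_nondegenerate_iff he).2 (fun _ ↦ h.nondegenerate) v hv

/-- On the zero level `ω₀` equals the nondegenerate form `ω`, and invertibility of the associated
map is an open condition. -/
theorem IsTubeChart.eventually_nondegenerate (h : IsRegular G B ω_X μ J)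
    (hc : IsTubeChart G ω_X J μ ε z₀ Ê zh vh) (hz₀ : μ z₀ = 0) :
    ∀ᶠ e in 𝓝 (κ z₀ z₀), ∀ v : E,
      (∀ w : E, (omega₀ G ω_X J μ ε).inChart z₀ e ![v, w] = 0) → v = 0 := by
  have he₀ := mem_extChartAt_target (I := 𝓘(ℝ, E)) z₀
  have h1 := (hc.smoothNear_omega₀ h).bilin
  have h2 : (bilin ((omega₀ G ω_X J μ ε).inChart z₀ (κ z₀ z₀))).IsInvertible := by
    rw [hc.omega₀_self h hz₀]
    exact isInvertible_bilin (h.inChart_nondegenerate he₀)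
  filter_upwards [(h1.inverse h2).2] with e he v hv
  refine he.bijective.injective ?_
  rw [map_zero]
  ext w
  exact (bilin_apply _ v w).trans (hv w)

/-- Translating the preimage of `y` in the disc bundle by `g` gives a preimage of `g • y`, and
preimages are unique. -/
theorem IsRegular.proj_smul (h : IsRegular G B ω_X μ J) (hr : IsTubeRadius G ω_X μ J ε) (g : G)
    {y : X} (hy : y ∈ tubeImage G ω_X J μ ε) :
    proj G ω_X J μ ε (g • y) = g • proj G ω_X J μ ε y ∧
      fibreVec G ω_X J μ ε (g • y) =
        smulT E g (proj G ω_X J μ ε y) (fibreVec G ω_X J μ ε y) := by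
  obtain ⟨z, ξ, hz, hξ, rfl⟩ := h.mem_tubeImage_iff.1 hy
  obtain ⟨h1, h2⟩ := proj_fibreVec_of_eq (h.tubeInv_normalExp hr hr.pos le_rfl hz hξ)
  have h3 := h.tubeInv_normalExp hr hr.pos le_rfl (h.ham.smul_eq_zero g hz) (ξ := Ad g ξ)
    (by rwa [h.normSq_smul])
  rw [h.normalExp_smul] at h3
  obtain ⟨h4, h5⟩ := proj_fibreVec_of_eq h3
  rw [h1, h2, h4, h5, normalVec_smul h.compatible]
  exact ⟨rfl, rfl⟩

theorem IsRegular.contMDiffAt_proj (h : IsRegular G B ω_X μ J) (hr : IsTubeRadius G ω_X μ J ε)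
    {y : X} (hy : y ∈ tubeImage G ω_X J μ ε) :
    ContMDiffAt 𝓘(ℝ, E) 𝓘(ℝ, E) ∞ (proj G ω_X J μ ε) y :=
  (Bundle.contMDiffAt_proj (TangentSpace 𝓘(ℝ, E))).comp y
    (h.contMDiffAt_tubeInv hr hr.pos le_rfl hy)

theorem IsRegular.hasMFDerivAt_proj (h : IsRegular G B ω_X μ J) (hr : IsTubeRadius G ω_X μ J ε)
    {y : X} (hy : y ∈ tubeImage G ω_X J μ ε) :
    HasMFDerivAt 𝓘(ℝ, E) 𝓘(ℝ, E) (proj G ω_X J μ ε) y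
      (projT (E := E) G ω_X J μ ε y :) :=
  ((h.contMDiffAt_proj hr hy).mdifferentiableAt (by simp)).hasMFDerivAt

theorem IsRegular.projT_smul (h : IsRegular G B ω_X μ J) (hr : IsTubeRadius G ω_X μ J ε) (g : G)
    {y : X} (hy : y ∈ tubeImage G ω_X J μ ε) (w : E) :
    projT G ω_X J μ ε (g • y) (smulT E g y w) =
      smulT E g (proj G ω_X J μ ε y) (projT G ω_X J μ ε y w) := by
  have h1 := HasMFDerivAt.comp y (h.hasMFDerivAt_proj hr (h.smul_mem_tubeImage g hy))
    (hasMFDerivAt_smul E_G g y)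
  have h2 := HasMFDerivAt.comp y (hasMFDerivAt_smul E_G g (proj G ω_X J μ ε y))
    (h.hasMFDerivAt_proj hr hy)
  have h3 : (proj G ω_X J μ ε ∘ fun x : X ↦ g • x) =ᶠ[𝓝 y]
      (fun x : X ↦ g • x) ∘ proj G ω_X J μ ε := by
    filter_upwards [(h.isOpen_tubeImage hr hr.pos le_rfl).mem_nhds hy] with x hx
    exact (h.proj_smul hr g hx).1
  have h4 := hasMFDerivAt_unique (h1.congr_of_eventuallyEq h3.symm) h2
  exact congrArg (fun T : E →L[ℝ] E ↦ T w) h4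

/-- Differentiate the equivariance of the projection along the orbit of `y`. -/
theorem IsRegular.projT_tensorL (h : IsRegular G B ω_X μ J) (hr : IsTubeRadius G ω_X μ J ε)
    {y : X} (hy : y ∈ tubeImage G ω_X J μ ε) (η : E_G) :
    projT G ω_X J μ ε y (tensorL E E_G G y η) = tensorL E E_G G (proj G ω_X J μ ε y) η := by
  have h0 : ∀ y' : X, y' = y → HasMFDerivAt 𝓘(ℝ, E) 𝓘(ℝ, E) (proj G ω_X J μ ε) y'
      (projT (E := E) G ω_X J μ ε y :) := by
    rintro _ rfl
    exact h.hasMFDerivAt_proj hr hy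
  have h1 := HasMFDerivAt.comp (1 : G) (h0 _ (one_smul G y)) (hasMFDerivAt_orbit (E := E) (E_G := E_G) (G := G) y)
  have h2 := hasMFDerivAt_orbit (E := E) (E_G := E_G) (G := G) (proj G ω_X J μ ε y)
  have h3 : (proj G ω_X J μ ε ∘ fun g : G ↦ g • y) = fun g : G ↦ g • proj G ω_X J μ ε y :=
    funext fun g ↦ (h.proj_smul hr g hy).1
  rw [h3] at h1
  have h4 := hasMFDerivAt_unique h1 h2
  exact congrArg (fun T : E_G →L[ℝ] E ↦ T η) h4

theorem IsRegular.oneForm_smul (h : IsRegular G B ω_X μ J) (hr : IsTubeRadius G ω_X μ J ε) (g : G)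
    {y : X} (hy : y ∈ tubeImage G ω_X J μ ε) (w : E) :
    (oneForm G ω_X J μ ε (g • y) ![smulT E g y w] : ℝ) = oneForm G ω_X J μ ε y ![w] := by
  obtain ⟨h1, h2⟩ := h.proj_smul hr g hy
  rw [oneForm_apply, oneForm_apply, h1, h2, h.projT_smul hr g hy, h.ham.bil_smul]

theorem IsRegular.tensorD_smul (h : IsRegular G B ω_X μ J) (g : G) (x : X) (v : E) :
    tensorD μ (g • x) (smulT E g x v) = Ad g (tensorD μ x v) := by
  have h1 : HasMFDerivAt 𝓘(ℝ, E) 𝓘(ℝ, E_G) μ (g • x) (tensorD (E := E) μ (g • x) :) :=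
    (h.ham.mdifferentiableAt _).hasMFDerivAt
  have h2 : HasMFDerivAt 𝓘(ℝ, E) 𝓘(ℝ, E_G) μ x (tensorD (E := E) μ x :) :=
    (h.ham.mdifferentiableAt _).hasMFDerivAt
  have h3 := HasMFDerivAt.comp x h1 (hasMFDerivAt_smul E_G g x)
  have h4 := HasMFDerivAt.comp x (Ad g : E_G →L[ℝ] E_G).hasFDerivAt.hasMFDerivAt h2
  have h5 : (μ ∘ fun x : X ↦ g • x) = (Ad g : E_G →L[ℝ] E_G) ∘ μ :=
    funext fun x ↦ h.ham.equivariant g x (mem_univ x)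
  rw [h5] at h3
  have h6 := hasMFDerivAt_unique h3 h4
  exact congrArg (fun T : E →L[ℝ] E_G ↦ T v) h6

theorem IsRegular.mu₀_smul (h : IsRegular G B ω_X μ J) (hr : IsTubeRadius G ω_X μ J ε) (g : G)
    {y : X} (hy : y ∈ tubeImage G ω_X J μ ε) :
    mu₀ G ω_X J μ ε (g • y) = Ad g (mu₀ G ω_X J μ ε y) := by
  obtain ⟨h1, h2⟩ := h.proj_smul hr g hy
  rw [mu₀_apply, mu₀_apply, h1, h2, h.tensorD_smul]

theorem IsTubePoint.mu₀_eq (h : IsRegular G B ω_X μ J) {e : E}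
    (hp : IsTubePoint G ω_X J μ ε z₀ Ê zh vh e) :
    mu₀ G ω_X J μ ε ((κ z₀).symm e) = fderiv ℝ (hatMu μ z₀) (zh e) (vh e) := by
  rw [mu₀_apply, hp.proj_eq, hp.fibreVec_eq, h.ham.fderiv_hatMu hp.zh_mem]

theorem IsTubeChart.smoothNear_mu₀ (h : IsRegular G B ω_X μ J)
    (hc : IsTubeChart G ω_X J μ ε z₀ Ê zh vh) :
    SmoothNear (fun e ↦ mu₀ G ω_X J μ ε ((κ z₀).symm e)) (κ z₀ z₀) := by
  have h1 : SmoothNear (fun e ↦ fderiv ℝ (hatMu μ z₀) (zh e)) (κ z₀ z₀) :=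
    SmoothNear.comp (g := fderiv ℝ (hatMu μ z₀))
      (h.ham.smoothNear_hatMu hc.eventually.self_of_nhds.zh_mem).fderiv hc.smooth_zh
  exact (h1.clm_apply hc.smooth_vh).congr (hc.eventually.mono fun e he ↦ he.mu₀_eq h)

theorem contMDiffAt_of_comp_chart {F : Type*} [NormedAddCommGroup F] [NormedSpace ℝ F] {f : X → F}
    {x₀ : X} {e : E} (he : e ∈ (κ x₀).target)
    (hf : ContDiffAt ℝ ∞ (fun e ↦ f ((κ x₀).symm e)) e) :
    ContMDiffAt 𝓘(ℝ, E) 𝓘(ℝ, F) ∞ f ((κ x₀).symm e) := by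
  have hx := (κ x₀).map_target he
  have h1 : ContMDiffAt 𝓘(ℝ, E) 𝓘(ℝ, F) ∞ ((fun e ↦ f ((κ x₀).symm e)) ∘ κ x₀)
      ((κ x₀).symm e) := by
    refine ContMDiffAt.comp (I' := 𝓘(ℝ, E)) _ ?_ (contMDiffAt_chart hx)
    rw [(κ x₀).right_inv he]
    exact hf.contMDiffAt
  refine h1.congr_of_eventuallyEq ?_
  filter_upwards [chart_source_mem_nhds (A := E) hx] with y hy
  simp only [Function.comp_apply]
  rw [(κ x₀).left_inv hy]

/-- The invariance of `Θ` under group elements near `1`, in the form required by Cartan's formula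
`extDeriv_hatL_of_invariant`. -/
theorem IsTubeChart.actionPullback_oneForm (h : IsRegular G B ω_X μ J)
    (hr : IsTubeRadius G ω_X μ J ε) {e : E} (hp : IsTubePoint G ω_X J μ ε z₀ Ê zh vh e) (w : E) :
    ∀ᶠ γ in 𝓝 (chartOne E_G G), actionPullback G z₀ ((oneForm G ω_X J μ ε).inChart z₀) (γ, e)
      ![(0, w)] = (oneForm G ω_X J μ ε).inChart z₀ e ![w] := by
  have c1 : ContinuousAt (fun γ : E_G ↦ (γ, e)) (chartOne E_G G) := by fun_prop
  filter_upwards [c1.eventually (eventually_actionChart (E_G := E_G) (G := G) hp.mem),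
    c1.eventually (smoothNear_actionChart (E_G := E_G) (G := G) hp.mem).eventually]
    with γ ⟨_, _, k1⟩ k2
  have k3 := fderiv_actionChart_snd hp.mem k1 k2.differentiableAt w
  have k4 := Form.apply_eq_inChart (oneForm G ω_X J μ ε) k1
    ![smulT E ((extChartAt 𝓘(ℝ, E_G) (1 : G)).symm γ) ((κ z₀).symm e) (chartS z₀ e w)]
  have k5 := h.oneForm_smul hr ((extChartAt 𝓘(ℝ, E_G) (1 : G)).symm γ) hp.mem_image
    (chartS z₀ e w)
  have k6 : (oneForm G ω_X J μ ε).inChart z₀ e ![w] =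
      oneForm G ω_X J μ ε ((κ z₀).symm e) ![chartS (A := E) z₀ e w] := by
    rw [Form.inChart_apply]
    exact congrArg _ (eq_vec_one _)
  have k7 : actionPullback G z₀ ((oneForm G ω_X J μ ε).inChart z₀) (γ, e) ![((0 : E_G), w)] =
      (oneForm G ω_X J μ ε).inChart z₀ (actionChart G z₀ (γ, e))
        (fderiv ℝ (actionChart G z₀) (γ, e) ∘ ![((0 : E_G), w)]) := rfl
  rw [comp_vec_one, k3] at k7
  refine k7.trans (Eq.trans (congrArg _ ?_) (k4.symm.trans (k5.trans k6.symm)))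
  ext i
  fin_cases i
  rfl

/-- Contracting `π^*ω` with `X_η` gives `⟨d(μ ∘ π), η⟩ = 0`, since `dπ (X_η) = X_η` and `μ ∘ π = 0`.
For the invariant form `Θ`, Cartan's formula gives `ι_{X_η} dΘ = -d(Θ(X_η))`. At a fibre vector `v`
over `z` one has `Θ(X_η) = ω(v, L_z η) = -⟨d_z μ (v), η⟩ = -⟨μ₀, η⟩`. -/
theorem IsTubeChart.moment (h : IsRegular G B ω_X μ J) (hr : IsTubeRadius G ω_X μ J ε)
    (hc : IsTubeChart G ω_X J μ ε z₀ Ê zh vh) :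
    ∀ᶠ e in 𝓝 (κ z₀ z₀), ∀ (η : E_G) (w : E),
      (omega₀ G ω_X J μ ε).hat z₀ e (hatL G z₀ e η) w =
        B (fderiv ℝ (fun e ↦ mu₀ G ω_X J μ ε ((κ z₀).symm e)) e w) η := by
  have hzh : ∀ᶠ e in 𝓝 (κ z₀ z₀), ∀ η : E_G,
      fderiv ℝ zh e (hatL G z₀ e η) = hatL G z₀ (zh e) η := by
    filter_upwards [hc.eventually_nhds, hc.smooth_zh.eventually] with e k1 k2 η
    have k3 := k1.self_of_nhds
    have k4 := projT_chart k1 k2.differentiableAt (hatL G z₀ e η)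
    rw [chartS_hatL k3.mem, h.projT_tensorL hr k3.mem_image, k3.proj_eq, ← chartS_hatL k3.zh_mem]
      at k4
    rw [← chartT_chartS k3.zh_mem (fderiv ℝ zh e (hatL G z₀ e η)), ← k4, chartT_chartS k3.zh_mem]
  filter_upwards [hzh.eventually_nhds, hc.eventually_nhds, hc.omega₀_inChart h,
    (hc.smoothNear_oneForm h).eventually, hc.smooth_zh.eventually,
    (hc.smoothNear_mu₀ h).eventually] with e k1 k2 k3 k4 k5 k6 η w
  have k7 := k2.self_of_nhds
  -- the pullback of `ω` does not contribute
  have k8 : ω_X.hat z₀ (zh e) (fderiv ℝ zh e (hatL G z₀ e η)) (fderiv ℝ zh e w) = 0 := by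
    rw [k1.self_of_nhds, h.ham.moment_chart k7.zh_mem]
    have k9 : (hatMu μ z₀ ∘ zh) =ᶠ[𝓝 e] fun _ ↦ 0 := k2.mono fun _ he ↦ he.level
    have k10 := (((h.ham.smoothNear_hatMu k7.zh_mem).differentiableAt.hasFDerivAt).comp e
      k5.differentiableAt.hasFDerivAt).fderiv
    rw [k9.fderiv_eq] at k10
    have k11 := congrArg (fun T : E →L[ℝ] E_G ↦ T w) k10
    simp only [fderiv_fun_const, ContinuousLinearMap.comp_apply] at k11
    rw [← k11]
    simp
  have k12 := extDeriv_hatL_of_invariant k7.mem k4 w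
    (IsTubeChart.actionPullback_oneForm h hr k7 w) η
  have k13 : (fun e' ↦ (oneForm G ω_X J μ ε).inChart z₀ e' ![hatL G z₀ e' η]) =ᶠ[𝓝 e]
      fun e' ↦ -B.flip η (mu₀ G ω_X J μ ε ((κ z₀).symm e')) := by
    filter_upwards [k1, k2.eventually_nhds, k5.eventually] with e' l1 l2 l3
    have l4 := l2.self_of_nhds
    rw [oneForm_inChart l2 l3.differentiableAt, l1, Form.hat_swap, h.ham.moment_chart l4.zh_mem,
      l4.mu₀_eq h]
    rfl
  rw [k13.fderiv_eq, fderiv_fun_neg] at k12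
  have k14 : fderiv ℝ (fun e' ↦ B.flip η (mu₀ G ω_X J μ ε ((κ z₀).symm e'))) e w =
      B (fderiv ℝ (fun e ↦ mu₀ G ω_X J μ ε ((κ z₀).symm e)) e w) η := by
    have l1 := ((B.flip η).hasFDerivAt.comp e k6.differentiableAt.hasFDerivAt).fderiv
    exact congrArg (fun T : E →L[ℝ] ℝ ↦ T w) l1
  rw [neg_apply, neg_neg, k14] at k12
  have k15 : (omega₀ G ω_X J μ ε).hat z₀ e (hatL G z₀ e η) w =
      ω_X.hat z₀ (zh e) (fderiv ℝ zh e (hatL G z₀ e η)) (fderiv ℝ zh e w) +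
        extDeriv ((oneForm G ω_X J μ ε).inChart z₀) e ![hatL G z₀ e η, w] := by
    rw [Form.hat_apply, Form.hat_apply, ← comp_vec_two, k3]
    rfl
  rw [k15, k8, k12, zero_add]

end Omega0Hamiltonian

/-! ### The normal form is a Hamiltonian `G`-manifold -/

section NormalFormHamiltonian

universe u

variable {E : Type u} [NormedAddCommGroup E] [NormedSpace ℝ E] [FiniteDimensional ℝ E]
  {X : Type*} [TopologicalSpace X] [ChartedSpace E X] [IsManifold 𝓘(ℝ, E) ∞ X] [T2Space X]
  {E_G : Type*} [NormedAddCommGroup E_G] [NormedSpace ℝ E_G] [FiniteDimensional ℝ E_G]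
  {G : Type*} [TopologicalSpace G] [ChartedSpace E_G G] [Group G] [LieGroup 𝓘(ℝ, E_G) ∞ G]
  [ConnectedSpace G] [MulAction G X] [ContMDiffSMul 𝓘(ℝ, E_G) 𝓘(ℝ, E) ∞ G X]
  {J : Π x : X, TangentSpace 𝓘(ℝ, E) x →L[ℝ] TangentSpace 𝓘(ℝ, E) x}
  {ω_X : Form E X 2} {μ : X → E_G} {B : E_G →L[ℝ] E_G →L[ℝ] ℝ}
  {ε ε₁ : ℝ} {z₀ : X} {Ê : E × E → E} {zh vh : E → E}

local notation "κ" => extChartAt 𝓘(ℝ, E)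

theorem Form.ext_one {α β : Form E X 1} {x : X} (h : ∀ w : E, (α x ![w] : ℝ) = β x ![w]) :
    α x = β x :=
  ContinuousAlternatingMap.ext fun v ↦ by
    have hv : v = ![(v 0 : E)] := eq_vec_one v
    rw [hv]
    exact h _

theorem Form.ext_two {α β : Form E X 2} {x : X} (h : ∀ v w : E, (α x ![v, w] : ℝ) = β x ![v, w]) :
    α x = β x :=
  ContinuousAlternatingMap.ext fun v ↦ by
    have hv : v = ![(v 0 : E), (v 1 : E)] := eq_vec_two v
    rw [hv]
    exact h _ _

theorem Form.bil_pullback (α : Form E X 2) {f : X → X} {x : X} {T : E →L[ℝ] E}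
    (hT : (mfderiv 𝓘(ℝ, E) 𝓘(ℝ, E) f x : E →L[ℝ] E) = T) (v w : E) :
    (α.pullback f).bil x v w = α.bil (f x) (T v) (T w) := by
  subst hT
  rw [Form.bil_apply, Form.bil_apply]
  exact congrArg (fun u : Fin 2 → E ↦ (α (f x) u : ℝ)) (comp_vec_two _ v w)

theorem omega₀_apply (y : X) (v w : E) : (omega₀ G ω_X J μ ε).bil y v w =
    ω_X.bil (proj G ω_X J μ ε y) (projT G ω_X J μ ε y v) (projT G ω_X J μ ε y w) +
      (oneForm G ω_X J μ ε).d.bil y v w := by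
  rw [← ω_X.bil_pullback (f := proj G ω_X J μ ε) (T := projT G ω_X J μ ε y) rfl]
  rfl

theorem IsRegular.tubeInv_eventuallyEq (h : IsRegular G B ω_X μ J)
    (hr : IsTubeRadius G ω_X μ J ε₁) (h0 : 0 < ε) (hε : ε ≤ ε₁) {y : X}
    (hy : y ∈ tubeImage G ω_X J μ ε) :
    tubeInv G ω_X J μ ε =ᶠ[𝓝 y] tubeInv G ω_X J μ ε₁ := by
  filter_upwards [(h.isOpen_tubeImage hr h0 hε).mem_nhds hy] with x hx
  exact h.tubeInv_eq hr h0 hε hx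

theorem projT_eq (h : tubeInv G ω_X J μ ε =ᶠ[𝓝 z₀] tubeInv G ω_X J μ ε₁) :
    projT G ω_X J μ ε z₀ = projT G ω_X J μ ε₁ z₀ := by
  have h1 : proj G ω_X J μ ε =ᶠ[𝓝 z₀] proj G ω_X J μ ε₁ := by
    filter_upwards [h] with y hy
    rw [proj, hy, proj]
  exact h1.mfderiv_eq

theorem fibreVec_eq (h : tubeInv G ω_X J μ ε z₀ = tubeInv G ω_X J μ ε₁ z₀) :
    fibreVec G ω_X J μ ε z₀ = fibreVec G ω_X J μ ε₁ z₀ := by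
  rw [fibreVec, h, fibreVec]

theorem proj_eq (h : tubeInv G ω_X J μ ε z₀ = tubeInv G ω_X J μ ε₁ z₀) :
    proj G ω_X J μ ε z₀ = proj G ω_X J μ ε₁ z₀ := by
  rw [proj, h, proj]

theorem oneForm_eq (h : tubeInv G ω_X J μ ε =ᶠ[𝓝 z₀] tubeInv G ω_X J μ ε₁) :
    oneForm G ω_X J μ ε z₀ = oneForm G ω_X J μ ε₁ z₀ := by
  refine Form.ext_one fun w ↦ ?_
  rw [oneForm_apply, oneForm_apply, projT_eq h, fibreVec_eq h.self_of_nhds, proj_eq h.self_of_nhds]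

theorem omega₀_eq (h : tubeInv G ω_X J μ ε =ᶠ[𝓝 z₀] tubeInv G ω_X J μ ε₁) :
    omega₀ G ω_X J μ ε z₀ = omega₀ G ω_X J μ ε₁ z₀ := by
  refine Form.ext_two fun v w ↦ ?_
  have h1 : (oneForm G ω_X J μ ε).d.bil z₀ = (oneForm G ω_X J μ ε₁).d.bil z₀ :=
    congrArg (fun a : E [⋀^Fin 2]→L[ℝ] ℝ ↦ bilin a)
      (Form.d_congr (h.eventuallyEq_nhds.mono fun _ ↦ oneForm_eq))
  rw [← Form.bil_apply, ← Form.bil_apply, omega₀_apply, omega₀_apply, projT_eq h,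
    proj_eq h.self_of_nhds, h1]

theorem mu₀_eq (h : tubeInv G ω_X J μ ε z₀ = tubeInv G ω_X J μ ε₁ z₀) :
    mu₀ G ω_X J μ ε z₀ = mu₀ G ω_X J μ ε₁ z₀ := by
  rw [mu₀_apply, mu₀_apply, proj_eq h, fibreVec_eq h]

/-- The local part of the statement that the normal form is a Hamiltonian `G`-manifold. -/
structure IsHamiltonianAt (G : Type*) [TopologicalSpace G] [ChartedSpace E_G G] [Group G]
    [MulAction G X] (B : E_G →L[ℝ] E_G →L[ℝ] ℝ) (ω_X : Form E X 2)
    (J : Π x : X, TangentSpace 𝓘(ℝ, E) x →L[ℝ] TangentSpace 𝓘(ℝ, E) x) (μ : X → E_G) (ε : ℝ)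
    (y : X) : Prop where
  smooth : (omega₀ G ω_X J μ ε).SmoothAt y
  smooth_oneForm : DifferentiableAt ℝ ((oneForm G ω_X J μ ε).inChart y) (κ y y)
  closed : (omega₀ G ω_X J μ ε).d y = 0
  nondegenerate : ∀ v : E, (∀ w : E, (omega₀ G ω_X J μ ε).bil y v w = 0) → v = 0
  smooth_moment : ContMDiffAt 𝓘(ℝ, E) 𝓘(ℝ, E_G) ∞ (mu₀ G ω_X J μ ε) y
  moment : ∀ (η : E_G) (w : E), (omega₀ G ω_X J μ ε).bil y (tensorL E E_G G y η) w =
    B (tensorD (mu₀ G ω_X J μ ε) y w) η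

theorem IsRegular.eventually_isHamiltonianAt (h : IsRegular G B ω_X μ J)
    (hr : IsTubeRadius G ω_X μ J ε) {z : X} (hz : μ z = 0) :
    ∀ᶠ y in 𝓝 z, IsHamiltonianAt G B ω_X J μ ε y := by
  obtain ⟨Ê, zh, vh, hc⟩ := h.exists_isTubeChart hr hz
  refine eventually_of_chart (mem_extChartAt_source (I := 𝓘(ℝ, E)) z) ?_
  filter_upwards [hc.eventually, hc.smoothNear_omega₀ h, hc.extDeriv_omega₀ h,
    hc.eventually_nondegenerate h hz, (hc.smoothNear_oneForm h).eventually, hc.smoothNear_mu₀ h,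
    hc.moment h hr] with e k1 k2 k3 k4 k5 k6 k7
  have k8 := contMDiffAt_of_comp_chart k1.mem k6
  refine ⟨Form.smoothAt_of_contDiffAt_inChart k1.mem k2, ?_,
    (Form.d_eq_zero_iff _ k1.mem (k2.differentiableAt (by simp))).2 k3,
    (inChart_nondegenerate_iff k1.mem).1 k4, k8, fun η w ↦ ?_⟩
  -- Regularity of `Θ` is known in the chart around `z` but is required in the preferred chart of
  -- the point, so the transition map intervenes.
  · have hs := mem_extChartAt_source (I := 𝓘(ℝ, E)) ((κ z).symm e)
    have ht := mem_extChartAt_target (I := 𝓘(ℝ, E)) ((κ z).symm e)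
    have hxx : (κ ((κ z).symm e)).symm (κ ((κ z).symm e) ((κ z).symm e)) = (κ z).symm e :=
      extChartAt_to_inv _
    have hm : (κ ((κ z).symm e)).symm (κ ((κ z).symm e) ((κ z).symm e)) ∈ (κ z).source := by
      rw [hxx]; exact (κ z).map_target k1.mem
    have hq : reading (A := E) (B := E) ((κ z).symm e) z (fun x : X ↦ x)
        (κ ((κ z).symm e) ((κ z).symm e)) = e := by
      rw [reading, hxx, (κ z).right_inv k1.mem]
    have l1 := smoothNear_compContinuousLinearMap_one (τ := (oneForm G ω_X J μ ε).inChart z)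
      (f := reading (A := E) (B := E) ((κ z).symm e) z (fun x : X ↦ x))
      (p := κ ((κ z).symm e) ((κ z).symm e)) (by rw [hq]; exact k5)
      (by
        filter_upwards [(chart_continuousAt_symm ht).eventually (chart_source_mem_nhds hm),
          chart_target_mem_nhds ht] with e' h1 h2
        exact contDiffAt_transition h2 h1)
    exact (l1.congr (Form.inChart_eventuallyEq _ ht hm)).differentiableAt
  · have l1 := k7 η (chartT z ((κ z).symm e) w)
    rw [Form.hat_eq_bil, chartS_hatL k1.mem, chartS_chartT' k1.mem,
      fderiv_comp_chart_symm k1.mem (k8.mdifferentiableAt (by simp)), chartS_chartT' k1.mem] at l1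
    exact l1

/-- All objects of the normal form depend only on the germ of `tubeInv`, which is the same for all
admissible radii. -/
theorem IsHamiltonianAt.congr (h : IsHamiltonianAt G B ω_X J μ ε₁ z₀)
    (he : tubeInv G ω_X J μ ε =ᶠ[𝓝 z₀] tubeInv G ω_X J μ ε₁) :
    IsHamiltonianAt G B ω_X J μ ε z₀ := by
  have h1 := he.eventuallyEq_nhds.mono fun _ ↦ omega₀_eq
  have h2 := he.eventuallyEq_nhds.mono fun _ ↦ oneForm_eq
  have h3 : mu₀ G ω_X J μ ε =ᶠ[𝓝 z₀] mu₀ G ω_X J μ ε₁ := he.mono fun _ ↦ mu₀_eq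
  have h4 : (omega₀ G ω_X J μ ε).bil z₀ = (omega₀ G ω_X J μ ε₁).bil z₀ :=
    congrArg (fun a : E [⋀^Fin 2]→L[ℝ] ℝ ↦ bilin a) (omega₀_eq he)
  have ht := mem_extChartAt_target (I := 𝓘(ℝ, E)) z₀
  have h5 : tensorD (mu₀ G ω_X J μ ε) z₀ = tensorD (E := E) (mu₀ G ω_X J μ ε₁) z₀ := h3.mfderiv_eq
  refine ⟨h.smooth.congr_of_eventuallyEq (Form.inChart_congr ht ?_), ?_, ?_, ?_,
    h.smooth_moment.congr_of_eventuallyEq h3, ?_⟩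
  · rwa [extChartAt_to_inv]
  · exact h.smooth_oneForm.congr_of_eventuallyEq (Form.inChart_congr ht (by rwa [extChartAt_to_inv]))
  · rw [Form.d_congr h1, h.closed]
  · rw [h4]; exact h.nondegenerate
  · rw [h4, h5]; exact h.moment

/-- If `ω₀` is symplectic near `U^ε` then `U^ε` is a Hamiltonian `G`-manifold. -/
theorem IsRegular.isHamiltonianOn (h : IsRegular G B ω_X μ J) (hr : IsTubeRadius G ω_X μ J ε₁)
    (h0 : 0 < ε) (hε : ε ≤ ε₁)
    (hy : ∀ y ∈ tubeImage G ω_X J μ ε, IsHamiltonianAt G B ω_X J μ ε₁ y) :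
    IsHamiltonianOn G B (omega₀ G ω_X J μ ε) (mu₀ G ω_X J μ ε) (tubeImage G ω_X J μ ε) := by
  have h1 : ∀ y ∈ tubeImage G ω_X J μ ε, IsHamiltonianAt G B ω_X J μ ε y := fun y h1 ↦
    (hy y h1).congr (h.tubeInv_eventuallyEq hr h0 hε h1)
  refine ⟨h.isOpen_tubeImage hr h0 hε, fun g x hx ↦ h.smul_mem_tubeImage g hx,
    fun x hx ↦ (h1 x hx).smooth, fun x hx ↦ (h1 x hx).closed, fun x hx v hv ↦ ?_,
    fun x hx ↦ (h1 x hx).smooth_moment.contMDiffWithinAt, fun g x hx ↦ ?_, fun x hx η v ↦ ?_⟩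
  · exact (h1 x hx).nondegenerate v fun w ↦ (Form.bil_apply (E := E) _ x v w).trans (hv w)
  · rw [mu₀_eq (h.tubeInv_eq hr h0 hε hx), mu₀_eq (h.tubeInv_eq hr h0 hε (h.smul_mem_tubeImage g hx))]
    exact h.mu₀_smul hr g (tubeImage_mono h0 hε hx)
  · exact (Form.bil_apply (E := E) _ x _ v).symm.trans ((h1 x hx).moment η v)

/-- The form `ω₀` is invariant. -/
theorem IsRegular.omega₀_smul (h : IsRegular G B ω_X μ J) (hr : IsTubeRadius G ω_X μ J ε) (g : G)
    {y : X} (hy : y ∈ tubeImage G ω_X J μ ε) (hd : IsHamiltonianAt G B ω_X J μ ε (g • y)) (v w : E) :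
    (omega₀ G ω_X J μ ε).bil (g • y) (smulT E g y v) (smulT E g y w) =
      (omega₀ G ω_X J μ ε).bil y v w := by
  rw [omega₀_apply, omega₀_apply, h.projT_smul hr g hy, h.projT_smul hr g hy,
    (h.proj_smul hr g hy).1, h.ham.bil_smul]
  congr 1
  have h1 : ∀ᶠ x in 𝓝 y, (oneForm G ω_X J μ ε).pullback (fun x : X ↦ g • x) x =
      oneForm G ω_X J μ ε x := by
    filter_upwards [(h.isOpen_tubeImage hr hr.pos le_rfl).mem_nhds hy] with x hx
    refine Form.ext_one fun w ↦ ?_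
    exact (congrArg (fun u : Fin 1 → E ↦ (oneForm G ω_X J μ ε (g • x) u : ℝ))
      (comp_vec_one (smulT E g x) w)).trans (h.oneForm_smul hr g hx w)
  -- Since `Θ` is invariant and `d` commutes with the pullback by `g`, the form `dΘ` is invariant.
  have h2 := Form.d_pullback (oneForm G ω_X J μ ε) (f := fun x : X ↦ g • x) (x := y)
    (.of_forall fun x ↦ contMDiff_smul_const E_G g x) hd.smooth_oneForm
  rw [Form.d_congr h1] at h2
  have h3 := congrArg (fun a : E [⋀^Fin 2]→L[ℝ] ℝ ↦ bilin a v w) h2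
  exact ((Form.bil_pullback _ (T := smulT E g y) rfl v w).symm.trans h3.symm :)

end NormalFormHamiltonian

/-! ### The radial retraction of the tubular neighbourhood -/

section Radial

universe u

variable {E : Type u} [NormedAddCommGroup E] [NormedSpace ℝ E] [FiniteDimensional ℝ E]
  {X : Type*} [TopologicalSpace X] [ChartedSpace E X] [IsManifold 𝓘(ℝ, E) ∞ X] [T2Space X]
  {E_G : Type*} [NormedAddCommGroup E_G] [NormedSpace ℝ E_G] [FiniteDimensional ℝ E_G]
  {G : Type*} [TopologicalSpace G] [ChartedSpace E_G G] [Group G] [LieGroup 𝓘(ℝ, E_G) ∞ G]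
  [ConnectedSpace G] [MulAction G X] [ContMDiffSMul 𝓘(ℝ, E_G) 𝓘(ℝ, E) ∞ G X]
  {J : Π x : X, TangentSpace 𝓘(ℝ, E) x →L[ℝ] TangentSpace 𝓘(ℝ, E) x}
  {ω_X : Form E X 2} {μ : X → E_G} {B : E_G →L[ℝ] E_G →L[ℝ] ℝ}
  {ε : ℝ} {z₀ : X} {Ê : E × E → E} {zh vh : E → E}

local notation "κ" => extChartAt 𝓘(ℝ, E)

/-- Multiplication by `s` in the fibres of `N`, seen on `U^ε`. -/
def radial (G : Type*) [TopologicalSpace G] [ChartedSpace E_G G] [Group G] [MulAction G X]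
    (ω_X : Form E X 2) (J : Π x : X, TangentSpace 𝓘(ℝ, E) x →L[ℝ] TangentSpace 𝓘(ℝ, E) x)
    (μ : X → E_G) (ε s : ℝ) (y : X) : X :=
  expAt ω_X J (proj G ω_X J μ ε y) (s • fibreVec G ω_X J μ ε y)

/-- The derivative of multiplication by `s` in the fibres. -/
def radialT (G : Type*) [TopologicalSpace G] [ChartedSpace E_G G] [Group G] [MulAction G X]
    (ω_X : Form E X 2) (J : Π x : X, TangentSpace 𝓘(ℝ, E) x →L[ℝ] TangentSpace 𝓘(ℝ, E) x)
    (μ : X → E_G) (ε s : ℝ) (y : X) : E →L[ℝ] E :=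
  (mfderiv 𝓘(ℝ, E) 𝓘(ℝ, E) (radial G ω_X J μ ε s) y :)

/-- The velocity of the radial curve through `y`. -/
def radialVelocity (G : Type*) [TopologicalSpace G] [ChartedSpace E_G G] [Group G] [MulAction G X]
    (ω_X : Form E X 2) (J : Π x : X, TangentSpace 𝓘(ℝ, E) x →L[ℝ] TangentSpace 𝓘(ℝ, E) x)
    (μ : X → E_G) (ε s : ℝ) (y : X) : E :=
  velocity E (fun r ↦ radial G ω_X J μ ε r y) s

/-- The radial homotopy in a chart. -/
def radialChart (Ê : E × E → E) (zh vh : E → E) (p : ℝ × E) : E := Ê (zh p.2, p.1 • vh p.2)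

theorem IsRegular.radial_smul (h : IsRegular G B ω_X μ J) (hr : IsTubeRadius G ω_X μ J ε) (g : G)
    (s : ℝ) {y : X} (hy : y ∈ tubeImage G ω_X J μ ε) :
    radial G ω_X J μ ε s (g • y) = g • radial G ω_X J μ ε s y := by
  obtain ⟨h1, h2⟩ := h.proj_smul hr g hy
  rw [radial, radial, h1, h2, ← map_smul, h.ham.expMap_smul h.compatible]

theorem IsTubeChart.radialChart_self (hc : IsTubeChart G ω_X J μ ε z₀ Ê zh vh) (t : ℝ) :
    radialChart Ê zh vh (t, κ z₀ z₀) = κ z₀ z₀ := by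
  simp only [radialChart]
  rw [hc.zh_self, hc.vh_self, smul_zero, hc.exp_zero.self_of_nhds]

theorem IsTubeChart.smoothNear_radialChart (hc : IsTubeChart G ω_X J μ ε z₀ Ê zh vh) (t : ℝ) :
    SmoothNear (radialChart Ê zh vh) (t, κ z₀ z₀) := by
  have h1 : SmoothNear (fun p : ℝ × E ↦ zh p.2) (t, κ z₀ z₀) :=
    SmoothNear.comp (f := Prod.snd) hc.smooth_zh (.of_contDiff contDiff_snd _)
  have h2 : SmoothNear (fun p : ℝ × E ↦ vh p.2) (t, κ z₀ z₀) :=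
    SmoothNear.comp (f := Prod.snd) hc.smooth_vh (.of_contDiff contDiff_snd _)
  have h3 : SmoothNear (fun p : ℝ × E ↦ p.1) (t, κ z₀ z₀) := .of_contDiff contDiff_fst _
  refine SmoothNear.comp (g := Ê) (f := fun p : ℝ × E ↦ (zh p.2, p.1 • vh p.2)) ?_
    (h1.prodMk (h3.smul h2))
  simp only [hc.zh_self, hc.vh_self, smul_zero]
  exact hc.smooth_exp

/-- In the chart, the radial homotopy is given by `radialChart` near `e`. -/
structure IsRadialPoint (G : Type*) [TopologicalSpace G] [ChartedSpace E_G G] [Group G]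
    [MulAction G X] (ω_X : Form E X 2)
    (J : Π x : X, TangentSpace 𝓘(ℝ, E) x →L[ℝ] TangentSpace 𝓘(ℝ, E) x) (μ : X → E_G) (ε : ℝ)
    (z₀ : X) (H : ℝ × E → E) (e : E) : Prop where
  mem : e ∈ (κ z₀).target
  map_mem : ∀ s ∈ Time, H (s, e) ∈ (κ z₀).target
  radial_eq : ∀ s ∈ Time, radial G ω_X J μ ε s ((κ z₀).symm e) = (κ z₀).symm (H (s, e))
  smooth : ∀ s ∈ Time, SmoothNear H (s, e)

/-- Near the centre the vectors `s • vh` with `s ∈ Time` are uniformly small, so the exponential map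
is given by `Ê` along the whole radial homotopy. -/
theorem IsTubeChart.eventually_radial (hc : IsTubeChart G ω_X J μ ε z₀ Ê zh vh) :
    ∀ᶠ e in 𝓝 (κ z₀ z₀), ∀ᶠ e' in 𝓝 e,
      IsRadialPoint G ω_X J μ ε z₀ (radialChart Ê zh vh) e' := by
  have h1 : ∀ᶠ e in 𝓝 (κ z₀ z₀), ∀ t ∈ Time, zh (t, e).2 ∈ (κ z₀).target ∧
      radialChart Ê zh vh (t, e) ∈ (κ z₀).target ∧
      expAt ω_X J ((κ z₀).symm (zh (t, e).2)) (chartS z₀ (zh (t, e).2) ((t, e).1 • vh (t, e).2)) =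
        (κ z₀).symm (radialChart Ê zh vh (t, e)) := by
    refine eventually_forall_time (P := fun p : ℝ × E ↦ zh p.2 ∈ (κ z₀).target ∧
      radialChart Ê zh vh p ∈ (κ z₀).target ∧
      expAt ω_X J ((κ z₀).symm (zh p.2)) (chartS z₀ (zh p.2) (p.1 • vh p.2)) =
        (κ z₀).symm (radialChart Ê zh vh p)) fun t _ ↦ ?_
    have c1 : ContinuousAt (fun p : ℝ × E ↦ (zh p.2, p.1 • vh p.2)) (t, κ z₀ z₀) :=
      (ContinuousAt.comp (f := Prod.snd) (x := (t, κ z₀ z₀)) hc.smooth_zh.continuousAt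
        continuousAt_snd).prodMk (continuousAt_fst.smul (ContinuousAt.comp (f := Prod.snd)
          (x := (t, κ z₀ z₀)) hc.smooth_vh.continuousAt continuousAt_snd))
    have h1 := hc.expAt_eq
    have h2 : (zh (t, κ z₀ z₀).2, (t, κ z₀ z₀).1 • vh (t, κ z₀ z₀).2) = (κ z₀ z₀, (0 : E)) := by
      simp only [hc.zh_self, hc.vh_self, smul_zero]
    rw [← h2] at h1
    exact c1.eventually h1
  have h2 : ∀ᶠ e in 𝓝 (κ z₀ z₀), ∀ t ∈ Time, SmoothNear (radialChart Ê zh vh) (t, e) :=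
    eventually_forall_time fun t _ ↦ (hc.smoothNear_radialChart t).eventually
  refine Filter.Eventually.eventually_nhds ?_
  filter_upwards [h1, h2, hc.eventually] with e k1 k2 k3
  refine ⟨k3.mem, fun s hs ↦ (k1 s hs).2.1, fun s hs ↦ ?_, k2⟩
  rw [radial, k3.proj_eq, k3.fibreVec_eq, ← map_smul]
  exact (k1 s hs).2.2

theorem time_mem_nhds {s : ℝ} (hs : s ∈ Ioo (-1 : ℝ) 2) : Time ∈ 𝓝 s := Icc_mem_nhds hs.1 hs.2

theorem IsRadialPoint.velocity_eq {H : ℝ × E → E} {e : E} (hp : IsRadialPoint G ω_X J μ ε z₀ H e)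
    {s : ℝ} (hs : s ∈ Ioo (-1 : ℝ) 2) :
    MDifferentiableAt 𝓘(ℝ, ℝ) 𝓘(ℝ, E) (fun r ↦ radial G ω_X J μ ε r ((κ z₀).symm e)) s ∧
      radialVelocity G ω_X J μ ε s ((κ z₀).symm e) =
        chartS z₀ (H (s, e)) (fderiv ℝ H (s, e) (1, 0)) := by
  have hsT : s ∈ Time := Ioo_subset_Icc_self hs
  have h1 : HasDerivAt (fun r ↦ H (r, e)) (fderiv ℝ H (s, e) (1, 0)) s :=
    (hasFDerivAt_fst_slice (hp.smooth s hsT).differentiableAt).hasDerivAt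
  obtain ⟨h2, h3⟩ := hasMFDerivAt_chart_symm_comp (hp.map_mem s hsT) h1
  have h4 : (fun r ↦ radial G ω_X J μ ε r ((κ z₀).symm e)) =ᶠ[𝓝 s]
      fun r ↦ (κ z₀).symm (H (r, e)) := by
    filter_upwards [time_mem_nhds hs] with r hr using hp.radial_eq r hr
  refine ⟨h2.congr_of_eventuallyEq h4, ?_⟩
  rw [← h3, radialVelocity, velocity, velocity, h4.mfderiv_eq]
  rfl

theorem radialT_chart {H : ℝ × E → E} {e : E}
    (hp : ∀ᶠ e' in 𝓝 e, IsRadialPoint G ω_X J μ ε z₀ H e') {s : ℝ} (hs : s ∈ Time) :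
    MDifferentiableAt 𝓘(ℝ, E) 𝓘(ℝ, E) (radial G ω_X J μ ε s) ((κ z₀).symm e) ∧ ∀ w : E,
      radialT G ω_X J μ ε s ((κ z₀).symm e) (chartS z₀ e w) =
        chartS z₀ (H (s, e)) (fderiv ℝ H (s, e) (0, w)) := by
  have h1 := hp.self_of_nhds
  have h2 : HasFDerivAt (fun x ↦ H (s, x)) ((fderiv ℝ H (s, e)).comp (.inr ℝ ℝ E)) e :=
    hasFDerivAt_snd_slice (h1.smooth s hs).differentiableAt
  have h3 : ∀ᶠ e' in 𝓝 e, radial G ω_X J μ ε s ((κ z₀).symm e') = (κ z₀).symm (H (s, e')) :=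
    hp.mono fun _ he ↦ he.radial_eq s hs
  refine ⟨(hasMFDerivAt_of_reading h1.mem (h1.map_mem s hs) h3 h2).mdifferentiableAt, fun w ↦ ?_⟩
  have h4 := chartT_mfderiv_of_reading (F := fun x ↦ H (s, x)) h1.mem (h1.map_mem s hs) h3
    h2.differentiableAt w
  rw [h2.fderiv] at h4
  exact h4

theorem IsRegular.radialT_tensorL (h : IsRegular G B ω_X μ J) (hr : IsTubeRadius G ω_X μ J ε)
    {y : X} (hy : y ∈ tubeImage G ω_X J μ ε) {s : ℝ}
    (hd : MDifferentiableAt 𝓘(ℝ, E) 𝓘(ℝ, E) (radial G ω_X J μ ε s) y) (η : E_G) :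
    radialT G ω_X J μ ε s y (tensorL E E_G G y η) =
      tensorL E E_G G (radial G ω_X J μ ε s y) η := by
  have h0 : ∀ y' : X, y' = y → HasMFDerivAt 𝓘(ℝ, E) 𝓘(ℝ, E) (radial G ω_X J μ ε s) y'
      (radialT (E := E) G ω_X J μ ε s y :) := by
    rintro _ rfl
    exact hd.hasMFDerivAt
  have h1 := HasMFDerivAt.comp (1 : G) (h0 _ (one_smul G y))
    (hasMFDerivAt_orbit (E := E) (E_G := E_G) (G := G) y)
  have h2 := hasMFDerivAt_orbit (E := E) (E_G := E_G) (G := G) (radial G ω_X J μ ε s y)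
  have h3 : (radial G ω_X J μ ε s ∘ fun g : G ↦ g • y) =
      fun g : G ↦ g • radial G ω_X J μ ε s y := funext fun g ↦ h.radial_smul hr g s hy
  rw [h3] at h1
  exact congrArg (fun T : E_G →L[ℝ] E ↦ T η) (hasMFDerivAt_unique h1 h2)

theorem IsRegular.radialT_smul (h : IsRegular G B ω_X μ J) (hr : IsTubeRadius G ω_X μ J ε) (g : G)
    {y : X} (hy : y ∈ tubeImage G ω_X J μ ε) {s : ℝ}
    (hd : MDifferentiableAt 𝓘(ℝ, E) 𝓘(ℝ, E) (radial G ω_X J μ ε s) y) (w : E) :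
    radialT G ω_X J μ ε s (g • y) (smulT E g y w) =
      smulT E g (radial G ω_X J μ ε s y) (radialT G ω_X J μ ε s y w) := by
  -- Near `g • y` the radial map is a conjugate of the one near `y`, so differentiability at `g • y`
  -- follows from that at `y`.
  have h0 : radial G ω_X J μ ε s =ᶠ[𝓝 (g • y)]
      (fun x ↦ g • x) ∘ radial G ω_X J μ ε s ∘ fun x ↦ g⁻¹ • x := by
    filter_upwards [(h.isOpen_tubeImage hr hr.pos le_rfl).mem_nhds (h.smul_mem_tubeImage g hy)]
      with x hx
    simp only [Function.comp_apply]
    rw [h.radial_smul hr g⁻¹ s hx, smul_inv_smul]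
  have h1 : ∀ y' : X, y' = y → HasMFDerivAt 𝓘(ℝ, E) 𝓘(ℝ, E) (radial G ω_X J μ ε s) y'
      (radialT (E := E) G ω_X J μ ε s y :) := by
    rintro _ rfl
    exact hd.hasMFDerivAt
  have h2 : ∀ x' : X, x' = radial G ω_X J μ ε s y → HasMFDerivAt 𝓘(ℝ, E) 𝓘(ℝ, E)
      (fun x : X ↦ g • x) x' (smulT E g (radial G ω_X J μ ε s y) :) := by
    rintro _ rfl
    exact hasMFDerivAt_smul E_G g _
  have h12 : HasMFDerivAt 𝓘(ℝ, E) 𝓘(ℝ, E) (radial G ω_X J μ ε s ∘ fun x : X ↦ g⁻¹ • x) (g • y)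
      ((radialT (E := E) G ω_X J μ ε s y).comp (smulT E g⁻¹ (g • y)) :) :=
    HasMFDerivAt.comp (g := radial G ω_X J μ ε s) (f := fun x : X ↦ g⁻¹ • x) (g • y)
      (h1 _ (inv_smul_smul g y)) (hasMFDerivAt_smul E_G g⁻¹ (g • y))
  have h3 := HasMFDerivAt.comp (g := fun x : X ↦ g • x)
    (f := radial G ω_X J μ ε s ∘ fun x : X ↦ g⁻¹ • x) (g • y)
    (h2 _ (congrArg (radial G ω_X J μ ε s) (inv_smul_smul g y))) h12
  have h4 := (h3.congr_of_eventuallyEq h0).mfderiv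
  have h5 := congrArg (fun T : E →L[ℝ] E ↦ T (smulT E g y w)) h4
  have h6 := smulT_inv_smulT E_G g y w
  refine h5.trans (congrArg (fun v : E ↦ smulT E g (radial G ω_X J μ ε s y)
    (radialT G ω_X J μ ε s y v)) h6)

variable (E_G) in
include E_G in
theorem velocity_smul (g : G) {γ : ℝ → X} {t : ℝ}
    (hγ : MDifferentiableAt 𝓘(ℝ, ℝ) 𝓘(ℝ, E) γ t) :
    MDifferentiableAt 𝓘(ℝ, ℝ) 𝓘(ℝ, E) (fun s ↦ g • γ s) t ∧
      velocity E (fun s ↦ g • γ s) t = smulT E g (γ t) (velocity E γ t) := by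
  have h1 := HasMFDerivAt.comp t (hasMFDerivAt_smul E_G g (γ t)) hγ.hasMFDerivAt
  exact ⟨h1.mdifferentiableAt, congrArg (fun T : ℝ →L[ℝ] E ↦ T 1) h1.mfderiv⟩

end Radial

/-! ### Moser's vector field on the tubular neighbourhood -/

section Moser

universe u

variable {E : Type u} [NormedAddCommGroup E] [NormedSpace ℝ E] [FiniteDimensional ℝ E]
  {X : Type*} [TopologicalSpace X] [ChartedSpace E X] [IsManifold 𝓘(ℝ, E) ∞ X] [T2Space X]
  {E_G : Type*} [NormedAddCommGroup E_G] [NormedSpace ℝ E_G] [FiniteDimensional ℝ E_G]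
  {G : Type*} [TopologicalSpace G] [ChartedSpace E_G G] [Group G] [LieGroup 𝓘(ℝ, E_G) ∞ G]
  [ConnectedSpace G] [MulAction G X] [ContMDiffSMul 𝓘(ℝ, E_G) 𝓘(ℝ, E) ∞ G X]
  {J : Π x : X, TangentSpace 𝓘(ℝ, E) x →L[ℝ] TangentSpace 𝓘(ℝ, E) x}
  {ω_X : Form E X 2} {μ : X → E_G} {B : E_G →L[ℝ] E_G →L[ℝ] ℝ}
  {ε : ℝ} {z₀ : X} {Ê : E × E → E} {zh vh : E → E}

local notation "κ" => extChartAt 𝓘(ℝ, E)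

/-- The contraction of the pullback of `ω - ω₀` under multiplication by `s` in the fibres with the
radial velocity. -/
def radialForm (G : Type*) [TopologicalSpace G] [ChartedSpace E_G G] [Group G] [MulAction G X]
    (ω_X : Form E X 2) (J : Π x : X, TangentSpace 𝓘(ℝ, E) x →L[ℝ] TangentSpace 𝓘(ℝ, E) x)
    (μ : X → E_G) (ε s : ℝ) (y : X) (w : E) : ℝ :=
  ω_X.bil (radial G ω_X J μ ε s y) (radialVelocity G ω_X J μ ε s y) (radialT G ω_X J μ ε s y w) -
    (omega₀ G ω_X J μ ε).bil (radial G ω_X J μ ε s y) (radialVelocity G ω_X J μ ε s y)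
      (radialT G ω_X J μ ε s y w)

/-- The vector `v` at `y` satisfies Moser's equation at time `t`. -/
def IsMoserVector (G : Type*) [TopologicalSpace G] [ChartedSpace E_G G] [Group G] [MulAction G X]
    (ω_X : Form E X 2) (J : Π x : X, TangentSpace 𝓘(ℝ, E) x →L[ℝ] TangentSpace 𝓘(ℝ, E) x)
    (μ : X → E_G) (ε t : ℝ) (y : X) (v : E) : Prop :=
  ∀ w : E, (omega₀ G ω_X J μ ε).bil y v w +
    t * (ω_X.bil y v w - (omega₀ G ω_X J μ ε).bil y v w) =
      -∫ s in (0 : ℝ)..1, radialForm G ω_X J μ ε s y w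

theorem IsRegular.omega₀_of_zero (h : IsRegular G B ω_X μ J) (hr : IsTubeRadius G ω_X μ J ε)
    {z : X} (hz : μ z = 0) : omega₀ G ω_X J μ ε z = ω_X z := by
  obtain ⟨Ê, zh, vh, hc⟩ := h.exists_isTubeChart hr hz
  have h1 := hc.omega₀_self h hz
  have hs := mem_extChartAt_source (I := 𝓘(ℝ, E)) z
  refine Form.ext_two fun v w ↦ ?_
  exact ((omega₀ G ω_X J μ ε).apply_eq_inChart hs _).trans
    ((congrArg (fun a : E [⋀^Fin 2]→L[ℝ] ℝ ↦ a _) h1).trans (ω_X.apply_eq_inChart hs _).symm)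

theorem inChart_radialForm {H : ℝ × E → E} {e : E}
    (hp : ∀ᶠ e' in 𝓝 e, IsRadialPoint G ω_X J μ ε z₀ H e') (w : E) :
    ∫ s in (0 : ℝ)..1, radialForm G ω_X J μ ε s ((κ z₀).symm e) (chartS z₀ e w) =
      ∫ s in (0 : ℝ)..1, (ω_X.inChart z₀ (H (s, e)) - (omega₀ G ω_X J μ ε).inChart z₀ (H (s, e)))
        ![fderiv ℝ H (s, e) (1, 0), fderiv ℝ H (s, e) (0, w)] := by
  refine intervalIntegral.integral_congr fun s hs ↦ ?_
  have hsT := mem_time_of_mem_uIcc hs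
  have h1 := hp.self_of_nhds
  simp only [radialForm]
  rw [(h1.velocity_eq (mem_Ioo_of_mem_uIcc hs)).2, (radialT_chart hp hsT).2, h1.radial_eq s hsT,
    ← Form.hat_eq_bil, ← Form.hat_eq_bil, Form.hat_apply, Form.hat_apply]
  rfl

/-- The terms of Moser's equation are tensorial, and the chart derivatives cancel. This identifies
the equation on the manifold with the one solved by `moserField`. -/
theorem isMoserVector_chart {H : ℝ × E → E} {e : E}
    (hp : ∀ᶠ e' in 𝓝 e, IsRadialPoint G ω_X J μ ε z₀ H e') (t : ℝ) (v : E) :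
    IsMoserVector G ω_X J μ ε t ((κ z₀).symm e) (chartS z₀ e v) ↔
      ∀ w : E, formPath (ω_X.inChart z₀) ((omega₀ G ω_X J μ ε).inChart z₀) (t, e) ![v, w] =
        -∫ s in (0 : ℝ)..1,
          (ω_X.inChart z₀ (H (s, e)) - (omega₀ G ω_X J μ ε).inChart z₀ (H (s, e)))
            ![fderiv ℝ H (s, e) (1, 0), fderiv ℝ H (s, e) (0, w)] := by
  have h1 (w : E) : formPath (ω_X.inChart z₀) ((omega₀ G ω_X J μ ε).inChart z₀) (t, e) ![v, w] =
      (omega₀ G ω_X J μ ε).bil ((κ z₀).symm e) (chartS z₀ e v) (chartS z₀ e w) +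
      t * (ω_X.bil ((κ z₀).symm e) (chartS z₀ e v) (chartS z₀ e w) -
        (omega₀ G ω_X J μ ε).bil ((κ z₀).symm e) (chartS z₀ e v) (chartS z₀ e w)) := by
    rw [← Form.hat_eq_bil, ← Form.hat_eq_bil, Form.hat_apply, Form.hat_apply]
    rfl
  constructor
  · intro h w
    rw [h1, ← inChart_radialForm hp]
    exact h _
  · intro h w
    have h2 := h (chartT z₀ ((κ z₀).symm e) w)
    rwa [h1, ← inChart_radialForm hp, chartS_chartT' hp.self_of_nhds.mem] at h2

/-- Moser's equation is invariant. -/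
theorem IsRegular.isMoserVector_smul (h : IsRegular G B ω_X μ J) (hr : IsTubeRadius G ω_X μ J ε)
    (g : G) {H : ℝ × E → E} {e : E} (hp : ∀ᶠ e' in 𝓝 e, IsRadialPoint G ω_X J μ ε z₀ H e')
    (hy : (κ z₀).symm e ∈ tubeImage G ω_X J μ ε)
    (hd : ∀ x ∈ tubeImage G ω_X J μ ε, IsHamiltonianAt G B ω_X J μ ε x)
    (hm : ∀ s ∈ Time, (κ z₀).symm (H (s, e)) ∈ tubeImage G ω_X J μ ε) {t : ℝ} {v : E}
    (hv : IsMoserVector G ω_X J μ ε t ((κ z₀).symm e) v) :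
    IsMoserVector G ω_X J μ ε t (g • (κ z₀).symm e) (smulT E g ((κ z₀).symm e) v) := by
  set y := (κ z₀).symm e with hydef
  intro w'
  obtain ⟨w, rfl⟩ : ∃ w, w' = smulT E g y w :=
    ⟨smulT E g⁻¹ (g • y) w', (smulT_smulT_inv E_G g y w').symm⟩
  rw [h.omega₀_smul hr g hy (hd _ (h.smul_mem_tubeImage g hy)), h.ham.bil_smul, hv w]
  congr 1
  refine intervalIntegral.integral_congr fun s hs ↦ ?_
  have hsT := mem_time_of_mem_uIcc hs
  have h1 := hp.self_of_nhds
  have h2 := hm s hsT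
  rw [← h1.radial_eq s hsT] at h2
  have h3 : radialVelocity G ω_X J μ ε s (g • y) =
      smulT E g (radial G ω_X J μ ε s y) (radialVelocity G ω_X J μ ε s y) := by
    rw [radialVelocity, radialVelocity,
      ← (velocity_smul E_G g (h1.velocity_eq (mem_Ioo_of_mem_uIcc hs)).1).2]
    congr 1
    exact funext fun r ↦ h.radial_smul hr g r hy
  simp only [radialForm]
  rw [h3, h.radialT_smul hr g hy (radialT_chart hp hsT).1, h.radial_smul hr g s hy,
    h.omega₀_smul hr g h2 (hd _ (h.smul_mem_tubeImage g h2)), h.ham.bil_smul]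

theorem IsTubeChart.eventually_radialChart (hc : IsTubeChart G ω_X J μ ε z₀ Ê zh vh)
    {P : E → Prop} (hP : ∀ᶠ e in 𝓝 (κ z₀ z₀), P e) :
    ∀ᶠ e in 𝓝 (κ z₀ z₀), ∀ s ∈ Time, P (radialChart Ê zh vh (s, e)) := by
  refine eventually_forall_time (P := fun p ↦ P (radialChart Ê zh vh p)) fun t _ ↦ ?_
  rw [← hc.radialChart_self t] at hP
  exact (hc.smoothNear_radialChart t).continuousAt.eventually hP

theorem IsTubeChart.radialChart_one (hc : IsTubeChart G ω_X J μ ε z₀ Ê zh vh) :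
    ∀ᶠ e in 𝓝 (κ z₀ z₀), radialChart Ê zh vh (1, e) = e := by
  filter_upwards [hc.eventually] with e he
  rw [radialChart, one_smul, he.exp_eq]

theorem IsTubeChart.radialChart_zero (hc : IsTubeChart G ω_X J μ ε z₀ Ê zh vh) :
    ∀ᶠ e in 𝓝 (κ z₀ z₀), radialChart Ê zh vh (0, e) = zh e := by
  have h1 := hc.exp_zero
  rw [← hc.zh_self] at h1
  filter_upwards [hc.smooth_zh.continuousAt.eventually h1] with e he
  rw [radialChart, zero_smul, he]

theorem IsTubeChart.radialT_hatL (h : IsRegular G B ω_X μ J) (hr : IsTubeRadius G ω_X μ J ε)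
    (hc : IsTubeChart G ω_X J μ ε z₀ Ê zh vh) :
    ∀ᶠ e in 𝓝 (κ z₀ z₀), ∀ s ∈ Time, ∀ η : E_G,
      fderiv ℝ (radialChart Ê zh vh) (s, e) (0, hatL G z₀ e η) =
        hatL G z₀ (radialChart Ê zh vh (s, e)) η := by
  filter_upwards [hc.eventually_radial, hc.eventually] with e k1 k2 s hs η
  have k3 := k1.self_of_nhds
  obtain ⟨k4, k5⟩ := radialT_chart k1 hs
  have k6 := k5 (hatL G z₀ e η)
  rw [chartS_hatL k2.mem, h.radialT_tensorL hr k2.mem_image k4, k3.radial_eq s hs,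
    ← chartS_hatL (k3.map_mem s hs)] at k6
  rw [← chartT_chartS (k3.map_mem s hs) (fderiv ℝ (radialChart Ê zh vh) (s, e) _), ← k6,
    chartT_chartS (k3.map_mem s hs)]

theorem integral_fderiv_comp_slice {f : E → ℝ} {H : ℝ × E → E} {e : E}
    (hH : ∀ s ∈ Time, SmoothNear H (s, e)) (hf : ∀ s ∈ Time, SmoothNear f (H (s, e))) :
    ∫ s in (0 : ℝ)..1, fderiv ℝ f (H (s, e)) (fderiv ℝ H (s, e) (1, 0)) =
      f (H (1, e)) - f (H (0, e)) := by
  refine intervalIntegral.integral_eq_sub_of_hasDerivAt (f := fun s ↦ f (H (s, e)))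
    (fun s hs ↦ ?_) (ContinuousOn.intervalIntegrable fun s hs ↦ ?_)
  · have hsT := mem_time_of_mem_uIcc hs
    exact ((hf s hsT).differentiableAt.hasFDerivAt.comp s
      (hasFDerivAt_fst_slice (hH s hsT).differentiableAt)).hasDerivAt
  · have hsT := mem_time_of_mem_uIcc hs
    have h1 : SmoothNear (fun p ↦ fderiv ℝ f (H p) (fderiv ℝ H p (1, 0))) (s, e) :=
      (SmoothNear.comp (g := fderiv ℝ f) (hf s hsT).fderiv (hH s hsT)).clm_apply
        ((hH s hsT).fderiv.clm_apply (smoothNear_const (1, 0) _))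
    have h2 : ContinuousAt (fun s : ℝ ↦ (s, e)) s := by fun_prop
    exact (ContinuousAt.comp (f := fun s : ℝ ↦ (s, e)) (x := s) h1.continuousAt
      h2).continuousWithinAt

/-- The derivative of the moment map of the path of forms along a solution of Moser's equation. -/
theorem IsTubeChart.moser_moment (h : IsRegular G B ω_X μ J) (hr : IsTubeRadius G ω_X μ J ε)
    (hc : IsTubeChart G ω_X J μ ε z₀ Ê zh vh) :
    ∀ᶠ e in 𝓝 (κ z₀ z₀), ∀ (t : ℝ) (v : E),
      (∀ w : E, formPath (ω_X.inChart z₀) ((omega₀ G ω_X J μ ε).inChart z₀) (t, e) ![v, w] =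
        -∫ s in (0 : ℝ)..1, (ω_X.inChart z₀ (radialChart Ê zh vh (s, e)) -
          (omega₀ G ω_X J μ ε).inChart z₀ (radialChart Ê zh vh (s, e)))
            ![fderiv ℝ (radialChart Ê zh vh) (s, e) (1, 0),
              fderiv ℝ (radialChart Ê zh vh) (s, e) (0, w)]) →
      ∀ η : E_G, B (fderiv ℝ (fun e ↦ mu₀ G ω_X J μ ε ((κ z₀).symm e)) e v) η +
          t * (B (fderiv ℝ (hatMu μ z₀) e v) η -
            B (fderiv ℝ (fun e ↦ mu₀ G ω_X J μ ε ((κ z₀).symm e)) e v) η) =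
        -(B (hatMu μ z₀ e) η - B (mu₀ G ω_X J μ ε ((κ z₀).symm e)) η) := by
  -- The point `zh e` lies on the zero level, where the fibre vector and hence `μ₀` vanish. This
  -- removes the lower end of the radial integral.
  have hz : ∀ᶠ e in 𝓝 (κ z₀ z₀), mu₀ G ω_X J μ ε ((κ z₀).symm (zh e)) = 0 := by
    have h1 : ∀ᶠ e in 𝓝 (κ z₀ z₀), IsTubePoint G ω_X J μ ε z₀ Ê zh vh e ∧
      (μ ((κ z₀).symm e) = 0 → zh e = e ∧ vh e = 0) := hc.eventually.and hc.zero
    rw [← hc.zh_self] at h1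
    filter_upwards [hc.smooth_zh.continuousAt.eventually h1, hc.eventually] with e k1 k2
    rw [k1.1.mu₀_eq h, (k1.2 k2.level).2, map_zero]
  have hM := hc.moment h hr
  filter_upwards [hc.radialT_hatL h hr, hc.eventually_radialChart hM, hM, hc.radialChart_one,
    hc.radialChart_zero, hc.eventually, hz,
    hc.eventually_radialChart (hc.smoothNear_mu₀ h).eventually, hc.eventually_radial]
    with e k1 k2 k3 k4 k5 k6 k7 k8 k9 t v hv η
  set H := radialChart Ê zh vh
  set m₀ : E → E_G := fun e ↦ mu₀ G ω_X J μ ε ((κ z₀).symm e)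
  have hm₀ (x : E) : mu₀ G ω_X J μ ε ((κ z₀).symm x) = m₀ x := rfl
  simp only [hm₀] at k7 ⊢
  have l0 := k9.self_of_nhds
  -- Moser's equation is tested on the infinitesimal action.
  have l1 := hv (hatL G z₀ e η)
  have l2 (s : ℝ) (hs : s ∈ Time) : SmoothNear (fun e ↦ B.flip η (hatMu μ z₀ e - m₀ e))
      (H (s, e)) :=
    ((h.ham.smoothNear_hatMu (l0.map_mem s hs)).sub (k8 s hs)).clm_const (B.flip η)
  have l3 := integral_fderiv_comp_slice l0.smooth l2
  -- The radial maps carry `X_η` to `X_η`, so the moment equations for `ω` and `ω₀` turn the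
  -- integrand into minus the derivative of `⟨μ - μ₀, η⟩` along the radial curve.
  have l4 : ∫ s in (0 : ℝ)..1, (ω_X.inChart z₀ (H (s, e)) -
      (omega₀ G ω_X J μ ε).inChart z₀ (H (s, e)))
        ![fderiv ℝ H (s, e) (1, 0), fderiv ℝ H (s, e) (0, hatL G z₀ e η)] =
      ∫ s in (0 : ℝ)..1, -(fderiv ℝ (fun e ↦ B.flip η (hatMu μ z₀ e - m₀ e)) (H (s, e))
        (fderiv ℝ H (s, e) (1, 0))) := by
    refine intervalIntegral.integral_congr fun s hs ↦ ?_
    have hsT := mem_time_of_mem_uIcc hs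
    have n1 : ∀ u : E, fderiv ℝ (fun e ↦ B.flip η (hatMu μ z₀ e - m₀ e)) (H (s, e)) u =
        B (fderiv ℝ (hatMu μ z₀) (H (s, e)) u) η - B (fderiv ℝ m₀ (H (s, e)) u) η := by
      intro u
      have := ((B.flip η).hasFDerivAt.comp (H (s, e))
        ((h.ham.smoothNear_hatMu (l0.map_mem s hsT)).differentiableAt.hasFDerivAt.sub
          (k8 s hsT).differentiableAt.hasFDerivAt)).fderiv
      refine (congrArg (fun T : E →L[ℝ] ℝ ↦ T u) this).trans ?_
      simp only [ContinuousLinearMap.comp_apply, sub_apply, map_sub,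
        ContinuousLinearMap.flip_apply]
    rw [n1, k1 s hsT, ← h.ham.moment_chart (l0.map_mem s hsT), ← k2 s hsT, ω_X.hat_swap,
      (omega₀ G ω_X J μ ε).hat_swap, Form.hat_apply, Form.hat_apply, sub_neg_eq_add, neg_add,
      neg_neg, ← sub_eq_add_neg]
    rfl
  rw [l4, intervalIntegral.integral_neg, neg_neg, l3, k4, k5, k7] at l1
  have l5 : formPath (ω_X.inChart z₀) ((omega₀ G ω_X J μ ε).inChart z₀) (t, e)
      ![v, hatL G z₀ e η] = (omega₀ G ω_X J μ ε).hat z₀ e v (hatL G z₀ e η) +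
        t * (ω_X.hat z₀ e v (hatL G z₀ e η) -
          (omega₀ G ω_X J μ ε).hat z₀ e v (hatL G z₀ e η)) := by
    rw [Form.hat_apply, Form.hat_apply]
    rfl
  have l6 : hatMu μ z₀ (zh e) = 0 := k6.level
  rw [l5, ω_X.hat_swap, (omega₀ G ω_X J μ ε).hat_swap, h.ham.moment_chart k6.mem, k3] at l1
  rw [l6, sub_zero, map_zero, sub_zero, map_sub] at l1
  simp only [ContinuousLinearMap.flip_apply] at l1
  linarith

end Moser

/-! ### The flow of Moser's vector field -/

section MoserFlow

universe u

variable {E : Type u} [NormedAddCommGroup E] [NormedSpace ℝ E] [FiniteDimensional ℝ E]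
  {X : Type*} [TopologicalSpace X] [ChartedSpace E X] [IsManifold 𝓘(ℝ, E) ∞ X] [T2Space X]
  {E_G : Type*} [NormedAddCommGroup E_G] [NormedSpace ℝ E_G] [FiniteDimensional ℝ E_G]
  {G : Type*} [TopologicalSpace G] [ChartedSpace E_G G] [Group G] [LieGroup 𝓘(ℝ, E_G) ∞ G]
  [ConnectedSpace G] [MulAction G X] [ContMDiffSMul 𝓘(ℝ, E_G) 𝓘(ℝ, E) ∞ G X]
  {J : Π x : X, TangentSpace 𝓘(ℝ, E) x →L[ℝ] TangentSpace 𝓘(ℝ, E) x}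
  {ω_X : Form E X 2} {μ : X → E_G} {B : E_G →L[ℝ] E_G →L[ℝ] ℝ}
  {ε : ℝ} {z₀ : X} {Ê : E × E → E} {zh vh : E → E}

local notation "κ" => extChartAt 𝓘(ℝ, E)

/-- In the chart around `z₀`, Moser's vector field is `V` and its flow is `Φ`. -/
structure IsMoserChart (G : Type*) [TopologicalSpace G] [ChartedSpace E_G G] [Group G]
    [MulAction G X] (ω_X : Form E X 2)
    (J : Π x : X, TangentSpace 𝓘(ℝ, E) x →L[ℝ] TangentSpace 𝓘(ℝ, E) x) (μ : X → E_G) (ε : ℝ)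
    (z₀ : X) (V : ℝ × E → E) (Φ : ℝ → E → E) : Prop where
  smooth_field : ∀ t ∈ Time, SmoothNear V (t, κ z₀ z₀)
  isMoserVector_iff : ∀ᶠ e in 𝓝 (κ z₀ z₀), ∀ t ∈ Time, ∀ v : E,
    IsMoserVector G ω_X J μ ε t ((κ z₀).symm e) (chartS z₀ e v) ↔ v = V (t, e)
  smul : ∀ᶠ e in 𝓝 (κ z₀ z₀), ∀ (g : G) (t : ℝ) (v : E),
    IsMoserVector G ω_X J μ ε t ((κ z₀).symm e) v →
      IsMoserVector G ω_X J μ ε t (g • (κ z₀).symm e) (smulT E g ((κ z₀).symm e) v)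
  small : ∀ U ∈ 𝓝 (κ z₀ z₀), ∀ᶠ e in 𝓝 (κ z₀ z₀), ∀ t, Φ t e ∈ U
  smooth : SmoothNear (Φ 1) (κ z₀ z₀)
  flow : ∀ᶠ e in 𝓝 (κ z₀ z₀), Φ 0 e = e ∧
    ∀ t ∈ Ioo (-1 : ℝ) 2, HasDerivAt (fun s ↦ Φ s e) (V (t, Φ t e)) t
  symplectic : ∀ᶠ e in 𝓝 (κ z₀ z₀), (ω_X.inChart z₀ (Φ 1 e)).compContinuousLinearMap
    (fderiv ℝ (Φ 1) e) = (omega₀ G ω_X J μ ε).inChart z₀ e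
  moment : ∀ᶠ e in 𝓝 (κ z₀ z₀), μ ((κ z₀).symm (Φ 1 e)) = mu₀ G ω_X J μ ε ((κ z₀).symm e)
  flow_self : Φ 1 (κ z₀ z₀) = κ z₀ z₀
  fderiv_self : fderiv ℝ (Φ 1) (κ z₀ z₀) = .id ℝ E

/-- The local Moser flow is applied to `ω` and `ω₀` with the radial homotopy. The moment maps are
matched because the interpolated moment `μ₀ + t (μ - μ₀)` is constant along the flow. -/
theorem IsRegular.exists_isMoserChart (h : IsRegular G B ω_X μ J)
    (hr : IsTubeRadius G ω_X μ J ε) (hd : ∀ x ∈ tubeImage G ω_X J μ ε, IsHamiltonianAt G B ω_X J μ ε x)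
    (hz₀ : μ z₀ = 0) :
    ∃ (V : ℝ × E → E) (Φ : ℝ → E → E), IsMoserChart G ω_X J μ ε z₀ V Φ := by
  obtain ⟨Ê, zh, vh, hc⟩ := h.exists_isTubeChart hr hz₀
  have he₀ := mem_extChartAt_target (I := 𝓘(ℝ, E)) z₀
  -- The retraction ends on the zero level, where the two forms agree.
  have hH0 : ∀ᶠ e in 𝓝 (κ z₀ z₀), ω_X.inChart z₀ (radialChart Ê zh vh (0, e)) =
      (omega₀ G ω_X J μ ε).inChart z₀ (radialChart Ê zh vh (0, e)) := by
    filter_upwards [hc.radialChart_zero, hc.eventually] with e k1 k2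
    rw [k1, Form.inChart, Form.inChart, h.omega₀_of_zero hr k2.level]
  obtain ⟨h1, h2, Φ, h3, h4, h5, h6, h7⟩ := exists_moser_flow (τ₁ := ω_X.inChart z₀)
    (τ₀ := (omega₀ G ω_X J μ ε).inChart z₀) (H := radialChart Ê zh vh) (e := κ z₀ z₀)
    (smoothNear_inChart h.smooth he₀) (hc.smoothNear_omega₀ h)
    (by
      filter_upwards [chart_target_mem_nhds he₀] with e he using h.ham.extDeriv_inChart he) (hc.extDeriv_omega₀ h)
    (fun t _ ↦ hc.smoothNear_radialChart t) (fun t _ ↦ hc.radialChart_self t) hc.radialChart_one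
    hH0 (h.inChart_nondegenerate he₀)
  set V := moserField (ω_X.inChart z₀) ((omega₀ G ω_X J μ ε).inChart z₀) (radialChart Ê zh vh)
  have hself := h7.self_of_nhds (fun t _ ↦ hc.radialChart_self t) (hc.omega₀_self h hz₀).symm
  have hmem : ∀ᶠ e in 𝓝 (κ z₀ z₀), (κ z₀).symm e ∈ tubeImage G ω_X J μ ε :=
    hc.eventually.mono fun _ he ↦ he.mem_image
  have hgood : ∀ᶠ e in 𝓝 (κ z₀ z₀), ∀ t, e ∈ (κ z₀).target ∧
      DifferentiableAt ℝ (fun e ↦ mu₀ G ω_X J μ ε ((κ z₀).symm e)) e ∧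
      (t ∈ Time → ∀ η : E_G, B (fderiv ℝ (fun e ↦ mu₀ G ω_X J μ ε ((κ z₀).symm e)) e (V (t, e))) η +
          t * (B (fderiv ℝ (hatMu μ z₀) e (V (t, e))) η -
            B (fderiv ℝ (fun e ↦ mu₀ G ω_X J μ ε ((κ z₀).symm e)) e (V (t, e))) η) =
        -(B (hatMu μ z₀ e) η - B (mu₀ G ω_X J μ ε ((κ z₀).symm e)) η)) := by
    filter_upwards [chart_target_mem_nhds he₀, (hc.smoothNear_mu₀ h).eventually,
      hc.moser_moment h hr, h2] with e k1 k2 k3 k4 t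
    exact ⟨k1, k2.differentiableAt, fun ht ↦ k3 t _ ((k4 t ht _).2 rfl)⟩
  refine ⟨V, Φ, h1, ?_, ?_, h3, ?_, h5, h6, ?_, hself.1 1, hself.2 1⟩
  · filter_upwards [h2, hc.eventually_radial] with e k1 k2 t ht v
    rw [← k1 t ht v, isMoserVector_chart k2]
  · filter_upwards [hc.eventually_radial, hmem, hc.eventually_radialChart hmem] with e k1 k2 k3 g t v
    exact h.isMoserVector_smul hr g k1 k2 hd k3
  · exact h4.mono fun e he ↦ (he 1).contDiffAt
  · filter_upwards [h3 _ hgood, h5] with e k1 ⟨k2, k3⟩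
    have key (η : E_G) : B (μ ((κ z₀).symm (Φ 1 e))) η = B (mu₀ G ω_X J μ ε ((κ z₀).symm e)) η := by
      set m₀ : E → E_G := fun e ↦ mu₀ G ω_X J μ ε ((κ z₀).symm e)
      -- The explicit time derivative `⟨μ - μ₀, η⟩` cancels the derivative along Moser's field given
      -- by `IsTubeChart.moser_moment`.
      have l1 (t : ℝ) (ht : t ∈ Ioo (-1 : ℝ) 2) : HasDerivAt (fun t ↦ B.flip η (m₀ (Φ t e) +
          t • (hatMu μ z₀ (Φ t e) - m₀ (Φ t e)))) 0 t := by
        obtain ⟨n1, n2, n3⟩ := k1 t t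
        have n4 : HasDerivAt (fun t ↦ m₀ (Φ t e)) (fderiv ℝ m₀ (Φ t e) (V (t, Φ t e))) t :=
          HasFDerivAt.comp_hasDerivAt t (l := m₀) n2.hasFDerivAt (k3 t ht)
        have n5 : HasDerivAt (fun t ↦ hatMu μ z₀ (Φ t e))
            (fderiv ℝ (hatMu μ z₀) (Φ t e) (V (t, Φ t e))) t :=
          HasFDerivAt.comp_hasDerivAt t (l := hatMu μ z₀)
            (h.ham.smoothNear_hatMu n1).differentiableAt.hasFDerivAt (k3 t ht)
        have n6 := (B.flip η).hasFDerivAt.comp_hasDerivAt t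
          (n4.add ((hasDerivAt_id t).smul (n5.sub n4)))
        refine n6.congr_deriv ?_
        have n7 := n3 (Ioo_subset_Icc_self ht) η
        simp only [map_add, map_smul, map_sub, ContinuousLinearMap.flip_apply, id_eq, one_smul,
          smul_eq_mul, Pi.sub_apply]
        change _ = -(B (hatMu μ z₀ (Φ t e)) η - B (m₀ (Φ t e)) η) at n7
        linarith
      have l2 := constant_of_has_deriv_right_zero (a := 0) (b := 1)
        (fun t ht ↦ (l1 t ⟨by linarith [ht.1], by linarith [ht.2]⟩).continuousAt.continuousWithinAt)
        (fun t ht ↦ (l1 t ⟨by linarith [ht.1], by linarith [ht.2]⟩).hasDerivWithinAt) 1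
        (right_mem_Icc.2 zero_le_one)
      simp only [one_smul, add_sub_cancel, zero_smul, add_zero, k2,
        ContinuousLinearMap.flip_apply] at l2
      exact l2
    -- Equality of all pairings is applied to the difference of the two values and the definiteness
    -- of `B`.
    by_contra hne
    refine (h.inner.pos _ (sub_ne_zero.2 hne)).ne' ?_
    rw [map_sub B, sub_apply, key, sub_self]

/-- A solution of Moser's equation on the unit interval. -/
structure IsMoserCurve (G : Type*) [TopologicalSpace G] [ChartedSpace E_G G] [Group G]
    [MulAction G X] (ω_X : Form E X 2)
    (J : Π x : X, TangentSpace 𝓘(ℝ, E) x →L[ℝ] TangentSpace 𝓘(ℝ, E) x) (μ : X → E_G) (ε : ℝ)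
    (γ : ℝ → X) (y : X) : Prop where
  start : γ 0 = y
  mdifferentiableAt : ∀ t ∈ Icc (0 : ℝ) 1, MDifferentiableAt 𝓘(ℝ, ℝ) 𝓘(ℝ, E) γ t
  isMoserVector : ∀ t ∈ Icc (0 : ℝ) 1, IsMoserVector G ω_X J μ ε t (γ t) (velocity E γ t)

open Classical in
/-- The time one map of the flow of Moser's vector field. -/
def moserMap (G : Type*) [TopologicalSpace G] [ChartedSpace E_G G] [Group G]
    [MulAction G X] (ω_X : Form E X 2)
    (J : Π x : X, TangentSpace 𝓘(ℝ, E) x →L[ℝ] TangentSpace 𝓘(ℝ, E) x) (μ : X → E_G) (ε : ℝ)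
    (y : X) : X :=
  if h : ∃ γ : ℝ → X, IsMoserCurve G ω_X J μ ε γ y then h.choose 1 else y

variable {V : ℝ × E → E} {Φ : ℝ → E → E}

theorem Icc_subset_time {t : ℝ} (ht : t ∈ Icc (0 : ℝ) 1) : t ∈ Ioo (-1 : ℝ) 2 :=
  ⟨by linarith [ht.1], by linarith [ht.2]⟩

/-- Solutions of Moser's equation are unique as long as one of them stays in the domain of the
chart. -/
theorem isMoserCurve_unique {c : ℝ → E} (hc : ∀ t ∈ Icc (0 : ℝ) 1, c t ∈ (κ z₀).target ∧
      SmoothNear V (t, c t) ∧ HasDerivAt c (V (t, c t)) t ∧ ∀ᶠ e in 𝓝 (c t), ∀ t ∈ Time, ∀ v : E,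
        IsMoserVector G ω_X J μ ε t ((κ z₀).symm e) (chartS z₀ e v) ↔ v = V (t, e))
    {γ : ℝ → X} (hγ : IsMoserCurve G ω_X J μ ε γ ((κ z₀).symm (c 0))) :
    ∀ t ∈ Icc (0 : ℝ) 1, γ t = (κ z₀).symm (c t) := by
  let s : Set ℝ := {t | γ t = (κ z₀).symm (c t)}
  have hcont (t : ℝ) (ht : t ∈ Icc (0 : ℝ) 1) : ContinuousAt (fun t ↦ (κ z₀).symm (c t)) t :=
    ContinuousAt.comp (f := c) (chart_continuousAt_symm (hc t ht).1) (hc t ht).2.2.1.continuousAt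
  -- Continuous induction: the agreement set is closed, and as long as the curves agree, the unknown
  -- one is still in the chart, where uniqueness for the differential equation applies.
  refine IsClosed.Icc_subset_of_forall_mem_nhdsWithin (s := s) ?_ hγ.start ?_
  · rw [← closure_subset_iff_isClosed]
    intro t ht
    have htI : t ∈ Icc (0 : ℝ) 1 := by
      have := closure_mono (inter_subset_right (s := s)) ht
      rwa [isClosed_Icc.closure_eq] at this
    exact ⟨tendsto_nhds_unique_of_frequently_eq (hγ.mdifferentiableAt t htI).continuousAt
      (hcont t htI) ((mem_closure_iff_frequently.1 ht).mono fun _ h ↦ h.1), htI⟩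
  · rintro t ⟨he, ht⟩
    have htI := Ico_subset_Icc_self ht
    obtain ⟨k1, k2, k3, k4⟩ := hc t htI
    have he' : γ t = (κ z₀).symm (c t) := he
    have hx : γ t ∈ (κ z₀).source := by rw [he']; exact (κ z₀).map_target k1
    have hxe : κ z₀ (γ t) = c t := by rw [he', (κ z₀).right_inv k1]
    have hI : ∀ᶠ u in 𝓝[≥] t, u ∈ Icc (0 : ℝ) 1 := by
      filter_upwards [Icc_mem_nhdsGE ht.2] with u hu using ⟨ht.1.trans hu.1, hu.2⟩
    have hγc : ContinuousAt γ t := (hγ.mdifferentiableAt t htI).continuousAt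
    have hs : ∀ᶠ u in 𝓝[≥] t, γ u ∈ (κ z₀).source :=
      mem_nhdsWithin_of_mem_nhds (hγc.eventually (chart_source_mem_nhds (A := E) hx))
    rw [← hxe] at k4
    have hm := eventually_nhdsWithin_of_eventually_nhds (s := Ici t)
      ((ContinuousAt.comp (f := γ) (chart_continuousAt (A := E) hx) hγc).eventually k4)
    -- Time is added as a coordinate with derivative `1`, which makes the equation autonomous.
    have h1 := eventuallyEq_right_of_hasDerivAt (E := ℝ × E) (t₀ := t)
      (v := fun p ↦ (1, V p)) (c₁ := fun u ↦ (u, c u)) (c₂ := fun u ↦ (u, κ z₀ (γ u)))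
      (contDiffAt_const.prodMk (k2.contDiffAt.of_le (by norm_cast))) (by simp only [hxe])
      (by
        filter_upwards [hI] with u hu
        exact (hasDerivAt_id u).prodMk (hc u hu).2.2.1)
      (by
        filter_upwards [hI, hs, hm] with u hu hus hum
        have l1 := hasDerivAt_chart_comp (hγ.mdifferentiableAt u hu) hus
        have l2 := hum u (Ioo_subset_Icc_self (Icc_subset_time hu)) (chartT z₀ (γ u) (velocity E γ u))
        simp only [Function.comp_apply] at l2
        rw [chartS_chartT hus, (κ z₀).left_inv hus] at l2
        rw [l2.1 (hγ.isMoserVector u hu)] at l1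
        exact (hasDerivAt_id u).prodMk l1)
    have h6 := nhdsWithin_mono t (Ioi_subset_Ici_self (a := t))
    filter_upwards [h6 h1, h6 hs] with u hu hus
    have h7 : c u = κ z₀ (γ u) := (Prod.mk.inj hu).2
    change γ u = (κ z₀).symm (c u)
    rw [h7, (κ z₀).left_inv hus]

/-- Flow lines starting near the centre stay in the chart for all times and are the only solutions.
Their translates solve the invariant equation as well, for arbitrary `g`, even when they leave the
chart. -/
theorem IsMoserChart.eventually_isMoserCurve (hc : IsMoserChart G ω_X J μ ε z₀ V Φ) :
    ∀ᶠ e in 𝓝 (κ z₀ z₀), ∃ γ : ℝ → X, γ 1 = (κ z₀).symm (Φ 1 e) ∧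
      IsMoserCurve G ω_X J μ ε γ ((κ z₀).symm e) ∧
      (∀ g : G, IsMoserCurve G ω_X J μ ε (fun t ↦ g • γ t) (g • (κ z₀).symm e)) ∧
      ∀ γ' : ℝ → X, IsMoserCurve G ω_X J μ ε γ' ((κ z₀).symm e) → γ' 1 = γ 1 := by
  have he₀ := mem_extChartAt_target (I := 𝓘(ℝ, E)) z₀
  have h1 := chart_target_mem_nhds he₀
  have h2 : ∀ᶠ e in 𝓝 (κ z₀ z₀), ∀ t ∈ Time, SmoothNear V (t, e) :=
    eventually_forall_time fun t ht ↦ (hc.smooth_field t ht).eventually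
  filter_upwards [hc.small _ (inter_mem h1 (inter_mem h2 (inter_mem
    hc.isMoserVector_iff.eventually_nhds hc.smul))), hc.flow] with e k1 ⟨k2, k3⟩
  have hmain (t : ℝ) (ht : t ∈ Icc (0 : ℝ) 1) :
      MDifferentiableAt 𝓘(ℝ, ℝ) 𝓘(ℝ, E) (fun t ↦ (κ z₀).symm (Φ t e)) t ∧
      IsMoserVector G ω_X J μ ε t ((κ z₀).symm (Φ t e))
        (velocity E (fun t ↦ (κ z₀).symm (Φ t e)) t) := by
    obtain ⟨n1, n2, n3, n4⟩ := k1 t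
    obtain ⟨l1, l2⟩ := hasMFDerivAt_chart_symm_comp n1 (k3 t (Icc_subset_time ht))
    refine ⟨l1, ?_⟩
    rw [l2]
    exact (n3.self_of_nhds t (Ioo_subset_Icc_self (Icc_subset_time ht)) _).2 rfl
  refine ⟨fun t ↦ (κ z₀).symm (Φ t e), rfl, ⟨by rw [k2], fun t ht ↦ (hmain t ht).1,
    fun t ht ↦ (hmain t ht).2⟩, fun g ↦ ⟨by simp only [k2], fun t ht ↦ (velocity_smul E_G g (hmain t ht).1).1,
    fun t ht ↦ ?_⟩, fun γ' hγ' ↦ ?_⟩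
  · rw [(velocity_smul E_G g (hmain t ht).1).2]
    exact (k1 t).2.2.2 g t _ (hmain t ht).2
  · rw [← k2] at hγ'
    refine isMoserCurve_unique (c := fun t ↦ Φ t e) (V := V) (fun t ht ↦ ?_) hγ' 1
      (right_mem_Icc.2 zero_le_one)
    obtain ⟨n1, n2, n3, n4⟩ := k1 t
    exact ⟨n1, n2 t (Ioo_subset_Icc_self (Icc_subset_time ht)), k3 t (Icc_subset_time ht), n3⟩

/-- Near the zero level, the solution of Moser's equation exists, is unique and equivariant. -/
def IsMoserPoint (G : Type*) [TopologicalSpace G] [ChartedSpace E_G G] [Group G]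
    [MulAction G X] (ω_X : Form E X 2)
    (J : Π x : X, TangentSpace 𝓘(ℝ, E) x →L[ℝ] TangentSpace 𝓘(ℝ, E) x) (μ : X → E_G) (ε : ℝ)
    (y : X) : Prop :=
  (∃ γ : ℝ → X, γ 1 = moserMap G ω_X J μ ε y ∧
    ∀ g : G, IsMoserCurve G ω_X J μ ε (fun t ↦ g • γ t) (g • y)) ∧
  ∀ γ : ℝ → X, IsMoserCurve G ω_X J μ ε γ y → γ 1 = moserMap G ω_X J μ ε y

/-- The translate by `g` of the solution from `y` is a solution from `g • y`, and the latter is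
unique. -/
theorem IsMoserPoint.moserMap_smul {y : X} (hy : IsMoserPoint G ω_X J μ ε y) (g : G)
    (hgy : IsMoserPoint G ω_X J μ ε (g • y)) :
    moserMap G ω_X J μ ε (g • y) = g • moserMap G ω_X J μ ε y := by
  obtain ⟨⟨γ, h1, h2⟩, -⟩ := hy
  rw [← hgy.2 _ (h2 g), ← h1]

/-- By uniqueness the solution chosen in `moserMap` is the flow line of the chart, so the local
flows define one global map. -/
theorem IsMoserChart.moserMap_eq (hc : IsMoserChart G ω_X J μ ε z₀ V Φ) :
    ∀ᶠ e in 𝓝 (κ z₀ z₀), moserMap G ω_X J μ ε ((κ z₀).symm e) = (κ z₀).symm (Φ 1 e) ∧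
      IsMoserPoint G ω_X J μ ε ((κ z₀).symm e) := by
  filter_upwards [hc.eventually_isMoserCurve] with e ⟨γ, h1, h2, h3, h4⟩
  have h5 : moserMap G ω_X J μ ε ((κ z₀).symm e) = γ 1 := by
    have hex : ∃ γ : ℝ → X, IsMoserCurve G ω_X J μ ε γ ((κ z₀).symm e) := ⟨γ, h2⟩
    rw [moserMap, dif_pos hex]
    exact h4 _ hex.choose_spec
  exact ⟨h5.trans h1, ⟨γ, h5.symm, h3⟩, fun γ' hγ' ↦ (h4 γ' hγ').trans h5.symm⟩

end MoserFlow

/-! ### The diffeomorphism onto the normal form -/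

section MoserMap

universe u

variable {E : Type u} [NormedAddCommGroup E] [NormedSpace ℝ E] [FiniteDimensional ℝ E]
  {X : Type*} [TopologicalSpace X] [ChartedSpace E X] [IsManifold 𝓘(ℝ, E) ∞ X] [T2Space X]
  {E_G : Type*} [NormedAddCommGroup E_G] [NormedSpace ℝ E_G] [FiniteDimensional ℝ E_G]
  {G : Type*} [TopologicalSpace G] [ChartedSpace E_G G] [Group G] [LieGroup 𝓘(ℝ, E_G) ∞ G]
  [ConnectedSpace G] [MulAction G X] [ContMDiffSMul 𝓘(ℝ, E_G) 𝓘(ℝ, E) ∞ G X]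
  {J : Π x : X, TangentSpace 𝓘(ℝ, E) x →L[ℝ] TangentSpace 𝓘(ℝ, E) x}
  {ω_X : Form E X 2} {μ : X → E_G} {B : E_G →L[ℝ] E_G →L[ℝ] ℝ}
  {ε : ℝ} {z₀ : X} {V : ℝ × E → E} {Φ : ℝ → E → E}

local notation "κ" => extChartAt 𝓘(ℝ, E)

theorem Form.eq_of_inChart_eq {n : ℕ} {α β : Form E X n} {x₀ : X} {e : E} (he : e ∈ (κ x₀).target)
    (h : α.inChart x₀ e = β.inChart x₀ e) : α ((κ x₀).symm e) = β ((κ x₀).symm e) := by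
  have hx := (κ x₀).map_target he
  refine ContinuousAlternatingMap.ext fun v ↦ ?_
  refine (α.apply_eq_inChart hx v).trans (Eq.trans ?_ (β.apply_eq_inChart hx v).symm)
  rw [(κ x₀).right_inv he, h]

/-- An injective map with smooth local sections is a diffeomorphism onto its image. -/
theorem exists_openPartialHomeomorph_of_section {f : X → X} {U : Set X} (hU : IsOpen U)
    (hinj : InjOn f U) (hf : ∀ y ∈ U, ContinuousAt f y)
    (hs : ∀ y ∈ U, ∃ s : X → X, s (f y) = y ∧ (∀ᶠ x in 𝓝 (f y), f (s x) = x) ∧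
      ContMDiffAt 𝓘(ℝ, E) 𝓘(ℝ, E) ∞ s (f y)) :
    ∃ P : OpenPartialHomeomorph X X, P.source = U ∧ P.target = f '' U ∧ (P : X → X) = f ∧
      ContMDiffOn 𝓘(ℝ, E) 𝓘(ℝ, E) ∞ P.symm P.target := by
  classical
  let g : X → X := fun x ↦ if h : ∃ y ∈ U, f y = x then h.choose else x
  have hg : ∀ y ∈ U, g (f y) = y := by
    intro y hy
    have h : ∃ y' ∈ U, f y' = f y := ⟨y, hy, rfl⟩
    simp only [g, dif_pos h]
    exact hinj h.choose_spec.1 hy h.choose_spec.2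
  have hloc : ∀ y ∈ U, (f '' U ∈ 𝓝 (f y)) ∧ ContMDiffAt 𝓘(ℝ, E) 𝓘(ℝ, E) ∞ g (f y) := by
    intro y hy
    obtain ⟨s, h1, h2, h3⟩ := hs y hy
    have h4 : ∀ᶠ x in 𝓝 (f y), s x ∈ U :=
      h3.continuousAt.eventually (by rw [h1]; exact hU.mem_nhds hy)
    refine ⟨?_, h3.congr_of_eventuallyEq ?_⟩
    · filter_upwards [h2, h4] with x k1 k2 using ⟨s x, k2, k1⟩
    · filter_upwards [h2, h4] with x k1 k2
      rw [← hg _ k2, k1]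
  have hcg : ContMDiffOn 𝓘(ℝ, E) 𝓘(ℝ, E) ∞ g (f '' U) := by
    rintro _ ⟨y, hy, rfl⟩
    exact (hloc y hy).2.contMDiffWithinAt
  exact ⟨{  toFun := f
            invFun := g
            source := U
            target := f '' U
            map_source' := fun y hy ↦ mem_image_of_mem f hy
            map_target' := by rintro _ ⟨y, hy, rfl⟩; rwa [hg y hy]
            left_inv' := hg
            right_inv' := by rintro _ ⟨y, hy, rfl⟩; rw [hg y hy]
            open_source := hU
            open_target := by
              refine isOpen_iff_mem_nhds.2 ?_
              rintro _ ⟨y, hy, rfl⟩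
              exact (hloc y hy).1
            continuousOn_toFun := fun y hy ↦ (hf y hy).continuousWithinAt
            continuousOn_invFun := hcg.continuousOn }, rfl, rfl, rfl, hcg⟩

/-- The properties of the Moser map near a point. -/
structure IsMoserDiffeoAt (G : Type*) [TopologicalSpace G] [ChartedSpace E_G G] [Group G]
    [MulAction G X] (ω_X : Form E X 2)
    (J : Π x : X, TangentSpace 𝓘(ℝ, E) x →L[ℝ] TangentSpace 𝓘(ℝ, E) x) (μ : X → E_G) (ε : ℝ)
    (y : X) : Prop where
  moser : IsMoserPoint G ω_X J μ ε y
  smooth : ContMDiffAt 𝓘(ℝ, E) 𝓘(ℝ, E) ∞ (moserMap G ω_X J μ ε) y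
  symplectic : ω_X.pullback (moserMap G ω_X J μ ε) y = omega₀ G ω_X J μ ε y
  moment : μ (moserMap G ω_X J μ ε y) = mu₀ G ω_X J μ ε y
  exists_section : ∃ s : X → X, s (moserMap G ω_X J μ ε y) = y ∧
    (∀ᶠ x in 𝓝 (moserMap G ω_X J μ ε y), moserMap G ω_X J μ ε (s x) = x) ∧
    ContMDiffAt 𝓘(ℝ, E) 𝓘(ℝ, E) ∞ s (moserMap G ω_X J μ ε y)

theorem IsMoserChart.moserMap_self (hc : IsMoserChart G ω_X J μ ε z₀ V Φ) :
    moserMap G ω_X J μ ε z₀ = z₀ ∧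
      HasMFDerivAt 𝓘(ℝ, E) 𝓘(ℝ, E) (moserMap G ω_X J μ ε) z₀ (.id ℝ E : E →L[ℝ] E) := by
  have he₀ := mem_extChartAt_target (I := 𝓘(ℝ, E)) z₀
  have hback : (κ z₀).symm (κ z₀ z₀) = z₀ := extChartAt_to_inv z₀
  have h1 := hc.moserMap_eq.self_of_nhds.1
  have h2 := hasMFDerivAt_of_reading he₀ (by rw [hc.flow_self]; exact he₀)
    (hc.moserMap_eq.mono fun e he ↦ he.1) hc.smooth.differentiableAt.hasFDerivAt
  rw [hc.flow_self, hback] at h1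
  refine ⟨h1, ?_⟩
  have h3 : ((chartS z₀ (Φ 1 (κ z₀ z₀))).comp ((fderiv ℝ (Φ 1) (κ z₀ z₀)).comp
      (chartT z₀ ((κ z₀).symm (κ z₀ z₀)))) : E →L[ℝ] E) = .id ℝ E := by
    rw [hc.flow_self, hback, hc.fderiv_self, chartT_self, chartS_self]
    rfl
  -- The base point and the derivative are replaced together, as the type of the statement depends
  -- on the point.
  have key : ∀ (x : X) (T : E →L[ℝ] E), x = z₀ → T = .id ℝ E →
      HasMFDerivAt 𝓘(ℝ, E) 𝓘(ℝ, E) (moserMap G ω_X J μ ε) x T →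
      HasMFDerivAt 𝓘(ℝ, E) 𝓘(ℝ, E) (moserMap G ω_X J μ ε) z₀ (.id ℝ E : E →L[ℝ] E) := by
    rintro _ _ rfl rfl h
    exact h
  exact key _ _ hback h3 h2

/-- The time one map has derivative the identity at the centre, so the inverse function theorem
provides local injectivity and smooth local sections. The other properties are read off from the
chart. -/
theorem IsMoserChart.eventually_isMoserDiffeoAt (hc : IsMoserChart G ω_X J μ ε z₀ V Φ) :
    (∀ᶠ y in 𝓝 z₀, IsMoserDiffeoAt G ω_X J μ ε y) ∧
      ∃ U ∈ 𝓝 z₀, InjOn (moserMap G ω_X J μ ε) U := by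
  have he₀ := mem_extChartAt_target (I := 𝓘(ℝ, E)) z₀
  have hx₀ := mem_extChartAt_source (I := 𝓘(ℝ, E)) z₀
  obtain ⟨P, hP0, hP, hPs⟩ := hc.smooth.exists_openPartialHomeomorph
    (by rw [hc.fderiv_self]; exact ⟨.refl ℝ E, rfl⟩)
  have hmem : ∀ᶠ e in 𝓝 (κ z₀ z₀), Φ 1 e ∈ (κ z₀).target := by
    filter_upwards [hc.small _ (chart_target_mem_nhds he₀)] with e he using he 1
  have hsource : ∀ᶠ e in 𝓝 (κ z₀ z₀), e ∈ P.source := P.open_source.mem_nhds hP0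
  have htarget : ∀ᶠ e in 𝓝 (κ z₀ z₀), e ∈ (κ z₀).target := chart_target_mem_nhds he₀
  have hgood := hc.moserMap_eq.and (hmem.and (hsource.and htarget))
  refine ⟨eventually_of_chart hx₀ ?_, ?_⟩
  · filter_upwards [hgood.eventually_nhds, hc.smooth, hc.symplectic, hc.moment]
      with e k1 k2 k3 k4
    obtain ⟨⟨l1, l2⟩, l3, l4, l5⟩ := k1.self_of_nhds
    have l6 : ∀ᶠ e' in 𝓝 e, moserMap G ω_X J μ ε ((κ z₀).symm e') = (κ z₀).symm (Φ 1 e') :=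
      k1.mono fun e' he' ↦ he'.1.1
    have l7 : P.symm (Φ 1 e) = e := by rw [← hP, P.left_inv l4]
    have l8 : Φ 1 e ∈ P.target := by rw [← hP]; exact P.map_source l4
    refine ⟨l2, contMDiffAt_of_reading le_rfl l5 l3 l6 k2, ?_, by rw [l1, k4], ?_⟩
    · refine Form.eq_of_inChart_eq l5 ?_
      rw [Form.inChart_pullback _ l5 l3 l6 (k2.differentiableAt (by simp)), k3]
    · rw [l1]
      have n1 : ∀ᶠ e' in 𝓝 (Φ 1 e), (κ z₀).symm (P.symm (κ z₀ ((κ z₀).symm e'))) =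
          (κ z₀).symm (P.symm e') := by
        filter_upwards [chart_target_mem_nhds l3] with e' he'
        rw [(κ z₀).right_inv he']
      refine ⟨fun x ↦ (κ z₀).symm (P.symm (κ z₀ x)), ?_, ?_, ?_⟩
      · simp only
        rw [(κ z₀).right_inv l3, l7]
      · refine eventually_of_chart ((κ z₀).map_target l3) ?_
        rw [(κ z₀).right_inv l3]
        have n2 := (hPs _ l8).continuousAt
        rw [ContinuousAt, l7] at n2
        filter_upwards [n1, n2.eventually l6, P.open_target.mem_nhds l8] with e' m1 m2 m3
        rw [m1, m2, ← hP, P.right_inv m3]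
      · refine contMDiffAt_of_reading le_rfl l3 (F := P.symm) ?_ n1 (hPs _ l8).contDiffAt
        rwa [l7]
  · refine ⟨{y | y ∈ (κ z₀).source ∧ moserMap G ω_X J μ ε y = (κ z₀).symm (Φ 1 (κ z₀ y)) ∧
      Φ 1 (κ z₀ y) ∈ (κ z₀).target ∧ κ z₀ y ∈ P.source}, ?_, ?_⟩
    · refine eventually_of_chart hx₀ ?_
      filter_upwards [hgood] with e ⟨⟨l1, _⟩, l3, l4, l5⟩
      rw [(κ z₀).right_inv l5]
      exact ⟨(κ z₀).map_target l5, l1, l3, l4⟩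
    · rintro y ⟨k1, k2, k3, k4⟩ y' ⟨k1', k2', k3', k4'⟩ hyy
      rw [k2, k2'] at hyy
      have l1 := (κ z₀).symm.injOn k3 k3' hyy
      rw [← hP, ← hP] at l1
      exact (κ z₀).injOn k1 k1' (P.injOn k4 k4' l1)

theorem IsTubeRadius.mono {ε₁ : ℝ} (hr : IsTubeRadius G ω_X μ J ε₁) (h0 : 0 < ε) (hε : ε ≤ ε₁) :
    IsTubeRadius G ω_X μ J ε := by
  have hle : ε ^ 2 ≤ ε₁ ^ 2 := pow_le_pow_left₀ h0.le hε 2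
  exact ⟨h0, fun h1 h2 h3 h4 ↦ hr.injective h1 (h2.trans_le hle) h3 (h4.trans_le hle),
    fun h1 h2 ↦ hr.exists_section h1 (h2.trans_le hle),
    fun h1 h2 ↦ hr.smooth h1 (h2.trans_le hle)⟩

end MoserMap

end NormalForm

end

/-! ### Choice of the radii and conclusion -/

theorem proposition3
    {E : Type*} [NormedAddCommGroup E] [NormedSpace ℝ E] [FiniteDimensional ℝ E]
    {X : Type*} [TopologicalSpace X] [ChartedSpace E X] [IsManifold 𝓘(ℝ, E) ∞ X]
    [T2Space X] [CompactSpace X]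
    {E_G : Type*} [NormedAddCommGroup E_G] [NormedSpace ℝ E_G] [FiniteDimensional ℝ E_G]
    {G : Type*} [TopologicalSpace G] [ChartedSpace E_G G] [Group G] [LieGroup 𝓘(ℝ, E_G) ∞ G]
    [T2Space G] [CompactSpace G] [ConnectedSpace G]
    [MulAction G X] [ContMDiffSMul 𝓘(ℝ, E_G) 𝓘(ℝ, E) ∞ G X]
    (B : E_G →L[ℝ] E_G →L[ℝ] ℝ) (hB : NormalForm.IsInvariantInner G B)
    (ω_X : NormalForm.Form E X 2) (μ : X → E_G) (hμ : NormalForm.IsHamiltonianOn G B ω_X μ univ)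
    (hreg : ∀ z, μ z = 0 → Function.Surjective (mvfderiv 𝓘(ℝ, E) μ z))
    (J : Π x : X, TangentSpace 𝓘(ℝ, E) x →L[ℝ] TangentSpace 𝓘(ℝ, E) x)
    (hJ : NormalForm.IsCompatible G ω_X J) :
    ∀ δ > 0, ∃ ε₀ > 0, ∀ ε, 0 < ε → ε < ε₀ →
      -- `exp : N^ε → U^ε` is an equivariant diffeomorphism onto an open set
      NormalForm.IsTube G ω_X J μ ε ∧
      -- `(U^ε, ω₀, G, μ₀)` is a Hamiltonian `G`-manifold
      NormalForm.IsHamiltonianOn G B (NormalForm.omega₀ G ω_X J μ ε) (NormalForm.mu₀ G ω_X J μ ε)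
        (NormalForm.tubeImage G ω_X J μ ε) ∧
      -- `φ` is a diffeomorphism from `N^ε` onto an open subset of `U^δ = exp (N^δ)`
      ∃ φ : OpenPartialHomeomorph X X,
        φ.source = NormalForm.tubeImage G ω_X J μ ε ∧
        φ.target ⊆ NormalForm.tubeImage G ω_X J μ δ ∧
        ContMDiffOn 𝓘(ℝ, E) 𝓘(ℝ, E) ∞ φ φ.source ∧
        ContMDiffOn 𝓘(ℝ, E) 𝓘(ℝ, E) ∞ φ.symm φ.target ∧
        -- `φ` is `G`-equivariant
        (∀ (g : G), ∀ y ∈ φ.source, φ (g • y) = g • φ y) ∧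
        -- `φ^*ω_X = ω₀` and `φ^*μ = μ₀`
        (∀ y ∈ φ.source, ω_X.pullback φ y = NormalForm.omega₀ G ω_X J μ ε y) ∧
        (∀ y ∈ φ.source, μ (φ y) = NormalForm.mu₀ G ω_X J μ ε y) ∧
        -- `φ` is the identity on `μ⁻¹(0)`, and so is its differential on `TX` along `μ⁻¹(0)`
        (∀ z, μ z = 0 → φ z = z) ∧
        (∀ p : TangentBundle 𝓘(ℝ, E) X, μ p.1 = 0 → tangentMap 𝓘(ℝ, E) 𝓘(ℝ, E) φ p = p) := by
  intro δ hδ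
  have h : NormalForm.IsRegular G B ω_X μ J := ⟨hB, hμ, hreg, hJ⟩
  obtain ⟨ε₁, hr₁⟩ := h.exists_isTubeRadius
  obtain ⟨ε₂, hε₂, hd₂⟩ := h.exists_tubeImage_subset
    (Q := fun y ↦ NormalForm.IsHamiltonianAt G B ω_X J μ ε₁ y)
    fun z hz ↦ h.eventually_isHamiltonianAt hr₁ hz
  -- The Moser map is built once, on the tube of radius `ε₃`, where the exponential map is injective
  -- and `ω₀` is Hamiltonian at every point. Smaller radii only restrict its domain.
  set ε₃ := min ε₁ ε₂ with hε₃
  have h₃ : 0 < ε₃ := lt_min hr₁.pos hε₂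
  have hr := hr₁.mono h₃ (min_le_left _ _)
  have hd : ∀ y ∈ NormalForm.tubeImage G ω_X J μ ε₃,
      NormalForm.IsHamiltonianAt G B ω_X J μ ε₃ y := fun y hy ↦
    (hd₂ y (NormalForm.tubeImage_mono h₃ (min_le_right _ _) hy)).congr
      (h.tubeInv_eventuallyEq hr₁ h₃ (min_le_left _ _) hy)
  have hself : ∀ z, μ z = 0 → NormalForm.moserMap G ω_X J μ ε₃ z = z ∧ HasMFDerivAt 𝓘(ℝ, E) 𝓘(ℝ, E)
      (NormalForm.moserMap G ω_X J μ ε₃) z (.id ℝ E : E →L[ℝ] E) := fun z hz ↦ by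
    obtain ⟨V, Φ, hc⟩ := h.exists_isMoserChart hr hd hz
    exact hc.moserMap_self
  -- The Moser map is the identity on the compact zero level and locally injective at each of its
  -- points, hence injective on a neighbourhood of it.
  obtain ⟨t, ht, hinj⟩ : ∃ t ∈ 𝓝ˢ {z | μ z = 0}, InjOn (NormalForm.moserMap G ω_X J μ ε₃) t := by
    refine InjOn.exists_mem_nhdsSet ?_ h.isCompact_zero
      (fun z hz ↦ (hself z hz).2.continuousAt) fun z hz ↦ ?_
    · intro z hz z' hz' hzz
      rwa [(hself z hz).1, (hself z' hz').1] at hzz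
    · obtain ⟨V, Φ, hc⟩ := h.exists_isMoserChart hr hd hz
      exact hc.eventually_isMoserDiffeoAt.2
  obtain ⟨ε₄, h₄, hQ⟩ := h.exists_tubeImage_subset (Q := fun y ↦
    NormalForm.IsMoserDiffeoAt G ω_X J μ ε₃ y ∧ y ∈ t ∧
      NormalForm.moserMap G ω_X J μ ε₃ y ∈ NormalForm.tubeImage G ω_X J μ δ) fun z hz ↦ by
    obtain ⟨V, Φ, hc⟩ := h.exists_isMoserChart hr hd hz
    have hmin : 0 < min ε₃ δ := lt_min h₃ hδ
    -- For large `δ` the image of `N^δ` is not known to be open, so a smaller tube contained in it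
    -- is used as a neighbourhood.
    have h1 : NormalForm.tubeImage G ω_X J μ (min ε₃ δ) ∈
        𝓝 (NormalForm.moserMap G ω_X J μ ε₃ z) := by
      rw [(hself z hz).1]
      exact (h.isOpen_tubeImage hr hmin (min_le_left _ _)).mem_nhds (h.mem_tubeImage hmin hz)
    filter_upwards [hc.eventually_isMoserDiffeoAt.1, mem_nhdsSet_iff_forall.1 ht z hz,
      (hself z hz).2.continuousAt.eventually h1] with y k1 k2 k3
    exact ⟨k1, k2, NormalForm.tubeImage_mono hmin (min_le_right _ _) k3⟩
  refine ⟨min ε₃ ε₄, lt_min h₃ h₄, fun ε h0 hε ↦ ?_⟩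
  have hε₃ : ε ≤ ε₃ := hε.le.trans (min_le_left _ _)
  have hQ' : ∀ y ∈ NormalForm.tubeImage G ω_X J μ ε,
      NormalForm.IsMoserDiffeoAt G ω_X J μ ε₃ y ∧ y ∈ t ∧
      NormalForm.moserMap G ω_X J μ ε₃ y ∈ NormalForm.tubeImage G ω_X J μ δ := fun y hy ↦
    hQ y (NormalForm.tubeImage_mono h0 (hε.le.trans (min_le_right _ _)) hy)
  refine ⟨h.isTube hr h0 hε₃,
    h.isHamiltonianOn hr h0 hε₃ fun y hy ↦ hd y (NormalForm.tubeImage_mono h0 hε₃ hy), ?_⟩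
  obtain ⟨φ, hφs, hφt, hφ, hφi⟩ := NormalForm.exists_openPartialHomeomorph_of_section
    (h.isOpen_tubeImage hr h0 hε₃) (hinj.mono fun y hy ↦ (hQ' y hy).2.1)
    (fun y hy ↦ (hQ' y hy).1.smooth.continuousAt) fun y hy ↦ (hQ' y hy).1.exists_section
  refine ⟨φ, hφs, ?_, ?_, hφi, ?_, ?_, ?_, ?_, ?_⟩
  · rw [hφt]
    rintro _ ⟨y, hy, rfl⟩
    exact (hQ' y hy).2.2
  · rw [hφs, hφ]
    exact fun y hy ↦ (hQ' y hy).1.smooth.contMDiffWithinAt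
  · rw [hφs, hφ]
    exact fun g y hy ↦ (hQ' y hy).1.moser.moserMap_smul g
      (hQ' _ (h.smul_mem_tubeImage g hy)).1.moser
  -- The Moser map pulls `ω` back to the normal form of radius `ε₃`, which coincides on the smaller
  -- tube with that of radius `ε`.
  · rw [hφs, hφ]
    exact fun y hy ↦ (hQ' y hy).1.symplectic.trans
      (NormalForm.omega₀_eq (h.tubeInv_eventuallyEq hr h0 hε₃ hy)).symm
  · rw [hφs, hφ]
    exact fun y hy ↦ (hQ' y hy).1.moment.trans (NormalForm.mu₀_eq (h.tubeInv_eq hr h0 hε₃ hy)).symm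
  · rw [hφ]
    exact fun z hz ↦ (hself z hz).1
  · rw [hφ]
    rintro ⟨z, v⟩ hz
    exact NormalForm.tangentBundle_mk_eq (hself z hz).1
      (congrArg (fun T : E →L[ℝ] E ↦ T v) (hself z hz).2.mfderiv)
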